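/- Let $\gamma_0=\{(-1+i)x: 0\le x\le 27^{1/4}/\sqrt2\}\cup\{(-1-i)x: 0\le x\le 27^{1/4}/\sqrt2\}\subset\mathbb C$, and let $\psi_0(w)=\big(w-\frac1w\big)\big(\frac{w-1}{w+1}\big)^{1/2}$ (principal branch) be the conformal map of $|w|>1$ onto $\mathbb C\setminus\gamma_0$, extended continuously to $|w|=1$ (so $\psi_0(-1)=0$), which maps $|w|=1$ onto $\gamma_0$. For $t\in[\frac{2\pi}3,\pi]$ let $J(t)$ be the unique point of $[0,\frac{2\pi}3]$ with $\psi_0(e^{iJ(t)})=\psi_0(e^{it})$. For $n\ge1$ and $0\le k\le\lfloor n/2\rfloor$ put $\theta_{n,k}=\frac{2k\pi}{n+1}$ if $n$ is even and $\theta_{n,k}=\frac{(2k+1)\pi}{n+1}$ if $n$ is odd (the Fejér points on $\gamma_0$ are the points $\psi_0(e^{i\theta_{n,k}})$ with $0\le k\le \lfloor n/2\rfloor$, and their complex conjugates), and put $\delta_n=\frac{2\pi}{3(n+1)}$. Call $(j,k)$, where $0\le j,k\le\lfloor n/2\rfloor$ and $\theta_{n,j}\le\frac{2\pi}3<\theta_{n,k}$,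 an adjustment pair if $|\theta_{n,j}-J(\theta_{n,k})|<\delta_n$; each index belongs to at most one adjustment pair. Define the adjusted angles $\tilde\theta_{n,k}$, $0\le k\le n$, as follows. (1) If $(j,k)$ is an adjustment pair and $J(\theta_{n,k})\le\theta_{n,j}$, then $\tilde\theta_{n,j}=J(\theta_{n,k})+\delta_n$ and $\tilde\theta_{n,k}=\theta_{n,j}-\delta_n$. (2) If $(j,k)$ is an adjustment pair and $J(\theta_{n,k})>\theta_{n,j}$, then $\tilde\theta_{n,j}=J(\theta_{n,k})-\delta_n$ and $\tilde\theta_{n,k}=\theta_{n,j}+\delta_n$. (3) For every $k\le\lfloor n/2\rfloor$ that belongs to no adjustment pair, $\tilde\theta_{n,k}=\theta_{n,k}$ if $\theta_{n,k}\le\frac{2\pi}3$, and $\tilde\theta_{n,k}=J(\theta_{n,k})$ if $\theta_{n,k}>\frac{2\pi}3$. (4) For $\lfloor n/2\rfloor<k\le n$, $\tilde\theta_{n,k}=-\tilde\theta_{n,2\lfloor n/2\rfloor+1-k}$. Let $z^{**}_{n,k}=\psi_0(e^{i\tilde\theta_{n,k}})\in\gamma_0$, $0\le k\le n$, be the adjusted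 Fejér points. Then for every $n\ge1$ the points $z^{**}_{n,0},\dots,z^{**}_{n,n}$ are distinct, and there are constants $c_1>0$ and $c_2>0$ such that $$c_1\log^2(n)\le L_{\mathbf z^{**}_n}\le c_2\log^2(n)\qquad\text{for all integers } n\ge2,$$ where $L_{\mathbf z^{**}_n}$ is the Lebesgue constant of $\mathbf z^{**}_n=\{z^{**}_{n,k}\}_{k=0}^n$, i.e. the operator norm, with respect to the sup norm on $\gamma_0$, of the operator that maps $f\in C(\gamma_0)$ to the polynomial of degree at most $n$ interpolating $f$ at $z^{**}_{n,0},\dots,z^{**}_{n,n}$. -/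

import Mathlib

open Set Polynomial
open scoped Real

namespace LArc

/-! ### Lagrange interpolation and the Lebesgue constant -/

/-- The Lagrange interpolation operator on `C(X)`: it sends `f` to the restriction to `X` of the
polynomial `∑ j, f (z j) ℓ_j` of degree at most `n` that interpolates `f` at the nodes
`z 0, …, z n` in `X`. -/
noncomputable def lagrangeOperator {X : Set ℂ} [CompactSpace X] {n : ℕ} (z : Fin (n + 1) → X) :
    C(X, ℂ) →L[ℂ] C(X, ℂ) :=
  ∑ j, (ContinuousMap.evalCLM ℂ (z j)).smulRight
    ((Lagrange.basis Finset.univ (fun i => (z i : ℂ)) j).toContinuousMapOn X)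

theorem lagrangeOperator_apply {X : Set ℂ} [CompactSpace X] {n : ℕ} (z : Fin (n + 1) → X)
    (f : C(X, ℂ)) (x : X) :
    lagrangeOperator z f x =
      (Lagrange.interpolate Finset.univ (fun i => (z i : ℂ)) (fun j => f (z j))).eval (x : ℂ) := by
  simp [lagrangeOperator, Lagrange.interpolate_apply, Polynomial.eval_finsetSum]

/-- The Lebesgue constant of the nodes `z 0, …, z n` in the compact set `X`: the norm of the
Lagrange interpolation operator with respect to the sup norm over `X`. -/
noncomputable def lebesgueConstant {X : Set ℂ} [CompactSpace X] {n : ℕ}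
    (z : Fin (n + 1) → X) : ℝ :=
  ‖lagrangeOperator z‖

/-! ### The L-shaped arc and its exterior conformal map -/

/-- The arc of two line segments of length `27 ^ (1 / 4)` which meet at the origin at a right
angle. -/
noncomputable def arc : Set ℂ :=
  (fun x : ℝ => (-1 + Complex.I) * (x : ℂ)) '' Icc 0 ((27 : ℝ) ^ (1 / 4 : ℝ) / √2) ∪
    (fun x : ℝ => (-1 - Complex.I) * (x : ℂ)) '' Icc 0 ((27 : ℝ) ^ (1 / 4 : ℝ) / √2)

instance : CompactSpace arc := by
  rw [← isCompact_iff_compactSpace]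
  exact (isCompact_Icc.image (by fun_prop)).union (isCompact_Icc.image (by fun_prop))

/-- The conformal map `(w - 1 / w) ((w - 1) / (w + 1)) ^ (1 / 2)` of `|w| > 1` onto the complement
of the arc, together with its continuous extension to `|w| = 1`. For `|w| ≥ 1`, `w ≠ -1`, the
quotient `(w - 1) / (w + 1)` lies in the closed right half plane, where the principal branch of the
square root is continuous; the value at `w = -1` is the limit `0`. -/
noncomputable def psi (w : ℂ) : ℂ :=
  (w - 1 / w) * ((w - 1) / (w + 1)) ^ (1 / 2 : ℂ)

theorem psi_neg_one : psi (-1) = 0 := by simp [psi]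

theorem psi_exp {t : ℝ} (h1 : -π < t) (h2 : t < π) :
    psi (Complex.exp (t * Complex.I)) =
      2 * Complex.I * Real.sin t * (Complex.I * Real.tan (t / 2)) ^ (1 / 2 : ℂ) := by
  have hc : 0 < Real.cos (t / 2) := Real.cos_pos_of_mem_Ioo ⟨by linarith, by linarith⟩
  have hc' : (Real.cos (t / 2) : ℂ) ≠ 0 := by exact_mod_cast hc.ne'
  have hs : Real.sin t = 2 * Real.sin (t / 2) * Real.cos (t / 2) := by
    rw [← Real.sin_two_mul]; ring_nf
  have hcc : Real.cos t = 2 * Real.cos (t / 2) ^ 2 - 1 := by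
    rw [← Real.cos_two_mul]; ring_nf
  have hp : (Real.sin (t / 2) : ℂ) ^ 2 + (Real.cos (t / 2) : ℂ) ^ 2 = 1 := by
    exact_mod_cast Real.sin_sq_add_cos_sq (t / 2)
  have hw : Complex.exp (t * Complex.I) = Real.cos t + Real.sin t * Complex.I := by
    rw [Complex.exp_mul_I]; push_cast; rfl
  have hinv : 1 / Complex.exp (t * Complex.I) = Real.cos t - Real.sin t * Complex.I := by
    rw [one_div, ← Complex.exp_neg, ← neg_mul, Complex.exp_mul_I]
    push_cast
    rw [Complex.cos_neg, Complex.sin_neg]; ring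
  have hne : (Real.cos (t / 2) : ℂ) + Real.sin (t / 2) * Complex.I ≠ 0 := by
    intro h
    have := congrArg Complex.re h
    simp only [Complex.add_re, Complex.mul_re, Complex.ofReal_re, Complex.ofReal_im,
      Complex.I_re, Complex.I_im, Complex.zero_re] at this
    linarith
  have hq : (Complex.exp (t * Complex.I) - 1) / (Complex.exp (t * Complex.I) + 1) =
      Complex.I * Real.tan (t / 2) := by
    have e1 : Complex.exp (t * Complex.I) - 1 = 2 * Real.sin (t / 2) * Complex.I *
        (Real.cos (t / 2) + Real.sin (t / 2) * Complex.I) := by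
      rw [hw, hs, hcc]; push_cast at hp ⊢
      linear_combination (2 : ℂ) * hp -
        2 * (Complex.sin (t / 2)) ^ 2 * Complex.I_sq
    have e2 : Complex.exp (t * Complex.I) + 1 = 2 * Real.cos (t / 2) *
        (Real.cos (t / 2) + Real.sin (t / 2) * Complex.I) := by
      rw [hw, hs, hcc]; push_cast; ring
    rw [e1, e2, Real.tan_eq_sin_div_cos]
    push_cast at hc' hne ⊢
    field_simp
  rw [psi, hq, hinv, hw]
  ring

/-- The distance of `psi (exp (i t))` from the corner, up to the sign of `t`. -/
noncomputable def radius (t : ℝ) : ℝ := √2 * Real.sin t * √(Real.tan (t / 2))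

theorem I_cpow_half : Complex.I ^ (1 / 2 : ℂ) = (1 + Complex.I) / (√2 : ℝ) := by
  rw [Complex.cpow_def_of_ne_zero Complex.I_ne_zero, Complex.log_I]
  have : (π : ℂ) / 2 * Complex.I * (1 / 2) = ((π / 4 : ℝ) : ℂ) * Complex.I := by
    push_cast; ring
  rw [this, Complex.exp_mul_I, ← Complex.ofReal_cos, ← Complex.ofReal_sin, Real.cos_pi_div_four,
    Real.sin_pi_div_four]
  have h2 : ((√2 : ℝ) : ℂ) ^ 2 = 2 := by exact_mod_cast Real.sq_sqrt (by norm_num : (0:ℝ) ≤ 2)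
  have h0 : ((√2 : ℝ) : ℂ) ≠ 0 := by
    intro h; rw [h] at h2; norm_num at h2
  push_cast
  field_simp
  rw [h2]

theorem ofReal_mul_cpow_half {x : ℝ} (hx : 0 ≤ x) (z : ℂ) :
    ((x : ℂ) * z) ^ (1 / 2 : ℂ) = (x : ℂ) ^ (1 / 2 : ℂ) * z ^ (1 / 2 : ℂ) := by
  rcases hx.eq_or_lt with rfl | hx
  · simp
  rcases eq_or_ne z 0 with rfl | hz
  · simp
  have hx' : (x : ℂ) ≠ 0 := by exact_mod_cast hx.ne'
  rw [Complex.cpow_def_of_ne_zero (mul_ne_zero hx' hz), Complex.cpow_def_of_ne_zero hx',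
    Complex.cpow_def_of_ne_zero hz, Complex.log_ofReal_mul hx hz, Complex.ofReal_log hx.le,
    ← Complex.exp_add, add_mul]

theorem psi_exp_of_nonneg {t : ℝ} (h1 : 0 ≤ t) (h2 : t < π) :
    psi (Complex.exp (t * Complex.I)) = (-1 + Complex.I) * (radius t : ℂ) := by
  have htan : 0 ≤ Real.tan (t / 2) :=
    Real.tan_nonneg_of_nonneg_of_le_pi_div_two (by linarith) (by linarith)
  have hsq : ((Real.tan (t / 2) : ℝ) : ℂ) ^ (1 / 2 : ℂ) = (√(Real.tan (t / 2)) : ℝ) := by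
    rw [Real.sqrt_eq_rpow, Complex.ofReal_cpow htan]; norm_num
  have h2' : ((√2 : ℝ) : ℂ) ^ 2 = 2 := by exact_mod_cast Real.sq_sqrt (by norm_num : (0:ℝ) ≤ 2)
  have h0 : ((√2 : ℝ) : ℂ) ≠ 0 := by
    intro h; rw [h] at h2'; norm_num at h2'
  rw [psi_exp (by linarith [Real.pi_pos]) h2, mul_comm Complex.I (Real.tan (t / 2) : ℂ),
    ofReal_mul_cpow_half htan, hsq, I_cpow_half, radius]
  push_cast
  field_simp
  linear_combination (Complex.sin t * √(Real.tan (t / 2)) : ℂ) * (2 * Complex.I_sq +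
    (1 - Complex.I) * h2')

theorem psi_exp_neg {t : ℝ} (h1 : 0 ≤ t) (h2 : t < π) :
    psi (Complex.exp ((-t : ℝ) * Complex.I)) = (-1 - Complex.I) * (radius t : ℂ) := by
  have hpi := Real.pi_pos
  have harg : (Complex.I * Real.tan (t / 2)).arg ≠ π := by
    rw [Ne, Complex.arg_eq_pi_iff]
    simp only [Complex.mul_re, Complex.I_re, Complex.I_im, Complex.ofReal_im]
    simp
  have hconj : Complex.I * (Real.tan (-t / 2) : ℂ) =
      starRingEnd ℂ (Complex.I * Real.tan (t / 2)) := by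
    rw [neg_div, Real.tan_neg, map_mul, Complex.conj_I, Complex.conj_ofReal]; push_cast; ring
  have hhalf : starRingEnd ℂ (1 / 2 : ℂ) = 1 / 2 := by
    rw [map_div₀, map_one, Complex.conj_ofNat]
  have h := congrArg (starRingEnd ℂ) (psi_exp_of_nonneg h1 h2)
  rw [psi_exp (by linarith) h2] at h
  rw [psi_exp (by linarith) (by linarith), hconj, Complex.conj_cpow _ _ harg, hhalf, Real.sin_neg]
  simp only [map_mul, Complex.conj_I, Complex.conj_ofReal, map_add, map_neg, map_one,
    Complex.conj_ofNat] at h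
  rw [Complex.ofReal_neg]
  linear_combination h

theorem radius_nonneg {t : ℝ} (h1 : 0 ≤ t) (h2 : t < π) : 0 ≤ radius t :=
  mul_nonneg (mul_nonneg (Real.sqrt_nonneg _) (Real.sin_nonneg_of_nonneg_of_le_pi h1 h2.le))
    (Real.sqrt_nonneg _)

theorem radius_pow_four {t : ℝ} (h1 : 0 ≤ t) (h2 : t < π) :
    radius t ^ 4 = 4 * ((1 - Real.cos t) ^ 3 * (1 + Real.cos t)) := by
  have hc : 0 < Real.cos (t / 2) := Real.cos_pos_of_mem_Ioo ⟨by linarith, by linarith⟩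
  have htan : 0 ≤ Real.tan (t / 2) :=
    Real.tan_nonneg_of_nonneg_of_le_pi_div_two (by linarith) (by linarith)
  have hs : Real.sin t = 2 * Real.sin (t / 2) * Real.cos (t / 2) := by
    rw [← Real.sin_two_mul]; ring_nf
  have hcc : Real.cos t = 1 - 2 * Real.sin (t / 2) ^ 2 := by
    rw [Real.sin_sq, eq_comm]; nlinarith [Real.cos_two_mul (t / 2), congrArg Real.cos
      (show 2 * (t / 2) = t by ring)]
  have hcc' : Real.cos t = 2 * Real.cos (t / 2) ^ 2 - 1 := by
    rw [← Real.cos_two_mul]; ring_nf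
  have e1 : 1 - Real.cos t = 2 * Real.sin (t / 2) ^ 2 := by rw [hcc]; ring
  have e2 : 1 + Real.cos t = 2 * Real.cos (t / 2) ^ 2 := by rw [hcc']; ring
  have h : radius t ^ 4 = (√2 ^ 2) ^ 2 * Real.sin t ^ 4 * (√(Real.tan (t / 2)) ^ 2) ^ 2 := by
    rw [radius]; ring
  rw [h, Real.sq_sqrt (by norm_num), Real.sq_sqrt htan, e1, e2, hs, Real.tan_eq_sin_div_cos]
  field_simp
  ring

theorem arc_length_pow_four : ((27 : ℝ) ^ (1 / 4 : ℝ) / √2) ^ 4 = 27 / 4 := by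
  have h1 : ((27 : ℝ) ^ (1 / 4 : ℝ)) ^ 4 = 27 := by
    rw [← Real.rpow_natCast, ← Real.rpow_mul (by norm_num)]; norm_num
  have h2 : (√2 : ℝ) ^ 4 = 4 := by
    rw [show (√2 : ℝ) ^ 4 = (√2 ^ 2) ^ 2 by ring, Real.sq_sqrt (by norm_num)]; norm_num
  rw [div_pow, h1, h2]

theorem radius_le {t : ℝ} (h1 : 0 ≤ t) (h2 : t < π) :
    radius t ≤ (27 : ℝ) ^ (1 / 4 : ℝ) / √2 := by
  rw [← pow_le_pow_iff_left₀ (radius_nonneg h1 h2) (by positivity) (by norm_num : 4 ≠ 0),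
    radius_pow_four h1 h2, arc_length_pow_four]
  nlinarith [sq_nonneg ((Real.cos t + 1 / 2) * (Real.cos t - 1)),
    mul_nonneg (sq_nonneg (Real.cos t + 1 / 2)) (sq_nonneg (Real.cos t - 5 / 2)),
    sq_nonneg (Real.cos t + 1 / 2)]

/-- The unit circle is mapped into the arc. -/
theorem psi_mem_arc (t : ℝ) : psi (Complex.exp (t * Complex.I)) ∈ arc := by
  obtain ⟨s, hs, hst⟩ : ∃ s ∈ Ioc (-π) π, Complex.exp (t * Complex.I) =
      Complex.exp ((s : ℝ) * Complex.I) := by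
    refine ⟨(Complex.exp (t * Complex.I)).arg, Complex.arg_mem_Ioc _, ?_⟩
    have h := Complex.norm_mul_exp_arg_mul_I (Complex.exp (t * Complex.I))
    rw [Complex.norm_exp_ofReal_mul_I] at h
    simpa using h.symm
  rw [hst]
  rcases hs.2.eq_or_lt with rfl | hlt
  · rw [Complex.exp_pi_mul_I, psi_neg_one]
    exact Or.inl ⟨0, ⟨le_rfl, by positivity⟩, by simp⟩
  rcases le_total 0 s with h0 | h0
  · rw [psi_exp_of_nonneg h0 hlt]
    exact Or.inl ⟨_, ⟨radius_nonneg h0 hlt, radius_le h0 hlt⟩, rfl⟩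
  · have hn : s = -(-s) := by ring
    have hlt' : -s < π := by linarith [hs.1]
    have h0' : 0 ≤ -s := by linarith
    rw [hn, psi_exp_neg h0' hlt']
    exact Or.inr ⟨_, ⟨radius_nonneg h0' hlt', radius_le h0' hlt'⟩, rfl⟩

/-! ### Folding the outer side of the arc onto the inner one -/

/-- Every angle in `[2π/3, π]` has exactly one partner in `[0, 2π/3]` with the same image on the
arc. -/
theorem existsUnique_fold {t : ℝ} (ht : t ∈ Icc (2 * π / 3) π) :
    ∃! s, s ∈ Icc 0 (2 * π / 3) ∧
      psi (Complex.exp (s * Complex.I)) = psi (Complex.exp (t * Complex.I)) := by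
  have hpi := Real.pi_pos
  have hcos : Real.cos (2 * π / 3) = -1 / 2 := by
    rw [show 2 * π / 3 = π - π / 3 by ring, Real.cos_pi_sub, Real.cos_pi_div_three]; norm_num
  have hc0 : (-1 + Complex.I : ℂ) ≠ 0 := by
    intro h; have := congrArg Complex.im h; simp at this
  -- the value at `t` is `(-1 + i) x` with `0 ≤ x ≤ radius (2π/3)`
  obtain ⟨x, hx0, hx1, hx⟩ : ∃ x : ℝ, 0 ≤ x ∧ x ≤ radius (2 * π / 3) ∧
      psi (Complex.exp (t * Complex.I)) = (-1 + Complex.I) * (x : ℂ) := by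
    have hmax : radius (2 * π / 3) = (27 : ℝ) ^ (1 / 4 : ℝ) / √2 := by
      refine (pow_left_inj₀ (radius_nonneg (by linarith) (by linarith)) (by positivity)
        (by norm_num : 4 ≠ 0)).1 ?_
      rw [radius_pow_four (by linarith) (by linarith), arc_length_pow_four, hcos]; norm_num
    rcases ht.2.eq_or_lt with rfl | hlt
    · exact ⟨0, le_rfl, radius_nonneg (by linarith) (by linarith), by
        rw [Complex.exp_pi_mul_I, psi_neg_one]; simp⟩
    · have h0 : 0 ≤ t := by linarith [ht.1]
      exact ⟨radius t, radius_nonneg h0 hlt, hmax ▸ radius_le h0 hlt, psi_exp_of_nonneg h0 hlt⟩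
  have key : ∀ s ∈ Icc 0 (2 * π / 3),
      (psi (Complex.exp (s * Complex.I)) = psi (Complex.exp (t * Complex.I)) ↔ radius s = x) := by
    intro s hs
    rw [psi_exp_of_nonneg hs.1 (by linarith [hs.2]), hx, mul_right_inj' hc0]
    exact_mod_cast Iff.rfl
  have hmono : StrictMonoOn radius (Icc 0 (2 * π / 3)) := by
    intro a ha b hb hab
    have ha2 : a < π := by linarith [ha.2]
    have hb2 : b < π := by linarith [hb.2]
    rw [← pow_lt_pow_iff_left₀ (radius_nonneg ha.1 ha2) (radius_nonneg hb.1 hb2)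
      (by norm_num : 4 ≠ 0), radius_pow_four ha.1 ha2, radius_pow_four hb.1 hb2]
    have hcab : Real.cos b < Real.cos a := Real.cos_lt_cos_of_nonneg_of_le_pi ha.1 hb2.le hab
    have hcb : -1 / 2 ≤ Real.cos b := by
      rw [← hcos]; exact Real.cos_le_cos_of_nonneg_of_le_pi hb.1 (by linarith) hb.2
    have hca : Real.cos a ≤ 1 := Real.cos_le_one a
    obtain ⟨u, hu⟩ : ∃ u, u = 1 - Real.cos a := ⟨_, rfl⟩
    obtain ⟨v, hv⟩ : ∃ v, v = 1 - Real.cos b := ⟨_, rfl⟩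
    have e1 : 1 + Real.cos a = 2 - u := by rw [hu]; ring
    have e2 : 1 + Real.cos b = 2 - v := by rw [hv]; ring
    rw [e1, e2, ← hu, ← hv]
    have hu0 : 0 ≤ u := by linarith
    have huv : u < v := by linarith
    have hv1 : v ≤ 3 / 2 := by linarith
    have hpos : 0 < 2 * (v ^ 2 + u * v + u ^ 2) - (v + u) * (v ^ 2 + u ^ 2) := by
      nlinarith [mul_nonneg (sq_nonneg v) (sub_nonneg.2 hv1),
        mul_nonneg (sq_nonneg u) (by linarith : 0 ≤ 3 / 2 - u),
        mul_nonneg (mul_nonneg hu0 (by linarith : 0 ≤ v)) (sub_nonneg.2 hv1),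
        mul_nonneg (mul_nonneg hu0 (by linarith : 0 ≤ v)) (by linarith : 0 ≤ 3 / 2 - u),
        mul_pos (sub_pos.2 huv) (sub_pos.2 huv)]
    nlinarith [mul_pos (sub_pos.2 huv) hpos]
  have hcont : ContinuousOn radius (Icc 0 (2 * π / 3)) := by
    unfold radius
    refine (by fun_prop : Continuous fun t => √2 * Real.sin t).continuousOn.mul
      (ContinuousOn.sqrt ?_)
    have hh : MapsTo (fun t : ℝ => t / 2) (Icc 0 (2 * π / 3)) {x | Real.cos x ≠ 0} := fun s hs =>
      (Real.cos_pos_of_mem_Ioo ⟨by linarith [hs.1], by linarith [hs.2]⟩).ne'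
    exact Real.continuousOn_tan.comp (by fun_prop) hh
  have h00 : radius 0 = 0 := by simp [radius]
  obtain ⟨s, hs, hsx⟩ := intermediate_value_Icc (by linarith : (0 : ℝ) ≤ 2 * π / 3) hcont
    ⟨h00.symm ▸ hx0, hx1⟩
  exact ⟨s, ⟨hs, (key s hs).2 hsx⟩, fun y hy =>
    hmono.injOn hy.1 hs (((key y hy.1).1 hy.2).trans hsx.symm)⟩

open Classical in
/-- The folded angle `J t` of `t ∈ [2π/3, π]`: the angle in `[0, 2π/3]` with
`psi (exp (i J t)) = psi (exp (i t))` (and `0` for all other `t`). -/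
noncomputable def foldAngle (t : ℝ) : ℝ :=
  if ht : t ∈ Icc (2 * π / 3) π then (existsUnique_fold ht).choose else 0

theorem foldAngle_spec {t : ℝ} (ht : t ∈ Icc (2 * π / 3) π) :
    foldAngle t ∈ Icc 0 (2 * π / 3) ∧
      psi (Complex.exp (foldAngle t * Complex.I)) = psi (Complex.exp (t * Complex.I)) := by
  rw [foldAngle, dif_pos ht]
  exact (existsUnique_fold ht).choose_spec.1

/-! ### Fejér points and adjusted Fejér points -/

/-- The angles of the Fejér points in `[0, π)`, for `k ≤ n / 2`: the angle is `2kπ/(n+1)` if `n` is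
even and `(2k+1)π/(n+1)` if `n` is odd. -/
noncomputable def fejerAngleUpper (n k : ℕ) : ℝ :=
  if Even n then 2 * k * π / (n + 1) else (2 * k + 1) * π / (n + 1)

/-- The angles of the Fejér points for `0 ≤ k ≤ n`; those with `k > n / 2` are the negatives of
those in `(0, π)`, in reverse order. -/
noncomputable def fejerAngle (n k : ℕ) : ℝ :=
  if k ≤ n / 2 then fejerAngleUpper n k else -fejerAngleUpper n (2 * (n / 2) + 1 - k)

/-- The separation threshold `2π/(3(n+1))`. -/
noncomputable def gap (n : ℕ) : ℝ := 2 * π / (3 * (n + 1))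

/-- The indices `j` and `k`, with Fejér angles `0 ≤ θ_j ≤ 2π/3 < θ_k < π`, form an adjustment pair
of the first kind: `θ_j - gap < J θ_k ≤ θ_j`. -/
def PairBelow (n j k : ℕ) : Prop :=
  j ≤ n / 2 ∧ k ≤ n / 2 ∧ fejerAngle n j ≤ 2 * π / 3 ∧ 2 * π / 3 < fejerAngle n k ∧
    fejerAngle n j - gap n < foldAngle (fejerAngle n k) ∧
    foldAngle (fejerAngle n k) ≤ fejerAngle n j

/-- The indices `j` and `k`, with Fejér angles `0 ≤ θ_j ≤ 2π/3 < θ_k < π`, form an adjustment pair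
of the second kind: `θ_j < J θ_k < θ_j + gap`. -/
def PairAbove (n j k : ℕ) : Prop :=
  j ≤ n / 2 ∧ k ≤ n / 2 ∧ fejerAngle n j ≤ 2 * π / 3 ∧ 2 * π / 3 < fejerAngle n k ∧
    fejerAngle n j < foldAngle (fejerAngle n k) ∧
    foldAngle (fejerAngle n k) < fejerAngle n j + gap n

open Classical in
/-- The adjusted angles for the indices `k ≤ n / 2`. An angle `θ_k ≤ 2π/3` stays where it is and an
angle `θ_k > 2π/3` is replaced by `J θ_k`, unless `k` belongs to an adjustment pair; the two angles
of such a pair are pushed apart. -/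
noncomputable def adjustedAngleUpper (n k : ℕ) : ℝ :=
  if fejerAngle n k ≤ 2 * π / 3 then
    if h : ∃ m, PairBelow n k m then foldAngle (fejerAngle n h.choose) + gap n
    else if h : ∃ m, PairAbove n k m then foldAngle (fejerAngle n h.choose) - gap n
    else fejerAngle n k
  else
    if h : ∃ j, PairBelow n j k then fejerAngle n h.choose - gap n
    else if h : ∃ j, PairAbove n j k then fejerAngle n h.choose + gap n
    else foldAngle (fejerAngle n k)

/-- The adjusted angles for all indices `0 ≤ k ≤ n`, by symmetry for `k > n / 2`. -/
noncomputable def adjustedAngle (n k : ℕ) : ℝ :=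
  if k ≤ n / 2 then adjustedAngleUpper n k
  else -adjustedAngleUpper n (2 * (n / 2) + 1 - k)

/-- The adjusted Fejér points on the arc. -/
noncomputable def adjustedFejerPoint (n : ℕ) (k : Fin (n + 1)) : arc :=
  ⟨psi (Complex.exp (adjustedAngle n k * Complex.I)), psi_mem_arc _⟩

end LArc

namespace LArc

open MeasureTheory

/-! ### Comparability up to a constant factor -/

/-- The nonnegative numbers `a` and `b` agree up to the factor `C`. -/
structure Cmp (C a b : ℝ) : Prop where
  left_nonneg : 0 ≤ a
  right_nonneg : 0 ≤ b
  pos : 0 < C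
  le : a ≤ C * b
  ge : b ≤ C * a

namespace Cmp

theorem symm {C a b : ℝ} (h : Cmp C a b) : Cmp C b a := ⟨h.2, h.1, h.3, h.5, h.4⟩

theorem mono {C D a b : ℝ} (h : Cmp C a b) (hCD : C ≤ D) : Cmp D a b :=
  ⟨h.1, h.2, h.3.trans_le hCD, h.4.trans (mul_le_mul_of_nonneg_right hCD h.2),
    h.5.trans (mul_le_mul_of_nonneg_right hCD h.1)⟩

theorem refl {a : ℝ} (h : 0 ≤ a) : Cmp 1 a a := ⟨h, h, one_pos, by simp, by simp⟩

theorem trans {C D a b c : ℝ} (h : Cmp C a b) (h' : Cmp D b c) : Cmp (C * D) a c :=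
  ⟨h.1, h'.2, mul_pos h.3 h'.3,
    h.4.trans (by rw [mul_assoc]; exact mul_le_mul_of_nonneg_left h'.4 h.3.le),
    h'.5.trans (by rw [mul_comm C, mul_assoc]; exact mul_le_mul_of_nonneg_left h.5 h'.3.le)⟩

theorem mul {C D a b a' b' : ℝ} (h : Cmp C a b) (h' : Cmp D a' b') :
    Cmp (C * D) (a * a') (b * b') :=
  ⟨mul_nonneg h.1 h'.1, mul_nonneg h.2 h'.2, mul_pos h.3 h'.3,
    (mul_le_mul h.4 h'.4 h'.1 (mul_nonneg h.3.le h.2)).trans_eq (by ring),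
    (mul_le_mul h.5 h'.5 h'.2 (mul_nonneg h.3.le h.1)).trans_eq (by ring)⟩

theorem add {C D a b a' b' : ℝ} (h : Cmp C a b) (h' : Cmp D a' b') :
    Cmp (C + D) (a + a') (b + b') := by
  obtain ⟨h1, h2, h3, h4, h5⟩ := h
  obtain ⟨h1', h2', h3', h4', h5'⟩ := h'
  exact ⟨by positivity, by positivity, by positivity,
    by nlinarith [mul_nonneg h3.le h2', mul_nonneg h3'.le h2],
    by nlinarith [mul_nonneg h3.le h1', mul_nonneg h3'.le h1]⟩

theorem pow {C a b : ℝ} (h : Cmp C a b) (n : ℕ) : Cmp (C ^ n) (a ^ n) (b ^ n) :=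
  ⟨pow_nonneg h.1 _, pow_nonneg h.2 _, pow_pos h.3 _,
    (pow_le_pow_left₀ h.1 h.4 n).trans_eq (mul_pow ..),
    (pow_le_pow_left₀ h.2 h.5 n).trans_eq (mul_pow ..)⟩

theorem of_sq {C a b : ℝ} (ha : 0 ≤ a) (hb : 0 ≤ b) (h : Cmp C (a ^ 2) (b ^ 2)) :
    Cmp (√C) a b :=
  ⟨ha, hb, Real.sqrt_pos.2 h.3,
    abs_le_of_sq_le_sq' (by rw [mul_pow, Real.sq_sqrt h.3.le]; exact h.4)
      (by positivity) |>.2,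
    abs_le_of_sq_le_sq' (by rw [mul_pow, Real.sq_sqrt h.3.le]; exact h.5)
      (by positivity) |>.2⟩

theorem cancel {C D a b x y : ℝ} (ha : 0 ≤ a) (hb : 0 ≤ b) (hx : 0 < x)
    (h : Cmp C (a * x) (b * y)) (h' : Cmp D x y) : Cmp (C * D) a b := by
  have hy : 0 < y := by
    rcases h'.2.eq_or_lt with h0 | h0
    · have := h'.4; rw [← h0] at this; linarith [h'.3]
    · exact h0
  refine ⟨ha, hb, mul_pos h.3 h'.3, le_of_mul_le_mul_right ?_ hx, le_of_mul_le_mul_right ?_ hy⟩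
  · calc a * x ≤ C * (b * y) := h.4
      _ ≤ C * (b * (D * x)) := by have := h.3; have := h'.5; gcongr
      _ = _ := by ring
  · calc b * y ≤ C * (a * x) := h.5
      _ ≤ C * (a * (D * y)) := by have := h.3; have := h'.4; gcongr
      _ = _ := by ring

theorem pos_iff {C a b : ℝ} (h : Cmp C a b) : 0 < a ↔ 0 < b := by
  obtain ⟨h1, h2, h3, h4, h5⟩ := h
  constructor <;> intro h
  · by_contra h0
    have : b = 0 := by linarith
    subst this; linarith
  · by_contra h0
    have : a = 0 := by linarith
    subst this; linarith

end Cmp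

/-! ### Elementary trigonometric bounds -/

theorem sin_cmp : ∃ C, ∀ y ∈ Icc 0 π, Cmp C (Real.sin y) (y * (π - y)) := by
  have hpi := Real.pi_pos
  have key : ∀ y, 0 ≤ y → y ≤ π / 2 → 2 / π * y ≤ Real.sin y ∧ Real.sin y ≤ y := fun y h0 h1 =>
    ⟨Real.mul_le_sin h0 h1, Real.sin_le h0⟩
  have h3 := Real.pi_gt_three
  have h4 := Real.pi_le_four
  have gen : ∀ y, 0 ≤ y → y ≤ π / 2 → Cmp 8 (Real.sin y) (y * (π - y)) := by
    intro y h0 h1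
    obtain ⟨k1, k2⟩ := key y h0 h1
    have k3 : y / 2 ≤ Real.sin y := by
      refine le_trans ?_ k1
      rw [div_mul_eq_mul_div, le_div_iff₀ hpi]; nlinarith
    refine ⟨by linarith, mul_nonneg h0 (by linarith), by norm_num, ?_, ?_⟩ <;> nlinarith
  refine ⟨8, fun y hy => ?_⟩
  rcases le_total y (π / 2) with h | h
  · exact gen y hy.1 h
  · have := gen (π - y) (by linarith [hy.2]) (by linarith)
    rw [Real.sin_pi_sub] at this
    rw [mul_comm]; convert this using 2; ring

theorem abs_sin_half_cmp : ∃ C, ∀ u, |u| ≤ π → Cmp C |Real.sin (u / 2)| |u| := by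
  have hpi := Real.pi_pos
  have h4 := Real.pi_le_four
  refine ⟨4, fun u hu => ?_⟩
  have h1 : |Real.sin (u / 2)| = Real.sin (|u| / 2) := by
    rw [Real.abs_sin_eq_sin_abs_of_abs_le_pi (by rw [abs_div, abs_two]; linarith), abs_div,
      abs_two]
  have k1 := Real.mul_le_sin (x := |u| / 2) (by positivity) (by linarith)
  have k2 := Real.sin_le (x := |u| / 2) (by positivity)
  have k3 : |u| / 4 ≤ Real.sin (|u| / 2) := by
    refine le_trans ?_ k1
    rw [div_mul_eq_mul_div, le_div_iff₀ hpi]; nlinarith [abs_nonneg u]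
  rw [h1]
  exact ⟨by linarith [abs_nonneg u], abs_nonneg u, by norm_num, by linarith [abs_nonneg u],
    by linarith⟩

theorem abs_cos_sub_cos_cmp : ∃ C, ∀ s ∈ Icc 0 π, ∀ t ∈ Icc 0 π,
    Cmp C |Real.cos s - Real.cos t| (|s - t| * ((s + t) * (2 * π - s - t))) := by
  obtain ⟨C, hC⟩ := sin_cmp
  obtain ⟨D, hD⟩ := abs_sin_half_cmp
  have hpi := Real.pi_pos
  refine ⟨2 * D * (4 * C), fun s hs t ht => ?_⟩
  have e : |Real.cos s - Real.cos t| =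
      2 * |Real.sin ((s - t) / 2)| * Real.sin ((s + t) / 2) := by
    rw [Real.cos_sub_cos, abs_mul, abs_mul, abs_neg, abs_two,
      abs_of_nonneg (Real.sin_nonneg_of_nonneg_of_le_pi (x := (s + t) / 2)
        (by linarith [hs.1, ht.1]) (by linarith [hs.2, ht.2]))]
    ring
  have h1 := hD (s - t) (abs_le.2 ⟨by linarith [hs.1, ht.2], by linarith [hs.2, ht.1]⟩)
  have h2 := hC ((s + t) / 2) ⟨by linarith [hs.1, ht.1], by linarith [hs.2, ht.2]⟩
  rw [e]
  have h1' : Cmp (2 * D) (2 * |Real.sin ((s - t) / 2)|) |s - t| :=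
    ⟨by positivity, h1.2, by linarith [h1.3], by linarith [h1.4], by nlinarith [h1.5, h1.1, h1.3]⟩
  have h2' : Cmp (4 * C) (Real.sin ((s + t) / 2)) ((s + t) * (2 * π - s - t)) := by
    have hh := mul_nonneg (show 0 ≤ s + t by linarith [hs.1, ht.1])
      (show 0 ≤ 2 * π - s - t by linarith [hs.2, ht.2])
    have e2 : (s + t) / 2 * (π - (s + t) / 2) = (s + t) * (2 * π - s - t) / 4 := by ring
    rw [e2] at h2
    exact ⟨h2.1, hh, by linarith [h2.3], by nlinarith [h2.4, h2.3, mul_nonneg h2.3.le hh],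
      by linarith [h2.5]⟩
  exact h1'.mul h2'

theorem cmp_of_mem_Icc {a m M : ℝ} (hm : 0 < m) (ha : a ∈ Icc m M) :
    Cmp (M + 1 / m) a 1 := by
  have : 0 < a := hm.trans_le ha.1
  have hM : m ≤ M := ha.1.trans ha.2
  have hM0 : 0 < M := hm.trans_le hM
  have h1 : 0 < 1 / m := by positivity
  have h2 : 1 ≤ 1 / m * a := by
    rw [div_mul_eq_mul_div, one_mul, le_div_iff₀ hm]; linarith [ha.1]
  exact ⟨this.le, zero_le_one, by positivity, by linarith [ha.2], by nlinarith⟩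

theorem one_sub_cos_cmp : ∃ C, ∀ s ∈ Icc 0 π, Cmp C (1 - Real.cos s) (s ^ 2) := by
  obtain ⟨D, hD⟩ := abs_sin_half_cmp
  refine ⟨2 * D ^ 2, fun s hs => ?_⟩
  have h := (hD s (by rw [abs_of_nonneg hs.1]; exact hs.2)).pow 2
  rw [sq_abs, sq_abs] at h
  have e : 1 - Real.cos s = 2 * Real.sin (s / 2) ^ 2 := by
    rw [Real.sin_sq_eq_half_sub]; ring_nf
  rw [e]
  exact ⟨by positivity, by positivity, by linarith [h.3], by linarith [h.4],
    by nlinarith [h.5, h.1, h.3]⟩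

theorem one_add_cos_cmp : ∃ C, ∀ s ∈ Icc 0 π, Cmp C (1 + Real.cos s) ((π - s) ^ 2) := by
  obtain ⟨C, hC⟩ := one_sub_cos_cmp
  refine ⟨C, fun s hs => ?_⟩
  have := hC (π - s) ⟨by linarith [hs.2], by linarith [hs.1]⟩
  rwa [Real.cos_pi_sub, sub_neg_eq_add] at this

theorem cos_tip : Real.cos (2 * π / 3) = -1 / 2 := by
  rw [show 2 * π / 3 = π - π / 3 by ring, Real.cos_pi_sub, Real.cos_pi_div_three]; norm_num

theorem abs_half_add_cos_cmp : ∃ C, ∀ s ∈ Icc 0 π,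
    Cmp C |1 / 2 + Real.cos s| |s - 2 * π / 3| := by
  obtain ⟨C, hC⟩ := abs_cos_sub_cos_cmp
  have hpi := Real.pi_pos
  refine ⟨C * (1 * ((2 * π) * (2 * π) + 1 / (π / 3 * (π / 3)))), fun s hs => ?_⟩
  have h := hC s hs (2 * π / 3) ⟨by linarith, by linarith⟩
  rw [cos_tip] at h
  have e : Real.cos s - -1 / 2 = 1 / 2 + Real.cos s := by ring
  rw [e] at h
  refine h.trans ?_
  have h2 := (Cmp.refl (abs_nonneg (s - 2 * π / 3))).mul (cmp_of_mem_Icc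
    (a := (s + 2 * π / 3) * (2 * π - s - 2 * π / 3)) (m := π / 3 * (π / 3))
    (M := 2 * π * (2 * π)) (by positivity)
    ⟨mul_le_mul (by linarith [hs.1]) (by linarith [hs.2]) (by linarith) (by linarith [hs.1]),
     mul_le_mul (by linarith [hs.2]) (by linarith [hs.1]) (by linarith [hs.2]) (by linarith)⟩)
  simpa using h2

/-! ### Bounds for the radius -/

theorem radius_pi : radius π = 0 := by simp [radius]

theorem radius_pow_four_of_mem {t : ℝ} (ht : t ∈ Icc 0 π) :
    radius t ^ 4 = 4 * ((1 - Real.cos t) ^ 3 * (1 + Real.cos t)) := by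
  rcases ht.2.eq_or_lt with rfl | h
  · simp [radius_pi]
  · exact radius_pow_four ht.1 h

theorem radius_nonneg_of_mem {t : ℝ} (ht : t ∈ Icc 0 π) : 0 ≤ radius t := by
  rcases ht.2.eq_or_lt with rfl | h
  · simp [radius_pi]
  · exact radius_nonneg ht.1 h

theorem half_add_cos_nonneg {s : ℝ} (hs : s ∈ Icc 0 (2 * π / 3)) : 0 ≤ 1 / 2 + Real.cos s := by
  have hpi := Real.pi_pos
  have := Real.cos_le_cos_of_nonneg_of_le_pi hs.1 (by linarith) hs.2
  rw [cos_tip] at this; linarith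

theorem half_add_cos_nonpos {s : ℝ} (hs : s ∈ Icc (2 * π / 3) π) : 1 / 2 + Real.cos s ≤ 0 := by
  have hpi := Real.pi_pos
  have := Real.cos_le_cos_of_nonneg_of_le_pi (by linarith) hs.2 hs.1
  rw [cos_tip] at this; linarith

theorem inner_bracket_cmp {q Q : ℝ} (hq : q ∈ Icc (0:ℝ) (3 / 2)) (hQ : Q ∈ Icc (0:ℝ) (3 / 2)) :
    Cmp 4 (2 * (q ^ 2 + q * Q + Q ^ 2) - (q + Q) * (q ^ 2 + Q ^ 2))
      ((q ^ 2 + Q ^ 2) * (3 - q - Q)) := by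
  have gen : ∀ q Q : ℝ, 0 ≤ Q → Q ≤ q → q ≤ 3 / 2 →
      (q ^ 2 + Q ^ 2) * (3 - q - Q) ≤
        4 * (2 * (q ^ 2 + q * Q + Q ^ 2) - (q + Q) * (q ^ 2 + Q ^ 2)) := by
    intro q Q h0 h1 h2
    obtain ⟨d, rfl⟩ : ∃ d, q = Q + d := ⟨q - Q, by ring⟩
    have hd : 0 ≤ d := by linarith
    obtain ⟨e, he⟩ : ∃ e, e = 3 / 2 - Q - d := ⟨_, rfl⟩
    have he0 : 0 ≤ e := by linarith
    have hQ : Q = 3 / 2 - d - e := by linarith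
    have hd2 : d ≤ 3 / 2 := by linarith
    subst hQ
    have h3 : 0 ≤ 3 / 2 - d - e := h0
    nlinarith [mul_nonneg hd he0, mul_nonneg (mul_nonneg hd he0) h3, mul_nonneg hd h3,
      mul_nonneg he0 h3, mul_nonneg (mul_nonneg hd hd) h3, mul_nonneg (mul_nonneg hd hd) he0,
      mul_nonneg (mul_nonneg he0 he0) hd, mul_nonneg (mul_nonneg he0 he0) h3,
      mul_nonneg (mul_nonneg h3 h3) hd, mul_nonneg (mul_nonneg h3 h3) he0,
      pow_nonneg hd 3, pow_nonneg he0 3, pow_nonneg h3 3]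
  have up : 2 * (q ^ 2 + q * Q + Q ^ 2) - (q + Q) * (q ^ 2 + Q ^ 2) ≤
      (q ^ 2 + Q ^ 2) * (3 - q - Q) := by nlinarith [sq_nonneg (q - Q)]
  have hR : 0 ≤ (q ^ 2 + Q ^ 2) * (3 - q - Q) :=
    mul_nonneg (by positivity) (by linarith [hq.2, hQ.2])
  have low : (q ^ 2 + Q ^ 2) * (3 - q - Q) ≤
      4 * (2 * (q ^ 2 + q * Q + Q ^ 2) - (q + Q) * (q ^ 2 + Q ^ 2)) := by
    rcases le_total Q q with h | h
    · exact gen q Q hQ.1 h hq.2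
    · have := gen Q q hq.1 h hQ.2
      linarith
  exact ⟨by linarith, hR, by norm_num, by linarith, low⟩

theorem outer_bracket_cmp {p P : ℝ} (hp : p ∈ Icc (0:ℝ) (1 / 2)) (hP : P ∈ Icc (0:ℝ) (1 / 2)) :
    Cmp 8 (8 - 12 * (p + P) + 6 * (p ^ 2 + p * P + P ^ 2) - (p + P) * (p ^ 2 + P ^ 2))
      (1 - p - P) := by
  obtain ⟨u, rfl⟩ : ∃ u, p = 1 / 2 - u := ⟨1 / 2 - p, by ring⟩
  obtain ⟨v, rfl⟩ : ∃ v, P = 1 / 2 - v := ⟨1 / 2 - P, by ring⟩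
  have hu : 0 ≤ u := by linarith [hp.2]
  have hv : 0 ≤ v := by linarith [hP.2]
  have hu' : u ≤ 1 / 2 := by linarith [hp.1]
  have hv' : v ≤ 1 / 2 := by linarith [hP.1]
  have hc : u + v ≤ 8 * (8 - 12 * (1 / 2 - u + (1 / 2 - v)) + 6 * ((1 / 2 - u) ^ 2 + (1 / 2 - u) * (1 / 2 - v) + (1 / 2 - v) ^ 2) - (1 / 2 - u + (1 / 2 - v)) * ((1 / 2 - u) ^ 2 + (1 / 2 - v) ^ 2)) := by
    nlinarith [mul_nonneg hu hv, mul_nonneg hu (sub_nonneg.2 hu'), mul_nonneg hv (sub_nonneg.2 hv'),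
      mul_nonneg (mul_nonneg hu hv) hu, mul_nonneg (mul_nonneg hu hv) hv, pow_nonneg hu 3,
      pow_nonneg hv 3, sq_nonneg (u - v)]
  refine ⟨by linarith, by linarith, by norm_num, ?_, by linarith⟩
  nlinarith [mul_nonneg hu hv, mul_nonneg hu (sub_nonneg.2 hu'), mul_nonneg hv (sub_nonneg.2 hv'),
      mul_nonneg (mul_nonneg hu hv) (sub_nonneg.2 hu'), mul_nonneg (mul_nonneg hu hv) (sub_nonneg.2 hv'),
      mul_nonneg (mul_nonneg hu hu) (sub_nonneg.2 hu'), mul_nonneg (mul_nonneg hv hv) (sub_nonneg.2 hv'),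
      mul_nonneg (mul_nonneg hu hu) (sub_nonneg.2 hv'), mul_nonneg (mul_nonneg hv hv) (sub_nonneg.2 hu'), sq_nonneg (u - v)]

namespace Cmp

theorem congr {C a b a' b' : ℝ} (h : Cmp C a b) (ha : a' = a) (hb : b' = b) : Cmp C a' b' := by
  rwa [ha, hb]

theorem const_mul {C a b c : ℝ} (hc : 0 < c) (h : Cmp C a b) :
    Cmp ((c + 1 / c) * C) (c * a) b := by
  simpa using (cmp_of_mem_Icc hc ⟨le_rfl, le_rfl⟩).mul h

theorem mul_one_right {C D a b d : ℝ} (h : Cmp C a (b * d)) (h' : Cmp D d 1) :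
    Cmp (C * (1 * D)) a b := by
  have hb : 0 ≤ b := by
    have hd : 0 < d := by
      by_contra hd
      nlinarith [h'.5, h'.3]
    exact nonneg_of_mul_nonneg_left h.2 hd
  simpa using h.trans ((Cmp.refl hb).mul h')

end Cmp

theorem pow_add_pow_cmp {s t : ℝ} (hs : 0 ≤ s) (ht : 0 ≤ t) (n : ℕ) :
    Cmp (2 ^ (n + 1)) (s ^ (n + 1) + t ^ (n + 1)) ((s + t) ^ (n + 1)) := by
  refine ⟨by positivity, by positivity, by positivity, ?_, ?_⟩
  · have h1 : s ^ (n + 1) ≤ (s + t) ^ (n + 1) := pow_le_pow_left₀ hs (by linarith) _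
    have h2 : t ^ (n + 1) ≤ (s + t) ^ (n + 1) := pow_le_pow_left₀ ht (by linarith) _
    have h3 : (2 : ℝ) ≤ 2 ^ (n + 1) := by
      rw [pow_succ]; linarith [one_le_pow₀ (one_le_two : (1 : ℝ) ≤ 2) (n := n)]
    nlinarith [pow_nonneg (add_nonneg hs ht) (n + 1)]
  · refine (add_pow_le hs ht (n + 1)).trans ?_
    refine mul_le_mul_of_nonneg_right ?_ (by positivity)
    exact pow_le_pow_right₀ one_le_two (by omega)

theorem radius_pow_four_sub_inner_cmp : ∃ C, ∀ s ∈ Icc 0 (2 * π / 3), ∀ t ∈ Icc 0 (2 * π / 3),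
    Cmp C |radius s ^ 4 - radius t ^ 4| (|s - t| * (s + t) ^ 5 * (4 * π / 3 - s - t)) := by
  have hpi := Real.pi_pos
  obtain ⟨C1, h1⟩ := abs_cos_sub_cos_cmp
  obtain ⟨C2, h2⟩ := one_sub_cos_cmp
  obtain ⟨C3, h3⟩ := abs_half_add_cos_cmp
  apply Exists.intro; intro s hs t ht
  have hs' : s ∈ Icc 0 π := ⟨hs.1, by linarith [hs.2]⟩
  have ht' : t ∈ Icc 0 π := ⟨ht.1, by linarith [ht.2]⟩
  have cs := half_add_cos_nonneg hs
  have ct := half_add_cos_nonneg ht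
  have b := inner_bracket_cmp (q := 1 - Real.cos s) (Q := 1 - Real.cos t)
    ⟨by linarith [Real.cos_le_one s], by linarith⟩ ⟨by linarith [Real.cos_le_one t], by linarith⟩
  have e : |radius s ^ 4 - radius t ^ 4| = 4 * (|Real.cos s - Real.cos t| *
      (2 * ((1 - Real.cos s) ^ 2 + (1 - Real.cos s) * (1 - Real.cos t) + (1 - Real.cos t) ^ 2) -
        ((1 - Real.cos s) + (1 - Real.cos t)) * ((1 - Real.cos s) ^ 2 + (1 - Real.cos t) ^ 2))) := by
    rw [radius_pow_four_of_mem hs', radius_pow_four_of_mem ht']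
    conv_rhs => rw [← abs_of_nonneg b.1, ← abs_mul, ← abs_of_pos (four_pos : (0:ℝ) < 4), ← abs_mul]
    rw [← abs_neg]; congr 1; ring
  have q := (((h2 s hs').pow 2).add ((h2 t ht').pow 2)).trans
    (((pow_add_pow_cmp hs.1 ht.1 3)).congr (a' := (s^2)^2 + (t^2)^2) (by ring) rfl)
  have c := (h3 s hs').add (h3 t ht')
  rw [abs_of_nonneg cs, abs_of_nonneg ct, abs_of_nonpos (by linarith [hs.2] : s - 2 * π / 3 ≤ 0),
    abs_of_nonpos (by linarith [ht.2] : t - 2 * π / 3 ≤ 0)] at c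
  have b' := b.trans ((q.mul c).congr (a' := ((1 - Real.cos s) ^ 2 + (1 - Real.cos t) ^ 2) *
    (3 - (1 - Real.cos s) - (1 - Real.cos t))) (by ring) rfl)
  have w := cmp_of_mem_Icc (a := 2 * π - s - t) (m := 2 * π / 3) (M := 2 * π) (by positivity)
    ⟨by linarith [hs.2, ht.2], by linarith [hs.1, ht.1]⟩
  have := ((h1 s hs' t ht').mul b').const_mul four_pos
  rw [← e] at this
  refine Cmp.mul_one_right (this.congr rfl ?_) w
  ring

theorem radius_pow_four_sub_outer_cmp : ∃ C, ∀ s ∈ Icc (2 * π / 3) π, ∀ t ∈ Icc (2 * π / 3) π,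
    Cmp C |radius s ^ 4 - radius t ^ 4|
      (|s - t| * ((π - s) + (π - t)) * ((s - 2 * π / 3) + (t - 2 * π / 3))) := by
  have hpi := Real.pi_pos
  obtain ⟨C1, h1⟩ := abs_cos_sub_cos_cmp
  obtain ⟨C3, h3⟩ := abs_half_add_cos_cmp
  apply Exists.intro; intro s hs t ht
  have hs' : s ∈ Icc 0 π := ⟨by linarith [hs.1], hs.2⟩
  have ht' : t ∈ Icc 0 π := ⟨by linarith [ht.1], ht.2⟩
  have cs := half_add_cos_nonpos hs
  have ct := half_add_cos_nonpos ht
  have b := outer_bracket_cmp (p := 1 + Real.cos s) (P := 1 + Real.cos t)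
    ⟨by linarith [Real.neg_one_le_cos s], by linarith⟩
    ⟨by linarith [Real.neg_one_le_cos t], by linarith⟩
  have e : |radius s ^ 4 - radius t ^ 4| = 4 * (|Real.cos s - Real.cos t| *
      (8 - 12 * ((1 + Real.cos s) + (1 + Real.cos t)) + 6 * ((1 + Real.cos s) ^ 2 +
        (1 + Real.cos s) * (1 + Real.cos t) + (1 + Real.cos t) ^ 2) -
        ((1 + Real.cos s) + (1 + Real.cos t)) * ((1 + Real.cos s) ^ 2 + (1 + Real.cos t) ^ 2))) := by
    rw [radius_pow_four_of_mem hs', radius_pow_four_of_mem ht']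
    conv_rhs => rw [← abs_of_nonneg b.1, ← abs_mul, ← abs_of_pos (four_pos : (0:ℝ) < 4), ← abs_mul]
    congr 1; ring
  have c := (h3 s hs').add (h3 t ht')
  rw [abs_of_nonpos cs, abs_of_nonpos ct, abs_of_nonneg (by linarith [hs.1] : 0 ≤ s - 2 * π / 3),
    abs_of_nonneg (by linarith [ht.1] : 0 ≤ t - 2 * π / 3)] at c
  have b' := b.trans (c.congr (a' := 1 - (1 + Real.cos s) - (1 + Real.cos t)) (by ring) rfl)
  have w := cmp_of_mem_Icc (a := s + t) (m := 4 * π / 3) (M := 2 * π) (by positivity)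
    ⟨by linarith [hs.1, ht.1], by linarith [hs.2, ht.2]⟩
  have := ((h1 s hs' t ht').mul b').const_mul four_pos
  rw [← e] at this
  refine Cmp.mul_one_right (this.congr rfl ?_) w
  ring

theorem radius_sq_cmp : ∃ C, ∀ s ∈ Icc 0 π, Cmp C (radius s ^ 2) (s ^ 3 * (π - s)) := by
  obtain ⟨C1, h1⟩ := one_sub_cos_cmp
  obtain ⟨C2, h2⟩ := one_add_cos_cmp
  apply Exists.intro; intro s hs
  have h := (((h1 s hs).pow 3).mul (h2 s hs)).const_mul four_pos
  rw [← radius_pow_four_of_mem hs] at h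
  exact Cmp.of_sq (by positivity) (mul_nonneg (pow_nonneg hs.1 3) (by linarith [hs.2]))
    (h.congr (by ring) (by ring))

theorem radius_sq_inner_cmp : ∃ C, ∀ s ∈ Icc 0 (2 * π / 3), Cmp C (radius s ^ 2) (s ^ 3) := by
  have hpi := Real.pi_pos
  obtain ⟨C, h⟩ := radius_sq_cmp
  exact ⟨_, fun s hs => (h s ⟨hs.1, by linarith [hs.2]⟩).mul_one_right
    (cmp_of_mem_Icc (a := π - s) (m := π / 3) (M := π) (by positivity)
      ⟨by linarith [hs.2], by linarith [hs.1]⟩)⟩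

theorem radius_sq_outer_cmp : ∃ C, ∀ s ∈ Icc (2 * π / 3) π, Cmp C (radius s ^ 2) (π - s) := by
  have hpi := Real.pi_pos
  obtain ⟨C, h⟩ := radius_sq_cmp
  exact ⟨_, fun s hs => ((h s ⟨by linarith [hs.1], hs.2⟩).congr rfl
    (mul_comm _ _)).mul_one_right
    (cmp_of_mem_Icc (a := s ^ 3) (m := (2 * π / 3) ^ 3) (M := π ^ 3) (by positivity)
      ⟨pow_le_pow_left₀ (by positivity) hs.1 3, pow_le_pow_left₀ (by linarith [hs.1]) hs.2 3⟩)⟩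

/-! ### Twin angles: two angles with the same image on the arc -/

/-- The inner angle `t` and the outer angle `t'` have the same image on the arc. -/
structure Twin (t t' : ℝ) : Prop where
  inner : t ∈ Icc 0 (2 * π / 3)
  outer : t' ∈ Icc (2 * π / 3) π
  radius_eq : radius t = radius t'

theorem Twin.mem_inner {t t' : ℝ} (h : Twin t t') : t ∈ Icc 0 π :=
  ⟨h.1.1, by linarith [h.1.2, Real.pi_pos]⟩

theorem Twin.mem_outer {t t' : ℝ} (h : Twin t t') : t' ∈ Icc 0 π :=
  ⟨by linarith [h.2.1, Real.pi_pos], h.2.2⟩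

theorem twin_cube_cmp : ∃ C, ∀ t t', Twin t t' → Cmp C (t ^ 3) (π - t') := by
  obtain ⟨C1, h1⟩ := radius_sq_inner_cmp
  obtain ⟨C2, h2⟩ := radius_sq_outer_cmp
  exact ⟨_, fun t t' h => (h1 t h.1).symm.trans ((h2 t' h.2).congr (by rw [h.3]) rfl)⟩

theorem twin_tip_cmp : ∃ C, ∀ t t', Twin t t' → Cmp C (2 * π / 3 - t) (t' - 2 * π / 3) := by
  have hpi := Real.pi_pos
  obtain ⟨C1, h1⟩ := radius_pow_four_sub_inner_cmp
  obtain ⟨C2, h2⟩ := radius_pow_four_sub_outer_cmp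
  apply Exists.intro; intro t t' h
  have a1 := h1 (2 * π / 3) ⟨by positivity, le_rfl⟩ t h.1
  have a2 := h2 (2 * π / 3) ⟨le_rfl, by linarith⟩ t' h.2
  rw [← h.3] at a2
  rw [abs_of_nonneg (by linarith [h.1.2] : 0 ≤ 2 * π / 3 - t)] at a1
  rw [abs_of_nonpos (by linarith [h.2.1] : 2 * π / 3 - t' ≤ 0)] at a2
  have a1' := (a1.congr (b' := (2 * π / 3 - t) ^ 2 * (2 * π / 3 + t) ^ 5) rfl
    (by ring)).mul_one_right (cmp_of_mem_Icc (m := (2 * π / 3) ^ 5) (M := (4 * π / 3) ^ 5)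
      (by positivity) ⟨pow_le_pow_left₀ (by positivity) (by linarith [h.1.1]) 5,
        pow_le_pow_left₀ (by linarith [h.1.1]) (by linarith [h.1.2]) 5⟩)
  have a2' := (a2.congr (b' := (t' - 2 * π / 3) ^ 2 * (π - 2 * π / 3 + (π - t'))) rfl
    (by ring)).mul_one_right (cmp_of_mem_Icc (m := π / 3) (M := π)
      (by positivity) ⟨by linarith [h.2.2], by linarith [h.2.1]⟩)
  exact Cmp.of_sq (by linarith [h.1.2]) (by linarith [h.2.1]) (a1'.symm.trans a2')

theorem twin_sub_cmp : ∃ C, ∀ a a' b b', Twin a a' → Twin b b' →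
    Cmp C |a' - b'| (|a - b| * (a + b) ^ 2) := by
  have hpi := Real.pi_pos
  obtain ⟨C1, h1⟩ := radius_pow_four_sub_inner_cmp
  obtain ⟨C2, h2⟩ := radius_pow_four_sub_outer_cmp
  obtain ⟨C3, h3⟩ := twin_cube_cmp
  obtain ⟨C4, h4⟩ := twin_tip_cmp
  apply Exists.intro; intro a a' b b' ha hb
  have c1 := ((h3 a a' ha).add (h3 b b' hb)).symm.trans (pow_add_pow_cmp ha.1.1 hb.1.1 2)
  have c2 := ((h4 a a' ha).add (h4 b b' hb)).symm
  have c3 := (h2 a' ha.2 b' hb.2).symm.trans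
    ((h1 a ha.1 b hb.1).congr (by rw [ha.3, hb.3]) rfl)
  have c4 := c1.mul c2
  have hnn : 0 ≤ |a - b| * (a + b) ^ 2 := by positivity
  by_cases hx : 0 < ((π - a') + (π - b')) * ((a' - 2 * π / 3) + (b' - 2 * π / 3))
  · refine Cmp.cancel (abs_nonneg _) hnn hx (c3.congr (by ring) ?_) c4
    ring
  · have hz : a = b ∧ a' = b' := by
      have n1 : 0 ≤ (π - a') + (π - b') := by linarith [ha.2.2, hb.2.2]
      have n2 : 0 ≤ (a' - 2 * π / 3) + (b' - 2 * π / 3) := by linarith [ha.2.1, hb.2.1]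
      rcases mul_eq_zero.1 (le_antisymm (not_lt.1 hx) (mul_nonneg n1 n2)) with h | h
      · have e1 : a' = π := by linarith [ha.2.2, hb.2.2]
        have e2 : b' = π := by linarith [ha.2.2, hb.2.2]
        have f1 := (h3 a a' ha).4
        have f2 := (h3 b b' hb).4
        rw [e1, sub_self, mul_zero] at f1
        rw [e2, sub_self, mul_zero] at f2
        have g1 := pow_eq_zero_iff (three_ne_zero) |>.1 (le_antisymm f1 (pow_nonneg ha.1.1 3))
        have g2 := pow_eq_zero_iff (three_ne_zero) |>.1 (le_antisymm f2 (pow_nonneg hb.1.1 3))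
        exact ⟨by rw [g1, g2], by rw [e1, e2]⟩
      · have e1 : a' = 2 * π / 3 := by linarith [ha.2.1, hb.2.1]
        have e2 : b' = 2 * π / 3 := by linarith [ha.2.1, hb.2.1]
        have f1 := (h4 a a' ha).4
        have f2 := (h4 b b' hb).4
        rw [e1, sub_self, mul_zero] at f1
        rw [e2, sub_self, mul_zero] at f2
        exact ⟨by linarith [ha.1.2, hb.1.2], by rw [e1, e2]⟩
    rw [hz.1, hz.2, sub_self, sub_self, abs_zero, zero_mul]
    exact ⟨le_rfl, le_rfl, mul_pos c3.3 c4.3, by simp, by simp⟩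

/-! ### The interpolation kernel -/

/-- Up to the factor 2, the product of the distances from a point of the arc with radius
`radius t` to the two points with radius `radius s`. -/
noncomputable def ker (t s : ℝ) : ℝ :=
  |radius s - radius t| * √(radius s ^ 2 + radius t ^ 2)

theorem ker_nonneg (t s : ℝ) : 0 ≤ ker t s := by unfold ker; positivity

theorem ker_mul_cmp {t s : ℝ} (ht : t ∈ Icc 0 π) (hs : s ∈ Icc 0 π) :
    Cmp 2 (ker t s * (radius s ^ 2 + radius t ^ 2)) |radius s ^ 4 - radius t ^ 4| := by
  have hx := radius_nonneg_of_mem ht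
  have hr := radius_nonneg_of_mem hs
  unfold ker
  set x := radius t
  set r := radius s
  have hw : 0 ≤ √(r ^ 2 + x ^ 2) := Real.sqrt_nonneg _
  have hw2 : √(r ^ 2 + x ^ 2) ^ 2 = r ^ 2 + x ^ 2 := Real.sq_sqrt (by positivity)
  set w := √(r ^ 2 + x ^ 2)
  have e : |r ^ 4 - x ^ 4| = |r - x| * w * ((r + x) * w) := by
    rw [show r ^ 4 - x ^ 4 = (r - x) * ((r + x) * w ^ 2) by rw [hw2]; ring, abs_mul,
      abs_of_nonneg (mul_nonneg (add_nonneg hr hx) (sq_nonneg w))]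
    ring
  rw [e]
  have k0 : 0 ≤ |r - x| * w := by positivity
  have l1 : w ≤ r + x := abs_le_of_sq_le_sq' (by rw [hw2]; nlinarith) (by positivity) |>.2
  have l2 : r + x ≤ 2 * w := abs_le_of_sq_le_sq'
    (by rw [mul_pow, hw2]; nlinarith [sq_nonneg (r - x)]) (by positivity) |>.2
  have l3 : r ^ 2 + x ^ 2 ≤ (r + x) * w := by rw [← hw2]; nlinarith
  have l4 : (r + x) * w ≤ 2 * (r ^ 2 + x ^ 2) := by rw [← hw2]; nlinarith
  have n1 : 0 ≤ (r + x) * w := by positivity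
  exact ⟨by positivity, by positivity, by norm_num,
    by nlinarith [mul_le_mul_of_nonneg_left l3 k0, mul_nonneg k0 n1],
    by nlinarith [mul_le_mul_of_nonneg_left l4 k0]⟩

theorem ker_inner_cmp : ∃ C, ∀ t ∈ Icc 0 (2 * π / 3), ∀ s ∈ Icc 0 (2 * π / 3),
    Cmp C (ker t s) (|s - t| * (s + t) ^ 2 * (4 * π / 3 - s - t)) := by
  have hpi := Real.pi_pos
  obtain ⟨C1, h1⟩ := radius_pow_four_sub_inner_cmp
  obtain ⟨C2, h2⟩ := radius_sq_inner_cmp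
  apply Exists.intro; intro t ht s hs
  have ht' : t ∈ Icc 0 π := ⟨ht.1, by linarith [ht.2]⟩
  have hs' : s ∈ Icc 0 π := ⟨hs.1, by linarith [hs.2]⟩
  have a1 := (ker_mul_cmp ht' hs').trans (h1 s hs t ht)
  have a2 := ((h2 s hs).add (h2 t ht)).trans (pow_add_pow_cmp hs.1 ht.1 2)
  have hnn : 0 ≤ |s - t| * (s + t) ^ 2 * (4 * π / 3 - s - t) :=
    mul_nonneg (by positivity) (by linarith [hs.2, ht.2])
  by_cases hx : 0 < radius s ^ 2 + radius t ^ 2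
  · exact Cmp.cancel (ker_nonneg t s) hnn hx (a1.congr rfl (by ring)) a2
  · have f := a2.5
    rw [le_antisymm (not_lt.1 hx) (by positivity), mul_zero] at f
    have g : s + t = 0 := pow_eq_zero_iff (three_ne_zero) |>.1
      (le_antisymm f (pow_nonneg (add_nonneg hs.1 ht.1) 3))
    have e1 : s = 0 := by linarith [hs.1, ht.1]
    have e2 : t = 0 := by linarith [hs.1, ht.1]
    rw [e1, e2]
    refine ⟨ker_nonneg _ _, by simp, mul_pos a1.3 a2.3, by simp [ker], by simp [ker]⟩

theorem ker_outer_cmp : ∃ C, ∀ t t', Twin t t' → ∀ s ∈ Icc (2 * π / 3) π,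
    Cmp C (ker t s) (|s - t'| * ((s - 2 * π / 3) + (t' - 2 * π / 3))) := by
  have hpi := Real.pi_pos
  obtain ⟨C1, h1⟩ := radius_pow_four_sub_outer_cmp
  obtain ⟨C2, h2⟩ := radius_sq_outer_cmp
  apply Exists.intro; intro t t' h s hs
  have hs' : s ∈ Icc 0 π := ⟨by linarith [hs.1], hs.2⟩
  have a1 := (ker_mul_cmp h.mem_inner hs').trans ((h1 s hs t' h.2).congr (by rw [h.3]) rfl)
  have a2 := ((h2 s hs).add (h2 t' h.2))
  rw [← h.3] at a2
  have hnn : 0 ≤ |s - t'| * ((s - 2 * π / 3) + (t' - 2 * π / 3)) :=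
    mul_nonneg (by positivity) (by linarith [hs.1, h.2.1])
  by_cases hx : 0 < radius s ^ 2 + radius t ^ 2
  · exact Cmp.cancel (ker_nonneg t s) hnn hx (a1.congr rfl (by ring)) a2
  · have f := a2.5
    rw [le_antisymm (not_lt.1 hx) (by positivity), mul_zero] at f
    have e1 : s = π := by linarith [hs.2, h.2.2]
    have e2 : t' = π := by linarith [hs.2, h.2.2]
    have e3 : ker t s = 0 := by rw [ker, h.3, e1, e2]; simp
    rw [e3, e1, e2]
    refine ⟨le_rfl, by simp, mul_pos a1.3 a2.3, by simp, by simp⟩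

theorem ker_cmp : ∃ C, ∀ t t', Twin t t' → ∀ s ∈ Icc 0 π,
    Cmp C (ker t s) (|s - t| * |s - t'| * (s + t) ^ 2) := by
  have hpi := Real.pi_pos
  obtain ⟨C1, h1⟩ := ker_inner_cmp
  obtain ⟨C2, h2⟩ := ker_outer_cmp
  obtain ⟨C3, h3⟩ := twin_tip_cmp
  have key : ∃ C, ∀ t t', Twin t t' → ∀ s ∈ Icc 0 (2 * π / 3),
      Cmp C (ker t s) (|s - t| * |s - t'| * (s + t) ^ 2) := by
    apply Exists.intro; intro t t' h s hs
    have a := (Cmp.refl (by linarith [hs.2] : 0 ≤ 2 * π / 3 - s)).add (h3 t t' h)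
    refine ((h1 t h.1 s hs).trans ((Cmp.refl (by positivity :
      0 ≤ |s - t| * (s + t) ^ 2)).mul (a.congr (by ring) rfl))).congr rfl ?_
    rw [abs_of_nonpos (by linarith [hs.2, h.2.1] : s - t' ≤ 0)]; ring
  have key' : ∃ C, ∀ t t', Twin t t' → ∀ s ∈ Icc (2 * π / 3) π,
      Cmp C (ker t s) (|s - t| * |s - t'| * (s + t) ^ 2) := by
    apply Exists.intro; intro t t' h s hs
    have a := (Cmp.refl (by linarith [hs.1] : 0 ≤ s - 2 * π / 3)).add (h3 t t' h).symm
    have w := (cmp_of_mem_Icc (a := (s + t) ^ 2) (m := (2 * π / 3) ^ 2) (M := (2 * π) ^ 2)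
      (by positivity) ⟨pow_le_pow_left₀ (by positivity) (by linarith [hs.1, h.1.1]) 2,
        pow_le_pow_left₀ (by linarith [hs.1, h.1.1]) (by linarith [hs.2, h.1.2]) 2⟩).symm
    refine (((h2 t t' h s hs).trans ((Cmp.refl (abs_nonneg _)).mul a)).mul w).congr
      (by rw [mul_one]) ?_
    rw [abs_of_nonneg (by linarith [hs.1, h.1.2] : 0 ≤ s - t)]; ring
  obtain ⟨D, hD⟩ := key
  obtain ⟨D', hD'⟩ := key'
  refine ⟨max D D', fun t t' h s hs => ?_⟩
  rcases le_total s (2 * π / 3) with hh | hh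
  · exact (hD t t' h s ⟨hs.1, hh⟩).mono (le_max_left _ _)
  · exact (hD' t t' h s ⟨hh, hs.2⟩).mono (le_max_right _ _)

/-! ### Calculus of the radius -/

/-- The logarithmic derivative of `radius`. -/
noncomputable def rho (s : ℝ) : ℝ := (1 + 2 * Real.cos s) / (2 * Real.sin s)

theorem radius_pos {s : ℝ} (hs : s ∈ Ioo 0 π) : 0 < radius s := by
  unfold radius
  have h1 := Real.sin_pos_of_mem_Ioo hs
  have h2 : 0 < Real.tan (s / 2) :=
    Real.tan_pos_of_pos_of_lt_pi_div_two (by linarith [hs.1]) (by linarith [hs.2])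
  positivity

theorem hasDerivAt_radius {s : ℝ} (hs : s ∈ Ioo 0 π) :
    HasDerivAt radius (radius s * rho s) s := by
  have hc : 0 < Real.cos (s / 2) :=
    Real.cos_pos_of_mem_Ioo ⟨by linarith [hs.1, Real.pi_pos], by linarith [hs.2]⟩
  have hs2 : 0 < Real.sin (s / 2) :=
    Real.sin_pos_of_pos_of_lt_pi (by linarith [hs.1]) (by linarith [hs.2, hs.1])
  have ht : 0 < Real.tan (s / 2) :=
    Real.tan_pos_of_pos_of_lt_pi_div_two (by linarith [hs.1]) (by linarith [hs.2])
  have hsin := Real.sin_pos_of_mem_Ioo hs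
  have h1 : HasDerivAt (fun x : ℝ => Real.tan (x / 2)) (1 / Real.cos (s / 2) ^ 2 * (1 / 2)) s :=
    HasDerivAt.comp (h₂ := Real.tan) (h := fun x : ℝ => x / 2) s (Real.hasDerivAt_tan hc.ne')
      ((hasDerivAt_id' s).div_const 2)
  have h2 := ((Real.hasDerivAt_sin s).const_mul √2).mul (h1.sqrt ht.ne')
  refine h2.congr_deriv ?_
  have e : Real.sin s = 2 * Real.sin (s / 2) * Real.cos (s / 2) := by
    rw [← Real.sin_two_mul]; ring_nf
  have hq := Real.sq_sqrt ht.le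
  have hq0 : 0 < √(Real.tan (s / 2)) := Real.sqrt_pos.2 ht
  have et : Real.tan (s / 2) * Real.cos (s / 2) = Real.sin (s / 2) := by
    rw [Real.tan_eq_sin_div_cos]; field_simp
  have e2 : 1 / Real.cos (s / 2) ^ 2 * (1 / 2) / (2 * √(Real.tan (s / 2))) =
      √(Real.tan (s / 2)) / (2 * Real.sin s) := by
    rw [e, ← et]
    rw [div_eq_div_iff (by positivity) (by positivity)]
    field_simp
    linear_combination (-1 : ℝ) * hq
  rw [e2]
  unfold radius rho
  field_simp
  ring

theorem hasDerivAt_rho {s : ℝ} (hs : s ∈ Ioo 0 π) :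
    HasDerivAt rho (-(2 + Real.cos s) / (2 * Real.sin s ^ 2)) s := by
  have hsin := Real.sin_pos_of_mem_Ioo hs
  have h := (((Real.hasDerivAt_cos s).const_mul 2).const_add 1).div
    ((Real.hasDerivAt_sin s).const_mul 2) (by positivity)
  refine h.congr_deriv ?_
  rw [div_eq_div_iff (by positivity) (by positivity)]
  have := Real.sin_sq_add_cos_sq s
  linear_combination (-8 * Real.sin s ^ 2) * this

theorem continuousOn_radius : ContinuousOn radius (Icc 0 π) := by
  have h : ∀ t ∈ Icc 0 π,
      radius t = √(√(4 * ((1 - Real.cos t) ^ 3 * (1 + Real.cos t)))) := by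
    intro t ht
    rw [← radius_pow_four_of_mem ht, show radius t ^ 4 = (radius t ^ 2) ^ 2 by ring,
      Real.sqrt_sq (by positivity), Real.sqrt_sq (radius_nonneg_of_mem ht)]
  exact ContinuousOn.congr (by fun_prop) h

theorem rho_pos {s : ℝ} (hs : s ∈ Ioo 0 (2 * π / 3)) : 0 < rho s := by
  have hpi := Real.pi_pos
  have h := Real.cos_lt_cos_of_nonneg_of_le_pi hs.1.le (by linarith) hs.2
  rw [cos_tip] at h
  exact div_pos (by linarith) (mul_pos two_pos (Real.sin_pos_of_mem_Ioo
    ⟨hs.1, by linarith [hs.2]⟩))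

theorem rho_neg {s : ℝ} (hs : s ∈ Ioo (2 * π / 3) π) : rho s < 0 := by
  have hpi := Real.pi_pos
  have h := Real.cos_lt_cos_of_nonneg_of_le_pi (by linarith) hs.2.le hs.1
  rw [cos_tip] at h
  exact div_neg_of_neg_of_pos (by linarith) (mul_pos two_pos (Real.sin_pos_of_mem_Ioo
    ⟨by linarith [hs.1], hs.2⟩))

theorem strictMonoOn_radius : StrictMonoOn radius (Icc 0 (2 * π / 3)) := by
  have hpi := Real.pi_pos
  refine strictMonoOn_of_deriv_pos (convex_Icc _ _)
    (continuousOn_radius.mono (Icc_subset_Icc_right (by linarith))) fun s hs => ?_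
  rw [interior_Icc] at hs
  have hs' : s ∈ Ioo 0 π := ⟨hs.1, by linarith [hs.2]⟩
  rw [(hasDerivAt_radius hs').deriv]
  exact mul_pos (radius_pos hs') (rho_pos hs)

theorem strictAntiOn_radius : StrictAntiOn radius (Icc (2 * π / 3) π) := by
  have hpi := Real.pi_pos
  refine strictAntiOn_of_deriv_neg (convex_Icc _ _)
    (continuousOn_radius.mono (Icc_subset_Icc_left (by linarith))) fun s hs => ?_
  rw [interior_Icc] at hs
  have hs' : s ∈ Ioo 0 π := ⟨by linarith [hs.1], hs.2⟩
  rw [(hasDerivAt_radius hs').deriv]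
  exact mul_neg_of_pos_of_neg (radius_pos hs') (rho_neg hs)

theorem exists_twin {t : ℝ} (ht : t ∈ Icc 0 (2 * π / 3)) : ∃ t', Twin t t' := by
  have hpi := Real.pi_pos
  have h := intermediate_value_Icc' (by linarith : 2 * π / 3 ≤ π)
    (continuousOn_radius.mono (Icc_subset_Icc_left (by linarith)))
  have hm : radius t ∈ Icc (radius π) (radius (2 * π / 3)) :=
    ⟨by rw [radius_pi]; exact radius_nonneg_of_mem ⟨ht.1, by linarith [ht.2]⟩,
      strictMonoOn_radius.monotoneOn ht ⟨by linarith, le_rfl⟩ ht.2⟩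
  obtain ⟨t', h1, h2⟩ := h hm
  exact ⟨t', ht, h1, h2.symm⟩

theorem Twin.eq_outer {a a' b' : ℝ} (h : Twin a a') (h' : Twin a b') : a' = b' :=
  strictAntiOn_radius.injOn h.2 h'.2 (h.3.symm.trans h'.3)

theorem Twin.eq_inner {a b a' : ℝ} (h : Twin a a') (h' : Twin b a') : a = b :=
  strictMonoOn_radius.injOn h.1 h'.1 (h.3.trans h'.3.symm)

theorem Twin.lt_iff {a a' b b' : ℝ} (h : Twin a a') (h' : Twin b b') : a < b ↔ b' < a' := by
  rw [← strictMonoOn_radius.lt_iff_lt h.1 h'.1, h.3, h'.3,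
    strictAntiOn_radius.lt_iff_gt h.2 h'.2]

/-- The outer angle with the same image on the arc as the inner angle `t`. -/
noncomputable def outerTwin (t : ℝ) : ℝ :=
  open Classical in if h : t ∈ Icc 0 (2 * π / 3) then (exists_twin h).choose else 0

theorem twin_outerTwin {t : ℝ} (ht : t ∈ Icc 0 (2 * π / 3)) : Twin t (outerTwin t) := by
  rw [outerTwin, dif_pos ht]; exact (exists_twin ht).choose_spec

theorem twin_tip : Twin (2 * π / 3) (2 * π / 3) :=
  ⟨⟨by positivity, le_rfl⟩, ⟨le_rfl, by linarith [Real.pi_pos]⟩, rfl⟩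

theorem twin_zero : Twin 0 π :=
  ⟨⟨le_rfl, by positivity⟩, ⟨by linarith [Real.pi_pos], le_rfl⟩, by simp [radius]⟩

theorem twin_cos_ineq {C c : ℝ} (h1 : -1 / 2 < C) (h2 : C ≤ 1) (h3 : -1 ≤ c) (h4 : c < -1 / 2)
    (h : (1 - C) ^ 3 * (1 + C) = (1 - c) ^ 3 * (1 + c)) :
    (1 + 2 * C) * (1 - C) ≤ -(1 + 2 * c) * (1 - c) := by
  have k : 2 * (C * c) * (1 - (C + c)) = 2 * (C + c) ^ 2 - (C + c) ^ 3 - 2 := by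
    have hne : C - c ≠ 0 := by linarith
    apply mul_left_cancel₀ hne
    linear_combination (-1 : ℝ) * h
  obtain ⟨u, hu⟩ : ∃ u, c = -1 / 2 - u := ⟨-1 / 2 - c, by ring⟩
  obtain ⟨v, hv⟩ : ∃ v, C = v - 1 / 2 := ⟨C + 1 / 2, by ring⟩
  subst hu hv
  have hu0 : 0 ≤ u := by linarith
  have key : 0 ≤ u ^ 2 + v ^ 2 - 3 / 2 * (v - u) := by
    rcases le_total v u with h | h
    · nlinarith [sq_nonneg u, sq_nonneg v]
    · have hpos : 0 < 2 - (v - u) := by linarith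
      have e : (u ^ 2 + v ^ 2 - 3 / 2 * (v - u)) * (2 - (v - u)) =
          (v - u) * (3 - (v - u)) / 2 := by linear_combination (-1 : ℝ) * k
      have : 0 ≤ (u ^ 2 + v ^ 2 - 3 / 2 * (v - u)) * (2 - (v - u)) := by
        rw [e]; exact div_nonneg (mul_nonneg (by linarith) (by linarith)) two_pos.le
      exact nonneg_of_mul_nonneg_left this hpos
  nlinarith [key]

theorem twin_rho_le {a a' : ℝ} (h : Twin a a') (ha : 0 < a) (ha' : a < 2 * π / 3) :
    a' ∈ Ioo (2 * π / 3) π ∧ rho a ≤ -rho a' := by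
  have hpi := Real.pi_pos
  have m1 : a' < π := by
    have := (twin_zero.lt_iff h).1 ha; exact this
  have m2 : 2 * π / 3 < a' := (h.lt_iff twin_tip).1 ha'
  refine ⟨⟨m2, m1⟩, ?_⟩
  have s1 : 0 < Real.sin a := Real.sin_pos_of_mem_Ioo ⟨ha, by linarith⟩
  have s2 : 0 < Real.sin a' := Real.sin_pos_of_mem_Ioo ⟨by linarith, m1⟩
  have c1 : -1 / 2 < Real.cos a := by
    have := Real.cos_lt_cos_of_nonneg_of_le_pi ha.le (by linarith) ha'
    rwa [cos_tip] at this
  have c2 : Real.cos a' < -1 / 2 := by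
    have := Real.cos_lt_cos_of_nonneg_of_le_pi (by linarith) m1.le m2
    rwa [cos_tip] at this
  have hg : (1 - Real.cos a) ^ 3 * (1 + Real.cos a) = (1 - Real.cos a') ^ 3 * (1 + Real.cos a') := by
    have e1 := radius_pow_four_of_mem h.mem_inner
    have e2 := radius_pow_four_of_mem h.mem_outer
    rw [h.3] at e1; linarith
  have k := twin_cos_ineq c1 (Real.cos_le_one _) (Real.neg_one_le_cos _) c2 hg
  have q1 : Real.sin a * (1 - Real.cos a) = Real.sin a' * (1 - Real.cos a') := by
    refine (pow_left_inj₀ (mul_nonneg s1.le (by linarith [Real.cos_le_one a]))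
      (mul_nonneg s2.le (by linarith)) two_ne_zero).1 ?_
    rw [mul_pow, mul_pow, Real.sin_sq, Real.sin_sq]
    linear_combination hg
  have hp1 : 0 < 1 - Real.cos a := by
    have := Real.cos_lt_cos_of_nonneg_of_le_pi le_rfl (by linarith) ha
    rw [Real.cos_zero] at this; linarith
  have hp2 : 0 < 1 - Real.cos a' := by linarith
  unfold rho
  rw [← neg_div, div_le_div_iff₀ (by positivity) (by positivity)]
  have e : 0 < Real.sin a * (1 - Real.cos a) := mul_pos s1 hp1
  have : (1 + 2 * Real.cos a) * (2 * Real.sin a') * ((1 - Real.cos a) * (1 - Real.cos a')) ≤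
      -(1 + 2 * Real.cos a') * (2 * Real.sin a) * ((1 - Real.cos a) * (1 - Real.cos a')) := by
    calc _ = 2 * ((1 + 2 * Real.cos a) * (1 - Real.cos a)) * (Real.sin a' * (1 - Real.cos a')) := by
            ring
      _ = 2 * ((1 + 2 * Real.cos a) * (1 - Real.cos a)) * (Real.sin a * (1 - Real.cos a)) := by
            rw [q1]
      _ ≤ 2 * (-(1 + 2 * Real.cos a') * (1 - Real.cos a')) * (Real.sin a * (1 - Real.cos a)) := by
            gcongr
      _ = _ := by ring
  exact le_of_mul_le_mul_right this (mul_pos hp1 hp2)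

theorem continuousOn_outerTwin : ContinuousOn outerTwin (Icc 0 (2 * π / 3)) := by
  obtain ⟨C, hC⟩ := twin_sub_cmp
  have hpi := Real.pi_pos
  have h : ∀ a ∈ Icc 0 (2 * π / 3), ∀ b ∈ Icc 0 (2 * π / 3),
      dist (outerTwin a) (outerTwin b) ≤ C * (4 * π / 3) ^ 2 * dist a b := by
    intro a ha b hb
    have k := hC _ _ _ _ (twin_outerTwin ha) (twin_outerTwin hb)
    rw [Real.dist_eq, Real.dist_eq]
    refine k.4.trans ?_
    have : (a + b) ^ 2 ≤ (4 * π / 3) ^ 2 :=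
      pow_le_pow_left₀ (by linarith [ha.1, hb.1]) (by linarith [ha.2, hb.2]) 2
    calc C * (|a - b| * (a + b) ^ 2) ≤ C * (|a - b| * (4 * π / 3) ^ 2) := by
          have := k.3; gcongr
      _ = _ := by ring
  have h0 : 0 ≤ C * (4 * π / 3) ^ 2 :=
    mul_nonneg (hC _ _ _ _ twin_zero twin_zero).3.le (by positivity)
  exact (LipschitzOnWith.of_dist_le_mul (K := ⟨_, h0⟩) h).continuousOn

theorem hasDerivAt_outerTwin {a : ℝ} (ha : a ∈ Ioo 0 (2 * π / 3)) :
    HasDerivAt outerTwin (rho a / rho (outerTwin a)) a := by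
  have hpi := Real.pi_pos
  have ha' : a ∈ Icc 0 (2 * π / 3) := Ioo_subset_Icc_self ha
  have tw := twin_outerTwin ha'
  obtain ⟨m, -⟩ := twin_rho_le tw ha.1 ha.2
  have m' : outerTwin a ∈ Ioo 0 π := ⟨by linarith [m.1], m.2⟩
  have hst : HasStrictDerivAt radius (radius (outerTwin a) * rho (outerTwin a)) (outerTwin a) := by
    refine hasStrictDerivAt_of_hasDerivAt_of_continuousAt (f' := fun s => radius s * rho s)
      (Filter.eventually_of_mem (Ioo_mem_nhds m'.1 m'.2) fun s hs => hasDerivAt_radius hs) ?_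
    exact (hasDerivAt_radius m').continuousAt.mul (hasDerivAt_rho m').continuousAt
  have hne : radius (outerTwin a) * rho (outerTwin a) ≠ 0 :=
    mul_ne_zero (radius_pos m').ne' (rho_neg m).ne
  have hinv := (hst.to_localInverse hne).hasDerivAt
  have hra : radius (outerTwin a) = radius a := tw.3.symm
  have hcont : ContinuousAt outerTwin a :=
    continuousOn_outerTwin.continuousAt (Icc_mem_nhds ha.1 ha.2)
  have hev : ∀ᶠ y in nhds a, outerTwin y = hst.localInverse _ _ _ hne (radius y) := by
    have h1 := hcont.eventually (HasStrictFDerivAt.eventually_left_inverse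
      (hst.hasStrictFDerivAt_equiv hne))
    filter_upwards [h1, Icc_mem_nhds ha.1 ha.2] with y hy hy'
    rw [(twin_outerTwin hy').3]
    exact hy.symm
  generalize hst.localInverse _ _ _ hne = g at hinv hev
  rw [hra] at hinv
  have hcomp := hinv.comp a (hasDerivAt_radius ⟨ha.1, by linarith [ha.2]⟩)
  refine (hcomp.congr_of_eventuallyEq hev).congr_deriv ?_
  have hr : radius a ≠ 0 := (radius_pos ⟨ha.1, by linarith [ha.2]⟩).ne'
  have hn := (rho_neg m).ne
  field_simp

theorem monotoneOn_add_outerTwin :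
    MonotoneOn (fun a => a + outerTwin a) (Icc 0 (2 * π / 3)) := by
  have hd : ∀ a ∈ Ioo 0 (2 * π / 3), HasDerivAt (fun a => a + outerTwin a)
      (1 + rho a / rho (outerTwin a)) a := fun a ha =>
    (hasDerivAt_id a).add (hasDerivAt_outerTwin ha)
  refine monotoneOn_of_deriv_nonneg (convex_Icc _ _)
    (continuousOn_id.add continuousOn_outerTwin) ?_ ?_
  · rw [interior_Icc]
    exact fun a ha => (hd a ha).differentiableAt.differentiableWithinAt
  · rw [interior_Icc]
    intro a ha
    rw [(hd a ha).deriv]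
    obtain ⟨m, hm⟩ := twin_rho_le (twin_outerTwin (Ioo_subset_Icc_self ha)) ha.1 ha.2
    have hn := rho_neg m
    have : -1 ≤ rho a / rho (outerTwin a) := by
      rw [le_div_iff_of_neg hn]; linarith
    linarith

/-- Folding the outer side onto the inner side does not decrease distances of angles. -/
theorem Twin.abs_sub_le {a a' b b' : ℝ} (h : Twin a a') (h' : Twin b b') :
    |a' - b'| ≤ |a - b| := by
  have gen : ∀ {a a' b b' : ℝ}, Twin a a' → Twin b b' → a ≤ b → |a' - b'| ≤ |a - b| := by
    intro a a' b b' h h' hab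
    have e1 := h.eq_outer (twin_outerTwin h.1)
    have e2 := h'.eq_outer (twin_outerTwin h'.1)
    have m := monotoneOn_add_outerTwin h.1 h'.1 hab
    simp only [← e1, ← e2] at m
    have : b' ≤ a' := not_lt.1 fun hlt => absurd ((h'.lt_iff h).2 hlt) (not_lt.2 hab)
    rw [abs_of_nonneg (by linarith), abs_of_nonpos (by linarith)]
    linarith
  rcases le_total a b with hab | hab
  · exact gen h h' hab
  · rw [abs_sub_comm a', abs_sub_comm a]; exact gen h' h hab

/-! ### Second derivative of the logarithm of the kernel -/

theorem Twin.radius_ne {t t' s : ℝ} (h : Twin t t') (hs : s ∈ Icc 0 π) (h1 : s ≠ t) (h2 : s ≠ t') :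
    radius s ≠ radius t := by
  rcases le_total s (2 * π / 3) with hh | hh
  · exact fun e => h1 (strictMonoOn_radius.injOn ⟨hs.1, hh⟩ h.1 e)
  · exact fun e => h2 (strictAntiOn_radius.injOn ⟨hh, hs.2⟩ h.2 (e.trans h.3))

/-- The derivative of `log (ker t s)` in `s`. -/
noncomputable def dlogKer (t s : ℝ) : ℝ :=
  rho s * (radius s / (radius s - radius t) + radius s ^ 2 / (radius s ^ 2 + radius t ^ 2))

/-- The second derivative of `log (ker t s)` in `s`. -/
noncomputable def ddlogKer (t s : ℝ) : ℝ :=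
  -(2 + Real.cos s) / (2 * Real.sin s ^ 2) *
      (radius s / (radius s - radius t) + radius s ^ 2 / (radius s ^ 2 + radius t ^ 2)) +
    rho s ^ 2 * (-(radius s * radius t) / (radius s - radius t) ^ 2 +
      2 * (radius s ^ 2 * radius t ^ 2) / (radius s ^ 2 + radius t ^ 2) ^ 2)

theorem hasDerivAt_log_ker {t s : ℝ} (hs : s ∈ Ioo 0 π) (hne : radius s ≠ radius t) :
    HasDerivAt (fun s => Real.log (ker t s)) (dlogKer t s) s := by
  have hr := radius_pos hs
  have hd := hasDerivAt_radius hs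
  have hq : 0 < radius s ^ 2 + radius t ^ 2 := by positivity
  have e : ∀ᶠ y in nhds s, Real.log (ker t y) =
      Real.log (radius y - radius t) + Real.log (radius y ^ 2 + radius t ^ 2) / 2 := by
    have c1 : ∀ᶠ y in nhds s, radius y ≠ radius t := hd.continuousAt.eventually_ne hne
    have c2 : ∀ᶠ y in nhds s, 0 < radius y :=
      Filter.eventually_of_mem (Ioo_mem_nhds hs.1 hs.2) fun y hy => radius_pos hy
    filter_upwards [c1, c2] with y h1 h2
    have : 0 < radius y ^ 2 + radius t ^ 2 := by positivity
    rw [ker, Real.log_mul (abs_ne_zero.2 (sub_ne_zero.2 h1)) (Real.sqrt_pos.2 this).ne',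
      Real.log_abs, Real.log_sqrt this.le]
  have h := ((hd.sub_const (radius t)).log (sub_ne_zero.2 hne)).add
    ((((hd.pow 2).add_const (radius t ^ 2)).log hq.ne').div_const 2)
  refine (h.congr_of_eventuallyEq e).congr_deriv ?_
  have := sub_ne_zero.2 hne
  unfold dlogKer
  simp only [Pi.pow_apply]
  field_simp
  push_cast
  ring

theorem hasDerivAt_dlogKer {t s : ℝ} (hs : s ∈ Ioo 0 π) (hne : radius s ≠ radius t) :
    HasDerivAt (dlogKer t) (ddlogKer t s) s := by
  have hr := radius_pos hs
  have hd := hasDerivAt_radius hs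
  have hq : radius s ^ 2 + radius t ^ 2 ≠ 0 := by positivity
  have hne' := sub_ne_zero.2 hne
  have h := (hasDerivAt_rho hs).mul ((hd.div (hd.sub_const (radius t)) hne').add
    ((hd.pow 2).div ((hd.pow 2).add_const (radius t ^ 2)) hq))
  refine h.congr_deriv ?_
  unfold ddlogKer
  simp only [Pi.pow_apply, Pi.add_apply, Pi.div_apply]
  have e1 : (radius s * rho s * (radius s - radius t) - radius s * (radius s * rho s)) /
      (radius s - radius t) ^ 2 = rho s * (-(radius s * radius t) / (radius s - radius t) ^ 2) := by
    field_simp; ring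
  have e2 : (((2 : ℕ) : ℝ) * radius s ^ (2 - 1) * (radius s * rho s) *
      (radius s ^ 2 + radius t ^ 2) - radius s ^ 2 * (((2 : ℕ) : ℝ) * radius s ^ (2 - 1) *
        (radius s * rho s))) / (radius s ^ 2 + radius t ^ 2) ^ 2 =
      rho s * (2 * (radius s ^ 2 * radius t ^ 2) / (radius s ^ 2 + radius t ^ 2) ^ 2) := by
    field_simp; push_cast; ring
  rw [e1, e2]
  ring

theorem abs_ddlogKer_le {t s : ℝ} (hs : s ∈ Ioo 0 π) (ht : t ∈ Icc 0 π)
    (hne : radius s ≠ radius t) {A P Q : ℝ}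
    (hA : radius s / |radius s - radius t| ≤ A) (hP : |rho s| ≤ P)
    (hQ : (2 + Real.cos s) / (2 * Real.sin s ^ 2) ≤ Q) :
    |ddlogKer t s| ≤ Q * (A + 1) + P ^ 2 * (A ^ 2 + A + 1) := by
  have hr := radius_pos hs
  have hx := radius_nonneg_of_mem ht
  have hsin := Real.sin_pos_of_mem_Ioo hs
  unfold ddlogKer
  set r := radius s
  set x := radius t
  have hd : 0 < |r - x| := abs_pos.2 (sub_ne_zero.2 hne)
  have hA0 : 0 ≤ r / |r - x| := by positivity
  have hP0 : 0 ≤ |rho s| := abs_nonneg _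
  have hQ0 : 0 ≤ (2 + Real.cos s) / (2 * Real.sin s ^ 2) :=
    div_nonneg (by linarith [Real.neg_one_le_cos s]) (by positivity)
  have b1 : |r / (r - x) + r ^ 2 / (r ^ 2 + x ^ 2)| ≤ A + 1 := by
    refine (abs_add_le _ _).trans (add_le_add ?_ ?_)
    · rwa [abs_div, abs_of_pos hr]
    · rw [abs_of_nonneg (by positivity), div_le_one (by positivity)]; nlinarith [sq_nonneg x]
  have b2 : |-(r * x) / (r - x) ^ 2 + 2 * (r ^ 2 * x ^ 2) / (r ^ 2 + x ^ 2) ^ 2| ≤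
      A ^ 2 + A + 1 := by
    refine (abs_add_le _ _).trans (add_le_add ?_ ?_)
    · rw [abs_div, abs_neg, abs_of_nonneg (by positivity : 0 ≤ r * x), abs_pow]
      have hxr : x ≤ r + |r - x| := by linarith [neg_abs_le (r - x)]
      have : r * x / |r - x| ^ 2 ≤ (r / |r - x|) ^ 2 + r / |r - x| := by
        rw [div_pow, div_add_div _ _ (by positivity) (by positivity),
          div_le_div_iff₀ (by positivity) (by positivity)]
        have := mul_le_mul_of_nonneg_left hxr hr.le
        calc r * x * (|r - x| ^ 2 * |r - x|) ≤ r * (r + |r - x|) * (|r - x| ^ 2 * |r - x|) := by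
              gcongr
          _ = _ := by ring
      refine this.trans ?_
      gcongr
    · rw [abs_of_nonneg (by positivity), div_le_one (by positivity)]
      nlinarith [sq_nonneg (r ^ 2), sq_nonneg (x ^ 2)]
  have hA1 : 0 ≤ A := hA0.trans hA
  refine (abs_add_le _ _).trans (add_le_add ?_ ?_)
  · rw [abs_mul, abs_div, abs_neg, abs_of_nonneg (by linarith [Real.neg_one_le_cos s] :
      0 ≤ 2 + Real.cos s), abs_of_pos (by positivity : 0 < 2 * Real.sin s ^ 2)]
    exact mul_le_mul hQ b1 (abs_nonneg _) (hQ0.trans hQ)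
  · rw [abs_mul, abs_pow]
    exact mul_le_mul (pow_le_pow_left₀ hP0 hP 2) b2 (abs_nonneg _) (by positivity)

theorem rho_bound : ∃ C, 0 < C ∧ ∀ s ∈ Ioo 0 π,
    |rho s| ≤ C * (|s - 2 * π / 3| / (s * (π - s))) ∧
    (2 + Real.cos s) / (2 * Real.sin s ^ 2) ≤ C / (s * (π - s)) ^ 2 := by
  obtain ⟨C1, h1⟩ := sin_cmp
  obtain ⟨C2, h2⟩ := abs_half_add_cos_cmp
  have hC1 : 0 < C1 := (h1 0 ⟨le_rfl, Real.pi_pos.le⟩).3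
  have hC2 : 0 < C2 := (h2 0 ⟨le_rfl, Real.pi_pos.le⟩).3
  refine ⟨C2 * C1 + 2 * C1 ^ 2, by positivity, fun s hs => ?_⟩
  have k1 := h1 s (Ioo_subset_Icc_self hs)
  have k2 := h2 s (Ioo_subset_Icc_self hs)
  have hsin := Real.sin_pos_of_mem_Ioo hs
  have hp : 0 < s * (π - s) := mul_pos hs.1 (by linarith [hs.2])
  constructor
  · have e : |rho s| = |1 / 2 + Real.cos s| / Real.sin s := by
      rw [rho, abs_div, abs_of_pos (by positivity : 0 < 2 * Real.sin s),
        show 1 + 2 * Real.cos s = 2 * (1 / 2 + Real.cos s) by ring, abs_mul, abs_two,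
        mul_div_mul_left _ _ two_ne_zero]
    rw [e, ← mul_div_assoc, div_le_div_iff₀ hsin hp]
    calc |1 / 2 + Real.cos s| * (s * (π - s))
        ≤ (C2 * |s - 2 * π / 3|) * (C1 * Real.sin s) := by
          apply mul_le_mul k2.4 k1.5 hp.le (by positivity)
      _ = (C2 * C1) * |s - 2 * π / 3| * Real.sin s := by ring
      _ ≤ _ := by
          have : 0 < C1 ^ 2 := by positivity
          gcongr; linarith
  · rw [div_le_div_iff₀ (by positivity) (by positivity)]
    have q : (s * (π - s)) ^ 2 ≤ (C1 * Real.sin s) ^ 2 := pow_le_pow_left₀ hp.le k1.5 2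
    calc (2 + Real.cos s) * (s * (π - s)) ^ 2 ≤ 3 * (C1 * Real.sin s) ^ 2 := by
          apply mul_le_mul (by linarith [Real.cos_le_one s]) q (by positivity) (by norm_num)
      _ ≤ _ := by
          have : 0 < C2 * C1 * Real.sin s ^ 2 := by positivity
          nlinarith [this, mul_pos (pow_pos hC1 2) (pow_pos hsin 2)]

theorem second_derivative_assembly {D K X a b q : ℝ} (hD : 0 ≤ D) (hK : 0 ≤ K) (hX : 0 ≤ X)
    (t1 : q * b ≤ 100 * X) (t2 : q ≤ X) (t3 : (a * b) ^ 2 ≤ 9 * X) (t4 : a * (a * b) ≤ 9 * X)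
    (t5 : a ^ 2 ≤ 9 * X) :
    D * q * (K * b + 1) + (D * a) ^ 2 * ((K * b) ^ 2 + K * b + 1) ≤
      1000 * (D + 1) ^ 2 * (K + 1) ^ 2 * X := by
  calc D * q * (K * b + 1) + (D * a) ^ 2 * ((K * b) ^ 2 + K * b + 1)
      = D * K * (q * b) + D * q + (D ^ 2 * K ^ 2 * (a * b) ^ 2 +
        D ^ 2 * K * (a * (a * b)) + D ^ 2 * a ^ 2) := by ring
    _ ≤ D * K * (100 * X) + D * X + (D ^ 2 * K ^ 2 * (9 * X) + D ^ 2 * K * (9 * X) +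
          D ^ 2 * (9 * X)) := by gcongr
    _ = (100 * (D * K) + D + 9 * (D ^ 2 * K ^ 2) + 9 * (D ^ 2 * K) + 9 * D ^ 2) * X := by ring
    _ ≤ (1000 * (D + 1) ^ 2 * (K + 1) ^ 2) * X := by
        refine mul_le_mul_of_nonneg_right ?_ hX
        have h1 : 0 ≤ D * K := by positivity
        have h2 : 0 ≤ D ^ 2 * K := by positivity
        have h3 : 0 ≤ D * K ^ 2 := by positivity
        have h4 : 0 ≤ D ^ 2 * K ^ 2 := by positivity
        have h5 : 0 ≤ D ^ 2 := by positivity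
        have h6 : 0 ≤ K ^ 2 := by positivity
        linarith

theorem radius_div_inner_bound : ∃ K, 0 < K ∧ ∀ t t', Twin t t' → ∀ s ∈ Ioc 0 (2 * π / 3), s ≠ t → s ≠ t' →
      0 < 4 * π / 3 - s - t ∧
      radius s / |radius s - radius t| ≤ K * (s / (|s - t| * (4 * π / 3 - s - t))) := by
  have hpi := Real.pi_gt_three
  have hpi4 := Real.pi_le_four
  obtain ⟨C1, h1⟩ := ker_inner_cmp
  obtain ⟨C2, h2⟩ := radius_sq_inner_cmp
  have hC1 : 0 < C1 := (h1 0 ⟨le_rfl, by positivity⟩ 0 ⟨le_rfl, by positivity⟩).3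
  have hC2 : 0 < C2 := (h2 0 ⟨le_rfl, by positivity⟩).3
  refine ⟨C1 * C2, by positivity, ?_⟩
  intro t t' h s hs hst hst'
  have hs' : s ∈ Icc 0 (2 * π / 3) := Ioc_subset_Icc_self hs
  have hsp : s ∈ Icc 0 π := ⟨hs.1.le, by linarith [hs.2]⟩
  have hr := radius_nonneg_of_mem hsp
  have hd : 0 < |radius s - radius t| := abs_pos.2 (sub_ne_zero.2 (h.radius_ne hsp hst hst'))
  have hdd : 0 < |s - t| := abs_pos.2 (sub_ne_zero.2 hst)
  have hw : 0 < 4 * π / 3 - s - t := by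
    rcases lt_or_gt_of_ne hst with h0 | h0
    · linarith [h.1.2]
    · linarith [hs.2]
  have ht0 := h.1.1
  have hs0 := hs.1
  refine ⟨hw, ?_⟩
  have k := (h1 t h.1 s hs').5
  have kr := (h2 s hs').4
  have kx := (h2 t h.1).4
  have hnum : radius s * √(radius s ^ 2 + radius t ^ 2) ≤ C2 * (s * (s + t) ^ 2) := by
    refine abs_le_of_sq_le_sq' ?_ (by positivity) |>.2
    rw [mul_pow, Real.sq_sqrt (by positivity)]
    calc radius s ^ 2 * (radius s ^ 2 + radius t ^ 2)
        ≤ (C2 * s ^ 3) * (C2 * s ^ 3 + C2 * t ^ 3) := by gcongr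
      _ = C2 ^ 2 * (s ^ 2 * (s * (s ^ 3 + t ^ 3))) := by ring
      _ ≤ C2 ^ 2 * (s ^ 2 * ((s + t) * (s + t) ^ 3)) := by
          gcongr
          · linarith
          · nlinarith [mul_nonneg hs0.le ht0, mul_nonneg (mul_nonneg hs0.le ht0) hs0.le,
              mul_nonneg (mul_nonneg hs0.le ht0) ht0]
      _ = _ := by ring
  have hw1 : 0 < √(radius s ^ 2 + radius t ^ 2) := by
    have := radius_pos (s := s) ⟨hs.1, by linarith [hs.2]⟩
    positivity
  rw [← mul_div_assoc, div_le_div_iff₀ hd (by positivity)]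
  have k' : |s - t| * (s + t) ^ 2 * (4 * π / 3 - s - t) ≤
      C1 * (|radius s - radius t| * √(radius s ^ 2 + radius t ^ 2)) := k
  have hst2 : 0 < (s + t) ^ 2 := by positivity
  refine le_of_mul_le_mul_right ?_ (mul_pos hw1 hst2)
  calc radius s * (|s - t| * (4 * π / 3 - s - t)) *
        (√(radius s ^ 2 + radius t ^ 2) * (s + t) ^ 2)
      = (radius s * √(radius s ^ 2 + radius t ^ 2)) *
        (|s - t| * (s + t) ^ 2 * (4 * π / 3 - s - t)) := by ring
    _ ≤ (C2 * (s * (s + t) ^ 2)) *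
        (C1 * (|radius s - radius t| * √(radius s ^ 2 + radius t ^ 2))) := by
        apply mul_le_mul hnum k' (by positivity) (by positivity)
    _ = _ := by ring

theorem ddlogKer_inner_bound : ∃ C, 0 < C ∧ ∀ t t', Twin t t' → ∀ s ∈ Ioc 0 (2 * π / 3),
    s ≠ t → s ≠ t' → |ddlogKer t s| ≤ C * (1 / (s - t) ^ 2 + 1 / s ^ 2) := by
  have hpi := Real.pi_gt_three
  have hpi4 := Real.pi_le_four
  obtain ⟨D, hD, h3⟩ := rho_bound
  obtain ⟨K, hK0, hA⟩ := radius_div_inner_bound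
  refine ⟨1000 * (D + 1) ^ 2 * (K + 1) ^ 2, by positivity, fun t t' h s hs hst hst' => ?_⟩
  obtain ⟨hw, hA'⟩ := hA t t' h s hs hst hst'
  have hsp : s ∈ Ioo 0 π := ⟨hs.1, by linarith [hs.2]⟩
  obtain ⟨hP, hQ⟩ := h3 s hsp
  have hs0 := hs.1
  have hd : 0 < |s - t| := abs_pos.2 (sub_ne_zero.2 hst)
  have hσ : 1 ≤ π - s := by linarith [hs.2]
  have hT : 0 ≤ 2 * π / 3 - s := by linarith [hs.2]
  have hP' : |rho s| ≤ D * ((2 * π / 3 - s) / s) := by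
    refine hP.trans ?_
    rw [abs_of_nonpos (by linarith), neg_sub]
    gcongr
    exact le_mul_of_one_le_right hs0.le hσ
  have hQ' : (2 + Real.cos s) / (2 * Real.sin s ^ 2) ≤ D / s ^ 2 := by
    refine hQ.trans ?_
    gcongr
    exact le_mul_of_one_le_right hs0.le hσ
  refine (abs_ddlogKer_le hsp h.mem_inner (h.radius_ne (Ioo_subset_Icc_self hsp) hst hst')
    hA' hP' hQ').trans ?_
  rw [← sq_abs (s - t)]
  set d := |s - t| with hddef
  set w := 4 * π / 3 - s - t with hwdef
  have hdw : d ≤ w := by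
    rw [hddef, abs_le]; constructor <;> linarith [h.1.2, hs.2]
  have hTw : 2 * π / 3 - s ≤ w := by linarith [h.1.2]
  have hTb : 2 * π / 3 - s ≤ 3 := by linarith
  set X := 1 / d ^ 2 + 1 / s ^ 2 with hX
  have hX1 : 1 / d ^ 2 ≤ X := by rw [hX]; have : 0 ≤ 1 / s ^ 2 := by positivity
                                 linarith
  have hX2 : 1 / s ^ 2 ≤ X := by rw [hX]; have : 0 ≤ 1 / d ^ 2 := by positivity
                                 linarith
  have hX3 : 1 / (s * d) ≤ X := by
    have := two_mul_le_add_sq (1 / s) (1 / d)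
    have e1 : 1 / (s * d) = 1 / s * (1 / d) := by rw [one_div_mul_one_div]
    have : 0 ≤ 1 / s * (1 / d) := by positivity
    rw [hX, e1, ← one_div_pow, ← one_div_pow]; nlinarith
  have hX0 : 0 ≤ X := by positivity
  have t1 : 1 / s ^ 2 * (s / (d * w)) ≤ 100 * X := by
    have e : 1 / s ^ 2 * (s / (d * w)) = 1 / (s * (d * w)) := by
      field_simp
    rw [e]
    have : 1 / (s * (d * w)) ≤ 2 * X := by
      rcases le_total s 1 with hs1 | hs1
      · have : 1 / 2 ≤ w := by linarith
        calc 1 / (s * (d * w)) ≤ 1 / (s * (d * (1 / 2))) := by gcongr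
          _ = 2 * (1 / (s * d)) := by field_simp
          _ ≤ _ := by linarith
      · calc 1 / (s * (d * w)) ≤ 1 / (1 * (d * d)) := by gcongr
          _ = 1 / d ^ 2 := by rw [one_mul, sq]
          _ ≤ _ := by linarith
    linarith
  have pa : (2 * π / 3 - s) / s * (s / (d * w)) ≤ 1 / d := by
    have e : (2 * π / 3 - s) / s * (s / (d * w)) = (2 * π / 3 - s) / w * (1 / d) := by field_simp
    rw [e]
    have : (2 * π / 3 - s) / w ≤ 1 := (div_le_one hw).2 hTw
    have h0 : 0 ≤ 1 / d := by positivity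
    nlinarith
  have pb : (2 * π / 3 - s) / s ≤ 3 * (1 / s) := by
    rw [mul_one_div]; gcongr
  have pa0 : 0 ≤ (2 * π / 3 - s) / s * (s / (d * w)) := by positivity
  have pb0 : 0 ≤ (2 * π / 3 - s) / s := by positivity
  set a := (2 * π / 3 - s) / s with ha
  set b := s / (d * w) with hb
  have t3 : (a * b) ^ 2 ≤ 9 * X := by
    calc (a * b) ^ 2 ≤ (1 / d) ^ 2 := pow_le_pow_left₀ pa0 pa 2
      _ = 1 / d ^ 2 := one_div_pow _ _
      _ ≤ 9 * X := by linarith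
  have t4 : a * (a * b) ≤ 9 * X := by
    calc a * (a * b) ≤ (3 * (1 / s)) * (1 / d) := mul_le_mul pb pa pa0 (by positivity)
      _ = 3 * (1 / (s * d)) := by rw [mul_assoc, one_div_mul_one_div]
      _ ≤ _ := by linarith
  have t5 : a ^ 2 ≤ 9 * X := by
    calc a ^ 2 ≤ (3 * (1 / s)) ^ 2 := pow_le_pow_left₀ pb0 pb 2
      _ = 9 * (1 / s ^ 2) := by ring
      _ ≤ _ := by linarith
  have hbn : 0 ≤ b := by positivity
  have := second_derivative_assembly hD.le hK0.le hX0 t1 hX2 t3 t4 t5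
  rwa [mul_one_div] at this

theorem radius_div_outer_bound : ∃ K, 0 < K ∧ ∀ t t', Twin t t' → ∀ s ∈ Ico (2 * π / 3) π, s ≠ t → s ≠ t' →
      0 < (s - 2 * π / 3) + (t' - 2 * π / 3) ∧
      radius s / |radius s - radius t| ≤ K *
        ((2 * (π - s) + |s - t'|) / (|s - t'| * ((s - 2 * π / 3) + (t' - 2 * π / 3)))) := by
  have hpi := Real.pi_gt_three
  have hpi4 := Real.pi_le_four
  obtain ⟨C1, h1⟩ := ker_outer_cmp
  obtain ⟨C2, h2⟩ := radius_sq_outer_cmp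
  have hC1 : 0 < C1 := (h1 _ _ twin_zero π ⟨by linarith, le_rfl⟩).3
  have hC2 : 0 < C2 := (h2 π ⟨by linarith, le_rfl⟩).3
  refine ⟨C1 * C2, by positivity, ?_⟩
  intro t t' h s hs hst hst'
  have hs' : s ∈ Icc (2 * π / 3) π := Ico_subset_Icc_self hs
  have hsp : s ∈ Icc 0 π := ⟨by linarith [hs.1], hs.2.le⟩
  have hr := radius_nonneg_of_mem hsp
  have hd : 0 < |radius s - radius t| := abs_pos.2 (sub_ne_zero.2 (h.radius_ne hsp hst hst'))
  have hdd : 0 < |s - t'| := abs_pos.2 (sub_ne_zero.2 hst')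
  have hw : 0 < (s - 2 * π / 3) + (t' - 2 * π / 3) := by
    rcases lt_or_gt_of_ne hst' with h0 | h0
    · linarith [hs.1]
    · linarith [h.2.1]
  have ht0 : 0 ≤ π - t' := by linarith [h.2.2]
  have hs0 : 0 < π - s := by linarith [hs.2]
  refine ⟨hw, ?_⟩
  have k := (h1 t t' h s hs').5
  have kr := (h2 s hs').4
  have kx := (h2 t' h.2).4
  rw [← h.3] at kx
  have htd : π - t' ≤ (π - s) + |s - t'| := by linarith [le_abs_self (s - t')]
  have hnum : radius s * √(radius s ^ 2 + radius t ^ 2) ≤ C2 * (2 * (π - s) + |s - t'|) := by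
    refine abs_le_of_sq_le_sq' ?_ (by positivity) |>.2
    rw [mul_pow, Real.sq_sqrt (by positivity)]
    calc radius s ^ 2 * (radius s ^ 2 + radius t ^ 2)
        ≤ (C2 * (π - s)) * (C2 * (π - s) + C2 * ((π - s) + |s - t'|)) := by
          have : C2 * (π - t') ≤ C2 * ((π - s) + |s - t'|) := by gcongr
          gcongr
          linarith
      _ = C2 ^ 2 * ((π - s) * (2 * (π - s) + |s - t'|)) := by ring
      _ ≤ C2 ^ 2 * ((2 * (π - s) + |s - t'|) * (2 * (π - s) + |s - t'|)) := by
          gcongr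
          linarith
      _ = _ := by ring
  have hw1 : 0 < √(radius s ^ 2 + radius t ^ 2) := by
    have := radius_pos (s := s) ⟨by linarith [hs.1], hs.2⟩
    positivity
  rw [← mul_div_assoc, div_le_div_iff₀ hd (by positivity)]
  have k' : |s - t'| * ((s - 2 * π / 3) + (t' - 2 * π / 3)) ≤
      C1 * (|radius s - radius t| * √(radius s ^ 2 + radius t ^ 2)) := k
  refine le_of_mul_le_mul_right ?_ hw1
  calc radius s * (|s - t'| * ((s - 2 * π / 3) + (t' - 2 * π / 3))) *
        √(radius s ^ 2 + radius t ^ 2)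
      = (radius s * √(radius s ^ 2 + radius t ^ 2)) *
        (|s - t'| * ((s - 2 * π / 3) + (t' - 2 * π / 3))) := by ring
    _ ≤ (C2 * (2 * (π - s) + |s - t'|)) *
        (C1 * (|radius s - radius t| * √(radius s ^ 2 + radius t ^ 2))) := by
        apply mul_le_mul hnum k' (by positivity) (by positivity)
    _ = _ := by ring

theorem outer_assembly {D K d σ w τ : ℝ} (hD : 0 < D) (hK0 : 0 < K) (hd : 0 < d) (hσ : 0 < σ)
    (hw : 0 < w) (hT : 0 ≤ τ) (hdw : d ≤ w) (hTw : τ ≤ w) (hTb : τ ≤ 3) (hσ2 : σ ≤ 2)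
    (hwσ : w ≤ 1 / 2 → 1 / 2 ≤ σ) :
    D / σ ^ 2 * (K * ((2 * σ + d) / (d * w)) + 1) + (D * (τ / σ)) ^ 2 *
      ((K * ((2 * σ + d) / (d * w))) ^ 2 + K * ((2 * σ + d) / (d * w)) + 1) ≤
      1000 * (D + 1) ^ 2 * (K + 1) ^ 2 * (1 / d ^ 2 + 1 / σ ^ 2) := by
  obtain ⟨X, hX⟩ : ∃ X, X = 1 / d ^ 2 + 1 / σ ^ 2 := ⟨_, rfl⟩
  rw [← hX]
  have hX1 : 1 / d ^ 2 ≤ X := by rw [hX]; have : 0 ≤ 1 / σ ^ 2 := by positivity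
                                 linarith
  have hX2 : 1 / σ ^ 2 ≤ X := by rw [hX]; have : 0 ≤ 1 / d ^ 2 := by positivity
                                 linarith
  have hX3 : 1 / (σ * d) ≤ X := by
    have := two_mul_le_add_sq (1 / σ) (1 / d)
    have e1 : 1 / (σ * d) = 1 / σ * (1 / d) := by rw [one_div_mul_one_div]
    have : 0 ≤ 1 / σ * (1 / d) := by positivity
    rw [hX, e1, ← one_div_pow, ← one_div_pow]; nlinarith
  have hX0 : 0 ≤ X := by rw [hX]; positivity
  obtain ⟨b, hb⟩ : ∃ b, b = (2 * σ + d) / (d * w) := ⟨_, rfl⟩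
  obtain ⟨a, ha⟩ : ∃ a, a = τ / σ := ⟨_, rfl⟩
  rw [← hb, ← ha]
  have hbn : 0 ≤ b := by rw [hb]; positivity
  have t1 : 1 / σ ^ 2 * b ≤ 100 * X := by
    rcases le_total w (1 / 2) with hw2 | hw2
    · have hσ1 : 1 / 2 ≤ σ := hwσ hw2
      have q1 : 1 / σ ^ 2 ≤ 4 := by
        rw [div_le_iff₀ (by positivity)]; nlinarith
      have q2 : b ≤ 6 * (1 / d ^ 2) := by
        calc b ≤ 6 / (d * d) := by rw [hb]; gcongr; linarith
          _ = 6 * (1 / d ^ 2) := by ring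
      calc 1 / σ ^ 2 * b ≤ 4 * (6 * (1 / d ^ 2)) := by gcongr
        _ ≤ _ := by linarith
    · have q2 : b ≤ 2 * (2 * σ + d) / d := by
        calc b ≤ (2 * σ + d) / (d * (1 / 2)) := by rw [hb]; gcongr
          _ = _ := by field_simp
      calc 1 / σ ^ 2 * b ≤ 1 / σ ^ 2 * (2 * (2 * σ + d) / d) := by gcongr
        _ = 4 * (1 / (σ * d)) + 2 * (1 / σ ^ 2) := by field_simp; ring
        _ ≤ _ := by linarith
  have pa : a * b ≤ 2 * (1 / d) + 1 / σ := by
    have e : a * b = τ / w * ((2 * σ + d) / (σ * d)) := by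
      rw [ha, hb]; field_simp
    have e2 : (2 * σ + d) / (σ * d) = 2 * (1 / d) + 1 / σ := by field_simp
    rw [e, e2]
    have : τ / w ≤ 1 := (div_le_one hw).2 hTw
    have h0 : 0 ≤ 2 * (1 / d) + 1 / σ := by positivity
    nlinarith
  have pb : a ≤ 3 * (1 / σ) := by
    rw [mul_one_div, ha]; gcongr
  have pb0 : 0 ≤ a := by rw [ha]; positivity
  have pa0 : 0 ≤ a * b := mul_nonneg pb0 hbn
  have t3 : (a * b) ^ 2 ≤ 9 * X := by
    calc (a * b) ^ 2 ≤ (2 * (1 / d) + 1 / σ) ^ 2 := pow_le_pow_left₀ pa0 pa 2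
      _ = 4 * (1 / d ^ 2) + 4 * (1 / (σ * d)) + 1 / σ ^ 2 := by field_simp; ring
      _ ≤ _ := by linarith
  have t4 : a * (a * b) ≤ 9 * X := by
    calc a * (a * b) ≤ (3 * (1 / σ)) * (2 * (1 / d) + 1 / σ) :=
          mul_le_mul pb pa pa0 (by positivity)
      _ = 6 * (1 / (σ * d)) + 3 * (1 / σ ^ 2) := by field_simp; ring
      _ ≤ _ := by linarith
  have t5 : a ^ 2 ≤ 9 * X := by
    calc a ^ 2 ≤ (3 * (1 / σ)) ^ 2 := pow_le_pow_left₀ pb0 pb 2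
      _ = 9 * (1 / σ ^ 2) := by ring
      _ ≤ _ := by linarith
  have := second_derivative_assembly hD.le hK0.le hX0 t1 hX2 t3 t4 t5
  rwa [mul_one_div] at this

theorem ddlogKer_outer_bound : ∃ C, 0 < C ∧ ∀ t t', Twin t t' → ∀ s ∈ Ico (2 * π / 3) π,
    s ≠ t → s ≠ t' → |ddlogKer t s| ≤ C * (1 / (s - t') ^ 2 + 1 / (π - s) ^ 2) := by
  have hpi := Real.pi_gt_three
  have hpi4 := Real.pi_le_four
  obtain ⟨D, hD, h3⟩ := rho_bound
  obtain ⟨K, hK0, hA⟩ := radius_div_outer_bound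
  refine ⟨1000 * (D + 1) ^ 2 * (K + 1) ^ 2, by positivity, fun t t' h s hs hst hst' => ?_⟩
  obtain ⟨hw, hA'⟩ := hA t t' h s hs hst hst'
  have hsp : s ∈ Ioo 0 π := ⟨by linarith [hs.1], hs.2⟩
  obtain ⟨hP, hQ⟩ := h3 s hsp
  have hs1 : 1 ≤ s := by linarith [hs.1]
  have hd : 0 < |s - t'| := abs_pos.2 (sub_ne_zero.2 hst')
  have hσ : 0 < π - s := by linarith [hs.2]
  have hT : 0 ≤ s - 2 * π / 3 := by linarith [hs.1]
  have hP' : |rho s| ≤ D * ((s - 2 * π / 3) / (π - s)) := by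
    refine hP.trans ?_
    rw [abs_of_nonneg hT]
    gcongr
    exact le_mul_of_one_le_left hσ.le hs1
  have hQ' : (2 + Real.cos s) / (2 * Real.sin s ^ 2) ≤ D / (π - s) ^ 2 := by
    refine hQ.trans ?_
    gcongr
    exact le_mul_of_one_le_left hσ.le hs1
  refine (abs_ddlogKer_le hsp h.mem_inner (h.radius_ne (Ioo_subset_Icc_self hsp) hst hst')
    hA' hP' hQ').trans ?_
  have hdw : |s - t'| ≤ (s - 2 * π / 3) + (t' - 2 * π / 3) := by
    rw [abs_le]; constructor <;> linarith [h.2.1, hs.1]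
  rw [← sq_abs (s - t')]
  exact outer_assembly hD hK0 hd hσ hw hT hdw (by linarith [h.2.1]) (by linarith) (by linarith)
    fun _ => by linarith [h.2.1]

/-- The second derivative of `log (ker t s)` is bounded by inverse squares of the distances to the
singularities `t`, its twin, and the end points. -/
theorem ddlogKer_bound : ∃ C, 0 < C ∧ ∀ t t', Twin t t' → ∀ s ∈ Ioo 0 π, s ≠ t → s ≠ t' →
    |ddlogKer t s| ≤
      C * (1 / (s - t) ^ 2 + 1 / (s - t') ^ 2 + 1 / (s - 0) ^ 2 + 1 / (s - π) ^ 2) := by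
  obtain ⟨C1, hC1, h1⟩ := ddlogKer_inner_bound
  obtain ⟨C2, hC2, h2⟩ := ddlogKer_outer_bound
  refine ⟨C1 + C2, by positivity, fun t t' h s hs hst hst' => ?_⟩
  have n1 : 0 ≤ 1 / (s - t) ^ 2 := by positivity
  have n2 : 0 ≤ 1 / (s - t') ^ 2 := by positivity
  have n3 : 0 ≤ 1 / (s - 0) ^ 2 := by positivity
  have n4 : 0 ≤ 1 / (s - π) ^ 2 := by positivity
  rcases le_total s (2 * π / 3) with hh | hh
  · refine (h1 t t' h s ⟨hs.1, hh⟩ hst hst').trans ?_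
    rw [sub_zero] at n3 ⊢
    refine mul_le_mul (by linarith) (by linarith) (by positivity) (by positivity)
  · refine (h2 t t' h s ⟨hh, hs.2⟩ hst hst').trans ?_
    rw [show (π - s) ^ 2 = (s - π) ^ 2 by ring]
    refine mul_le_mul (by linarith) (by linarith) (by positivity) (by positivity)

/-! ### Averages of the logarithm of the kernel -/

theorem integral_log_le {a b R : ℝ} (hab : a ≤ b) (ha : -R ≤ a) (hb : b ≤ R) :
    ∫ u in a..b, Real.log u ≤ (b - a) * Real.log R := by
  have h : ∫ u in a..b, Real.log u ≤ ∫ _ in a..b, Real.log R := by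
    refine intervalIntegral.integral_mono_ae_restrict hab
      intervalIntegral.intervalIntegrable_log' intervalIntegrable_const ?_
    have h0 : ∀ᵐ u : ℝ ∂volume, u ≠ 0 := Measure.ae_ne volume 0
    filter_upwards [ae_restrict_of_ae h0, ae_restrict_mem measurableSet_Icc] with u hu hu'
    rw [← Real.log_abs]
    exact Real.log_le_log (abs_pos.2 hu) (abs_le.2 ⟨by linarith [hu'.1], by linarith [hu'.2]⟩)
  simpa [intervalIntegral.integral_const] using h

theorem abs_average_log_le {h : ℝ} (hh : 0 < h) (y : ℝ) :
    |(1 / (2 * h)) * (∫ u in (y - h)..(y + h), Real.log u) - Real.log (max h |y|)| ≤ 4 := by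
  have hM : 0 < max h |y| := lt_max_of_lt_left hh
  have l2 : Real.log 2 ≤ 1 := by linarith [Real.log_two_lt_d9]
  have l3 : Real.log 3 ≤ 2 := by
    have := Real.log_le_sub_one_of_pos (show (0:ℝ) < 3 by norm_num); linarith
  have l3' : 0 ≤ Real.log 3 := Real.log_nonneg (by norm_num)
  have up : (∫ u in (y - h)..(y + h), Real.log u) ≤ 2 * h * (Real.log (max h |y|) + 1) := by
    have := integral_log_le (a := y - h) (b := y + h) (R := 2 * max h |y|) (by linarith)
      (by linarith [le_max_left h |y|, le_max_right h |y|, neg_abs_le y])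
      (by linarith [le_max_left h |y|, le_max_right h |y|, le_abs_self y])
    rw [Real.log_mul two_ne_zero hM.ne'] at this
    refine this.trans ?_
    rw [show y + h - (y - h) = 2 * h by ring]
    exact mul_le_mul_of_nonneg_left (by linarith) (by positivity)
  have low : 2 * h * (Real.log (max h |y|) - 4) ≤ ∫ u in (y - h)..(y + h), Real.log u := by
    rcases le_total (2 * h) |y| with hy | hy
    · have hy0 : 0 < |y| := by linarith
      have e : max h |y| = |y| := max_eq_right (by linarith)
      have hm : ∫ _ in (y - h)..(y + h), Real.log (|y| / 2) ≤
          ∫ u in (y - h)..(y + h), Real.log u := by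
        refine intervalIntegral.integral_mono_on (by linarith) intervalIntegrable_const
          intervalIntegral.intervalIntegrable_log' fun u hu => ?_
        rw [← Real.log_abs u]
        refine Real.log_le_log (by positivity) ?_
        have : |y| ≤ |u| + h := by
          calc |y| = |u + (y - u)| := by ring_nf
            _ ≤ |u| + |y - u| := abs_add_le _ _
            _ ≤ |u| + h := by
              gcongr; rw [abs_le]; constructor <;> linarith [hu.1, hu.2]
        linarith
      rw [intervalIntegral.integral_const, smul_eq_mul, show y + h - (y - h) = 2 * h by ring,
        Real.log_div hy0.ne' two_ne_zero] at hm
      rw [e]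
      refine le_trans ?_ hm
      gcongr; linarith
    · have hy1 := abs_le.1 hy
      have hi : ∀ a b : ℝ, IntervalIntegrable Real.log volume a b := fun a b =>
        intervalIntegral.intervalIntegrable_log'
      have s1 := intervalIntegral.integral_add_adjacent_intervals (hi (-(3 * h)) (y - h))
        (hi (y - h) (y + h))
      have s2 := intervalIntegral.integral_add_adjacent_intervals (hi (-(3 * h)) (y + h))
        (hi (y + h) (3 * h))
      have b1 := integral_log_le (a := -(3 * h)) (b := y - h) (R := 3 * h) (by linarith)
        (by linarith) (by linarith)
      have b2 := integral_log_le (a := y + h) (b := 3 * h) (R := 3 * h) (by linarith)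
        (by linarith) (by linarith)
      have tot : ∫ u in (-(3 * h))..(3 * h), Real.log u =
          6 * h * Real.log (3 * h) - 6 * h := by
        rw [integral_log, Real.log_neg_eq_log]; ring
      have hmax : Real.log (max h |y|) ≤ Real.log (3 * h) :=
        Real.log_le_log hM (max_le (by linarith) (by linarith))
      have key : 2 * h * (Real.log (3 * h) - 4) ≤ ∫ u in (y - h)..(y + h), Real.log u := by
        nlinarith
      refine le_trans ?_ key
      gcongr
  have h2 : 0 < 2 * h := by positivity
  rw [abs_le]
  have e : (1 / (2 * h)) * (∫ u in (y - h)..(y + h), Real.log u) =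
      (∫ u in (y - h)..(y + h), Real.log u) / (2 * h) := by ring
  rw [e]
  constructor
  · rw [neg_le_sub_iff_le_add, ← sub_le_iff_le_add, le_div_iff₀ h2]; linarith
  · rw [sub_le_iff_le_add, div_le_iff₀ h2]; nlinarith

/-- The model for `log (ker t s)`. -/
noncomputable def modelLog (t t' s : ℝ) : ℝ :=
  Real.log (s - t) + Real.log (s - t') + 2 * Real.log (s + t)

theorem intervalIntegrable_log_sub (a b c : ℝ) :
    IntervalIntegrable (fun s => Real.log (s - c)) volume a b := by
  have := (intervalIntegral.intervalIntegrable_log' (a := a - c) (b := b - c)).comp_sub_right c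
  simpa using this

theorem intervalIntegrable_modelLog (t t' a b : ℝ) :
    IntervalIntegrable (modelLog t t') volume a b := by
  have h3 := intervalIntegrable_log_sub a b (-t)
  simp only [sub_neg_eq_add] at h3
  exact ((intervalIntegrable_log_sub a b t).add (intervalIntegrable_log_sub a b t')).add
    (h3.const_mul 2)

theorem abs_average_modelLog_le {h θ : ℝ} (hh : 0 < h) (t t' : ℝ) :
    |(1 / (2 * h)) * (∫ s in (θ - h)..(θ + h), modelLog t t' s) -
      (Real.log (max h |θ - t|) + Real.log (max h |θ - t'|) + 2 * Real.log (max h |θ + t|))| ≤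
      16 := by
  have key : ∀ c, |(1 / (2 * h)) * (∫ s in (θ - h)..(θ + h), Real.log (s - c)) -
      Real.log (max h |θ - c|)| ≤ 4 := by
    intro c
    have := abs_average_log_le hh (θ - c)
    rw [intervalIntegral.integral_comp_sub_right (fun u => Real.log u) c]
    rwa [show θ - h - c = θ - c - h by ring, show θ + h - c = θ - c + h by ring]
  have h3 := intervalIntegrable_log_sub (θ - h) (θ + h) (-t)
  have k1 := abs_le.1 (key t)
  have k2 := abs_le.1 (key t')
  have k3 := abs_le.1 (key (-t))
  simp only [sub_neg_eq_add] at h3 k3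
  have e : ∫ s in (θ - h)..(θ + h), modelLog t t' s =
      (∫ s in (θ - h)..(θ + h), Real.log (s - t)) + (∫ s in (θ - h)..(θ + h), Real.log (s - t')) +
        2 * ∫ s in (θ - h)..(θ + h), Real.log (s + t) := by
    unfold modelLog
    rw [intervalIntegral.integral_add ((intervalIntegrable_log_sub _ _ t).add
      (intervalIntegrable_log_sub _ _ t')) (h3.const_mul 2),
      intervalIntegral.integral_add (intervalIntegrable_log_sub _ _ t)
      (intervalIntegrable_log_sub _ _ t'), intervalIntegral.integral_const_mul]
  rw [e, abs_le]
  constructor <;> nlinarith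

theorem abs_log_sub_log_le {C a b : ℝ} (h : Cmp C a b) (hb : 0 < b) :
    |Real.log a - Real.log b| ≤ Real.log C := by
  have ha := h.pos_iff.2 hb
  have h1 := Real.log_le_log ha h.4
  have h2 := Real.log_le_log hb h.5
  rw [Real.log_mul h.3.ne' hb.ne'] at h1
  rw [Real.log_mul h.3.ne' ha.ne'] at h2
  rw [abs_le]; constructor <;> linarith

theorem log_ker_sub_modelLog_le : ∃ C, ∀ t t', Twin t t' → ∀ s ∈ Icc 0 π,
    s ≠ t → s ≠ t' → s ≠ -t → |Real.log (ker t s) - modelLog t t' s| ≤ C := by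
  obtain ⟨C, hC⟩ := ker_cmp
  refine ⟨Real.log C, fun t t' h s hs h1 h2 h3 => ?_⟩
  have n1 := sub_ne_zero.2 h1
  have n2 := sub_ne_zero.2 h2
  have n3 : s + t ≠ 0 := fun e => h3 (by linarith)
  have := abs_log_sub_log_le (hC t t' h s hs) (by positivity)
  rwa [Real.log_mul (by positivity) (by positivity), Real.log_mul (by positivity) (by positivity),
    Real.log_abs, Real.log_abs, Real.log_pow, Nat.cast_ofNat] at this

theorem intervalIntegrable_log_ker {t t' : ℝ} (h : Twin t t') :
    IntervalIntegrable (fun s => Real.log (ker t s)) volume 0 π := by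
  obtain ⟨C, hC⟩ := log_ker_sub_modelLog_le
  have hm := intervalIntegrable_modelLog t t' 0 π
  have hpi := Real.pi_pos
  rw [intervalIntegrable_iff_integrableOn_Ioc_of_le hpi.le] at hm ⊢
  have hmeas : AEStronglyMeasurable (fun s => Real.log (ker t s)) (volume.restrict (Ioc 0 π)) := by
    have hc : ContinuousOn (ker t) (Ioc 0 π) := by
      have := continuousOn_radius.mono (Ioc_subset_Icc_self (a := 0) (b := π))
      unfold ker
      exact (this.sub continuousOn_const).abs.mul ((this.pow 2).add continuousOn_const).sqrt
    exact (Real.measurable_log.comp_aemeasurable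
      (hc.aestronglyMeasurable measurableSet_Ioc).aemeasurable).aestronglyMeasurable
  refine Integrable.mono' (hm.norm.add (integrable_const C)) hmeas ?_
  filter_upwards [ae_restrict_of_ae (Measure.ae_ne volume t),
    ae_restrict_of_ae (Measure.ae_ne volume t'),
    ae_restrict_of_ae (Measure.ae_ne volume (-t)), ae_restrict_mem measurableSet_Ioc]
    with s h1 h2 h3 hs
  have k := hC t t' h s (Ioc_subset_Icc_self hs) h1 h2 h3
  rw [Pi.add_apply, Real.norm_eq_abs, Real.norm_eq_abs]
  calc |Real.log (ker t s)| = |modelLog t t' s + (Real.log (ker t s) - modelLog t t' s)| := by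
        ring_nf
    _ ≤ _ := (abs_add_le _ _).trans (by gcongr)

theorem intervalIntegrable_log_ker_of_mem {t t' : ℝ} (h : Twin t t') {a b : ℝ}
    (ha : a ∈ Icc 0 π) (hb : b ∈ Icc 0 π) :
    IntervalIntegrable (fun s => Real.log (ker t s)) volume a b :=
  (intervalIntegrable_log_ker h).mono_set (by
    rw [uIcc_of_le Real.pi_pos.le]; exact (convex_Icc 0 π).ordConnected.uIcc_subset ha hb)

theorem abs_average_log_ker_le : ∃ C, 0 < C ∧ ∀ t t', Twin t t' → ∀ θ h : ℝ, 0 < h → 0 ≤ θ - h →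
    θ + h ≤ π → |(1 / (2 * h)) * (∫ s in (θ - h)..(θ + h), Real.log (ker t s)) -
      (Real.log (max h |θ - t|) + Real.log (max h |θ - t'|) + 2 * Real.log (max h (θ + t)))| ≤
      C := by
  obtain ⟨C, hC⟩ := log_ker_sub_modelLog_le
  refine ⟨|C| + 16, by positivity, fun t t' tw θ h hh h1 h2 => ?_⟩
  have i1 := intervalIntegrable_log_ker_of_mem tw (a := θ - h) (b := θ + h)
    ⟨h1, by linarith⟩ ⟨by linarith, h2⟩
  have i2 := intervalIntegrable_modelLog t t' (θ - h) (θ + h)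
  have k := abs_average_modelLog_le (θ := θ) hh t t'
  rw [abs_of_nonneg (show 0 ≤ θ + t by linarith [tw.1.1])] at k
  have d : |(∫ s in (θ - h)..(θ + h), Real.log (ker t s)) -
      ∫ s in (θ - h)..(θ + h), modelLog t t' s| ≤ 2 * h * |C| := by
    rw [← intervalIntegral.integral_sub i1 i2, ← Real.norm_eq_abs]
    have := intervalIntegral.norm_integral_le_of_norm_le_const_ae (a := θ - h) (b := θ + h)
      (C := |C|) (f := fun s => Real.log (ker t s) - modelLog t t' s) (by
        filter_upwards [Measure.ae_ne volume t, Measure.ae_ne volume t',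
          Measure.ae_ne volume (-t)] with s n1 n2 n3 hs
        rw [uIoc_of_le (by linarith)] at hs
        exact (hC t t' tw s ⟨by linarith [hs.1], by linarith [hs.2]⟩ n1 n2 n3).trans
          (le_abs_self C))
    refine this.trans_eq ?_
    rw [show θ + h - (θ - h) = 2 * h by ring, abs_of_pos (show 0 < 2 * h by positivity)]; ring
  have e : |(1 / (2 * h)) * (∫ s in (θ - h)..(θ + h), Real.log (ker t s)) -
      (1 / (2 * h)) * ∫ s in (θ - h)..(θ + h), modelLog t t' s| ≤ |C| := by
    rw [← mul_sub, abs_mul, abs_of_pos (show 0 < 1 / (2 * h) by positivity)]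
    calc 1 / (2 * h) * _ ≤ 1 / (2 * h) * (2 * h * |C|) := by gcongr
      _ = |C| := by field_simp
  calc _ ≤ _ := abs_sub_le _ ((1 / (2 * h)) * ∫ s in (θ - h)..(θ + h), modelLog t t' s) _
    _ ≤ _ := add_le_add e k

/-! ### The logarithmic potential of the arc -/

/-- `v ψ(1 / v)`, an analytic function on the open unit disc. -/
noncomputable def phi (v : ℂ) : ℂ := (1 - v ^ 2) * ((1 - v) / (1 + v)) ^ (1 / 2 : ℂ)

theorem phi_eq {v : ℂ} (hv : v ≠ 0) : phi v = v * psi (1 / v) := by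
  have e : (1 / v - 1) / (1 / v + 1) = (1 - v) / (1 + v) := by
    rcases eq_or_ne (1 + v) 0 with h | h
    · have : 1 / v + 1 = (1 + v) / v := by field_simp
      rw [h, zero_div] at this
      rw [h, this, div_zero, div_zero]
    · have : 1 / v + 1 ≠ 0 := by
        rw [show 1 / v + 1 = (1 + v) / v by field_simp]
        exact div_ne_zero h hv
      field_simp
  rw [phi, psi, e]
  field_simp

theorem cpow_half_sq (a : ℂ) : (a ^ (1 / 2 : ℂ)) ^ 2 = a := by
  rw [one_div]; exact Complex.cpow_nat_inv_pow a two_ne_zero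

theorem phi_sq (v : ℂ) : phi v ^ 2 = (1 - v) ^ 3 * (1 + v) := by
  rw [phi, mul_pow, cpow_half_sq]
  rcases eq_or_ne (1 + v) 0 with h | h
  · rw [h, div_zero, mul_zero, mul_zero]
  · field_simp; ring

theorem phi_zero : phi 0 = 1 := by simp [phi]

theorem re_div_pos {v : ℂ} (hv : ‖v‖ < 1) : 0 < ((1 - v) / (1 + v)).re := by
  have h1 : 1 + v ≠ 0 := by
    intro h
    have : v = -1 := by linear_combination h
    rw [this] at hv; simp at hv
  rw [Complex.div_re]
  have hn : 0 < Complex.normSq (1 + v) := Complex.normSq_pos.2 h1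
  rw [← add_div]
  refine div_pos ?_ hn
  have h2 : v.re ^ 2 + v.im ^ 2 < 1 := by
    have := Complex.sq_norm v
    rw [Complex.normSq_apply] at this
    nlinarith [norm_nonneg v]
  simp only [Complex.sub_re, Complex.add_re, Complex.one_re, Complex.sub_im, Complex.add_im,
    Complex.one_im]
  nlinarith

theorem re_sqrt_pos {a : ℂ} (ha : 0 < a.re) : 0 < (a ^ (1 / 2 : ℂ)).re := by
  have h0 : a ≠ 0 := by rintro rfl; simp at ha
  rw [Complex.cpow_def_of_ne_zero h0, Complex.exp_re]
  refine mul_pos (Real.exp_pos _) (Real.cos_pos_of_mem_Ioo ?_)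
  have : (Complex.log a * (1 / 2)).im = a.arg / 2 := by
    rw [show (1 / 2 : ℂ) = ((1 / 2 : ℝ) : ℂ) by push_cast; ring, Complex.im_mul_ofReal,
      Complex.log_im]; ring
  rw [this]
  have h1 := Complex.neg_pi_lt_arg a
  have h2 := (Complex.abs_arg_lt_pi_div_two_iff).2 (Or.inl ha)
  have h3 := abs_lt.1 h2
  constructor <;> linarith [Real.pi_pos]

/-- A real form of the fact that the exterior map omits the arc. -/
theorem no_exterior_preimage {m k x : ℝ} (hm : 0 < m) (hk : 0 < k) (hx : 0 ≤ x)
    (hx4 : x ^ 4 ≤ 27 / 4)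
    (hre : 4 * (m ^ 3 - 3 * m * k ^ 2) = x * (4 + m ^ 4 - 6 * m ^ 2 * k ^ 2 + k ^ 4))
    (him : 3 * m ^ 2 - k ^ 2 = x * m * (m ^ 2 - k ^ 2)) : False := by
  have hN : (m ^ 2 + k ^ 2) ^ 3 = 4 * (3 * m ^ 2 - k ^ 2) := by
    have e : 4 * (m ^ 3 - 3 * m * k ^ 2) * (m * (m ^ 2 - k ^ 2)) =
        (3 * m ^ 2 - k ^ 2) * (4 + m ^ 4 - 6 * m ^ 2 * k ^ 2 + k ^ 4) := by
      rw [hre, him]; ring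
    linear_combination e
  have h1 : 0 < 3 * m ^ 2 - k ^ 2 := by
    have : 0 < (m ^ 2 + k ^ 2) ^ 3 := by positivity
    linarith
  have h2 : 0 < m ^ 2 - k ^ 2 := by
    have : 0 < (x * m) * (m ^ 2 - k ^ 2) := him ▸ h1
    exact pos_of_mul_pos_right this (by positivity)
  have h3 : (3 * m ^ 2 - k ^ 2) ^ 4 = x ^ 4 * (m ^ 4 * (m ^ 2 - k ^ 2) ^ 4) := by
    rw [him]; ring
  have h4 : ((3 * m ^ 2 - k ^ 2) * (m ^ 2 + k ^ 2)) ^ 3 ≤ 27 * (m ^ 4 * (m ^ 2 - k ^ 2) ^ 4) := by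
    have : ((3 * m ^ 2 - k ^ 2) * (m ^ 2 + k ^ 2)) ^ 3 = 4 * (3 * m ^ 2 - k ^ 2) ^ 4 := by
      rw [mul_pow, hN]; ring
    rw [this, h3]
    have : 0 ≤ m ^ 4 * (m ^ 2 - k ^ 2) ^ 4 := by positivity
    nlinarith
  have h5 : (m ^ 2 - k ^ 2) ^ 4 ≤ (m ^ 2) ^ 4 := pow_le_pow_left₀ h2.le (by nlinarith) 4
  have h6 : 3 * m ^ 4 < (3 * m ^ 2 - k ^ 2) * (m ^ 2 + k ^ 2) := by
    nlinarith [mul_pos (pow_pos hk 2) (show 0 < 2 * m ^ 2 - k ^ 2 by nlinarith)]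
  have h7 : (3 * m ^ 4) ^ 3 < ((3 * m ^ 2 - k ^ 2) * (m ^ 2 + k ^ 2)) ^ 3 :=
    pow_lt_pow_left₀ h6 (by positivity) (by norm_num)
  have h8 : m ^ 4 * (m ^ 2 - k ^ 2) ^ 4 ≤ m ^ 4 * (m ^ 2) ^ 4 := by gcongr
  nlinarith

theorem phi_sub_ne_zero {v : ℂ} (hv : ‖v‖ < 1) {x : ℝ} (hx : 0 ≤ x) (hx4 : x ^ 4 ≤ 27 / 4) :
    phi v - (-1 + Complex.I) * x * v ≠ 0 := by
  intro h
  have hv0 : v ≠ 0 := by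
    rintro rfl; rw [phi_zero] at h; simp at h
  have h1 : 1 + v ≠ 0 := by
    intro h
    have : v = -1 := by linear_combination h
    rw [this] at hv; simp at hv
  have ha := re_div_pos hv
  set a := (1 - v) / (1 + v) with hadef
  set b := a ^ (1 / 2 : ℂ) with hb
  have hb2 : b ^ 2 = a := cpow_half_sq a
  have hbre : 0 < b.re := re_sqrt_pos ha
  have hv1 : v * (1 + a) = 1 - a := by rw [hadef]; field_simp; ring
  have ha1 : 1 + a ≠ 0 := by
    intro h
    have := congrArg Complex.re h
    simp at this; linarith
  have hvv : v = (1 - a) / (1 + a) := by rw [eq_div_iff ha1, hv1]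
  have hphi : phi v = (1 - v ^ 2) * b := rfl
  have key : 4 * b ^ 3 = (-1 + Complex.I) * x * (1 - b ^ 4) := by
    have e : (1 - v ^ 2) * b - (-1 + Complex.I) * x * v = 0 := by rw [← hphi]; exact h
    rw [hvv] at e
    field_simp at e
    rw [show b ^ 3 = b ^ 2 * b by ring, show b ^ 4 = (b ^ 2) ^ 2 by ring, hb2]
    linear_combination e
  obtain ⟨p, q, hpq⟩ : ∃ p q : ℝ, b = p + q * Complex.I := ⟨b.re, b.im, (Complex.re_add_im b).symm⟩
  have hp : 0 < p := by rw [hpq] at hbre; simpa using hbre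
  have hpq2 : q ^ 2 < p ^ 2 := by
    have : 0 < (b ^ 2).re := by rw [hb2]; exact ha
    rw [hpq] at this
    simp [pow_two] at this
    nlinarith
  have habs := abs_lt_of_sq_lt_sq hpq2 hp.le
  obtain ⟨hq1, hq2⟩ := abs_lt.1 habs
  rw [hpq] at key
  have kre := congrArg Complex.re key
  have kim := congrArg Complex.im key
  simp [pow_succ] at kre kim
  refine no_exterior_preimage (m := p + q) (k := p - q) (x := x) (by linarith) (by linarith) hx
    hx4 ?_ ?_
  · linear_combination 2 * kim - 2 * kre
  · have hk : 4 * (p - q) ≠ 0 := by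
      have : 0 < p - q := by linarith
      positivity
    apply mul_left_cancel₀ hk
    linear_combination (2 : ℝ) * kre + 2 * kim

theorem norm_radial_sub_ge {v a : ℂ} {ρ : ℝ} (hv : ‖v‖ = 1) (ha : a ≠ 0) (h1 : 1 / 2 ≤ ρ) :
    ‖v - a / ‖a‖‖ / 4 ≤ ‖ρ * v - a‖ := by
  have hn : 0 < ‖a‖ := norm_pos_iff.2 ha
  have hn' : (‖a‖ : ℂ) ≠ 0 := by exact_mod_cast hn.ne'
  have e : (ρ : ℂ) * (v - a / ‖a‖) = (ρ * v - a) + ((‖a‖ - ρ : ℝ) : ℂ) * (a / ‖a‖) := by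
    push_cast; field_simp; ring
  have h2 : ‖(ρ : ℂ) * (v - a / ‖a‖)‖ ≤ ‖ρ * v - a‖ + |‖a‖ - ρ| := by
    rw [e]
    refine (norm_add_le _ _).trans (add_le_add le_rfl ?_)
    rw [norm_mul, norm_div, Complex.norm_real, Complex.norm_real, norm_norm, div_self hn.ne',
      mul_one, Real.norm_eq_abs]
  have h3 : |‖a‖ - ρ| ≤ ‖ρ * v - a‖ := by
    have h := abs_norm_sub_norm_le a (ρ * v)
    rw [norm_mul, hv, mul_one, Complex.norm_real, Real.norm_eq_abs,
      abs_of_nonneg (by linarith : 0 ≤ ρ), norm_sub_rev] at h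
    exact h
  rw [norm_mul, Complex.norm_real, Real.norm_eq_abs, abs_of_nonneg (by linarith : 0 ≤ ρ)] at h2
  nlinarith [norm_nonneg (v - a / ‖a‖)]

theorem exists_radial_bound (s : Multiset ℂ) (h0 : (0 : ℂ) ∉ s) :
    ∃ g : ℝ → ℝ, IntervalIntegrable g volume 0 (2 * π) ∧ ∀ᵐ θ : ℝ, ∀ ρ : ℝ, 1 / 2 ≤ ρ →
      Real.exp (-g θ) ≤ ‖(s.map fun a => circleMap 0 ρ θ - a).prod‖ := by
  induction s using Multiset.induction with
  | empty => exact ⟨0, intervalIntegrable_const, by simp⟩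
  | cons a s ih =>
    obtain ⟨g, hg, hb⟩ := ih fun h => h0 (Multiset.mem_cons_of_mem h)
    have ha : a ≠ 0 := fun h => h0 (h ▸ Multiset.mem_cons_self a s)
    have hI : IntervalIntegrable (fun θ => |Real.log ‖circleMap 0 1 θ - a / ‖a‖‖|) volume 0
        (2 * π) := (circleIntegrable_log_norm_sub_const (c := 0) (a := a / ‖a‖) 1).abs
    refine ⟨fun θ => g θ + (|Real.log ‖circleMap 0 1 θ - a / ‖a‖‖| + Real.log 4),
      hg.add (hI.add intervalIntegrable_const), ?_⟩
    have hc : ∀ᵐ θ : ℝ, circleMap 0 1 θ ≠ a / ‖a‖ := by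
      have := ((countable_singleton (a / ‖a‖ : ℂ)).preimage_circleMap 0 one_ne_zero).measure_zero
        (volume : Measure ℝ)
      rw [ae_iff]
      simp only [ne_eq, not_not]
      exact this
    filter_upwards [hb, hc] with θ h1 h2 ρ hρ
    rw [Multiset.map_cons, Multiset.prod_cons, norm_mul, neg_add, Real.exp_add, mul_comm]
    refine mul_le_mul ?_ (h1 ρ hρ) (Real.exp_pos _).le (norm_nonneg _)
    have hpos : 0 < ‖circleMap 0 1 θ - a / ‖a‖‖ := norm_pos_iff.2 (sub_ne_zero.2 h2)
    have hn := norm_radial_sub_ge (v := circleMap 0 1 θ) (a := a) (ρ := ρ) (by simp) ha hρ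
    have e : (ρ : ℂ) * circleMap 0 1 θ = circleMap 0 ρ θ := by simp [circleMap]
    rw [e] at hn
    refine le_trans ?_ hn
    rw [neg_add, Real.exp_add, Real.exp_neg (Real.log 4), Real.exp_log (by norm_num), ← div_eq_mul_inv]
    gcongr
    calc Real.exp (-|Real.log ‖circleMap 0 1 θ - a / ‖a‖‖|)
        ≤ Real.exp (Real.log ‖circleMap 0 1 θ - a / ‖a‖‖) := Real.exp_le_exp.2 (neg_abs_le _)
      _ = _ := Real.exp_log hpos

theorem exists_radial_bound_polynomial (P : ℂ[X]) (h0 : P.eval 0 ≠ 0) :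
    ∃ g : ℝ → ℝ, IntervalIntegrable g volume 0 (2 * π) ∧ ∀ᵐ θ : ℝ, ∀ ρ : ℝ, 1 / 2 ≤ ρ →
      Real.exp (-g θ) ≤ ‖P.eval (circleMap 0 ρ θ)‖ := by
  have hP : P ≠ 0 := by rintro rfl; simp at h0
  obtain ⟨g, hg, hb⟩ := exists_radial_bound P.roots (by
    rw [mem_roots hP]; exact h0)
  have hl : 0 < ‖P.leadingCoeff‖ := norm_pos_iff.2 (leadingCoeff_ne_zero.2 hP)
  refine ⟨fun θ => g θ + -Real.log ‖P.leadingCoeff‖, hg.add intervalIntegrable_const, ?_⟩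
  filter_upwards [hb] with θ h ρ hρ
  rw [(IsAlgClosed.splits P).eval_eq_prod_roots, norm_mul, neg_add, neg_neg, Real.exp_add,
    Real.exp_log hl, mul_comm]
  gcongr
  exact h ρ hρ

theorem norm_phi_le {v : ℂ} (hv : ‖v‖ ≤ 1) : ‖phi v‖ ≤ 4 := by
  have h : ‖phi v‖ ^ 2 ≤ 4 ^ 2 := by
    rw [← norm_pow, phi_sq, norm_mul, norm_pow]
    have h1 : ‖1 - v‖ ≤ 2 := (norm_sub_le _ _).trans (by rw [norm_one]; linarith)
    have h2 : ‖1 + v‖ ≤ 2 := (norm_add_le _ _).trans (by rw [norm_one]; linarith)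
    calc ‖1 - v‖ ^ 3 * ‖1 + v‖ ≤ 2 ^ 3 * 2 := by gcongr
      _ = 4 ^ 2 := by norm_num
  exact abs_le_of_sq_le_sq' h (by norm_num) |>.2

theorem analyticAt_phi {v : ℂ} (h1 : 1 + v ≠ 0) (h2 : (1 - v) / (1 + v) ∈ Complex.slitPlane) :
    AnalyticAt ℂ phi v := by
  unfold phi
  exact ((analyticAt_const.sub (analyticAt_id.pow 2))).mul
    (((analyticAt_const.sub analyticAt_id).div (analyticAt_const.add analyticAt_id) h1).cpow
      analyticAt_const h2)

theorem analyticAt_phi_of_norm_lt {v : ℂ} (hv : ‖v‖ < 1) : AnalyticAt ℂ phi v := by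
  refine analyticAt_phi ?_ (Or.inl (re_div_pos hv))
  intro h
  have : v = -1 := by linear_combination h
  rw [this] at hv; simp at hv

theorem analyticAt_phi_of_norm_eq {v : ℂ} (hv : ‖v‖ = 1) (h1 : v ≠ 1) (h2 : v ≠ -1) :
    AnalyticAt ℂ phi v := by
  have h3 : 1 + v ≠ 0 := fun h => h2 (by linear_combination h)
  refine analyticAt_phi h3 (Or.inr ?_)
  have hq : v.re ^ 2 + v.im ^ 2 = 1 := by
    have := Complex.sq_norm v
    rw [Complex.normSq_apply, hv] at this
    nlinarith
  have him : v.im ≠ 0 := by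
    intro h
    rw [h] at hq
    have : (v.re - 1) * (v.re + 1) = 0 := by nlinarith
    rcases mul_eq_zero.1 this with h' | h'
    · exact h1 (Complex.ext (by simp; linarith) (by simp [h]))
    · exact h2 (Complex.ext (by simp; linarith) (by simp [h]))
  rw [Complex.div_im, ← sub_div]
  refine div_ne_zero ?_ (Complex.normSq_pos.2 h3).ne'
  simp only [Complex.sub_re, Complex.add_re, Complex.one_re, Complex.sub_im, Complex.add_im,
    Complex.one_im]
  intro h
  apply him
  nlinarith

theorem ae_circleMap_notMem {s : Set ℂ} (hs : s.Countable) :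
    ∀ᵐ θ : ℝ, circleMap 0 1 θ ∉ s := by
  have := (hs.preimage_circleMap 0 one_ne_zero).measure_zero (volume : Measure ℝ)
  rw [ae_iff]
  simp only [not_not]
  exact this

/-- The mean value of `log |φ(v) - z v|` over the unit circle vanishes for `z` on the arc. -/
theorem integral_log_norm_phi {x : ℝ} (hx : 0 ≤ x) (hx4 : x ^ 4 ≤ 27 / 4) :
    IntervalIntegrable (fun θ => Real.log ‖phi (circleMap 0 1 θ) -
      (-1 + Complex.I) * x * circleMap 0 1 θ‖) volume 0 (2 * π) ∧
    ∫ θ in 0..2 * π, Real.log ‖phi (circleMap 0 1 θ) -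
      (-1 + Complex.I) * x * circleMap 0 1 θ‖ = 0 := by
  set z : ℂ := (-1 + Complex.I) * x with hz
  have hpi := Real.pi_pos
  set H : ℂ → ℂ := fun v => phi v - z * v with hH
  set P : ℂ[X] := (1 - X) ^ 3 * (1 + X) - C (z ^ 2) * X ^ 2 with hP
  have hPe : ∀ v, P.eval v = H v * (phi v + z * v) := by
    intro v
    have e : H v * (phi v + z * v) = phi v ^ 2 - z ^ 2 * v ^ 2 := by rw [hH]; ring
    rw [e, phi_sq, hP]; simp
  have hP0 : P.eval 0 ≠ 0 := by rw [hP]; simp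
  have hPne : P ≠ 0 := by intro h; rw [h] at hP0; simp at hP0
  obtain ⟨g, hg, hb⟩ := exists_radial_bound_polynomial P hP0
  set M : ℝ := 4 + ‖z‖ with hM
  have hM1 : 1 ≤ M := by rw [hM]; linarith [norm_nonneg z]
  have up : ∀ v, ‖v‖ ≤ 1 → ‖H v‖ ≤ M ∧ ‖phi v + z * v‖ ≤ M := by
    intro v hv
    have h1 := norm_phi_le hv
    have h2 : ‖z * v‖ ≤ ‖z‖ := by
      rw [norm_mul]; exact mul_le_of_le_one_right (norm_nonneg _) hv
    exact ⟨(norm_sub_le _ _).trans (by linarith), (norm_add_le _ _).trans (by linarith)⟩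
  have hlogM : 0 ≤ Real.log M := Real.log_nonneg hM1
  have bound : ∀ᵐ θ : ℝ, ∀ ρ : ℝ, 1 / 2 ≤ ρ → ρ ≤ 1 →
      |Real.log ‖H (circleMap 0 ρ θ)‖| ≤ |g θ| + Real.log M := by
    filter_upwards [hb] with θ h ρ h1 h2
    have hn : ‖circleMap 0 ρ θ‖ ≤ 1 := by
      rw [norm_circleMap_zero, abs_of_nonneg (by linarith)]; exact h2
    obtain ⟨u1, u2⟩ := up _ hn
    have h3 := h ρ h1
    rw [hPe, norm_mul] at h3
    have hHpos : 0 < ‖H (circleMap 0 ρ θ)‖ := by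
      by_contra h0
      rw [le_antisymm (not_lt.1 h0) (norm_nonneg _), zero_mul] at h3
      exact absurd h3 (not_le.2 (Real.exp_pos _))
    have h4 : Real.exp (-g θ) ≤ ‖H (circleMap 0 ρ θ)‖ * M := by
      refine h3.trans ?_; gcongr
    have h5 := Real.log_le_log (Real.exp_pos _) h4
    rw [Real.log_exp, Real.log_mul hHpos.ne' (by linarith)] at h5
    have h6 := Real.log_le_log hHpos u1
    rw [abs_le]
    constructor <;> linarith [le_abs_self (g θ), neg_abs_le (g θ), abs_nonneg (g θ)]
  have bint : IntervalIntegrable (fun θ => |g θ| + Real.log M) volume 0 (2 * π) :=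
    hg.abs.add intervalIntegrable_const
  have hHa : ∀ v, AnalyticAt ℂ phi v → AnalyticAt ℂ H v := fun v h =>
    h.sub (analyticAt_const.mul analyticAt_id)
  have hmean : ∀ ρ : ℝ, 0 ≤ ρ → ρ < 1 →
      ∫ θ in 0..2 * π, Real.log ‖H (circleMap 0 ρ θ)‖ = 0 := by
    intro ρ h0 h1
    have hball : ∀ v ∈ Metric.closedBall (0 : ℂ) |ρ|, ‖v‖ < 1 := by
      intro v hv
      rw [mem_closedBall_zero_iff, abs_of_nonneg h0] at hv
      linarith
    have := AnalyticOnNhd.circleAverage_log_norm_of_ne_zero (c := 0) (R := ρ) (g := H)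
      (fun v hv => hHa v (analyticAt_phi_of_norm_lt (hball v hv)))
      (fun v hv => phi_sub_ne_zero (hball v hv) hx hx4)
    rw [Real.circleAverage_def] at this
    have e : H 0 = 1 := by rw [hH]; simp [phi_zero]
    rw [e, norm_one, Real.log_one, smul_eq_mul] at this
    rcases mul_eq_zero.1 this with h | h
    · exfalso; have : (2 * π)⁻¹ > 0 := by positivity
      linarith
    · exact h
  have hmeas : ∀ ρ : ℝ, 0 ≤ ρ → ρ < 1 → AEStronglyMeasurable
      (fun θ => Real.log ‖H (circleMap 0 ρ θ)‖) (volume.restrict (uIoc 0 (2 * π))) := by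
    intro ρ h0 h1
    have hc : Continuous fun θ => H (circleMap 0 ρ θ) := by
      rw [continuous_iff_continuousAt]
      intro θ
      have : AnalyticAt ℂ H (circleMap 0 ρ θ) := hHa _ (analyticAt_phi_of_norm_lt (by
        rw [norm_circleMap_zero, abs_of_nonneg h0]; exact h1))
      exact ContinuousAt.comp (f := circleMap 0 ρ) this.continuousAt
        (continuous_circleMap 0 ρ).continuousAt
    exact (Real.measurable_log.comp hc.norm.measurable).aestronglyMeasurable
  set r : ℕ → ℝ := fun n => 1 - 1 / ((n : ℝ) + 2) with hr
  have hr1 : ∀ n, 1 / 2 ≤ r n ∧ r n < 1 := by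
    intro n
    have h2 : (2 : ℝ) ≤ (n : ℝ) + 2 := by linarith [n.cast_nonneg (α := ℝ)]
    have h3 : 1 / ((n : ℝ) + 2) ≤ 1 / 2 := one_div_le_one_div_of_le two_pos h2
    have h4 : 0 < 1 / ((n : ℝ) + 2) := by positivity
    constructor <;> simp only [hr] <;> linarith
  have hrt : Filter.Tendsto r Filter.atTop (nhds 1) := by
    have h := tendsto_one_div_add_atTop_nhds_zero_nat (𝕜 := ℝ)
    have h' := (Filter.tendsto_add_atTop_iff_nat 1).2 h
    have := h'.const_sub 1
    rw [sub_zero] at this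
    refine this.congr fun n => ?_
    simp only [hr]; push_cast; ring
  have hlim : ∀ᵐ θ : ℝ, Filter.Tendsto (fun n => Real.log ‖H (circleMap 0 (r n) θ)‖)
      Filter.atTop (nhds (Real.log ‖H (circleMap 0 1 θ)‖)) := by
    have hfin : ({1, -1} ∪ (P.roots.toFinset : Set ℂ)).Countable :=
      ((Set.toFinite _).union (Finset.finite_toSet _)).countable
    filter_upwards [ae_circleMap_notMem hfin] with θ hθ
    simp only [mem_union, mem_insert_iff, mem_singleton_iff, Finset.mem_coe, Multiset.mem_toFinset,
      not_or] at hθ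
    obtain ⟨⟨n1, n2⟩, n3⟩ := hθ
    have hne : H (circleMap 0 1 θ) ≠ 0 := by
      intro h0
      apply n3
      rw [mem_roots hPne, IsRoot, hPe, h0, zero_mul]
    have hca : ContinuousAt H (circleMap 0 1 θ) :=
      (hHa _ (analyticAt_phi_of_norm_eq (by simp) n1 n2)).continuousAt
    have hcm : Filter.Tendsto (fun n => circleMap 0 (r n) θ) Filter.atTop
        (nhds (circleMap 0 1 θ)) := by
      have : Continuous fun ρ : ℝ => circleMap 0 ρ θ := by unfold circleMap; fun_prop
      exact (this.tendsto 1).comp hrt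
    exact ((Real.continuousAt_log (norm_ne_zero_iff.2 hne)).tendsto).comp
      ((hca.tendsto.comp hcm).norm)
  have htend := intervalIntegral.tendsto_integral_filter_of_dominated_convergence
    (a := 0) (b := 2 * π) (μ := volume) (l := Filter.atTop)
    (F := fun n θ => Real.log ‖H (circleMap 0 (r n) θ)‖)
    (f := fun θ => Real.log ‖H (circleMap 0 1 θ)‖) (fun θ => |g θ| + Real.log M)
    (Filter.Eventually.of_forall fun n => hmeas (r n) (by linarith [(hr1 n).1]) (hr1 n).2)
    (Filter.Eventually.of_forall fun n => by
      filter_upwards [bound] with θ h _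
      exact h (r n) (hr1 n).1 (hr1 n).2.le) bint
    (by filter_upwards [hlim] with θ h _ using h)
  have hz0 : ∀ n, ∫ θ in 0..2 * π, Real.log ‖H (circleMap 0 (r n) θ)‖ = 0 := fun n =>
    hmean (r n) (by linarith [(hr1 n).1]) (hr1 n).2
  simp only [hz0] at htend
  refine ⟨?_, (tendsto_nhds_unique htend tendsto_const_nhds)⟩
  rw [intervalIntegrable_iff] at bint ⊢
  refine Integrable.mono' bint ?_ ?_
  · exact aestronglyMeasurable_of_tendsto_ae Filter.atTop
      (fun n => hmeas (r n) (by linarith [(hr1 n).1]) (hr1 n).2) (ae_restrict_of_ae hlim)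
  · filter_upwards [ae_restrict_of_ae bound] with θ h
    exact h 1 (by norm_num) le_rfl

theorem norm_phi_sub {θ x : ℝ} :
    ‖phi (circleMap 0 1 θ) - (-1 + Complex.I) * x * circleMap 0 1 θ‖ =
      ‖psi (Complex.exp ((-θ : ℝ) * Complex.I)) - (-1 + Complex.I) * x‖ := by
  have h0 : circleMap 0 1 θ ≠ 0 := circleMap_ne_center one_ne_zero
  have e : 1 / circleMap 0 1 θ = Complex.exp ((-θ : ℝ) * Complex.I) := by
    rw [circleMap_zero, Complex.ofReal_one, one_mul, one_div, ← Complex.exp_neg]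
    push_cast; ring_nf
  rw [phi_eq h0, e, mul_comm ((-1 + Complex.I) * (x : ℂ)), ← mul_sub, norm_mul,
    norm_circleMap_zero, abs_one, one_mul]

theorem norm_upper_sub_upper (r x : ℝ) :
    ‖(-1 + Complex.I) * (r : ℂ) - (-1 + Complex.I) * x‖ = √2 * |r - x| := by
  rw [← mul_sub, norm_mul, ← Complex.ofReal_sub, Complex.norm_real, Real.norm_eq_abs]
  congr 1
  rw [Complex.norm_eq_sqrt_sq_add_sq]; norm_num

theorem norm_lower_sub_upper (r x : ℝ) :
    ‖(-1 - Complex.I) * (r : ℂ) - (-1 + Complex.I) * x‖ = √2 * √(r ^ 2 + x ^ 2) := by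
  rw [← Real.sqrt_mul two_pos.le, Complex.norm_eq_sqrt_sq_add_sq]
  congr 1
  simp
  ring

/-- The logarithmic potential of the arc is constant on the arc. -/
theorem integral_log_ker {t t' : ℝ} (h : Twin t t') :
    ∫ s in 0..π, Real.log (ker t s) = -(π * Real.log 2) := by
  have hpi := Real.pi_pos
  have hx := radius_nonneg_of_mem h.mem_inner
  have hx4 : radius t ^ 4 ≤ 27 / 4 := by
    rw [← arc_length_pow_four]
    refine pow_le_pow_left₀ hx (radius_le h.1.1 ?_) 4
    linarith [h.1.2]
  obtain ⟨hi, h0⟩ := integral_log_norm_phi hx hx4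
  simp only [norm_phi_sub] at hi h0
  set f : ℝ → ℝ := fun θ => Real.log ‖psi (Complex.exp ((-θ : ℝ) * Complex.I)) -
    (-1 + Complex.I) * radius t‖ with hf
  have i1 : IntervalIntegrable f volume 0 π := hi.mono_set (by
    rw [uIcc_of_le hpi.le, uIcc_of_le (by linarith)]; exact Icc_subset_Icc_right (by linarith))
  have i2 : IntervalIntegrable f volume π (2 * π) := hi.mono_set (by
    rw [uIcc_of_le (by linarith), uIcc_of_le (by linarith)]; exact Icc_subset_Icc_left hpi.le)
  rw [← intervalIntegral.integral_add_adjacent_intervals i1 i2] at h0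
  have i3 : IntervalIntegrable (fun s => f (2 * π - s)) volume 0 π := by
    have := i2.comp_sub_left (2 * π)
    rw [sub_self, show 2 * π - π = π by ring] at this
    exact this.symm
  have e2 : ∫ θ in π..2 * π, f θ = ∫ s in 0..π, f (2 * π - s) := by
    rw [intervalIntegral.integral_comp_sub_left f (2 * π), sub_zero, show 2 * π - π = π by ring]
  rw [e2, ← intervalIntegral.integral_add i1 i3] at h0
  have e3 : ∫ s in 0..π, (f s + f (2 * π - s)) = ∫ s in 0..π, (Real.log 2 + Real.log (ker t s)) := by
    refine intervalIntegral.integral_congr_ae ?_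
    filter_upwards [Measure.ae_ne volume t, Measure.ae_ne volume t', Measure.ae_ne volume π]
      with s n1 n2 n3 hs
    rw [uIoc_of_le hpi.le] at hs
    have hs' : s ∈ Ioo 0 π := ⟨hs.1, lt_of_le_of_ne hs.2 n3⟩
    have hne := h.radius_ne (Ioo_subset_Icc_self hs') n1 n2
    have hr := radius_pos hs'
    have a1 : f s = Real.log (√2 * √(radius s ^ 2 + radius t ^ 2)) := by
      rw [hf]; simp only
      rw [psi_exp_neg hs'.1.le hs'.2, norm_lower_sub_upper]
    have a2 : f (2 * π - s) = Real.log (√2 * |radius s - radius t|) := by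
      rw [hf]; simp only
      have : Complex.exp ((-(2 * π - s) : ℝ) * Complex.I) = Complex.exp (s * Complex.I) := by
        rw [Complex.exp_eq_exp_iff_exists_int]
        exact ⟨-1, by push_cast; ring⟩
      rw [this, psi_exp_of_nonneg hs'.1.le hs'.2, norm_upper_sub_upper]
    have p1 : 0 < |radius s - radius t| := abs_pos.2 (sub_ne_zero.2 hne)
    have p2 : 0 < √(radius s ^ 2 + radius t ^ 2) := by positivity
    rw [a1, a2, ← Real.log_mul (by positivity) (by positivity), ker,
      ← Real.log_mul (by positivity) (by positivity)]
    congr 1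
    have := Real.mul_self_sqrt (two_pos.le : (0:ℝ) ≤ 2)
    linear_combination (√(radius s ^ 2 + radius t ^ 2) * |radius s - radius t|) * this
  rw [e3, intervalIntegral.integral_add intervalIntegrable_const (intervalIntegrable_log_ker h),
    intervalIntegral.integral_const, smul_eq_mul, sub_zero] at h0
  linarith

/-! ### The adjusted angles -/

theorem gap_pos (n : ℕ) : 0 < gap n := by unfold gap; positivity

theorem gap_mul (n : ℕ) : 3 * gap n * (n + 1) = 2 * π := by
  unfold gap; field_simp

theorem exists_fejerAngleUpper_eq (n : ℕ) : ∃ ε : ℝ, (Even n ∧ ε = 0 ∨ ¬ Even n ∧ ε = 1 / 2) ∧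
    ∀ k, fejerAngleUpper n k = 3 * gap n * (k + ε) := by
  by_cases h : Even n
  · refine ⟨0, Or.inl ⟨h, rfl⟩, fun k => ?_⟩
    rw [fejerAngleUpper, if_pos h, gap]; field_simp; ring
  · refine ⟨1 / 2, Or.inr ⟨h, rfl⟩, fun k => ?_⟩
    rw [fejerAngleUpper, if_neg h, gap]; field_simp

theorem fejerAngleUpper_sub (n j k : ℕ) :
    fejerAngleUpper n j - fejerAngleUpper n k = 3 * gap n * (j - k) := by
  obtain ⟨ε, -, h⟩ := exists_fejerAngleUpper_eq n
  rw [h, h]; ring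

theorem fejerAngleUpper_last (n : ℕ) : fejerAngleUpper n (n / 2) = π - 3 * gap n / 2 := by
  obtain ⟨ε, hε, h⟩ := exists_fejerAngleUpper_eq n
  have hg := gap_mul n
  rw [h]
  rcases hε with ⟨he, rfl⟩ | ⟨he, rfl⟩
  · have e : ((n / 2 : ℕ) : ℝ) * 2 = n := by exact_mod_cast Nat.div_mul_cancel he.two_dvd
    linear_combination (3 * gap n / 2) * e + hg / 2
  · have e : ((n / 2 : ℕ) : ℝ) * 2 + 1 = n := by
      exact_mod_cast Nat.div_two_mul_two_add_one_of_odd (Nat.not_even_iff_odd.1 he)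
    linear_combination (3 * gap n / 2) * e + hg / 2

theorem fejerAngleUpper_nonneg (n k : ℕ) : 0 ≤ fejerAngleUpper n k := by
  obtain ⟨ε, hε, h⟩ := exists_fejerAngleUpper_eq n
  have := gap_pos n
  have h0 : 0 ≤ ε := by rcases hε with ⟨-, rfl⟩ | ⟨-, rfl⟩ <;> norm_num
  rw [h]; positivity

theorem fejerAngleUpper_le {n k : ℕ} (hk : k ≤ n / 2) :
    fejerAngleUpper n k ≤ π - 3 * gap n / 2 := by
  have h := fejerAngleUpper_sub n (n / 2) k
  have hk' : (k : ℝ) ≤ (n / 2 : ℕ) := by exact_mod_cast hk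
  have := mul_nonneg (mul_pos three_pos (gap_pos n)).le (sub_nonneg.2 hk')
  linarith [fejerAngleUpper_last n]

theorem fejerAngleUpper_mem {n k : ℕ} (hk : k ≤ n / 2) : fejerAngleUpper n k ∈ Icc 0 π :=
  ⟨fejerAngleUpper_nonneg n k, by linarith [fejerAngleUpper_le hk, gap_pos n]⟩

theorem three_gap_le_abs_sub {n j k : ℕ} (h : j ≠ k) :
    3 * gap n ≤ |fejerAngleUpper n j - fejerAngleUpper n k| := by
  have hg := gap_pos n
  rw [fejerAngleUpper_sub, abs_mul, abs_of_pos (by positivity : 0 < 3 * gap n)]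
  have : (1 : ℝ) ≤ |(j : ℝ) - k| := by
    have : (1 : ℤ) ≤ |(j : ℤ) - k| := Int.one_le_abs (by omega)
    exact_mod_cast this
  nlinarith

theorem half_gap_le_of_pos {n k : ℕ} (h : 0 < fejerAngleUpper n k) :
    3 * gap n / 2 ≤ fejerAngleUpper n k := by
  obtain ⟨ε, hε, he⟩ := exists_fejerAngleUpper_eq n
  have hg := gap_pos n
  rw [he] at h ⊢
  rcases hε with ⟨-, rfl⟩ | ⟨-, rfl⟩
  · rcases Nat.eq_zero_or_pos k with rfl | hk
    · simp at h
    · have : (1 : ℝ) ≤ k := by exact_mod_cast hk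
      nlinarith
  · nlinarith [k.cast_nonneg (α := ℝ)]

/-- The indices of the Fejér angles in `(0, π)`. -/
noncomputable def posIndices (n : ℕ) : Finset ℕ :=
  (Finset.range (n / 2 + 1)).filter fun k => 0 < fejerAngleUpper n k

theorem mem_posIndices {n k : ℕ} : k ∈ posIndices n ↔ k ≤ n / 2 ∧ 0 < fejerAngleUpper n k := by
  simp [posIndices]

theorem posIndices_of_even {n : ℕ} (h : Even n) : posIndices n = Finset.Icc 1 (n / 2) := by
  ext k
  have e : fejerAngleUpper n k = 3 * gap n * k := by
    obtain ⟨ε, ⟨-, rfl⟩ | ⟨h', -⟩, he⟩ := exists_fejerAngleUpper_eq n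
    · rw [he]; ring
    · exact absurd h h'
  have hg := gap_pos n
  rw [mem_posIndices, e, Finset.mem_Icc, mul_pos_iff_of_pos_left (by positivity), Nat.cast_pos]
  omega

theorem posIndices_of_odd {n : ℕ} (h : ¬ Even n) : posIndices n = Finset.range (n / 2 + 1) := by
  ext k
  have hg := gap_pos n
  have e : 0 < fejerAngleUpper n k := by
    obtain ⟨ε, ⟨h', -⟩ | ⟨-, rfl⟩, he⟩ := exists_fejerAngleUpper_eq n
    · exact absurd h' h
    · rw [he]; positivity
  rw [mem_posIndices, Finset.mem_range]
  exact ⟨fun h => by omega, fun h => ⟨by omega, e⟩⟩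

theorem fejerAngle_eq {n k : ℕ} (hk : k ≤ n / 2) : fejerAngle n k = fejerAngleUpper n k :=
  if_pos hk

theorem twin_foldAngle {t : ℝ} (ht : t ∈ Icc (2 * π / 3) π) : Twin (foldAngle t) t := by
  have hpi := Real.pi_pos
  obtain ⟨h1, h2⟩ := foldAngle_spec ht
  refine ⟨h1, ht, ?_⟩
  have hc0 : (-1 + Complex.I : ℂ) ≠ 0 := by
    intro h; have := congrArg Complex.im h; simp at this
  rw [psi_exp_of_nonneg h1.1 (by linarith [h1.2])] at h2
  rcases ht.2.eq_or_lt with rfl | hlt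
  · rw [Complex.exp_pi_mul_I, psi_neg_one] at h2
    rw [radius_pi]
    exact_mod_cast (mul_eq_zero.1 h2).resolve_left hc0
  · rw [psi_exp_of_nonneg (by linarith [ht.1]) hlt, mul_right_inj' hc0] at h2
    exact_mod_cast h2

/-- The folded Fejér angle. -/
noncomputable def foldedFejer (n k : ℕ) : ℝ := foldAngle (fejerAngleUpper n k)

theorem twin_foldedFejer {n k : ℕ} (hk : k ≤ n / 2) (h : 2 * π / 3 < fejerAngleUpper n k) :
    Twin (foldedFejer n k) (fejerAngleUpper n k) :=
  twin_foldAngle ⟨h.le, (fejerAngleUpper_mem hk).2⟩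

/-- The indices `j` and `k` form an adjustment pair. -/
structure Paired (n j k : ℕ) : Prop where
  left_le : j ≤ n / 2
  right_le : k ≤ n / 2
  left_inner : fejerAngleUpper n j ≤ 2 * π / 3
  right_outer : 2 * π / 3 < fejerAngleUpper n k
  close : |fejerAngleUpper n j - foldedFejer n k| < gap n

namespace Paired

variable {n j k j' k' : ℕ}

theorem twin (h : Paired n j k) : Twin (foldedFejer n k) (fejerAngleUpper n k) :=
  twin_foldedFejer h.2 h.4

theorem left_unique (h : Paired n j k) (h' : Paired n j' k) : j = j' := by
  by_contra hne
  have h1 := three_gap_le_abs_sub (n := n) hne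
  have h2 := h.close
  have h3 := h'.close
  rw [abs_lt] at h2 h3
  rw [le_abs] at h1
  have := gap_pos n
  rcases h1 with h1 | h1 <;> linarith

theorem right_unique (h : Paired n j k) (h' : Paired n j k') : k = k' := by
  by_contra hne
  have h1 := (three_gap_le_abs_sub (n := n) hne).trans (h.twin.abs_sub_le h'.twin)
  have h2 := h.close
  have h3 := h'.close
  rw [abs_lt] at h2 h3
  rw [le_abs] at h1
  have := gap_pos n
  rcases h1 with h1 | h1 <;> linarith

theorem of_below (h : PairBelow n j k) : Paired n j k := by
  obtain ⟨h1, h2, h3, h4, h5, h6⟩ := h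
  rw [fejerAngle_eq h1] at h3 h5 h6
  rw [fejerAngle_eq h2] at h4 h5 h6
  refine ⟨h1, h2, h3, h4, ?_⟩
  rw [foldedFejer, abs_lt]
  constructor <;> linarith [gap_pos n]

theorem of_above (h : PairAbove n j k) : Paired n j k := by
  obtain ⟨h1, h2, h3, h4, h5, h6⟩ := h
  rw [fejerAngle_eq h1] at h3 h5 h6
  rw [fejerAngle_eq h2] at h4 h5 h6
  refine ⟨h1, h2, h3, h4, ?_⟩
  rw [foldedFejer, abs_lt]
  constructor <;> linarith [gap_pos n]

theorem below_or_above (h : Paired n j k) :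
    (PairBelow n j k ∧ foldedFejer n k ≤ fejerAngleUpper n j) ∨
      (PairAbove n j k ∧ fejerAngleUpper n j < foldedFejer n k) := by
  obtain ⟨h1, h2, h3, h4, h5⟩ := h
  rw [abs_lt] at h5
  unfold PairBelow PairAbove
  rw [fejerAngle_eq h1, fejerAngle_eq h2]
  rcases le_or_gt (foldedFejer n k) (fejerAngleUpper n j) with h | h
  · refine Or.inl ⟨⟨h1, h2, h3, h4, ?_, h⟩, h⟩
    change _ < foldedFejer n k; linarith
  · refine Or.inr ⟨⟨h1, h2, h3, h4, h, ?_⟩, h⟩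
    change foldedFejer n k < _; linarith

theorem adjusted (h : Paired n j k) :
    (foldedFejer n k ≤ fejerAngleUpper n j ∧
      adjustedAngleUpper n j = foldedFejer n k + gap n ∧
      adjustedAngleUpper n k = fejerAngleUpper n j - gap n) ∨
    (fejerAngleUpper n j < foldedFejer n k ∧
      adjustedAngleUpper n j = foldedFejer n k - gap n ∧
      adjustedAngleUpper n k = fejerAngleUpper n j + gap n) := by
  rcases h.below_or_above with ⟨hb, hle⟩ | ⟨ha, hlt⟩
  · left
    have ej : ∃ m, PairBelow n j m := ⟨k, hb⟩
    have ek : ∃ i, PairBelow n i k := ⟨j, hb⟩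
    have cj : ej.choose = k := ((Paired.of_below ej.choose_spec).right_unique h)
    have ck : ek.choose = j := ((Paired.of_below ek.choose_spec).left_unique h)
    refine ⟨hle, ?_, ?_⟩
    · rw [adjustedAngleUpper, fejerAngle_eq h.1, if_pos h.3, dif_pos ej, cj, fejerAngle_eq h.2]
      rfl
    · rw [adjustedAngleUpper, fejerAngle_eq h.2, if_neg (not_le.2 h.4), dif_pos ek, ck,
        fejerAngle_eq h.1]
  · right
    have nb : ¬ PairBelow n j k := fun hb => by
      have := hb.2.2.2.2.2
      rw [fejerAngle_eq h.1, fejerAngle_eq h.2] at this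
      exact absurd hlt (not_lt.2 this)
    have nj : ¬ ∃ m, PairBelow n j m := fun ⟨m, hm⟩ => by
      rw [(Paired.of_below hm).right_unique h] at hm; exact nb hm
    have nk : ¬ ∃ i, PairBelow n i k := fun ⟨i, hi⟩ => by
      rw [(Paired.of_below hi).left_unique h] at hi; exact nb hi
    have ej : ∃ m, PairAbove n j m := ⟨k, ha⟩
    have ek : ∃ i, PairAbove n i k := ⟨j, ha⟩
    have cj : ej.choose = k := ((Paired.of_above ej.choose_spec).right_unique h)
    have ck : ek.choose = j := ((Paired.of_above ek.choose_spec).left_unique h)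
    refine ⟨hlt, ?_, ?_⟩
    · rw [adjustedAngleUpper, fejerAngle_eq h.1, if_pos h.3, dif_neg nj, dif_pos ej, cj,
        fejerAngle_eq h.2]
      rfl
    · rw [adjustedAngleUpper, fejerAngle_eq h.2, if_neg (not_le.2 h.4), dif_neg nk, dif_pos ek, ck,
        fejerAngle_eq h.1]

end Paired

theorem adjusted_of_inner {n k : ℕ} (hk : k ≤ n / 2) (h : fejerAngleUpper n k ≤ 2 * π / 3)
    (hn : ∀ m, ¬ Paired n k m) : adjustedAngleUpper n k = fejerAngleUpper n k := by
  rw [adjustedAngleUpper, fejerAngle_eq hk, if_pos h,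
    dif_neg fun ⟨m, hm⟩ => hn m (Paired.of_below hm),
    dif_neg fun ⟨m, hm⟩ => hn m (Paired.of_above hm)]

theorem adjusted_of_outer {n k : ℕ} (hk : k ≤ n / 2) (h : 2 * π / 3 < fejerAngleUpper n k)
    (hn : ∀ m, ¬ Paired n m k) : adjustedAngleUpper n k = foldedFejer n k := by
  rw [adjustedAngleUpper, fejerAngle_eq hk, if_neg (not_le.2 h),
    dif_neg fun ⟨m, hm⟩ => hn m (Paired.of_below hm),
    dif_neg fun ⟨m, hm⟩ => hn m (Paired.of_above hm)]
  rfl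

theorem half_gap_le_foldedFejer {n k : ℕ} (hk : k ≤ n / 2) (h : 2 * π / 3 < fejerAngleUpper n k) :
    3 * gap n / 2 ≤ foldedFejer n k := by
  have ht := twin_foldedFejer hk h
  have := ht.abs_sub_le twin_zero
  rw [sub_zero, abs_of_nonneg ht.1.1, abs_sub_comm] at this
  linarith [le_abs_self (π - fejerAngleUpper n k), fejerAngleUpper_le hk]

theorem sub_tip_le {n k : ℕ} (hk : k ≤ n / 2) (h : 2 * π / 3 < fejerAngleUpper n k) :
    fejerAngleUpper n k - 2 * π / 3 ≤ 2 * π / 3 - foldedFejer n k := by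
  have ht := twin_foldedFejer hk h
  have := ht.abs_sub_le twin_tip
  rw [abs_sub_comm (foldedFejer n k), abs_of_nonneg (sub_nonneg.2 ht.1.2)] at this
  exact (le_abs_self _).trans this

theorem Paired.left_pos {n j k : ℕ} (h : Paired n j k) : 0 < fejerAngleUpper n j := by
  have h1 := half_gap_le_foldedFejer h.2 h.4
  have h2 := abs_lt.1 h.close
  linarith [gap_pos n]

theorem Paired.gap_le {n j k : ℕ} (h : Paired n j k) : gap n ≤ 2 * π / 3 - foldedFejer n k := by
  have h1 := sub_tip_le h.2 h.4
  have h2 := abs_lt.1 h.close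
  have hne : k ≠ j := by rintro rfl; exact absurd h.3 (not_le.2 h.4)
  have h3 := three_gap_le_abs_sub (n := n) hne
  rw [abs_of_nonneg (by linarith [h.3, h.4])] at h3
  linarith

/-- In an adjustment pair, the two angles are shifted by opposite amounts. -/
theorem Paired.exists_shift {n j k : ℕ} (h : Paired n j k) : ∃ σ : ℝ, |σ| ≤ gap n ∧
    adjustedAngleUpper n j = fejerAngleUpper n j + σ ∧
    adjustedAngleUpper n k = foldedFejer n k - σ := by
  have h2 := abs_lt.1 h.close
  rcases h.adjusted with ⟨h1, e1, e2⟩ | ⟨h1, e1, e2⟩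
  · exact ⟨foldedFejer n k + gap n - fejerAngleUpper n j, abs_le.2 ⟨by linarith, by linarith⟩,
      by rw [e1]; ring, by rw [e2]; ring⟩
  · exact ⟨foldedFejer n k - gap n - fejerAngleUpper n j, abs_le.2 ⟨by linarith, by linarith⟩,
      by rw [e1]; ring, by rw [e2]; ring⟩

theorem Paired.adjusted_left_mem {n j k : ℕ} (h : Paired n j k) :
    adjustedAngleUpper n j ∈ Icc (gap n / 2) (2 * π / 3) := by
  have h1 := half_gap_le_foldedFejer h.2 h.4
  have h2 := h.gap_le
  have h3 := gap_pos n
  rcases h.adjusted with ⟨-, e, -⟩ | ⟨-, e, -⟩ <;> rw [e] <;> constructor <;> linarith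

theorem Paired.adjusted_right_mem {n j k : ℕ} (h : Paired n j k) :
    adjustedAngleUpper n k ∈ Icc (gap n / 2) (2 * π / 3) := by
  have h1 := half_gap_le_of_pos h.left_pos
  have h2 := h.gap_le
  have h3 := gap_pos n
  have h4 := h.3
  rcases h.adjusted with ⟨h0, -, e⟩ | ⟨h0, -, e⟩ <;> rw [e] <;> constructor <;> linarith

theorem adjusted_mem {n k : ℕ} (hk : k ∈ posIndices n) :
    adjustedAngleUpper n k ∈ Icc (gap n / 2) (2 * π / 3) := by
  obtain ⟨h1, h2⟩ := mem_posIndices.1 hk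
  have hg := gap_pos n
  rcases le_or_gt (fejerAngleUpper n k) (2 * π / 3) with h | h
  · by_cases hp : ∃ m, Paired n k m
    · obtain ⟨m, hm⟩ := hp; exact hm.adjusted_left_mem
    · rw [adjusted_of_inner h1 h fun m hm => hp ⟨m, hm⟩]
      exact ⟨by linarith [half_gap_le_of_pos h2], h⟩
  · by_cases hp : ∃ m, Paired n m k
    · obtain ⟨m, hm⟩ := hp; exact hm.adjusted_right_mem
    · rw [adjusted_of_outer h1 h fun m hm => hp ⟨m, hm⟩]
      exact ⟨by linarith [half_gap_le_foldedFejer h1 h], (twin_foldedFejer h1 h).1.2⟩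

theorem adjusted_mem' {n k : ℕ} (hk : k ∈ posIndices n) :
    adjustedAngleUpper n k ∈ Icc 0 (2 * π / 3) :=
  ⟨by linarith [(adjusted_mem hk).1, gap_pos n], (adjusted_mem hk).2⟩

theorem adjusted_zero_of_even {n : ℕ} (h : Even n) : adjustedAngleUpper n 0 = 0 := by
  have e : fejerAngleUpper n 0 = 0 := by simp [fejerAngleUpper, h]
  rw [adjusted_of_inner (Nat.zero_le _) (by rw [e]; positivity), e]
  intro m hm
  exact hm.left_pos.ne' e

theorem abs_adjusted_sub_inner {n k : ℕ} (hk : k ≤ n / 2) (h : fejerAngleUpper n k ≤ 2 * π / 3) :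
    |adjustedAngleUpper n k - fejerAngleUpper n k| ≤ gap n := by
  by_cases hp : ∃ m, Paired n k m
  · obtain ⟨m, hm⟩ := hp
    obtain ⟨σ, h1, h2, -⟩ := hm.exists_shift
    rw [h2]; simpa using h1
  · rw [adjusted_of_inner hk h fun m hm => hp ⟨m, hm⟩]; simpa using (gap_pos n).le

theorem abs_adjusted_sub_outer {n k : ℕ} (hk : k ≤ n / 2) (h : 2 * π / 3 < fejerAngleUpper n k) :
    |adjustedAngleUpper n k - foldedFejer n k| ≤ gap n := by
  by_cases hp : ∃ m, Paired n m k
  · obtain ⟨m, hm⟩ := hp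
    obtain ⟨σ, h1, -, h2⟩ := hm.exists_shift
    rw [h2]; simpa using h1
  · rw [adjusted_of_outer hk h fun m hm => hp ⟨m, hm⟩]; simpa using (gap_pos n).le

theorem outer_pos {n k : ℕ} (h : 2 * π / 3 < fejerAngleUpper n k) : 0 < fejerAngleUpper n k :=
  lt_trans (by positivity) h

theorem gap_le_adjusted_sub_aux {n j k : ℕ} (hj : j ≤ n / 2) (hk : k ≤ n / 2)
    (hj' : fejerAngleUpper n j ≤ 2 * π / 3) (hk' : 2 * π / 3 < fejerAngleUpper n k) :
    gap n ≤ |adjustedAngleUpper n j - adjustedAngleUpper n k| := by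
  have hg := gap_pos n
  by_cases hjk : Paired n j k
  · have h2 := abs_lt.1 hjk.close
    rcases hjk.adjusted with ⟨-, e1, e2⟩ | ⟨-, e1, e2⟩ <;> rw [e1, e2, le_abs]
    · left; linarith
    · right; linarith
  have fold : ∀ m, m ≤ n / 2 → 2 * π / 3 < fejerAngleUpper n m → m ≠ k →
      3 * gap n ≤ |foldedFejer n m - foldedFejer n k| := fun m h1 h2 h3 =>
    (three_gap_le_abs_sub h3).trans ((twin_foldedFejer h1 h2).abs_sub_le (twin_foldedFejer hk hk'))
  by_cases hp : ∃ m, Paired n j m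
  · obtain ⟨m, hm⟩ := hp
    have hmk : m ≠ k := by rintro rfl; exact hjk hm
    by_cases hq : ∃ i, Paired n i k
    · obtain ⟨i, hi⟩ := hq
      have hij : j ≠ i := by rintro rfl; exact hjk hi
      have h1 := three_gap_le_abs_sub (n := n) hij
      have h2 := abs_le.1 (abs_adjusted_sub_inner hj hj')
      rw [le_abs] at h1 ⊢
      rcases hi.adjusted with ⟨-, -, e⟩ | ⟨-, -, e⟩ <;> rw [e] <;> rcases h1 with h1 | h1
      · left; linarith
      · right; linarith
      · left; linarith
      · right; linarith
    · rw [adjusted_of_outer hk hk' fun i hi => hq ⟨i, hi⟩]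
      have h1 := fold m hm.2 hm.4 hmk
      rw [le_abs] at h1 ⊢
      rcases hm.adjusted with ⟨-, e, -⟩ | ⟨-, e, -⟩ <;> rw [e] <;> rcases h1 with h1 | h1
      · left; linarith
      · right; linarith
      · left; linarith
      · right; linarith
  · rw [adjusted_of_inner hj hj' fun m hm => hp ⟨m, hm⟩]
    by_cases hq : ∃ i, Paired n i k
    · obtain ⟨i, hi⟩ := hq
      have hij : j ≠ i := by rintro rfl; exact hjk hi
      have h1 := three_gap_le_abs_sub (n := n) hij
      rw [le_abs] at h1 ⊢
      rcases hi.adjusted with ⟨-, -, e⟩ | ⟨-, -, e⟩ <;> rw [e] <;> rcases h1 with h1 | h1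
      · left; linarith
      · right; linarith
      · left; linarith
      · right; linarith
    · rw [adjusted_of_outer hk hk' fun i hi => hq ⟨i, hi⟩]
      by_contra hlt
      exact hjk ⟨hj, hk, hj', hk', not_le.1 hlt⟩

/-- The adjusted angles are separated. -/
theorem gap_le_adjusted_sub {n j k : ℕ} (hj : j ≤ n / 2) (hk : k ≤ n / 2) (hne : j ≠ k) :
    gap n ≤ |adjustedAngleUpper n j - adjustedAngleUpper n k| := by
  have same : ∀ {a b A B d : ℝ}, |A - a| ≤ d → |B - b| ≤ d → 3 * d ≤ |a - b| → d ≤ |A - B| := by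
    intro a b A B d h1 h2 h3
    rw [abs_le] at h1 h2
    rw [le_abs] at h3 ⊢
    rcases h3 with h3 | h3
    · left; linarith
    · right; linarith
  rcases le_or_gt (fejerAngleUpper n j) (2 * π / 3) with h1 | h1 <;>
    rcases le_or_gt (fejerAngleUpper n k) (2 * π / 3) with h2 | h2
  · exact same (abs_adjusted_sub_inner hj h1) (abs_adjusted_sub_inner hk h2)
      (three_gap_le_abs_sub hne)
  · exact gap_le_adjusted_sub_aux hj hk h1 h2
  · rw [abs_sub_comm]; exact gap_le_adjusted_sub_aux hk hj h2 h1
  · exact same (abs_adjusted_sub_outer hj h1) (abs_adjusted_sub_outer hk h2)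
      ((three_gap_le_abs_sub hne).trans
        ((twin_foldedFejer hj h1).abs_sub_le (twin_foldedFejer hk h2)))

/-- The adjusted angle, moved back to the side of the arc from which it comes. -/
noncomputable def sideAngle (n k : ℕ) : ℝ :=
  if fejerAngleUpper n k ≤ 2 * π / 3 then adjustedAngleUpper n k
  else outerTwin (adjustedAngleUpper n k)

theorem sideAngle_inner {n k : ℕ} (h : fejerAngleUpper n k ≤ 2 * π / 3) :
    sideAngle n k = adjustedAngleUpper n k := if_pos h

theorem twin_sideAngle {n k : ℕ} (hk : k ≤ n / 2) (h : 2 * π / 3 < fejerAngleUpper n k) :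
    Twin (adjustedAngleUpper n k) (sideAngle n k) := by
  rw [sideAngle, if_neg (not_le.2 h)]
  exact twin_outerTwin (adjusted_mem' (mem_posIndices.2 ⟨hk, outer_pos h⟩))

theorem abs_sideAngle_sub {n k : ℕ} (hk : k ≤ n / 2) :
    |sideAngle n k - fejerAngleUpper n k| ≤ gap n := by
  rcases le_or_gt (fejerAngleUpper n k) (2 * π / 3) with h | h
  · rw [sideAngle_inner h]; exact abs_adjusted_sub_inner hk h
  · exact ((twin_sideAngle hk h).abs_sub_le (twin_foldedFejer hk h)).trans
      (abs_adjusted_sub_outer hk h)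

theorem sideAngle_mem {n k : ℕ} (hk : k ∈ posIndices n) :
    sideAngle n k ∈ Icc (gap n / 2) (π - gap n / 2) := by
  obtain ⟨h1, h2⟩ := mem_posIndices.1 hk
  have h3 := abs_le.1 (abs_sideAngle_sub h1)
  constructor <;> linarith [half_gap_le_of_pos h2, fejerAngleUpper_le h1]

theorem sideAngle_mem' {n k : ℕ} (hk : k ∈ posIndices n) : sideAngle n k ∈ Icc 0 π := by
  have := sideAngle_mem hk
  have h := gap_pos n
  exact ⟨by linarith [this.1], by linarith [this.2]⟩

theorem radius_sideAngle {n k : ℕ} (hk : k ≤ n / 2) :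
    radius (sideAngle n k) = radius (adjustedAngleUpper n k) := by
  rcases le_or_gt (fejerAngleUpper n k) (2 * π / 3) with h | h
  · rw [sideAngle_inner h]
  · exact (twin_sideAngle hk h).3.symm

theorem gap_le_sideAngle_sub {n j k : ℕ} (hj : j ≤ n / 2) (hk : k ≤ n / 2)
    (hne : j ≠ k) : gap n ≤ |sideAngle n j - sideAngle n k| := by
  have h1 := abs_le.1 (abs_sideAngle_sub hj)
  have h2 := abs_le.1 (abs_sideAngle_sub hk)
  have h3 := three_gap_le_abs_sub (n := n) hne
  rw [le_abs] at h3 ⊢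
  rcases h3 with h3 | h3
  · left; linarith
  · right; linarith

/-! ### The partner of an index in an adjustment pair -/

open Classical in
/-- The other index of an adjustment pair, or the index itself if it belongs to no pair. -/
noncomputable def partner (n k : ℕ) : ℕ :=
  if h : ∃ m, Paired n k m then h.choose else if h : ∃ j, Paired n j k then h.choose else k

theorem Paired.partner_left {n j k : ℕ} (h : Paired n j k) : partner n j = k := by
  have e : ∃ m, Paired n j m := ⟨k, h⟩
  rw [partner, dif_pos e]; exact e.choose_spec.right_unique h

theorem Paired.partner_right {n j k : ℕ} (h : Paired n j k) : partner n k = j := by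
  have e : ∃ m, Paired n m k := ⟨j, h⟩
  rw [partner, dif_neg (fun ⟨m, hm⟩ => absurd hm.3 (not_le.2 h.4)), dif_pos e]
  exact e.choose_spec.left_unique h

theorem partner_cases {n k : ℕ} (hk : k ≤ n / 2) :
    (partner n k = k ∧ radius (adjustedAngleUpper n k) = radius (fejerAngleUpper n k)) ∨
      Paired n k (partner n k) ∨ Paired n (partner n k) k := by
  by_cases hp : ∃ m, Paired n k m
  · obtain ⟨m, hm⟩ := hp; right; left; rw [hm.partner_left]; exact hm
  by_cases hq : ∃ m, Paired n m k
  · obtain ⟨m, hm⟩ := hq; right; right; rw [hm.partner_right]; exact hm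
  left
  refine ⟨by rw [partner, dif_neg hp, dif_neg hq], ?_⟩
  rcases le_or_gt (fejerAngleUpper n k) (2 * π / 3) with h | h
  · rw [adjusted_of_inner hk h fun m hm => hp ⟨m, hm⟩]
  · rw [adjusted_of_outer hk h fun m hm => hq ⟨m, hm⟩]; exact (twin_foldedFejer hk h).3

theorem partner_mem {n k : ℕ} (hk : k ∈ posIndices n) : partner n k ∈ posIndices n := by
  rcases partner_cases (mem_posIndices.1 hk).1 with ⟨h, -⟩ | h | h
  · rwa [h]
  · exact mem_posIndices.2 ⟨h.2, outer_pos h.4⟩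
  · exact mem_posIndices.2 ⟨h.1, h.left_pos⟩

theorem partner_partner {n k : ℕ} (hk : k ≤ n / 2) : partner n (partner n k) = k := by
  rcases partner_cases hk with ⟨h, -⟩ | h | h
  · rw [h, h]
  · exact h.partner_right
  · exact h.partner_left

/-! ### Sums over separated points -/

theorem sum_floor_le {S : Finset ℕ} {a : ℕ → ℝ} {δ t : ℝ} (hδ : 0 < δ)
    (hs : ∀ j ∈ S, ∀ k ∈ S, j ≠ k → δ ≤ |a j - a k|) {g : ℕ → ℝ} (hg : ∀ m, 0 ≤ g m) {M : ℕ}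
    (hM : ∀ k ∈ S, |a k - t| < M * δ) :
    ∑ k ∈ S, g ⌊|a k - t| / δ⌋₊ ≤ 2 * ∑ m ∈ Finset.range M, g m := by
  have half : ∀ P : Finset ℕ, P ⊆ S → (∀ j ∈ P, ∀ k ∈ P, |a j - a k| = |(|a j - t| - |a k - t|)|) →
      ∑ k ∈ P, g ⌊|a k - t| / δ⌋₊ ≤ ∑ m ∈ Finset.range M, g m := by
    intro P hP habs
    have inj : Set.InjOn (fun k => ⌊|a k - t| / δ⌋₊) P := by
      intro j hj k hk hjk
      by_contra hne
      have h1 := hs j (hP hj) k (hP hk) hne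
      rw [habs j hj k hk] at h1
      have h2 : 1 ≤ |(|a j - t| / δ - |a k - t| / δ)| := by
        rw [← sub_div, abs_div, abs_of_pos hδ, le_div_iff₀ hδ, one_mul]; exact h1
      have f1 := Nat.floor_le (by positivity : 0 ≤ |a j - t| / δ)
      have f2 := Nat.lt_floor_add_one (|a j - t| / δ)
      have f3 := Nat.floor_le (by positivity : 0 ≤ |a k - t| / δ)
      have f4 := Nat.lt_floor_add_one (|a k - t| / δ)
      simp only at hjk
      rw [hjk] at f1 f2
      rw [le_abs] at h2
      rcases h2 with h2 | h2 <;> linarith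
    rw [← Finset.sum_image (f := g) inj]
    refine Finset.sum_le_sum_of_subset_of_nonneg ?_ fun m _ _ => hg m
    intro m hm
    obtain ⟨k, hk, rfl⟩ := Finset.mem_image.1 hm
    rw [Finset.mem_range, Nat.floor_lt (by positivity), div_lt_iff₀ hδ]
    exact hM k (hP hk)
  rw [← Finset.sum_filter_add_sum_filter_not S (fun k => t ≤ a k), two_mul]
  refine add_le_add (half _ (Finset.filter_subset _ _) ?_) (half _ (Finset.filter_subset _ _) ?_)
  · intro j hj k hk
    rw [abs_of_nonneg (sub_nonneg.2 (Finset.mem_filter.1 hj).2),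
      abs_of_nonneg (sub_nonneg.2 (Finset.mem_filter.1 hk).2)]
    congr 1; ring
  · intro j hj k hk
    rw [abs_of_nonpos (sub_nonpos.2 (not_le.1 (Finset.mem_filter.1 hj).2).le),
      abs_of_nonpos (sub_nonpos.2 (not_le.1 (Finset.mem_filter.1 hk).2).le), ← abs_neg]
    congr 1; ring

theorem card_near_le {S : Finset ℕ} {a : ℕ → ℝ} {δ t : ℝ} (hδ : 0 < δ)
    (hs : ∀ j ∈ S, ∀ k ∈ S, j ≠ k → δ ≤ |a j - a k|) (M : ℕ) :
    (S.filter fun k => |a k - t| < M * δ).card ≤ 2 * M := by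
  have := sum_floor_le (S := S.filter fun k => |a k - t| < M * δ) (t := t) (g := fun _ => 1) hδ
    (fun j hj k hk => hs j (Finset.mem_filter.1 hj).1 k (Finset.mem_filter.1 hk).1)
    (fun _ => zero_le_one) (M := M) fun k hk => (Finset.mem_filter.1 hk).2
  simp only [Finset.sum_const, nsmul_eq_mul, mul_one, Finset.card_range] at this
  exact_mod_cast this

theorem one_div_max_le (u : ℝ) : 1 / max 1 u ≤ 1 / max 1 (⌊u⌋₊ : ℝ) := by
  rcases le_or_gt u 0 with h | h
  · rw [Nat.floor_of_nonpos h, max_eq_left (by linarith)]; simp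
  · exact one_div_le_one_div_of_le (by positivity) (max_le_max le_rfl (Nat.floor_le h.le))

theorem sum_one_div_max_sq_le {S : Finset ℕ} {a : ℕ → ℝ} {δ t : ℝ} (hδ : 0 < δ)
    (hs : ∀ j ∈ S, ∀ k ∈ S, j ≠ k → δ ≤ |a j - a k|) :
    ∑ k ∈ S, (1 / max 1 (|a k - t| / δ)) ^ 2 ≤ 6 := by
  obtain ⟨M, hM⟩ : ∃ M : ℕ, ∀ k ∈ S, |a k - t| < M * δ := by
    obtain ⟨M, hM⟩ := exists_nat_gt (∑ k ∈ S, |a k - t| / δ)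
    refine ⟨M, fun k hk => (div_lt_iff₀ hδ).1 (lt_of_le_of_lt ?_ hM)⟩
    exact Finset.single_le_sum (f := fun k => |a k - t| / δ) (fun i _ => by positivity) hk
  have h1 : ∑ k ∈ S, (1 / max 1 (|a k - t| / δ)) ^ 2 ≤
      ∑ k ∈ S, (fun m : ℕ => (1 / max 1 (m : ℝ)) ^ 2) ⌊|a k - t| / δ⌋₊ := by
    refine Finset.sum_le_sum fun k _ => pow_le_pow_left₀ (by positivity) (one_div_max_le _) 2
  have h2 := sum_floor_le (t := t) (g := fun m : ℕ => (1 / max 1 (m : ℝ)) ^ 2) hδ hs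
    (fun _ => by positivity) hM
  have h3 : ∀ M : ℕ, ∑ m ∈ Finset.range (M + 2), (1 / max 1 (m : ℝ)) ^ 2 ≤
      3 - 1 / (M + 1 : ℝ) := by
    intro M
    induction M with
    | zero => norm_num [Finset.sum_range_succ]
    | succ M ih =>
      rw [Finset.sum_range_succ]
      have e : max 1 (((M + 2 : ℕ) : ℝ)) = M + 2 := by
        rw [max_eq_right (by push_cast; linarith [M.cast_nonneg (α := ℝ)])]; push_cast; ring
      have : (1 / (M + 2 : ℝ)) ^ 2 ≤ 1 / (M + 1 : ℝ) - 1 / (M + 2 : ℝ) := by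
        rw [div_sub_div _ _ (by positivity) (by positivity), div_pow,
          div_le_div_iff₀ (by positivity) (by positivity)]
        nlinarith [M.cast_nonneg (α := ℝ)]
      have e2 : ((M + 1 : ℕ) : ℝ) + 1 = M + 2 := by push_cast; ring
      rw [e, e2]
      linarith
  have h4 : ∑ m ∈ Finset.range M, (1 / max 1 (m : ℝ)) ^ 2 ≤ 3 :=
    (Finset.sum_le_sum_of_subset_of_nonneg (Finset.range_mono (by omega : M ≤ M + 2))
      fun m _ _ => by positivity).trans ((h3 M).trans (by
        have : 0 < 1 / (M + 1 : ℝ) := by positivity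
        linarith))
  linarith

theorem sum_one_div_max_le {S : Finset ℕ} {a : ℕ → ℝ} {δ t : ℝ} (hδ : 0 < δ)
    (hs : ∀ j ∈ S, ∀ k ∈ S, j ≠ k → δ ≤ |a j - a k|) {M : ℕ}
    (hM : ∀ k ∈ S, |a k - t| < (M + 1 : ℕ) * δ) :
    ∑ k ∈ S, 1 / max 1 (|a k - t| / δ) ≤ 2 * (2 + Real.log M) := by
  have h1 : ∑ k ∈ S, 1 / max 1 (|a k - t| / δ) ≤
      ∑ k ∈ S, (fun m : ℕ => 1 / max 1 (m : ℝ)) ⌊|a k - t| / δ⌋₊ :=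
    Finset.sum_le_sum fun k _ => one_div_max_le _
  have h2 := sum_floor_le (t := t) (g := fun m : ℕ => 1 / max 1 (m : ℝ)) hδ hs
    (fun _ => by positivity) hM
  have h3 : ∑ m ∈ Finset.range (M + 1), 1 / max 1 (m : ℝ) ≤ 2 + Real.log M := by
    rw [Finset.sum_range_succ']
    have e : ∑ m ∈ Finset.range M, 1 / max 1 (((m + 1 : ℕ) : ℝ)) = (harmonic M : ℝ) := by
      rw [harmonic]
      push_cast
      refine Finset.sum_congr rfl fun m _ => ?_
      rw [max_eq_right (by linarith [m.cast_nonneg (α := ℝ)]), one_div]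
    rw [e]
    have := harmonic_le_one_add_log M
    norm_num
    linarith
  linarith

/-! ### Second differences -/

/-- A symmetric second difference is bounded by the second derivative. -/
theorem abs_add_sub_add_sub_le {f f' f'' : ℝ → ℝ} {lo hi B a b σ : ℝ}
    (h1 : ∀ s ∈ Icc lo hi, HasDerivAt f (f' s) s) (h2 : ∀ s ∈ Icc lo hi, HasDerivAt f' (f'' s) s)
    (h3 : ∀ s ∈ Icc lo hi, |f'' s| ≤ B) (ha : a ∈ Icc lo hi) (ha' : a + σ ∈ Icc lo hi)
    (hb : b ∈ Icc lo hi) (hb' : b - σ ∈ Icc lo hi) :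
    |(f (a + σ) - f a) + (f (b - σ) - f b)| ≤ B * (|a - b| + 2 * |σ|) * |σ| := by
  have hB : 0 ≤ B := (abs_nonneg _).trans (h3 a ha)
  have lip : ∀ x ∈ Icc lo hi, ∀ y ∈ Icc lo hi, |f' x - f' y| ≤ B * |x - y| := fun x hx y hy =>
    (convex_Icc lo hi).norm_image_sub_le_of_norm_hasDerivWithin_le
      (fun s hs => (h2 s hs).hasDerivWithinAt) h3 hy hx
  have mem1 : ∀ x ∈ uIcc 0 σ, a + x ∈ Icc lo hi := by
    intro x hx
    have : a + x ∈ uIcc (a + 0) (a + σ) := by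
      rw [← image_const_add_uIcc]; exact ⟨x, hx, rfl⟩
    rw [add_zero] at this
    exact (convex_Icc lo hi).ordConnected.uIcc_subset ha ha' this
  have mem2 : ∀ x ∈ uIcc 0 σ, b - x ∈ Icc lo hi := by
    intro x hx
    have : b - x ∈ uIcc (b - 0) (b - σ) := by
      rw [← image_const_sub_uIcc]; exact ⟨x, hx, rfl⟩
    rw [sub_zero] at this
    exact (convex_Icc lo hi).ordConnected.uIcc_subset hb hb' this
  have key := (convex_uIcc 0 σ).norm_image_sub_le_of_norm_hasDerivWithin_le
    (f := fun x => f (a + x) + f (b - x)) (f' := fun x => f' (a + x) - f' (b - x))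
    (C := B * (|a - b| + 2 * |σ|)) (x := 0) (y := σ) (fun x hx => by
      have d1 := (h1 _ (mem1 x hx)).comp_const_add a x
      have d2 := (h1 _ (mem2 x hx)).comp_const_sub b x
      exact (d1.add d2).hasDerivWithinAt) (fun x hx => by
      refine (lip _ (mem1 x hx) _ (mem2 x hx)).trans (mul_le_mul_of_nonneg_left ?_ hB)
      have hx' : |x| ≤ |σ| := by
        have := abs_sub_left_of_mem_uIcc hx
        simpa using this
      have e : a + x - (b - x) = (a - b) + 2 * x := by ring
      rw [e]
      refine (abs_add_le _ _).trans ?_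
      rw [abs_mul, abs_two]; linarith) left_mem_uIcc right_mem_uIcc
  simp only [add_zero, sub_zero, Real.norm_eq_abs] at key
  convert key using 2
  ring

/-- The midpoint rule. -/
theorem abs_sub_average_le {f f' f'' : ℝ → ℝ} {B θ h : ℝ} (hh : 0 < h)
    (h1 : ∀ s ∈ Icc (θ - h) (θ + h), HasDerivAt f (f' s) s)
    (h2 : ∀ s ∈ Icc (θ - h) (θ + h), HasDerivAt f' (f'' s) s)
    (h3 : ∀ s ∈ Icc (θ - h) (θ + h), |f'' s| ≤ B) :
    |f θ - 1 / (2 * h) * ∫ s in (θ - h)..(θ + h), f s| ≤ B * h ^ 2 := by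
  have hθ : θ ∈ Icc (θ - h) (θ + h) := ⟨by linarith, by linarith⟩
  have hB : 0 ≤ B := (abs_nonneg _).trans (h3 θ hθ)
  have lip : ∀ x ∈ Icc (θ - h) (θ + h), |f' x - f' θ| ≤ B * |x - θ| := fun x hx =>
    (convex_Icc _ _).norm_image_sub_le_of_norm_hasDerivWithin_le
      (fun s hs => (h2 s hs).hasDerivWithinAt) h3 hθ hx
  have taylor : ∀ s ∈ Icc (θ - h) (θ + h), |f s - f θ - f' θ * (s - θ)| ≤ B * h * h := by
    intro s hs
    have key := (convex_Icc (θ - h) (θ + h)).norm_image_sub_le_of_norm_hasDerivWithin_le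
      (f := fun x => f x - f' θ * x) (f' := fun x => f' x - f' θ) (C := B * h) (x := θ) (y := s)
      (fun x hx => by
        have := (h1 x hx).sub ((hasDerivAt_id' x).const_mul (f' θ))
        rw [mul_one] at this
        exact this.hasDerivWithinAt)
      (fun x hx => (lip x hx).trans (mul_le_mul_of_nonneg_left
        (abs_le.2 ⟨by linarith [hx.1], by linarith [hx.2]⟩) hB)) hθ hs
    simp only [Real.norm_eq_abs] at key
    have e : f s - f' θ * s - (f θ - f' θ * θ) = f s - f θ - f' θ * (s - θ) := by ring
    rw [e] at key
    exact key.trans (mul_le_mul_of_nonneg_left (abs_le.2 ⟨by linarith [hs.1], by linarith [hs.2]⟩)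
      (by positivity))
  have hi : IntervalIntegrable f volume (θ - h) (θ + h) := by
    refine ContinuousOn.intervalIntegrable fun s hs => ?_
    rw [uIcc_of_le (by linarith)] at hs
    exact (h1 s hs).continuousAt.continuousWithinAt
  have e : ∫ s in (θ - h)..(θ + h), (f s - f θ - f' θ * (s - θ)) =
      (∫ s in (θ - h)..(θ + h), f s) - 2 * h * f θ := by
    rw [intervalIntegral.integral_sub (hi.sub intervalIntegrable_const)
      (by fun_prop : Continuous fun s => f' θ * (s - θ)).continuousOn.intervalIntegrable,
      intervalIntegral.integral_sub hi intervalIntegrable_const, intervalIntegral.integral_const,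
      intervalIntegral.integral_const_mul, intervalIntegral.integral_comp_sub_right (fun s => s) θ]
    simp only [integral_id, smul_eq_mul]
    ring
  have b := intervalIntegral.norm_integral_le_of_norm_le_const (a := θ - h) (b := θ + h)
    (f := fun s => f s - f θ - f' θ * (s - θ)) (C := B * h * h) (fun s hs => by
      rw [uIoc_of_le (by linarith)] at hs
      exact taylor s (Ioc_subset_Icc_self hs))
  rw [e, Real.norm_eq_abs, show θ + h - (θ - h) = 2 * h by ring,
    abs_of_pos (show 0 < 2 * h by positivity)] at b
  have e2 : f θ - 1 / (2 * h) * ∫ s in (θ - h)..(θ + h), f s =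
      -(1 / (2 * h) * ((∫ s in (θ - h)..(θ + h), f s) - 2 * h * f θ)) := by
    field_simp; ring
  rw [e2, abs_neg, abs_mul, abs_of_pos (show 0 < 1 / (2 * h) by positivity)]
  calc 1 / (2 * h) * _ ≤ 1 / (2 * h) * (B * h * h * (2 * h)) := by gcongr
    _ = B * h ^ 2 := by field_simp

/-! ### Comparison of the products with their integral means -/

/-- The sum of the inverse squared distances to the singular angles. -/
noncomputable def invSq (t t' θ : ℝ) : ℝ :=
  1 / (θ - t) ^ 2 + 1 / (θ - t') ^ 2 + 1 / (θ - 0) ^ 2 + 1 / (θ - π) ^ 2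

theorem invSq_nonneg (t t' θ : ℝ) : 0 ≤ invSq t t' θ := by unfold invSq; positivity

/-- The angle `θ` is far from the singular angles. -/
structure Far (δ t t' θ : ℝ) : Prop where
  inner : 4 * δ ≤ |θ - t|
  outer : 4 * δ ≤ |θ - t'|
  zero : 4 * δ ≤ |θ - 0|
  pi : 4 * δ ≤ |θ - π|

theorem ddlogKer_bound_of_far : ∃ C, 0 < C ∧ ∀ δ t t' θ : ℝ, 0 < δ → Twin t t' → θ ∈ Icc 0 π →
    Far δ t t' θ → ∀ s ∈ Icc (θ - 2 * δ) (θ + 2 * δ),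
      s ∈ Ioo 0 π ∧ radius s ≠ radius t ∧ |ddlogKer t s| ≤ C * invSq t t' θ := by
  obtain ⟨C, hC0, hC⟩ := ddlogKer_bound
  refine ⟨C * 4, by positivity, fun δ t t' θ hδ tw hθ hf s hs => ?_⟩
  have key : ∀ a, 4 * δ ≤ |θ - a| → |θ - a| / 2 ≤ |s - a| ∧ s ≠ a ∧
      1 / (s - a) ^ 2 ≤ 4 * (1 / (θ - a) ^ 2) := by
    intro a ha
    have h1 : |θ - a| ≤ |s - a| + 2 * δ := by
      have := abs_sub_le θ s a
      have h2 : |θ - s| ≤ 2 * δ := abs_le.2 ⟨by linarith [hs.2], by linarith [hs.1]⟩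
      linarith
    have h2 : |θ - a| / 2 ≤ |s - a| := by linarith
    have h3 : 0 < |θ - a| := by linarith
    have h4 : s ≠ a := by
      rintro rfl; simp at h2; linarith [abs_pos.1 h3, abs_nonneg (θ - s)]
    refine ⟨h2, h4, ?_⟩
    rw [← sq_abs (s - a), ← sq_abs (θ - a), mul_one_div, div_le_div_iff₀ (by
      have := abs_pos.2 (sub_ne_zero.2 h4); positivity) (by positivity)]
    nlinarith
  obtain ⟨-, n1, b1⟩ := key t hf.1
  obtain ⟨-, n2, b2⟩ := key t' hf.2
  obtain ⟨-, n3, b3⟩ := key 0 hf.3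
  obtain ⟨-, n4, b4⟩ := key π hf.4
  have h0 := hf.3
  have hp := hf.4
  rw [sub_zero, abs_of_nonneg hθ.1] at h0
  rw [abs_sub_comm, abs_of_nonneg (sub_nonneg.2 hθ.2)] at hp
  have hs' : s ∈ Ioo 0 π := ⟨by linarith [hs.1], by linarith [hs.2]⟩
  refine ⟨hs', tw.radius_ne (Ioo_subset_Icc_self hs') n1 n2, ?_⟩
  refine (hC t t' tw s hs' n1 n2).trans ?_
  rw [mul_assoc]
  refine mul_le_mul_of_nonneg_left ?_ hC0.le
  unfold invSq
  linarith

/-- The mean of `log ker` over the cell around a Fejér angle. -/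
noncomputable def cellAverage (n : ℕ) (t : ℝ) (k : ℕ) : ℝ :=
  1 / (2 * (3 * gap n / 2)) * ∫ s in (fejerAngleUpper n k - 3 * gap n / 2)..
    (fejerAngleUpper n k + 3 * gap n / 2), Real.log (ker t s)

theorem ker_congr {t s s' : ℝ} (h : radius s = radius s') : ker t s = ker t s' := by
  rw [ker, ker, h]

theorem abs_sub_cellAverage_le : ∃ C, 0 < C ∧ ∀ (n : ℕ) (t t' : ℝ), Twin t t' → ∀ k ≤ n / 2,
    Far (gap n) t t' (fejerAngleUpper n k) →
    |Real.log (ker t (fejerAngleUpper n k)) - cellAverage n t k| ≤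
      C * (gap n ^ 2 * invSq t t' (fejerAngleUpper n k)) := by
  obtain ⟨C, hC0, hC⟩ := ddlogKer_bound_of_far
  refine ⟨C * (9 / 4), by positivity, fun n t t' tw k hk hf => ?_⟩
  have hg := gap_pos n
  have hc := hC (gap n) t t' _ hg tw (fejerAngleUpper_mem hk) hf
  have sub : Icc (fejerAngleUpper n k - 3 * gap n / 2) (fejerAngleUpper n k + 3 * gap n / 2) ⊆
      Icc (fejerAngleUpper n k - 2 * gap n) (fejerAngleUpper n k + 2 * gap n) :=
    Icc_subset_Icc (by linarith) (by linarith)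
  have := abs_sub_average_le (f := fun s => Real.log (ker t s)) (f' := dlogKer t)
    (f'' := ddlogKer t) (B := C * invSq t t' (fejerAngleUpper n k))
    (θ := fejerAngleUpper n k) (h := 3 * gap n / 2) (by positivity)
    (fun s hs => hasDerivAt_log_ker (hc s (sub hs)).1 (hc s (sub hs)).2.1)
    (fun s hs => hasDerivAt_dlogKer (hc s (sub hs)).1 (hc s (sub hs)).2.1)
    (fun s hs => (hc s (sub hs)).2.2)
  refine this.trans_eq ?_
  ring

theorem Paired.abs_shift_le : ∃ C, 0 < C ∧ ∀ (n : ℕ) (t t' : ℝ), Twin t t' → ∀ j k, Paired n j k →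
    Far (gap n) t t' (fejerAngleUpper n j) →
    |(Real.log (ker t (adjustedAngleUpper n j)) - Real.log (ker t (fejerAngleUpper n j))) +
      (Real.log (ker t (adjustedAngleUpper n k)) - Real.log (ker t (fejerAngleUpper n k)))| ≤
      C * (gap n ^ 2 * invSq t t' (fejerAngleUpper n j)) := by
  obtain ⟨C, hC0, hC⟩ := ddlogKer_bound_of_far
  refine ⟨C * 3, by positivity, fun n t t' tw j k hp hf => ?_⟩
  have hg := gap_pos n
  have hc := hC (gap n) t t' _ hg tw (fejerAngleUpper_mem hp.1) hf
  obtain ⟨σ, h1, e1, e2⟩ := hp.exists_shift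
  have h2 := hp.close
  have h1' := abs_le.1 h1
  have h2' := abs_lt.1 h2
  have := abs_add_sub_add_sub_le (f := fun s => Real.log (ker t s)) (f' := dlogKer t)
    (f'' := ddlogKer t) (B := C * invSq t t' (fejerAngleUpper n j))
    (lo := fejerAngleUpper n j - 2 * gap n) (hi := fejerAngleUpper n j + 2 * gap n)
    (a := fejerAngleUpper n j) (b := foldedFejer n k) (σ := σ)
    (fun s hs => hasDerivAt_log_ker (hc s hs).1 (hc s hs).2.1)
    (fun s hs => hasDerivAt_dlogKer (hc s hs).1 (hc s hs).2.1)
    (fun s hs => (hc s hs).2.2) ⟨by linarith, by linarith⟩ ⟨by linarith, by linarith⟩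
    ⟨by linarith, by linarith⟩ ⟨by linarith, by linarith⟩
  rw [e1, e2, ← ker_congr (t := t) hp.twin.3]
  refine this.trans ?_
  have hi := invSq_nonneg t t' (fejerAngleUpper n j)
  calc C * invSq t t' (fejerAngleUpper n j) * (|fejerAngleUpper n j - foldedFejer n k| + 2 * |σ|) *
        |σ| ≤ C * invSq t t' (fejerAngleUpper n j) * (gap n + 2 * gap n) * gap n := by gcongr
    _ = _ := by ring

theorem sum_invSq_le {n : ℕ} {t t' : ℝ} {S : Finset ℕ}
    (hf : ∀ k ∈ S, Far (gap n) t t' (fejerAngleUpper n k)) :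
    ∑ k ∈ S, gap n ^ 2 * invSq t t' (fejerAngleUpper n k) ≤ 24 := by
  have hg := gap_pos n
  have one : ∀ a : ℝ, (∀ k ∈ S, 4 * gap n ≤ |fejerAngleUpper n k - a|) →
      ∑ k ∈ S, gap n ^ 2 * (1 / (fejerAngleUpper n k - a) ^ 2) ≤ 6 := by
    intro a ha
    have := sum_one_div_max_sq_le (S := S) (a := fejerAngleUpper n) (t := a) hg
      fun j _ k _ hjk => by linarith [three_gap_le_abs_sub (n := n) hjk]
    refine le_trans (Finset.sum_le_sum fun k hk => ?_) this
    have h := ha k hk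
    have h0 : 0 < |fejerAngleUpper n k - a| := by linarith
    rw [max_eq_right (by rw [le_div_iff₀ hg]; linarith), one_div_div, div_pow, sq_abs,
      mul_one_div]
  unfold invSq
  simp only [mul_add, Finset.sum_add_distrib]
  have h1 := one t fun k hk => (hf k hk).1
  have h2 := one t' fun k hk => (hf k hk).2
  have h3 := one 0 fun k hk => (hf k hk).3
  have h4 := one π fun k hk => (hf k hk).4
  linarith

theorem abs_sum_log_ker_sub_le : ∃ C, 0 < C ∧ ∀ (n : ℕ) (t t' : ℝ), Twin t t' →
    ∀ S ⊆ posIndices n, (∀ k ∈ S, Far (gap n) t t' (fejerAngleUpper n k)) →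
    (∀ k ∈ S, partner n k ∈ S) →
    |∑ k ∈ S, (Real.log (ker t (adjustedAngleUpper n k)) - cellAverage n t k)| ≤ C := by
  obtain ⟨C1, p1, h1⟩ := abs_sub_cellAverage_le
  obtain ⟨C2, p2, h2⟩ := Paired.abs_shift_le
  refine ⟨C1 * 24 + C2 * 24, by positivity, fun n t t' tw S hS hf hp => ?_⟩
  obtain ⟨q, hq⟩ : ∃ q : ℕ → ℝ, q = fun k => gap n ^ 2 * invSq t t' (fejerAngleUpper n k) := ⟨_, rfl⟩
  have hq0 : ∀ k, 0 ≤ q k := fun k => by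
    rw [hq]; exact mul_nonneg (sq_nonneg _) (invSq_nonneg _ _ _)
  have hqs : ∑ k ∈ S, q k ≤ 24 := by rw [hq]; exact sum_invSq_le hf
  obtain ⟨sh, hsh⟩ : ∃ sh : ℕ → ℝ, sh = fun k => Real.log (ker t (adjustedAngleUpper n k)) -
    Real.log (ker t (fejerAngleUpper n k)) := ⟨_, rfl⟩
  have hle : ∀ k ∈ S, k ≤ n / 2 := fun k hk => (mem_posIndices.1 (hS hk)).1
  have swap : ∀ f : ℕ → ℝ, ∑ k ∈ S, f (partner n k) = ∑ k ∈ S, f k := fun f =>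
    Finset.sum_nbij' (partner n) (partner n) hp hp
      (fun k hk => partner_partner (hle k hk)) (fun k hk => partner_partner (hle k hk))
      fun _ _ => rfl
  have pair : ∀ k ∈ S, |sh k + sh (partner n k)| ≤ C2 * (q k + q (partner n k)) := by
    intro k hk
    rw [hsh, hq]; simp only
    have q1 := hq0 k
    have q2 := hq0 (partner n k)
    rw [hq] at q1 q2
    simp only at q1 q2
    rcases partner_cases (hle k hk) with ⟨e, hr⟩ | hP | hP
    · rw [e, ker_congr (t := t) hr, sub_self, add_zero, abs_zero]; positivity
    · refine (h2 n t t' tw _ _ hP (hf k hk)).trans ?_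
      exact mul_le_mul_of_nonneg_left (by linarith) p2.le
    · rw [add_comm]
      refine (h2 n t t' tw _ _ hP (hf _ (hp k hk))).trans ?_
      exact mul_le_mul_of_nonneg_left (by linarith) p2.le
  have b2 : |∑ k ∈ S, sh k| ≤ C2 * 24 := by
    have e : ∑ k ∈ S, (sh k + sh (partner n k)) = 2 * ∑ k ∈ S, sh k := by
      rw [Finset.sum_add_distrib, swap sh]; ring
    have b : |∑ k ∈ S, (sh k + sh (partner n k))| ≤ C2 * (2 * ∑ k ∈ S, q k) := by
      refine (Finset.abs_sum_le_sum_abs _ _).trans ((Finset.sum_le_sum pair).trans_eq ?_)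
      rw [← Finset.mul_sum, Finset.sum_add_distrib, swap q]; ring
    rw [e, abs_mul, abs_two] at b
    nlinarith
  have b1 : |∑ k ∈ S, (Real.log (ker t (fejerAngleUpper n k)) - cellAverage n t k)| ≤ C1 * 24 := by
    refine (Finset.abs_sum_le_sum_abs _ _).trans ((Finset.sum_le_sum (g := fun k => C1 * q k)
      fun k hk => ?_).trans ?_)
    · rw [hq]; exact h1 n t t' tw k (hle k hk) (hf k hk)
    · rw [← Finset.mul_sum]; exact mul_le_mul_of_nonneg_left hqs p1.le
  have e : ∑ k ∈ S, (Real.log (ker t (adjustedAngleUpper n k)) - cellAverage n t k) =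
      ∑ k ∈ S, (Real.log (ker t (fejerAngleUpper n k)) - cellAverage n t k) + ∑ k ∈ S, sh k := by
    rw [hsh, ← Finset.sum_add_distrib]
    exact Finset.sum_congr rfl fun k _ => by ring
  rw [e]
  exact (abs_add_le _ _).trans (add_le_add b1 b2)

theorem Cmp.prod {S : Finset ℕ} {f g : ℕ → ℝ} {C : ℝ}
    (h : ∀ k ∈ S, Cmp C (f k) (g k)) : Cmp (C ^ S.card) (∏ k ∈ S, f k) (∏ k ∈ S, g k) := by
  induction S using Finset.induction_on with
  | empty => simpa using Cmp.refl (zero_le_one (α := ℝ))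
  | insert a S ha ih =>
    rw [Finset.prod_insert ha, Finset.prod_insert ha, Finset.card_insert_of_notMem ha, pow_succ,
      mul_comm _ C]
    exact (h a (Finset.mem_insert_self a S)).mul
      (ih fun k hk => h k (Finset.mem_insert_of_mem hk))

theorem Cmp.exp {C a b : ℝ} (h : |a - b| ≤ C) : Cmp (Real.exp C) (Real.exp a) (Real.exp b) := by
  rw [abs_le] at h
  refine ⟨(Real.exp_pos _).le, (Real.exp_pos _).le, Real.exp_pos _, ?_, ?_⟩ <;>
    rw [← Real.exp_add] <;> exact Real.exp_le_exp.2 (by linarith)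

/-- The model of `exp (cellAverage n t k)`. -/
noncomputable def cellModel (n : ℕ) (t t' : ℝ) (k : ℕ) : ℝ :=
  max (3 * gap n / 2) |fejerAngleUpper n k - t| * max (3 * gap n / 2) |fejerAngleUpper n k - t'| *
    max (3 * gap n / 2) (fejerAngleUpper n k + t) ^ 2

theorem cellModel_pos (n : ℕ) (t t' : ℝ) (k : ℕ) : 0 < cellModel n t t' k := by
  have h := gap_pos n
  have h' : ∀ u, 0 < max (3 * gap n / 2) u := fun u => lt_max_of_lt_left (by positivity)
  unfold cellModel
  exact mul_pos (mul_pos (h' _) (h' _)) (pow_pos (h' _) 2)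

theorem exp_log_add_log_add {a b c : ℝ} (ha : 0 < a) (hb : 0 < b) (hc : 0 < c) :
    Real.exp (Real.log a + Real.log b + 2 * Real.log c) = a * b * c ^ 2 := by
  rw [Real.exp_add, Real.exp_add, Real.exp_log ha, Real.exp_log hb, two_mul, Real.exp_add,
    Real.exp_log hc, sq]

theorem exp_cellAverage_cmp : ∃ C, ∀ (n : ℕ) (t t' : ℝ), Twin t t' → ∀ k ∈ posIndices n,
    Cmp C (Real.exp (cellAverage n t k)) (cellModel n t t' k) := by
  obtain ⟨C, -, hC⟩ := abs_average_log_ker_le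
  refine ⟨Real.exp C, fun n t t' tw k hk => ?_⟩
  obtain ⟨h1, h2⟩ := mem_posIndices.1 hk
  have hg := gap_pos n
  have h' : ∀ u, 0 < max (3 * gap n / 2) u := fun u => lt_max_of_lt_left (by positivity)
  have := hC t t' tw (fejerAngleUpper n k) (3 * gap n / 2) (by positivity)
    (by linarith [half_gap_le_of_pos h2]) (by linarith [fejerAngleUpper_le h1])
  refine (Cmp.exp this).congr rfl ?_
  rw [exp_log_add_log_add (h' _) (h' _) (h' _), cellModel]

/-- The defect of the node with index `k` at the angle `s`. -/
noncomputable def defect (n k : ℕ) (s : ℝ) : ℝ := min 1 (|sideAngle n k - s| / gap n)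

theorem defect_nonneg (n k : ℕ) (s : ℝ) : 0 ≤ defect n k s :=
  le_min zero_le_one (div_nonneg (abs_nonneg _) (gap_pos n).le)

theorem defect_le_one (n k : ℕ) (s : ℝ) : defect n k s ≤ 1 := min_le_left _ _

theorem abs_cmp_max_mul_min {δ u v : ℝ} (hδ : 0 < δ) (h : |u - v| ≤ δ) :
    Cmp 2 |u| (max (3 * δ / 2) |v| * min 1 (|u| / δ)) := by
  have h1 : |u| ≤ |v| + δ := by
    have := abs_sub_abs_le_abs_sub u v; linarith
  have h2 : |v| ≤ |u| + δ := by
    have := abs_sub_abs_le_abs_sub v u; rw [abs_sub_comm] at this; linarith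
  have h0 := abs_nonneg u
  have m0 : 0 ≤ min 1 (|u| / δ) := le_min zero_le_one (by positivity)
  have hM : 0 < max (3 * δ / 2) |v| := lt_max_of_lt_left (by positivity)
  have M1 := le_max_left (3 * δ / 2) |v|
  have M2 := le_max_right (3 * δ / 2) |v|
  rcases le_total δ |u| with hu | hu
  · rw [min_eq_left (by rwa [le_div_iff₀ hδ, one_mul]), mul_one]
    exact ⟨h0, hM.le, two_pos, by linarith, max_le (by linarith) (by linarith)⟩
  · rw [min_eq_right (by rwa [div_le_one hδ])]
    have M3 : max (3 * δ / 2) |v| ≤ 2 * δ := max_le (by linarith) (by linarith)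
    have e : |u| / δ * δ = |u| := by field_simp
    have p : 0 ≤ |u| / δ := by positivity
    refine ⟨h0, by positivity, two_pos, ?_, ?_⟩ <;> nlinarith

theorem add_cmp_max {δ θ u t : ℝ} (hδ : 0 < δ) (hθ : 3 * δ / 2 ≤ θ) (h : |u - θ| ≤ δ)
    (ht : 0 ≤ t) : Cmp 3 (u + t) (max (3 * δ / 2) (θ + t)) := by
  rw [abs_le] at h
  have M2 := le_max_right (3 * δ / 2) (θ + t)
  refine ⟨by linarith, by linarith, three_pos, by linarith, max_le (by linarith) (by linarith)⟩

theorem ker_adjusted_cmp : ∃ C, 1 ≤ C ∧ ∀ (n : ℕ) (t t' : ℝ), Twin t t' → ∀ k ∈ posIndices n,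
    Cmp C (ker t (adjustedAngleUpper n k))
      (Real.exp (cellAverage n t k) * (defect n k t * defect n k t')) := by
  obtain ⟨C1, h1⟩ := ker_cmp
  obtain ⟨C2, h2⟩ := exp_cellAverage_cmp
  obtain ⟨D, hD⟩ : ∃ D, D = C1 * (2 * 2 * 3 ^ 2) * (C2 * 1) := ⟨_, rfl⟩
  refine ⟨max 1 D, le_max_left _ _, fun n t t' tw k hk => Cmp.mono (C := D) ?_ (le_max_right _ _)⟩
  obtain ⟨k1, k2⟩ := mem_posIndices.1 hk
  have hg := gap_pos n
  have a1 := h1 t t' tw _ (sideAngle_mem' hk)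
  rw [ker_congr (radius_sideAngle k1)] at a1
  have hs := abs_sideAngle_sub k1
  have b1 := abs_cmp_max_mul_min (u := sideAngle n k - t) (v := fejerAngleUpper n k - t) hg
    (by convert hs using 2; ring)
  have b2 := abs_cmp_max_mul_min (u := sideAngle n k - t') (v := fejerAngleUpper n k - t') hg
    (by convert hs using 2; ring)
  have b3 := add_cmp_max hg (half_gap_le_of_pos k2) hs tw.1.1
  have c := ((b1.mul b2).mul (b3.pow 2))
  have d := (h2 n t t' tw k hk).symm.mul (Cmp.refl (mul_nonneg (defect_nonneg n k t)
    (defect_nonneg n k t')))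
  rw [hD]
  refine ((a1.trans c).trans (d.congr ?_ rfl))
  unfold cellModel defect
  ring

open Classical in
theorem card_not_far_le (n : ℕ) (t t' : ℝ) :
    ((posIndices n).filter fun k => ¬ Far (gap n) t t' (fejerAngleUpper n k)).card ≤ 32 := by
  have hg := gap_pos n
  have one : ∀ a : ℝ, ((posIndices n).filter fun k =>
      |fejerAngleUpper n k - a| < (4 : ℕ) * gap n).card ≤ 8 := fun a =>
    card_near_le (S := posIndices n) (a := fejerAngleUpper n) (t := a) hg
      (fun j _ k _ hjk => by linarith [three_gap_le_abs_sub (n := n) hjk]) 4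
  have sub : ((posIndices n).filter fun k => ¬ Far (gap n) t t' (fejerAngleUpper n k)) ⊆
      (((posIndices n).filter fun k => |fejerAngleUpper n k - t| < (4 : ℕ) * gap n) ∪
      ((posIndices n).filter fun k => |fejerAngleUpper n k - t'| < (4 : ℕ) * gap n)) ∪
      (((posIndices n).filter fun k => |fejerAngleUpper n k - 0| < (4 : ℕ) * gap n) ∪
      ((posIndices n).filter fun k => |fejerAngleUpper n k - π| < (4 : ℕ) * gap n)) := by
    intro k hk
    simp only [Finset.mem_union, Finset.mem_filter] at hk ⊢
    obtain ⟨h1, h2⟩ := hk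
    by_contra h
    push Not at h
    apply h2
    have a1 := h.1.1 h1
    have a2 := h.1.2 h1
    have a3 := h.2.1 h1
    have a4 := h.2.2 h1
    push_cast at a1 a2 a3 a4
    exact ⟨a1, a2, a3, a4⟩
  refine (Finset.card_le_card sub).trans ((Finset.card_union_le _ _).trans ?_)
  have u1 := Finset.card_union_le
    ((posIndices n).filter fun k => |fejerAngleUpper n k - t| < (4 : ℕ) * gap n)
    ((posIndices n).filter fun k => |fejerAngleUpper n k - t'| < (4 : ℕ) * gap n)
  have u2 := Finset.card_union_le
    ((posIndices n).filter fun k => |fejerAngleUpper n k - 0| < (4 : ℕ) * gap n)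
    ((posIndices n).filter fun k => |fejerAngleUpper n k - π| < (4 : ℕ) * gap n)
  have := one t
  have := one t'
  have := one 0
  have := one π
  omega

theorem Far.defect_eq_one {n k : ℕ} (hk : k ≤ n / 2) {t t' : ℝ}
    (h : Far (gap n) t t' (fejerAngleUpper n k)) : defect n k t = 1 ∧ defect n k t' = 1 := by
  have hg := gap_pos n
  have hs := abs_sideAngle_sub hk
  have key : ∀ a, 4 * gap n ≤ |fejerAngleUpper n k - a| → defect n k a = 1 := by
    intro a ha
    refine min_eq_left ?_
    rw [le_div_iff₀ hg, one_mul]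
    have := abs_sub_le (fejerAngleUpper n k) (sideAngle n k) a
    rw [abs_sub_comm (fejerAngleUpper n k) (sideAngle n k)] at this
    linarith
  exact ⟨key t h.1, key t' h.2⟩

theorem prod_ker_cmp : ∃ C, ∀ (n : ℕ) (t t' : ℝ), Twin t t' → ∀ j : ℕ,
    Cmp C (∏ k ∈ (posIndices n).erase j, ker t (adjustedAngleUpper n k))
      (∏ k ∈ (posIndices n).erase j,
        (Real.exp (cellAverage n t k) * (defect n k t * defect n k t'))) := by
  classical
  obtain ⟨C1, p1, h1⟩ := ker_adjusted_cmp
  obtain ⟨C2, p2, h2⟩ := abs_sum_log_ker_sub_le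
  refine ⟨C1 ^ 66 * Real.exp C2, fun n t t' tw j => ?_⟩
  obtain ⟨B, hB⟩ : ∃ B : Finset ℕ, B = insert j ((posIndices n).filter fun k =>
    ¬ Far (gap n) t t' (fejerAngleUpper n k)) := ⟨_, rfl⟩
  have hBc : B.card ≤ 33 := by
    rw [hB]; exact (Finset.card_insert_le _ _).trans (by
      have := card_not_far_le n t t'
      omega)
  obtain ⟨S, hS⟩ : ∃ S : Finset ℕ, S = (posIndices n).filter fun k =>
    k ∉ B ∧ partner n k ∉ B := ⟨_, rfl⟩
  have hSU : S ⊆ posIndices n := hS ▸ Finset.filter_subset _ _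
  have hSj : S ⊆ (posIndices n).erase j := by
    intro k hk
    refine Finset.mem_erase.2 ⟨?_, hSU hk⟩
    rintro rfl
    rw [hS, Finset.mem_filter, hB] at hk
    exact hk.2.1 (Finset.mem_insert_self _ _)
  have hfar : ∀ k ∈ S, Far (gap n) t t' (fejerAngleUpper n k) := by
    intro k hk
    have hU := hSU hk
    rw [hS, Finset.mem_filter, hB] at hk
    by_contra hf
    exact hk.2.1 (Finset.mem_insert_of_mem (Finset.mem_filter.2 ⟨hU, hf⟩))
  have hpar : ∀ k ∈ S, partner n k ∈ S := by
    intro k hk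
    have hU := hSU hk
    rw [hS, Finset.mem_filter] at hk ⊢
    rw [partner_partner (mem_posIndices.1 hU).1]
    exact ⟨partner_mem hU, hk.2.2, hk.2.1⟩
  have hcard : ((posIndices n).erase j \ S).card ≤ 66 := by
    have sub : (posIndices n).erase j \ S ⊆ B ∪ B.image (partner n) := by
      intro k hk
      rw [Finset.mem_sdiff, Finset.mem_erase, hS, Finset.mem_filter] at hk
      by_contra h
      rw [Finset.mem_union, not_or, Finset.mem_image] at h
      refine hk.2 ⟨hk.1.2, h.1, fun hb => h.2 ⟨_, hb, partner_partner (mem_posIndices.1 hk.1.2).1⟩⟩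
    have := Finset.card_le_card sub
    have := Finset.card_union_le B (B.image (partner n))
    have := Finset.card_image_le (s := B) (f := partner n)
    omega
  rw [← Finset.prod_sdiff hSj, ← Finset.prod_sdiff (f := fun k =>
    Real.exp (cellAverage n t k) * (defect n k t * defect n k t')) hSj]
  refine Cmp.mul ?_ ?_
  · refine (Cmp.prod fun k hk => h1 n t t' tw k ?_).mono (pow_le_pow_right₀ p1 hcard)
    exact Finset.mem_of_mem_erase (Finset.mem_sdiff.1 hk).1
  · have hd : ∀ k ∈ S, Real.exp (cellAverage n t k) * (defect n k t * defect n k t') =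
        Real.exp (cellAverage n t k) := by
      intro k hk
      obtain ⟨e1, e2⟩ := (hfar k hk).defect_eq_one (mem_posIndices.1 (hSU hk)).1
      rw [e1, e2]; ring
    have hpos : ∀ k ∈ S, 0 < ker t (adjustedAngleUpper n k) := by
      intro k hk
      have := h1 n t t' tw k (hSU hk)
      rw [hd k hk] at this
      exact this.pos_iff.2 (Real.exp_pos _)
    rw [Finset.prod_congr rfl hd, ← Real.exp_sum]
    have e : ∏ k ∈ S, ker t (adjustedAngleUpper n k) =
        Real.exp (∑ k ∈ S, Real.log (ker t (adjustedAngleUpper n k))) := by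
      rw [Real.exp_sum]
      exact Finset.prod_congr rfl fun k hk => (Real.exp_log (hpos k hk)).symm
    rw [e]
    apply Cmp.exp
    rw [← Finset.sum_sub_distrib]
    exact h2 n t t' tw S hSU hfar hpar

/-! ### The sum of the cell averages -/

/-- The contribution of the interval next to the corner which belongs to no cell. -/
noncomputable def cornerAverage (n : ℕ) (t : ℝ) : ℝ :=
  if Even n then 1 / (2 * (3 * gap n / 2)) * ∫ s in 0..(3 * gap n / 2), Real.log (ker t s) else 0

theorem sum_cellAverage_range {n : ℕ} {t t' : ℝ} (tw : Twin t t') {a : ℕ → ℝ} {m l : ℕ}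
    (ha : ∀ k ≤ m, a k ∈ Icc 0 π) (h1 : ∀ k < m, fejerAngleUpper n (l + k) - 3 * gap n / 2 = a k)
    (h2 : ∀ k < m, fejerAngleUpper n (l + k) + 3 * gap n / 2 = a (k + 1)) :
    ∑ k ∈ Finset.range m, cellAverage n t (l + k) =
      1 / (2 * (3 * gap n / 2)) * ∫ s in (a 0)..(a m), Real.log (ker t s) := by
  rw [← intervalIntegral.sum_integral_adjacent_intervals (a := a) fun k hk =>
    intervalIntegrable_log_ker_of_mem tw (ha k hk.le) (ha (k + 1) hk), Finset.mul_sum]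
  refine Finset.sum_congr rfl fun k hk => ?_
  rw [Finset.mem_range] at hk
  rw [cellAverage, h1 k hk, h2 k hk]

theorem exists_sum_cellAverage : ∃ κ : ℕ → ℝ, ∀ (n : ℕ) (t t' : ℝ), Twin t t' →
    ∑ k ∈ posIndices n, cellAverage n t k = κ n - cornerAverage n t := by
  refine ⟨fun n => 1 / (2 * (3 * gap n / 2)) * (-(π * Real.log 2)), fun n t t' tw => ?_⟩
  have hg := gap_pos n
  have hpi := Real.pi_pos
  have hlast := fejerAngleUpper_last n
  obtain ⟨ε, hε, he⟩ := exists_fejerAngleUpper_eq n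
  rcases hε with ⟨hn, rfl⟩ | ⟨hn, rfl⟩
  · have e : 3 * gap n * ((n / 2 : ℕ) : ℝ) + 3 * gap n / 2 = π := by
      rw [he] at hlast; linarith
    have hu : posIndices n = Finset.Ico 1 (n / 2 + 1) := by
      rw [posIndices_of_even hn]; ext k; simp only [Finset.mem_Icc, Finset.mem_Ico]; omega
    have := sum_cellAverage_range tw (n := n) (a := fun k => 3 * gap n * k + 3 * gap n / 2)
      (m := n / 2) (l := 1) (fun k hk => ⟨by positivity, by
        have : (k : ℝ) ≤ (n / 2 : ℕ) := by exact_mod_cast hk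
        nlinarith⟩)
      (fun k _ => by rw [he]; push_cast; ring) (fun k _ => by rw [he]; push_cast; ring)
    rw [hu, Finset.sum_Ico_eq_sum_range, Nat.add_sub_cancel, this, cornerAverage, if_pos hn,
      ← mul_sub, ← integral_log_ker tw, e, Nat.cast_zero, mul_zero, zero_add]
    congr 1
    rw [eq_sub_iff_add_eq, add_comm]
    refine intervalIntegral.integral_add_adjacent_intervals ?_ ?_
    · exact intervalIntegrable_log_ker_of_mem tw ⟨le_rfl, hpi.le⟩
        ⟨by positivity, by rw [← e]; linarith [mul_nonneg hg.le (n / 2 : ℕ).cast_nonneg (α := ℝ)]⟩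
    · exact intervalIntegrable_log_ker_of_mem tw
        ⟨by positivity, by rw [← e]; linarith [mul_nonneg hg.le (n / 2 : ℕ).cast_nonneg (α := ℝ)]⟩
        ⟨hpi.le, le_rfl⟩
  · have e : 3 * gap n * ((n / 2 + 1 : ℕ) : ℝ) = π := by
      rw [he] at hlast; push_cast; linarith
    have := sum_cellAverage_range tw (n := n) (a := fun k => 3 * gap n * k)
      (m := n / 2 + 1) (l := 0) (fun k hk => ⟨by positivity, by
        have : (k : ℝ) ≤ (n / 2 + 1 : ℕ) := by exact_mod_cast hk
        nlinarith⟩)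
      (fun k _ => by rw [he]; push_cast; ring) (fun k _ => by rw [he]; push_cast; ring)
    simp only [zero_add] at this
    rw [posIndices_of_odd hn, this, cornerAverage, if_neg hn, sub_zero, e, Nat.cast_zero, mul_zero,
      integral_log_ker tw]

theorem exp_cornerAverage_cmp : ∃ C, ∀ (n : ℕ), Even n → ∀ t t' : ℝ, Twin t t' →
    Cmp C (Real.exp (cornerAverage n t) ^ 2) ((t + gap n) ^ 3) := by
  obtain ⟨C, -, hC⟩ := abs_average_log_ker_le
  have hpi := Real.pi_pos
  refine ⟨Real.exp C * (8 * (π + 1 / (π / 12)) * 2 ^ 2), fun n hn t t' tw => ?_⟩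
  have hg := gap_pos n
  have hg2 : 3 * gap n ≤ 2 * π := by
    have := gap_mul n
    nlinarith [mul_nonneg hg.le (n.cast_nonneg (α := ℝ))]
  obtain ⟨h, hh⟩ : ∃ h, h = 3 * gap n / 4 := ⟨_, rfl⟩
  have h0 : 0 < h := by rw [hh]; positivity
  have ht := tw.1.1
  have key := hC t t' tw h h h0 (by linarith) (by rw [hh]; linarith)
  have e1 : Real.exp (cornerAverage n t) ^ 2 =
      Real.exp (1 / (2 * h) * ∫ s in (h - h)..(h + h), Real.log (ker t s)) := by
    rw [← Real.exp_nat_mul, cornerAverage, if_pos hn, sub_self,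
      show h + h = 3 * gap n / 2 by rw [hh]; ring, hh]
    congr 1; push_cast; field_simp
    norm_num
    ring
  have h' : ∀ u, 0 < max h u := fun u => lt_max_of_lt_left h0
  have k2 := Cmp.exp key
  rw [← e1, exp_log_add_log_add (h' _) (h' _) (h' _)] at k2
  refine k2.trans ?_
  have c1 : Cmp 8 (max h |h - t|) (t + gap n) := by
    refine ⟨(h' _).le, by linarith, by norm_num, max_le (by linarith) ?_, ?_⟩
    · exact abs_le.2 ⟨by linarith, by linarith⟩
    · have m1 := le_max_left h |h - t|
      have m2 := (neg_le_abs (h - t)).trans (le_max_right h |h - t|)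
      linarith
  have c2 : Cmp (π + 1 / (π / 12)) (max h |h - t'|) 1 := by
    refine cmp_of_mem_Icc (by positivity) ⟨?_, max_le (by linarith) ?_⟩
    · rcases le_total h (π / 2) with h3 | h3
      · exact le_max_of_le_right (by
          rw [abs_sub_comm]
          exact le_trans (by linarith [tw.2.1]) (le_abs_self _))
      · exact le_max_of_le_left (by linarith)
    · exact abs_le.2 ⟨by linarith [tw.2.2], by linarith [tw.2.1]⟩
  have c3 : Cmp 2 (max h (h + t)) (t + gap n) := by
    rw [max_eq_right (by linarith)]
    exact ⟨by linarith, by linarith, two_pos, by linarith, by linarith⟩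
  exact ((c1.mul c2).mul (c3.pow 2)).congr rfl (by ring)

/-! ### The Lebesgue constant and the Lebesgue function -/

theorem norm_eval_basis {n : ℕ} (v : Fin (n + 1) → ℂ) (j : Fin (n + 1)) (x : ℂ) :
    ‖(Lagrange.basis Finset.univ v j).eval x‖ =
      ∏ i, if i = j then 1 else ‖x - v i‖ / ‖v j - v i‖ := by
  classical
  rw [Lagrange.basis, Polynomial.eval_prod, norm_prod,
    ← Finset.mul_prod_erase Finset.univ _ (Finset.mem_univ j), if_pos rfl, one_mul]
  refine Finset.prod_congr rfl fun i hi => ?_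
  rw [if_neg (Finset.ne_of_mem_erase hi), Lagrange.basisDivisor]
  simp only [Polynomial.eval_mul, Polynomial.eval_C, Polynomial.eval_sub, Polynomial.eval_X,
    norm_mul, norm_inv]
  rw [div_eq_inv_mul]

theorem lagrangeOperator_apply_eq_sum {X : Set ℂ} [CompactSpace X] {n : ℕ} (z : Fin (n + 1) → X)
    (f : C(X, ℂ)) (x : X) : lagrangeOperator z f x =
      ∑ j, f (z j) * (Lagrange.basis Finset.univ (fun i => (z i : ℂ)) j).eval (x : ℂ) := by
  rw [lagrangeOperator_apply, Lagrange.interpolate_apply, Polynomial.eval_finsetSum]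
  simp

theorem lebesgueConstant_le {X : Set ℂ} [CompactSpace X] {n : ℕ} (z : Fin (n + 1) → X) {M : ℝ}
    (hM : 0 ≤ M)
    (h : ∀ x : X, ∑ j, ‖(Lagrange.basis Finset.univ (fun i => (z i : ℂ)) j).eval (x : ℂ)‖ ≤ M) :
    lebesgueConstant z ≤ M := by
  refine ContinuousLinearMap.opNorm_le_bound _ hM fun f => ?_
  rw [ContinuousMap.norm_le _ (by positivity)]
  intro x
  rw [lagrangeOperator_apply_eq_sum]
  refine (norm_sum_le _ _).trans ?_
  calc _ ≤ ∑ j, ‖f‖ * ‖(Lagrange.basis Finset.univ (fun i => (z i : ℂ)) j).eval (x : ℂ)‖ := by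
        refine Finset.sum_le_sum fun j _ => ?_
        rw [norm_mul]
        exact mul_le_mul_of_nonneg_right (f.norm_coe_le_norm _) (norm_nonneg _)
    _ ≤ ‖f‖ * M := by rw [← Finset.mul_sum]; exact mul_le_mul_of_nonneg_left (h x) (norm_nonneg _)
    _ = _ := mul_comm _ _

theorem le_two_mul_lebesgueConstant {X : Set ℂ} [CompactSpace X] {n : ℕ} {z : Fin (n + 1) → X}
    (hz : Function.Injective z) (x : X) :
    ∑ j, ‖(Lagrange.basis Finset.univ (fun i => (z i : ℂ)) j).eval (x : ℂ)‖ ≤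
      2 * lebesgueConstant z := by
  obtain ⟨l, hl⟩ : ∃ l : Fin (n + 1) → ℂ, l = fun j =>
    (Lagrange.basis Finset.univ (fun i => (z i : ℂ)) j).eval (x : ℂ) := ⟨_, rfl⟩
  have hc : Topology.IsClosedEmbedding z :=
    Topology.IsClosedEmbedding.of_continuous_injective_isClosedMap continuous_of_discreteTopology hz
      (fun s _ => ((Set.toFinite s).image z).isClosed)
  have ext : ∀ c : Fin (n + 1) → ℝ, (∀ j, |c j| ≤ 1) →
      ∃ g : C(X, ℝ), (∀ y, |g y| ≤ 1) ∧ ∀ j, g (z j) = c j := by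
    intro c hcb
    obtain ⟨g, hg1, hg2⟩ := ContinuousMap.exists_extension_forall_mem_of_isClosedEmbedding
      (⟨c, continuous_of_discreteTopology⟩ : C(Fin (n + 1), ℝ)) (t := Icc (-1) 1)
      (fun j => abs_le.1 (hcb j)) ⟨0, by norm_num, by norm_num⟩ hc
    exact ⟨g, fun y => abs_le.2 (hg1 y), fun j => congrFun hg2 j⟩
  obtain ⟨s, hs⟩ : ∃ s : Fin (n + 1) → ℂ, s = fun j => starRingEnd ℂ (l j) / ‖l j‖ := ⟨_, rfl⟩
  have hs1 : ∀ j, ‖s j‖ ≤ 1 := by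
    intro j
    rw [hs]; simp only
    rw [norm_div, RCLike.norm_conj, Complex.norm_real, norm_norm]
    exact div_self_le_one _
  obtain ⟨g1, b1, e1⟩ := ext (fun j => (s j).re) fun j => (Complex.abs_re_le_norm _).trans (hs1 j)
  obtain ⟨g2, b2, e2⟩ := ext (fun j => (s j).im) fun j => (Complex.abs_im_le_norm _).trans (hs1 j)
  obtain ⟨f, hf⟩ : ∃ f : C(X, ℂ), ∀ y, f y = g1 y + g2 y * Complex.I :=
    ⟨⟨fun y => g1 y + g2 y * Complex.I, by fun_prop⟩, fun y => rfl⟩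
  have hfn : ‖f‖ ≤ 2 := by
    rw [ContinuousMap.norm_le _ two_pos.le]
    intro y
    rw [hf]
    refine (norm_add_le _ _).trans ?_
    rw [norm_mul, Complex.norm_I, mul_one, Complex.norm_real, Complex.norm_real,
      Real.norm_eq_abs, Real.norm_eq_abs]
    linarith [b1 y, b2 y]
  have hfz : ∀ j, f (z j) = s j := fun j => by rw [hf, e1, e2, Complex.re_add_im]
  have key : lagrangeOperator z f x = ((∑ j, ‖l j‖ : ℝ) : ℂ) := by
    rw [lagrangeOperator_apply_eq_sum, Complex.ofReal_sum]
    refine Finset.sum_congr rfl fun j _ => ?_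
    have e : (Lagrange.basis Finset.univ (fun i => (z i : ℂ)) j).eval (x : ℂ) = l j := by rw [hl]
    rw [hfz, e, hs]; simp only
    rcases eq_or_ne (l j) 0 with h0 | h0
    · simp [h0]
    · have : (‖l j‖ : ℂ) ≠ 0 := by exact_mod_cast (norm_pos_iff.2 h0).ne'
      rw [div_mul_eq_mul_div, div_eq_iff this, Complex.conj_mul']; ring
  have h1 : ∑ j, ‖l j‖ ≤ ‖lagrangeOperator z f‖ := by
    have := (lagrangeOperator z f).norm_coe_le_norm x
    rw [key, Complex.norm_real, Real.norm_of_nonneg (Finset.sum_nonneg fun _ _ => norm_nonneg _)]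
      at this
    exact this
  have h2 := (lagrangeOperator z).le_opNorm f
  rw [hl] at h1
  calc _ ≤ _ := h1
    _ ≤ _ := h2
    _ ≤ ‖lagrangeOperator z‖ * 2 := by gcongr
    _ = _ := by rw [lebesgueConstant]; ring

theorem half_le_lebesgueConstant {X : Set ℂ} [CompactSpace X] {n : ℕ} {z : Fin (n + 1) → X}
    (hz : Function.Injective z) : 1 / 2 ≤ lebesgueConstant z := by
  have h := le_two_mul_lebesgueConstant hz (z 0)
  have e : (Lagrange.basis Finset.univ (fun i => (z i : ℂ)) 0).eval ((z 0 : X) : ℂ) = 1 :=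
    Lagrange.eval_basis_self (v := fun i => (z i : ℂ))
      (fun i _ j _ hij => hz (Subtype.ext hij)) (Finset.mem_univ 0)
  have h1 := Finset.single_le_sum (f := fun j =>
    ‖(Lagrange.basis Finset.univ (fun i => (z i : ℂ)) j).eval ((z 0 : X) : ℂ)‖)
    (fun j _ => norm_nonneg _) (Finset.mem_univ 0)
  simp only [e, norm_one] at h1
  linarith

/-! ### The nodes -/

theorem adjusted_mem_of_le {n k : ℕ} (hk : k ≤ n / 2) :
    adjustedAngleUpper n k ∈ Icc 0 (2 * π / 3) := by
  by_cases h : k ∈ posIndices n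
  · exact adjusted_mem' h
  · have h0 : fejerAngleUpper n k = 0 :=
      le_antisymm (not_lt.1 fun h' => h (mem_posIndices.2 ⟨hk, h'⟩)) (fejerAngleUpper_nonneg n k)
    rw [adjusted_of_inner hk (by rw [h0]; positivity) fun m hm => hm.left_pos.ne' h0, h0]
    exact ⟨le_rfl, by positivity⟩

/-- The adjusted Fejér points as a sequence of complex numbers. -/
noncomputable def node (n i : ℕ) : ℂ := psi (Complex.exp (adjustedAngle n i * Complex.I))

theorem coe_adjustedFejerPoint (n : ℕ) (i : Fin (n + 1)) :
    (adjustedFejerPoint n i : ℂ) = node n i := rfl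

theorem node_upper {n i : ℕ} (h : i ≤ n / 2) :
    node n i = (-1 + Complex.I) * radius (adjustedAngleUpper n i) := by
  have := adjusted_mem_of_le h
  rw [node, adjustedAngle, if_pos h,
    psi_exp_of_nonneg this.1 (by linarith [this.2, Real.pi_pos])]

/-- The index of the complex conjugate node. -/
def reflect (n k : ℕ) : ℕ := 2 * (n / 2) + 1 - k

theorem reflect_mem {n i : ℕ} (h1 : n / 2 < i) (h2 : i ≤ n) : reflect n i ∈ posIndices n := by
  unfold reflect
  by_cases h : Even n
  · rw [posIndices_of_even h, Finset.mem_Icc]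
    obtain ⟨m, rfl⟩ := h
    omega
  · rw [posIndices_of_odd h, Finset.mem_range]
    have := Nat.div_two_mul_two_add_one_of_odd (Nat.not_even_iff_odd.1 h)
    omega

theorem lt_reflect {n k : ℕ} (h : k ∈ posIndices n) : n / 2 < reflect n k ∧ reflect n k ≤ n := by
  have h1 := (mem_posIndices.1 h).1
  unfold reflect
  by_cases he : Even n
  · rw [posIndices_of_even he, Finset.mem_Icc] at h
    obtain ⟨m, rfl⟩ := he
    omega
  · have := Nat.div_two_mul_two_add_one_of_odd (Nat.not_even_iff_odd.1 he)
    omega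

theorem reflect_reflect {n k : ℕ} (h : k ≤ n) : reflect n (reflect n k) = k := by
  unfold reflect; omega

theorem node_lower {n i : ℕ} (h : n / 2 < i) (hi : i ≤ n) :
    node n i = (-1 - Complex.I) * radius (adjustedAngleUpper n (reflect n i)) := by
  have := adjusted_mem' (reflect_mem h hi)
  rw [node, adjustedAngle, if_neg (not_le.2 h)]
  exact psi_exp_neg (t := adjustedAngleUpper n (reflect n i)) this.1
    (by linarith [this.2, Real.pi_pos])

theorem radius_adjusted_pos {n k : ℕ} (h : k ∈ posIndices n) :
    0 < radius (adjustedAngleUpper n k) := by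
  have := adjusted_mem h
  exact radius_pos ⟨by linarith [this.1, gap_pos n], by linarith [this.2, Real.pi_pos]⟩

theorem radius_adjusted_injective {n j k : ℕ} (hj : j ≤ n / 2) (hk : k ≤ n / 2)
    (h : radius (adjustedAngleUpper n j) = radius (adjustedAngleUpper n k)) : j = k := by
  by_contra hne
  have h1 := gap_le_adjusted_sub hj hk hne
  rw [strictMonoOn_radius.injOn (adjusted_mem_of_le hj) (adjusted_mem_of_le hk) h, sub_self,
    abs_zero] at h1
  linarith [gap_pos n]

theorem upper_eq_lower {a b : ℝ} (ha : 0 ≤ a)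
    (h : (-1 + Complex.I) * (a : ℂ) = (-1 - Complex.I) * (b : ℂ)) (hb : 0 ≤ b) : b = 0 := by
  have := congrArg Complex.im h
  simp at this
  linarith

theorem injective_adjustedFejerPoint (n : ℕ) : Function.Injective (adjustedFejerPoint n) := by
  intro i j hij
  have h := congrArg (Subtype.val) hij
  rw [coe_adjustedFejerPoint, coe_adjustedFejerPoint] at h
  have c1 : (-1 + Complex.I : ℂ) ≠ 0 := by
    intro h; have := congrArg Complex.im h; simp at this
  have c2 : (-1 - Complex.I : ℂ) ≠ 0 := by
    intro h; have := congrArg Complex.im h; simp at this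
  have hi := i.2
  have hj := j.2
  rcases le_or_gt (i : ℕ) (n / 2) with h1 | h1 <;> rcases le_or_gt (j : ℕ) (n / 2) with h2 | h2
  · rw [node_upper h1, node_upper h2, mul_right_inj' c1] at h
    exact Fin.ext (radius_adjusted_injective h1 h2 (by exact_mod_cast h))
  · rw [node_upper h1, node_lower h2 (by omega)] at h
    have hp := radius_adjusted_pos (reflect_mem h2 (by omega))
    have := upper_eq_lower (radius_nonneg_of_mem
      (Icc_subset_Icc_right (by linarith [Real.pi_pos]) (adjusted_mem_of_le h1))) h hp.le
    exact absurd this hp.ne'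
  · rw [node_lower h1 (by omega), node_upper h2] at h
    have hp := radius_adjusted_pos (reflect_mem h1 (by omega))
    have := upper_eq_lower (radius_nonneg_of_mem
      (Icc_subset_Icc_right (by linarith [Real.pi_pos]) (adjusted_mem_of_le h2))) h.symm hp.le
    exact absurd this hp.ne'
  · rw [node_lower h1 (by omega), node_lower h2 (by omega), mul_right_inj' c2] at h
    have m1 := (mem_posIndices.1 (reflect_mem h1 (by omega))).1
    have m2 := (mem_posIndices.1 (reflect_mem h2 (by omega))).1
    have := congrArg (reflect n) (radius_adjusted_injective m1 m2 (by exact_mod_cast h))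
    rw [reflect_reflect (by omega), reflect_reflect (by omega)] at this
    exact Fin.ext this

theorem range_succ_eq (n : ℕ) : Finset.range (n + 1) =
    ((if Even n then {0} else ∅) ∪ posIndices n) ∪ (posIndices n).image (reflect n) := by
  ext i
  simp only [Finset.mem_range, Finset.mem_union, Finset.mem_image]
  constructor
  · intro hi
    rcases le_or_gt i (n / 2) with h | h
    · left
      by_cases he : Even n
      · rw [posIndices_of_even he, Finset.mem_Icc, if_pos he, Finset.mem_singleton]; omega
      · rw [posIndices_of_odd he, Finset.mem_range]; right; omega
    · exact Or.inr ⟨_, reflect_mem h (by omega), reflect_reflect (by omega)⟩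
  · rintro ((h | h) | ⟨k, hk, rfl⟩)
    · by_cases he : Even n
      · rw [if_pos he, Finset.mem_singleton] at h; omega
      · rw [if_neg he] at h; simp at h
    · have := (mem_posIndices.1 h).1; omega
    · have := (lt_reflect hk).2; omega

theorem notMem_posIndices_zero {n : ℕ} (h : Even n) : 0 ∉ posIndices n := by
  rw [posIndices_of_even h]; simp

section

variable {M : Type*} [CommMonoid M]

@[to_additive]
theorem prod_range_succ_eq (n : ℕ) (g : ℕ → M) : ∏ i ∈ Finset.range (n + 1), g i =
    (if Even n then g 0 else 1) * ∏ k ∈ posIndices n, (g k * g (reflect n k)) := by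
  have d1 : Disjoint (if Even n then {0} else ∅ : Finset ℕ) (posIndices n) := by
    split_ifs with h
    · rw [Finset.disjoint_singleton_left]; exact notMem_posIndices_zero h
    · exact Finset.disjoint_empty_left _
  have d2 : Disjoint ((if Even n then {0} else ∅ : Finset ℕ) ∪ posIndices n)
      ((posIndices n).image (reflect n)) := by
    rw [Finset.disjoint_right]
    intro i hi
    obtain ⟨k, hk, rfl⟩ := Finset.mem_image.1 hi
    have := (lt_reflect hk).1
    rw [Finset.mem_union, not_or]
    refine ⟨?_, fun h => by have := (mem_posIndices.1 h).1; omega⟩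
    split_ifs
    · rw [Finset.mem_singleton]; omega
    · simp
  rw [range_succ_eq, Finset.prod_union d2, Finset.prod_union d1, Finset.prod_image, mul_assoc,
    ← Finset.prod_mul_distrib]
  · congr 1
    split_ifs <;> simp
  · intro a ha b hb hab
    have h1 := (mem_posIndices.1 ha).1
    have h2 := (mem_posIndices.1 hb).1
    rw [← reflect_reflect (n := n) (k := a) (by omega), hab, reflect_reflect (by omega)]

end

/-- `x` is one of the two points of the arc at the distance from the corner given by `t`. -/
def OnArms (x : ℂ) (t : ℝ) : Prop :=
  x = (-1 + Complex.I) * (radius t : ℂ) ∨ x = (-1 - Complex.I) * (radius t : ℂ)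

theorem radius_tip : radius (2 * π / 3) = (27 : ℝ) ^ (1 / 4 : ℝ) / √2 := by
  have hpi := Real.pi_pos
  refine (pow_left_inj₀ (radius_nonneg (by linarith) (by linarith)) (by positivity)
    (by norm_num : 4 ≠ 0)).1 ?_
  rw [radius_pow_four (by linarith) (by linarith), arc_length_pow_four, cos_tip]; norm_num

theorem exists_onArms {x : ℂ} (hx : x ∈ arc) : ∃ t ∈ Icc 0 (2 * π / 3), OnArms x t := by
  have hpi := Real.pi_pos
  have h00 : radius 0 = 0 := by simp [radius]
  have ivt := intermediate_value_Icc (by linarith : (0 : ℝ) ≤ 2 * π / 3)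
    (continuousOn_radius.mono (Icc_subset_Icc_right (by linarith)))
  rw [h00, radius_tip] at ivt
  rcases hx with ⟨r, hr, rfl⟩ | ⟨r, hr, rfl⟩
  · obtain ⟨t, ht, rfl⟩ := ivt hr
    exact ⟨t, ht, Or.inl rfl⟩
  · obtain ⟨t, ht, rfl⟩ := ivt hr
    exact ⟨t, ht, Or.inr rfl⟩

theorem norm_lower_sub_lower (r x : ℝ) :
    ‖(-1 - Complex.I) * (r : ℂ) - (-1 - Complex.I) * x‖ = √2 * |r - x| := by
  rw [← mul_sub, norm_mul, ← Complex.ofReal_sub, Complex.norm_real, Real.norm_eq_abs]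
  congr 1
  rw [Complex.norm_eq_sqrt_sq_add_sq]; norm_num

theorem node_reflect {n k : ℕ} (hk : k ∈ posIndices n) :
    node n (reflect n k) = (-1 - Complex.I) * radius (adjustedAngleUpper n k) := by
  have h := lt_reflect hk
  have h1 := (mem_posIndices.1 hk).1
  rw [node_lower h.1 h.2, reflect_reflect (by omega)]

theorem onArms_node {n k : ℕ} (hk : k ∈ posIndices n) :
    OnArms (node n k) (adjustedAngleUpper n k) := Or.inl (node_upper (mem_posIndices.1 hk).1)

theorem onArms_node_reflect {n k : ℕ} (hk : k ∈ posIndices n) :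
    OnArms (node n (reflect n k)) (adjustedAngleUpper n k) := Or.inr (node_reflect hk)

theorem OnArms.norm_mul_norm {x : ℂ} {t : ℝ} (hx : OnArms x t) {n k : ℕ} (hk : k ∈ posIndices n) :
    ‖x - node n k‖ * ‖x - node n (reflect n k)‖ = 2 * ker t (adjustedAngleUpper n k) := by
  have h2 := Real.mul_self_sqrt (two_pos.le : (0 : ℝ) ≤ 2)
  rw [node_upper (mem_posIndices.1 hk).1, node_reflect hk, ker]
  rcases hx with rfl | rfl
  · rw [norm_upper_sub_upper, norm_sub_rev, norm_lower_sub_upper, abs_sub_comm]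
    linear_combination (|radius (adjustedAngleUpper n k) - radius t| *
      √(radius (adjustedAngleUpper n k) ^ 2 + radius t ^ 2)) * h2
  · rw [norm_lower_sub_upper, norm_lower_sub_lower, abs_sub_comm, add_comm (radius t ^ 2)]
    linear_combination (|radius (adjustedAngleUpper n k) - radius t| *
      √(radius (adjustedAngleUpper n k) ^ 2 + radius t ^ 2)) * h2

theorem node_zero_of_even {n : ℕ} (h : Even n) : node n 0 = 0 := by
  rw [node_upper (Nat.zero_le _), adjusted_zero_of_even h]; simp [radius]

theorem OnArms.norm_eq {x : ℂ} {t : ℝ} (hx : OnArms x t) (ht : 0 ≤ radius t) :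
    ‖x‖ = √2 * radius t := by
  rcases hx with rfl | rfl
  · have := norm_upper_sub_upper (radius t) 0
    simpa [abs_of_nonneg ht] using this
  · have := norm_lower_sub_lower (radius t) 0
    simpa [abs_of_nonneg ht] using this

/-- The part of the Lagrange basis polynomials of a conjugate pair of nodes which both have in
common. -/
noncomputable def lagCore (n : ℕ) (t : ℝ) (j : ℕ) : ℝ :=
  (if Even n then radius t / radius (adjustedAngleUpper n j) else 1) *
    ∏ k ∈ (posIndices n).erase j,
      ker t (adjustedAngleUpper n k) / ker (adjustedAngleUpper n j) (adjustedAngleUpper n k)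

/-- The absolute value of the Lagrange basis polynomial of the corner node. -/
noncomputable def lagCorner (n : ℕ) (t : ℝ) : ℝ :=
  ∏ k ∈ posIndices n, ker t (adjustedAngleUpper n k) / ker 0 (adjustedAngleUpper n k)

/-- The absolute value of the Lagrange basis polynomial with index `i`. -/
noncomputable def lagNorm (n : ℕ) (x : ℂ) (i : ℕ) : ℝ :=
  ∏ l ∈ Finset.range (n + 1), if l = i then 1 else ‖x - node n l‖ / ‖node n i - node n l‖

theorem norm_eval_basis_adjusted (n : ℕ) (x : ℂ) (i : Fin (n + 1)) :
    ‖(Lagrange.basis Finset.univ (fun i => (adjustedFejerPoint n i : ℂ)) i).eval x‖ =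
      lagNorm n x i := by
  rw [norm_eval_basis, lagNorm, ← Fin.prod_univ_eq_prod_range]
  refine Finset.prod_congr rfl fun l _ => ?_
  simp only [coe_adjustedFejerPoint, Fin.ext_iff]

theorem lagNorm_nonneg (n : ℕ) (x : ℂ) (i : ℕ) : 0 ≤ lagNorm n x i :=
  Finset.prod_nonneg fun l _ => by split_ifs <;> positivity

theorem radius_nonneg_inner {t : ℝ} (ht : t ∈ Icc 0 (2 * π / 3)) : 0 ≤ radius t :=
  radius_nonneg_of_mem (Icc_subset_Icc_right (by linarith [Real.pi_pos]) ht)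

theorem lagNorm_eq_mul {n j i : ℕ} (hj : j ∈ posIndices n) (hi : i = j ∨ i = reflect n j)
    {x : ℂ} {t : ℝ} (ht : t ∈ Icc 0 (2 * π / 3)) (hx : OnArms x t) :
    lagNorm n x i = lagCore n t j *
      ((if j = i then 1 else ‖x - node n j‖ / ‖node n i - node n j‖) *
        (if reflect n j = i then 1 else
          ‖x - node n (reflect n j)‖ / ‖node n i - node n (reflect n j)‖)) := by
  have hw : OnArms (node n i) (adjustedAngleUpper n j) := by
    rcases hi with rfl | rfl
    · exact onArms_node hj
    · exact onArms_node_reflect hj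
  have hjn := (mem_posIndices.1 hj).1
  have hjr := lt_reflect hj
  have hr := radius_adjusted_pos hj
  rw [lagNorm, prod_range_succ_eq, ← Finset.mul_prod_erase _ _ hj, lagCore]
  have e0 : (if Even n then
      (if 0 = i then (1 : ℝ) else ‖x - node n 0‖ / ‖node n i - node n 0‖) else 1) =
      if Even n then radius t / radius (adjustedAngleUpper n j) else 1 := by
    split_ifs with he h0
    · exfalso
      have h1 := notMem_posIndices_zero he
      rcases hi with rfl | rfl
      · rw [← h0] at hj; exact h1 hj
      · omega
    · rw [node_zero_of_even he, sub_zero, sub_zero, hx.norm_eq (radius_nonneg_inner ht),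
        hw.norm_eq hr.le]
      field_simp
    · rfl
  rw [e0]
  have e1 : ∏ k ∈ (posIndices n).erase j,
      ((if k = i then 1 else ‖x - node n k‖ / ‖node n i - node n k‖) *
        (if reflect n k = i then 1 else
          ‖x - node n (reflect n k)‖ / ‖node n i - node n (reflect n k)‖)) =
      ∏ k ∈ (posIndices n).erase j,
      ker t (adjustedAngleUpper n k) / ker (adjustedAngleUpper n j) (adjustedAngleUpper n k) := by
    refine Finset.prod_congr rfl fun k hk => ?_
    obtain ⟨hne, hk⟩ := Finset.mem_erase.1 hk
    have hkn := (mem_posIndices.1 hk).1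
    have hkr := lt_reflect hk
    have n1 : k ≠ i := by rcases hi with rfl | rfl <;> omega
    have n2 : reflect n k ≠ i := by
      rcases hi with rfl | rfl
      · omega
      · intro h
        have := congrArg (reflect n) h
        rw [reflect_reflect (by omega), reflect_reflect (by omega)] at this
        exact hne this
    rw [if_neg n1, if_neg n2, div_mul_div_comm, hx.norm_mul_norm hk, hw.norm_mul_norm hk,
      mul_div_mul_left _ _ two_ne_zero]
  rw [e1]
  ring

theorem lagNorm_corner {n : ℕ} (hn : Even n) {x : ℂ} {t : ℝ} (hx : OnArms x t) :
    lagNorm n x 0 = lagCorner n t := by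
  rw [lagNorm, prod_range_succ_eq, if_pos hn, if_pos rfl, one_mul, lagCorner]
  refine Finset.prod_congr rfl fun k hk => ?_
  have hkr := lt_reflect hk
  have hw : OnArms (node n 0) 0 := Or.inl (by rw [node_zero_of_even hn]; simp [radius])
  have n1 : k ≠ 0 := by rintro rfl; exact notMem_posIndices_zero hn hk
  rw [if_neg n1, if_neg (by omega), div_mul_div_comm, hx.norm_mul_norm hk, hw.norm_mul_norm hk,
    mul_div_mul_left _ _ two_ne_zero]

theorem lagCore_nonneg {n j : ℕ} (hj : j ∈ posIndices n) {t : ℝ} (ht : t ∈ Icc 0 (2 * π / 3)) :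
    0 ≤ lagCore n t j := by
  have h1 := radius_nonneg_inner ht
  have h2 := (radius_adjusted_pos hj).le
  refine mul_nonneg (by split_ifs <;> positivity)
    (Finset.prod_nonneg fun k _ => div_nonneg (ker_nonneg _ _) (ker_nonneg _ _))

theorem norm_node_sub_reflect {n j : ℕ} (hj : j ∈ posIndices n) :
    ‖node n j - node n (reflect n j)‖ = 2 * radius (adjustedAngleUpper n j) := by
  have hr := radius_adjusted_pos hj
  rw [node_upper (mem_posIndices.1 hj).1, node_reflect hj, norm_sub_rev, norm_lower_sub_upper,
    ← two_mul, Real.sqrt_mul two_pos.le, Real.sqrt_sq hr.le, ← mul_assoc,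
    Real.mul_self_sqrt two_pos.le]

theorem lagNorm_add_le {n j : ℕ} (hj : j ∈ posIndices n) {x : ℂ} {t : ℝ}
    (ht : t ∈ Icc 0 (2 * π / 3)) (hx : OnArms x t) :
    lagNorm n x j + lagNorm n x (reflect n j) ≤
      2 * ((radius t + radius (adjustedAngleUpper n j)) / radius (adjustedAngleUpper n j) *
        lagCore n t j) := by
  have hr := radius_adjusted_pos hj
  have hjn := (mem_posIndices.1 hj).1
  have hjr := lt_reflect hj
  have h0 := lagCore_nonneg hj ht
  have hs : √2 ≤ 2 := by
    rw [Real.sqrt_le_left two_pos.le]; norm_num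
  have bound : ∀ w, OnArms w (adjustedAngleUpper n j) →
      ‖x - w‖ / (2 * radius (adjustedAngleUpper n j)) ≤
      (radius t + radius (adjustedAngleUpper n j)) / radius (adjustedAngleUpper n j) := by
    intro w hw
    have := norm_sub_le x w
    have h1 := radius_nonneg_inner ht
    rw [hx.norm_eq h1, hw.norm_eq hr.le] at this
    rw [div_le_div_iff₀ (by positivity) hr]
    have h2 : ‖x - w‖ ≤ 2 * (radius t + radius (adjustedAngleUpper n j)) := by
      rw [← mul_add] at this
      exact this.trans (mul_le_mul_of_nonneg_right hs (by linarith))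
    calc _ ≤ _ := mul_le_mul_of_nonneg_right h2 hr.le
      _ = _ := by ring
  rw [lagNorm_eq_mul hj (Or.inl rfl) ht hx, lagNorm_eq_mul hj (Or.inr rfl) ht hx, if_pos rfl,
    if_neg (by omega), if_neg (by omega), if_pos rfl, one_mul, mul_one, norm_node_sub_reflect hj,
    norm_sub_rev (node n (reflect n j)), norm_node_sub_reflect hj]
  have b1 := mul_le_mul_of_nonneg_left (bound _ (onArms_node hj)) h0
  have b2 := mul_le_mul_of_nonneg_left (bound _ (onArms_node_reflect hj)) h0
  linarith

theorem lagCore_le_lagNorm {n j : ℕ} (hj : j ∈ posIndices n) {t : ℝ}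
    (ht : t ∈ Icc 0 (2 * π / 3)) :
    lagCore n t j ≤ 2 * lagNorm n ((-1 + Complex.I) * radius t) j := by
  have hr := radius_adjusted_pos hj
  have hjr := lt_reflect hj
  have hjn := (mem_posIndices.1 hj).1
  have h0 := lagCore_nonneg hj ht
  rw [lagNorm_eq_mul hj (Or.inl rfl) ht (Or.inl rfl), if_pos rfl, if_neg (by omega), one_mul,
    norm_node_sub_reflect hj, node_reflect hj, norm_sub_rev, norm_lower_sub_upper]
  have h1 : radius (adjustedAngleUpper n j) ≤
      √(radius (adjustedAngleUpper n j) ^ 2 + radius t ^ 2) :=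
    Real.le_sqrt_of_sq_le (by nlinarith [sq_nonneg (radius t)])
  have h2 : 1 ≤ √2 := Real.one_le_sqrt.2 (by norm_num)
  have h3 : 1 / 2 ≤ √2 * √(radius (adjustedAngleUpper n j) ^ 2 + radius t ^ 2) /
      (2 * radius (adjustedAngleUpper n j)) := by
    rw [div_le_div_iff₀ two_pos (by positivity)]
    nlinarith
  nlinarith

theorem lebesgueConstant_adjusted_le {n : ℕ} {M : ℝ} (hM : 0 ≤ M)
    (h : ∀ t ∈ Icc 0 (2 * π / 3), (if Even n then lagCorner n t else 0) +
      ∑ j ∈ posIndices n, 2 * ((radius t + radius (adjustedAngleUpper n j)) /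
        radius (adjustedAngleUpper n j) * lagCore n t j) ≤ M) :
    lebesgueConstant (adjustedFejerPoint n) ≤ M := by
  refine lebesgueConstant_le _ hM fun x => ?_
  obtain ⟨t, ht, hx⟩ := exists_onArms x.2
  simp only [norm_eval_basis_adjusted]
  rw [Fin.sum_univ_eq_sum_range (fun i => lagNorm n x i), sum_range_succ_eq]
  refine le_trans (add_le_add ?_ (Finset.sum_le_sum fun j hj => lagNorm_add_le hj ht hx)) (h t ht)
  split_ifs with he
  · exact (lagNorm_corner he hx).le
  · exact le_rfl

theorem sum_lagCore_le {n : ℕ} {t : ℝ} (ht : t ∈ Icc 0 (2 * π / 3)) {J : Finset ℕ}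
    (hJ : J ⊆ posIndices n) :
    ∑ j ∈ J, lagCore n t j ≤ 4 * lebesgueConstant (adjustedFejerPoint n) := by
  have hx : (-1 + Complex.I) * (radius t : ℂ) ∈ arc :=
    Or.inl ⟨radius t, ⟨radius_nonneg_inner ht, radius_le ht.1 (by linarith [ht.2, Real.pi_pos])⟩,
      rfl⟩
  have h := le_two_mul_lebesgueConstant (injective_adjustedFejerPoint n) ⟨_, hx⟩
  simp only [norm_eval_basis_adjusted] at h
  rw [Fin.sum_univ_eq_sum_range (fun i => lagNorm n ((-1 + Complex.I) * (radius t : ℂ)) i)] at h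
  have h1 : ∑ j ∈ J, lagNorm n ((-1 + Complex.I) * (radius t : ℂ)) j ≤
      ∑ j ∈ Finset.range (n + 1), lagNorm n ((-1 + Complex.I) * (radius t : ℂ)) j := by
    refine Finset.sum_le_sum_of_subset_of_nonneg (fun j hj => ?_) fun _ _ _ => lagNorm_nonneg _ _ _
    have := (mem_posIndices.1 (hJ hj)).1
    rw [Finset.mem_range]; omega
  have h2 : ∑ j ∈ J, lagCore n t j ≤
      ∑ j ∈ J, 2 * lagNorm n ((-1 + Complex.I) * (radius t : ℂ)) j :=
    Finset.sum_le_sum fun j hj => lagCore_le_lagNorm (hJ hj) ht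
  rw [← Finset.mul_sum] at h2
  linarith

/-! ### Size of the Lagrange basis polynomials -/

theorem Cmp.inv {C a b : ℝ} (h : Cmp C a b) : Cmp C a⁻¹ b⁻¹ := by
  rcases h.1.eq_or_lt with h0 | h0
  · have hb : b = 0 := by
      have := h.5; rw [← h0, mul_zero] at this; exact le_antisymm this h.2
    rw [← h0, hb, inv_zero]
    exact ⟨le_rfl, le_rfl, h.3, by simp, by simp⟩
  · have hb := h.pos_iff.1 h0
    have hC := h.3
    refine ⟨by positivity, by positivity, hC, ?_, ?_⟩
    · rw [← div_eq_mul_inv, inv_le_comm₀ h0 (by positivity), inv_div]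
      rw [div_le_iff₀ hC, mul_comm]; exact h.5
    · rw [← div_eq_mul_inv, inv_le_comm₀ hb (by positivity), inv_div]
      rw [div_le_iff₀ hC, mul_comm]; exact h.4

theorem Cmp.div {C D a b a' b' : ℝ} (h : Cmp C a b) (h' : Cmp D a' b') :
    Cmp (C * D) (a / a') (b / b') := by
  rw [div_eq_mul_inv, div_eq_mul_inv]; exact h.mul h'.inv

/-- The factor which comes from the node and the free interval at the corner. -/
noncomputable def cornerFactor (n : ℕ) (t : ℝ) : ℝ :=
  if Even n then radius t * (Real.exp (cornerAverage n t))⁻¹ else 1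

theorem cornerFactor_bounds : ∃ C, 1 ≤ C ∧ ∀ (n : ℕ) (t t' : ℝ), Twin t t' →
    0 ≤ cornerFactor n t ∧ cornerFactor n t ≤ C ∧
      (gap n / 8 ≤ t → Cmp C (cornerFactor n t) 1) := by
  obtain ⟨C1, h1⟩ := radius_sq_inner_cmp
  obtain ⟨C2, h2⟩ := exp_cornerAverage_cmp
  have p : 0 < C1 * C2 := by
    have := (h1 0 ⟨le_rfl, by positivity⟩).3
    have := (h2 0 (by simp) _ _ twin_zero).3
    positivity
  obtain ⟨C, hC⟩ : ∃ C, C = 1 + C1 * C2 * 9 ^ 3 := ⟨_, rfl⟩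
  have hC1 : 1 ≤ C := by rw [hC]; nlinarith
  have hC2 : C1 * C2 ≤ C := by rw [hC]; nlinarith
  refine ⟨C, hC1, fun n t t' tw => ?_⟩
  unfold cornerFactor
  split_ifs with he
  · have hg := gap_pos n
    have hr := radius_nonneg_inner tw.1
    have ht := tw.1.1
    obtain ⟨ω, hω⟩ : ∃ ω, ω = radius t * (Real.exp (cornerAverage n t))⁻¹ := ⟨_, rfl⟩
    have h0 : 0 ≤ ω := by rw [hω]; positivity
    have hsq : Cmp (C1 * C2) (ω ^ 2) ((t / (t + gap n)) ^ 3) :=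
      ((h1 t tw.1).div (h2 n he t t' tw)).congr (by rw [hω]; field_simp) (by rw [div_pow])
    rw [← hω]
    have hle : ω ≤ C := by
      have e : (t / (t + gap n)) ^ 3 ≤ 1 := by
        refine pow_le_one₀ (by positivity) ?_
        rw [div_le_one (by positivity)]; linarith
      have : ω ^ 2 ≤ C := hsq.4.trans (by nlinarith)
      nlinarith
    refine ⟨h0, hle, fun h8 => ⟨h0, zero_le_one, by linarith, by linarith, ?_⟩⟩
    have e : (1 / 9 : ℝ) ^ 3 ≤ (t / (t + gap n)) ^ 3 := by
      refine pow_le_pow_left₀ (by norm_num) ?_ 3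
      rw [div_le_div_iff₀ (by norm_num) (by positivity)]; linarith
    have h3 := e.trans hsq.5
    have h4 : 1 ≤ C * ω ^ 2 := by
      rw [hC]; nlinarith [sq_nonneg ω]
    by_contra h5
    push Not at h5
    have h6 : ω ≤ 1 := by nlinarith
    nlinarith
  · exact ⟨zero_le_one, hC1, fun _ => ⟨zero_le_one, zero_le_one, by linarith, by linarith,
      by linarith⟩⟩

/-- The product of the defects of all nodes but the one with index `j`. -/
noncomputable def defectProd (n j : ℕ) (t t' : ℝ) : ℝ :=
  ∏ k ∈ (posIndices n).erase j, (defect n k t * defect n k t')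

theorem defectProd_nonneg (n j : ℕ) (t t' : ℝ) : 0 ≤ defectProd n j t t' :=
  Finset.prod_nonneg fun k _ => mul_nonneg (defect_nonneg n k t) (defect_nonneg n k t')

theorem exists_lagCore_cmp : ∃ C, ∀ (n : ℕ) (t t' s s' : ℝ), Twin t t' → Twin s s' →
    ∀ j ∈ posIndices n, s = adjustedAngleUpper n j →
    Cmp C (lagCore n t j) (cornerFactor n t * (cellModel n s s' j / cellModel n t t' j) *
      (defectProd n j t t' / defectProd n j s s')) := by
  obtain ⟨C1, h1⟩ := prod_ker_cmp
  obtain ⟨C2, h2⟩ := exp_cellAverage_cmp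
  obtain ⟨κ, hκ⟩ := exists_sum_cellAverage
  obtain ⟨C3, -, h3⟩ := cornerFactor_bounds
  have num : ∃ C, ∀ (n : ℕ) (t t' : ℝ), Twin t t' → ∀ j ∈ posIndices n,
      Cmp C ((if Even n then radius t else 1) *
        ∏ k ∈ (posIndices n).erase j, ker t (adjustedAngleUpper n k))
        (Real.exp (κ n) * (cornerFactor n t * (cellModel n t t' j)⁻¹ * defectProd n j t t')) := by
    refine ⟨C1 * (1 * (C2 * 1)), fun n t t' tw j hj => ?_⟩
    have hr := radius_nonneg_inner tw.1
    have hN : 0 ≤ (if Even n then radius t else 1) := by split_ifs <;> positivity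
    have hf := (h3 n t t' tw).1
    have hq := defectProd_nonneg n j t t'
    have e : (if Even n then radius t else 1) * ∏ k ∈ (posIndices n).erase j,
        (Real.exp (cellAverage n t k) * (defect n k t * defect n k t')) =
        (Real.exp (κ n) * cornerFactor n t) *
          ((Real.exp (cellAverage n t j))⁻¹ * defectProd n j t t') := by
      rw [Finset.prod_mul_distrib, ← Real.exp_sum, defectProd]
      have hs := hκ n t t' tw
      rw [← Finset.add_sum_erase _ _ hj] at hs
      have e1 : ∑ k ∈ (posIndices n).erase j, cellAverage n t k =
          κ n + (-cornerAverage n t) + (-cellAverage n t j) := by linarith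
      rw [e1, Real.exp_add, Real.exp_add, Real.exp_neg, Real.exp_neg, cornerFactor]
      split_ifs with he
      · ring
      · rw [cornerAverage, if_neg he, Real.exp_zero]; ring
    have a := (Cmp.refl hN).mul (h1 n t t' tw j)
    rw [e] at a
    have b := (Cmp.refl (mul_nonneg (Real.exp_pos (κ n)).le hf)).mul
      ((h2 n t t' tw j hj).inv.mul (Cmp.refl hq))
    exact ((a.trans b).mono (by simp)).congr rfl (by ring)
  obtain ⟨C, hC⟩ := num
  refine ⟨C * C * (1 * C3 * 1), fun n t t' s s' tw sw j hj hs => ?_⟩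
  have a := (hC n t t' tw j hj).div (hC n s s' sw j hj)
  have hm := adjusted_mem hj
  have hg := gap_pos n
  have b := ((h3 n s s' sw).2.2 (by rw [hs]; linarith [hm.1])).inv
  rw [inv_one] at b
  have p1 := cellModel_pos n s s' j
  have p2 := cellModel_pos n t t' j
  have nn : 0 ≤ cornerFactor n t * (cellModel n s s' j / cellModel n t t' j) :=
    mul_nonneg (h3 n t t' tw).1 (by positivity)
  have nq : 0 ≤ defectProd n j t t' / defectProd n j s s' :=
    div_nonneg (defectProd_nonneg _ _ _ _) (defectProd_nonneg _ _ _ _)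
  have c := ((Cmp.refl nn).mul b).mul (Cmp.refl nq)
  refine (a.trans (c.congr ?_ ?_)).congr ?_ rfl
  · have := Real.exp_ne_zero (κ n)
    rw [mul_div_mul_left _ _ this]
    rw [div_eq_mul_inv, div_eq_mul_inv, div_eq_mul_inv, mul_inv, mul_inv, inv_inv]
    ring
  · ring
  · rw [lagCore, Finset.prod_div_distrib, ← hs]
    split_ifs
    · rw [mul_div_mul_comm]
    · rw [one_mul, one_mul, one_mul]

/-! ### The ratio of the cell models -/

/-- A decay factor at the scale of the gap. -/
noncomputable def decay (n : ℕ) (u v : ℝ) : ℝ := 1 / max 1 (|u - v| / gap n)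

theorem decay_pos (n : ℕ) (u v : ℝ) : 0 < decay n u v := by unfold decay; positivity

theorem decay_eq (n : ℕ) (u v : ℝ) : decay n u v = gap n / max (gap n) |u - v| := by
  have hg := gap_pos n
  have e : max (gap n) |u - v| = gap n * max 1 (|u - v| / gap n) := by
    rw [mul_max_of_nonneg _ _ hg.le, mul_one, mul_div_cancel₀ _ hg.ne']
  rw [decay, e, div_mul_eq_div_div, div_self hg.ne']

theorem radius_ratio_inner_le : ∃ C, 0 < C ∧ ∀ s ∈ Ioc 0 (2 * π / 3), ∀ t ∈ Icc 0 (2 * π / 3),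
    (radius t + radius s) / radius s * (s / (s + t)) ^ 2 ≤ C := by
  obtain ⟨C1, h1⟩ := radius_sq_inner_cmp
  have p : 0 < C1 := (h1 0 ⟨le_rfl, by positivity⟩).3
  refine ⟨√(2 * C1 ^ 2), by positivity, fun s hs t ht => ?_⟩
  have hs0 := hs.1
  have ht0 := ht.1
  have a := h1 s ⟨hs0.le, hs.2⟩
  have b := h1 t ht
  have rs : 0 < radius s := radius_pos ⟨hs0, by linarith [hs.2, Real.pi_pos]⟩
  have rt := radius_nonneg_inner ht
  refine Real.le_sqrt_of_sq_le ?_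
  have e : ((radius t + radius s) / radius s * (s / (s + t)) ^ 2) ^ 2 =
      (radius t + radius s) ^ 2 * s ^ 4 / (radius s ^ 2 * (s + t) ^ 4) := by
    field_simp
  rw [e, div_le_iff₀ (by positivity)]
  have c1 : (radius t + radius s) ^ 2 ≤ 2 * C1 * (s + t) ^ 3 := by
    have : t ^ 3 + s ^ 3 ≤ (s + t) ^ 3 := by
      nlinarith [mul_nonneg hs0.le ht0, mul_nonneg (mul_nonneg hs0.le ht0) (add_nonneg hs0.le ht0)]
    nlinarith [sq_nonneg (radius t - radius s), a.4, b.4]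
  calc (radius t + radius s) ^ 2 * s ^ 4 ≤ 2 * C1 * (s + t) ^ 3 * s ^ 4 := by gcongr
    _ = 2 * C1 * s ^ 3 * ((s + t) ^ 3 * s) := by ring
    _ ≤ 2 * C1 * (C1 * radius s ^ 2) * ((s + t) ^ 3 * (s + t)) := by
        have := a.5
        gcongr
        linarith
    _ = _ := by ring

theorem max_cross_inner_le : ∃ C, 0 < C ∧ ∀ δ θ s s' t t' : ℝ, 0 < δ → Twin s s' → Twin t t' →
    θ ≤ 2 * π / 3 → |s - θ| ≤ δ →
      max (3 * δ / 2) |θ - s'| ≤ C * max (3 * δ / 2) |θ - t'| := by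
  obtain ⟨C, hC⟩ := twin_tip_cmp
  have p : 0 < C := (hC _ _ twin_zero).3
  refine ⟨C + 1 + C, by positivity, fun δ θ s s' t t' hδ sw tw hθ h => ?_⟩
  have h1 := (hC s s' sw).5
  have h2 := sw.2.1
  have h3 := tw.2.1
  rw [abs_le] at h
  rw [abs_sub_comm θ s', abs_sub_comm θ t', abs_of_nonneg (by linarith : 0 ≤ s' - θ),
    abs_of_nonneg (by linarith : 0 ≤ t' - θ)]
  have m1 := le_max_left (3 * δ / 2) (t' - θ)
  have m2 := le_max_right (3 * δ / 2) (t' - θ)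
  refine max_le ?_ ?_
  · nlinarith
  · nlinarith

theorem max_cross_outer_le : ∃ C, 0 < C ∧ ∀ δ θ s s' t t' : ℝ, 0 < δ → Twin s s' → Twin t t' →
    2 * π / 3 ≤ θ → |s' - θ| ≤ δ →
      max (3 * δ / 2) |θ - s| ≤ C * max (3 * δ / 2) |θ - t| := by
  obtain ⟨C, hC⟩ := twin_tip_cmp
  have p : 0 < C := (hC _ _ twin_zero).3
  refine ⟨C + 1 + C, by positivity, fun δ θ s s' t t' hδ sw tw hθ h => ?_⟩
  have h1 := (hC s s' sw).4
  have h2 := sw.1.2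
  have h3 := tw.1.2
  rw [abs_le] at h
  rw [abs_of_nonneg (by linarith : 0 ≤ θ - s), abs_of_nonneg (by linarith : 0 ≤ θ - t)]
  have m1 := le_max_left (3 * δ / 2) (θ - t)
  have m2 := le_max_right (3 * δ / 2) (θ - t)
  refine max_le ?_ ?_
  · nlinarith
  · nlinarith

theorem div_max_le_decay {n : ℕ} {θ u v : ℝ} (h : |u - θ| ≤ gap n) :
    (3 * gap n / 2) / max (3 * gap n / 2) |θ - v| ≤ 3 * decay n u v := by
  have hg := gap_pos n
  have m1 := le_max_left (3 * gap n / 2) |θ - v|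
  have m2 := le_max_right (3 * gap n / 2) |θ - v|
  have h2 := abs_sub_le u θ v
  have h3 : max (gap n) |u - v| ≤ 2 * max (3 * gap n / 2) |θ - v| :=
    max_le (by linarith) (by linarith)
  have h4 : 0 < max (gap n) |u - v| := lt_max_of_lt_left hg
  rw [decay_eq, mul_div_assoc', div_le_div_iff₀ (by linarith) h4]
  nlinarith

theorem inner_ratio_le : ∃ C, 0 < C ∧ ∀ (n : ℕ) (t t' s s' : ℝ), Twin t t' → Twin s s' →
    ∀ j ∈ posIndices n, s = adjustedAngleUpper n j → fejerAngleUpper n j ≤ 2 * π / 3 →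
    (radius t + radius s) / radius s * (cellModel n s s' j / cellModel n t t' j) ≤
      C * decay n s t := by
  obtain ⟨C1, p1, h1⟩ := radius_ratio_inner_le
  obtain ⟨C2, p2, h2⟩ := max_cross_inner_le
  refine ⟨3 * C2 * 12 ^ 2 * C1, by positivity, fun n t t' s s' tw sw j hj hs hin => ?_⟩
  obtain ⟨k1, k2⟩ := mem_posIndices.1 hj
  have hg := gap_pos n
  have hm := adjusted_mem hj
  rw [← hs] at hm
  have hs0 : 0 < s := by linarith [hm.1]
  have ht0 := tw.1.1
  have ha := abs_adjusted_sub_inner k1 hin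
  rw [← hs] at ha
  have hθ := half_gap_le_of_pos k2
  obtain ⟨θ, hθe⟩ : ∃ θ, θ = fejerAngleUpper n j := ⟨_, rfl⟩
  have h' : ∀ u, 0 < max (3 * gap n / 2) u := fun u => lt_max_of_lt_left (by positivity)
  have a1 := div_max_le_decay (n := n) (v := t) ha
  have a2 := h2 (gap n) _ s s' t t' hg sw tw hin ha
  have a3 := h1 s ⟨hs0, sw.1.2⟩ t tw.1
  have ha' := abs_le.1 ha
  unfold cellModel
  rw [← hθe] at ha hθ hin a1 a2 ha' ⊢
  have e0 : max (3 * gap n / 2) |θ - s| = 3 * gap n / 2 := by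
    rw [abs_sub_comm]; exact max_eq_left (by linarith)
  have b2 : max (3 * gap n / 2) |θ - s'| / max (3 * gap n / 2) |θ - t'| ≤ C2 := by
    rw [div_le_iff₀ (h' _)]; exact a2
  have b3 : max (3 * gap n / 2) (θ + s) / max (3 * gap n / 2) (θ + t) ≤ 12 * (s / (s + t)) := by
    have u1 : max (3 * gap n / 2) (θ + s) ≤ 4 * s := max_le (by linarith) (by linarith)
    have u2 : (s + t) / 3 ≤ max (3 * gap n / 2) (θ + t) :=
      le_max_of_le_right (by linarith)
    have hst : 0 < s + t := by linarith
    rw [div_le_iff₀ (h' _), mul_div_assoc', div_mul_eq_mul_div, le_div_iff₀ hst]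
    nlinarith
  have g0 : 0 ≤ (radius t + radius s) / radius s := by
    have := radius_nonneg_inner tw.1
    have := radius_nonneg_inner sw.1
    positivity
  have hd := decay_pos n s t
  calc (radius t + radius s) / radius s *
        (max (3 * gap n / 2) |θ - s| * max (3 * gap n / 2) |θ - s'| *
          max (3 * gap n / 2) (θ + s) ^ 2 / (max (3 * gap n / 2) |θ - t| *
          max (3 * gap n / 2) |θ - t'| * max (3 * gap n / 2) (θ + t) ^ 2))
      = (radius t + radius s) / radius s * ((3 * gap n / 2) / max (3 * gap n / 2) |θ - t| *
        (max (3 * gap n / 2) |θ - s'| / max (3 * gap n / 2) |θ - t'|) *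
        (max (3 * gap n / 2) (θ + s) / max (3 * gap n / 2) (θ + t)) ^ 2) := by
        rw [e0]
        congr 1
        rw [div_pow, div_mul_div_comm, div_mul_div_comm]
    _ ≤ (radius t + radius s) / radius s * (3 * decay n s t * C2 * (12 * (s / (s + t))) ^ 2) := by
        gcongr
    _ = 3 * C2 * 12 ^ 2 * ((radius t + radius s) / radius s * (s / (s + t)) ^ 2) * decay n s t := by
        ring
    _ ≤ _ := by gcongr

theorem div_le_decay_pi {n : ℕ} {u : ℝ} (h : u ≤ π - gap n / 2) :
    gap n / (π - u) ≤ 2 * decay n u π := by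
  have hg := gap_pos n
  have h4 : 0 < max (gap n) |u - π| := lt_max_of_lt_left hg
  have h3 : max (gap n) |u - π| ≤ 2 * (π - u) := by
    rw [abs_sub_comm, abs_of_nonneg (by linarith)]
    exact max_le (by linarith) (by linarith)
  rw [decay_eq, mul_div_assoc', div_le_div_iff₀ (by linarith) h4]
  nlinarith

theorem radius_ratio_outer_le : ∃ C, 0 < C ∧ ∀ (n : ℕ) (t t' s s' : ℝ), Twin t t' → Twin s s' →
    s' ≤ π - gap n / 2 →
    (radius t + radius s) / radius s * decay n s' t' ≤ C * (decay n s' t' + decay n s' π) := by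
  obtain ⟨C1, h1⟩ := radius_sq_outer_cmp
  have p : 0 < C1 := (h1 _ twin_zero.2).3
  refine ⟨√(8 * C1 ^ 2) * 2, by positivity, fun n t t' s s' tw sw hs => ?_⟩
  have hg := gap_pos n
  have a := h1 s' sw.2
  have b := h1 t' tw.2
  rw [← sw.3] at a
  rw [← tw.3] at b
  have hσ : 0 < π - s' := by linarith
  have rs : 0 < radius s := by
    have := a.5
    rcases (radius_nonneg_inner sw.1).eq_or_lt with h0 | h0
    · rw [← h0] at this; norm_num at this; linarith
    · exact h0
  have rt := radius_nonneg_inner tw.1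
  obtain ⟨m, hm⟩ : ∃ m, m = max (gap n) |s' - t'| := ⟨_, rfl⟩
  have m1 : gap n ≤ m := hm ▸ le_max_left _ _
  have m2 : |s' - t'| ≤ m := hm ▸ le_max_right _ _
  have hm0 : 0 < m := by linarith
  obtain ⟨q, hq⟩ : ∃ q, q = gap n / (π - s') := ⟨_, rfl⟩
  have hq0 : 0 < q := by rw [hq]; positivity
  have hd : decay n s' t' = gap n / m := by rw [hm, decay_eq]
  have key : ((radius t + radius s) / radius s * decay n s' t') ^ 2 ≤
      8 * C1 ^ 2 * (decay n s' t' + q) ^ 2 := by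
    have c1 : (radius t + radius s) ^ 2 ≤ 2 * C1 * (m + 2 * (π - s')) := by
      have : π - t' ≤ (π - s') + m := by linarith [le_abs_self (s' - t')]
      nlinarith [sq_nonneg (radius t - radius s), a.4, b.4]
    have c2 : ((radius t + radius s) / radius s) ^ 2 ≤ 2 * C1 ^ 2 * (m / (π - s') + 2) := by
      rw [div_pow, div_le_iff₀ (by positivity)]
      calc _ ≤ _ := c1
        _ = 2 * C1 * (m / (π - s') + 2) * (π - s') := by field_simp
        _ ≤ 2 * C1 * (m / (π - s') + 2) * (C1 * radius s ^ 2) := by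
            have := a.5
            gcongr
        _ = _ := by ring
    have e : m / (π - s') * decay n s' t' = q := by rw [hd, hq]; field_simp
    have hd0 := decay_pos n s' t'
    calc ((radius t + radius s) / radius s * decay n s' t') ^ 2
        = ((radius t + radius s) / radius s) ^ 2 * decay n s' t' ^ 2 := by ring
      _ ≤ 2 * C1 ^ 2 * (m / (π - s') + 2) * decay n s' t' ^ 2 := by gcongr
      _ = 2 * C1 ^ 2 * (q * decay n s' t' + 2 * decay n s' t' ^ 2) := by rw [← e]; ring
      _ ≤ 2 * C1 ^ 2 * (4 * (decay n s' t' + q) ^ 2) := by gcongr; nlinarith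
      _ = _ := by ring
  have hd0 := decay_pos n s' t'
  have h2 := Real.le_sqrt_of_sq_le key
  rw [Real.sqrt_mul (by positivity), Real.sqrt_sq (by positivity)] at h2
  have h3 := div_le_decay_pi hs
  rw [← hq] at h3
  calc _ ≤ _ := h2
    _ ≤ √(8 * C1 ^ 2) * (2 * (decay n s' t' + decay n s' π)) := by gcongr; linarith
    _ = _ := by ring

theorem outer_ratio_le : ∃ C, 0 < C ∧ ∀ (n : ℕ) (t t' s s' : ℝ), Twin t t' → Twin s s' →
    ∀ j ∈ posIndices n, s' = sideAngle n j → 2 * π / 3 < fejerAngleUpper n j →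
    (radius t + radius s) / radius s * (cellModel n s s' j / cellModel n t t' j) ≤
      C * (decay n s' t' + decay n s' π) := by
  obtain ⟨C1, p1, h1⟩ := radius_ratio_outer_le
  obtain ⟨C2, p2, h2⟩ := max_cross_outer_le
  refine ⟨3 * C2 * 3 ^ 2 * C1, by positivity, fun n t t' s s' tw sw j hj hs hout => ?_⟩
  obtain ⟨k1, k2⟩ := mem_posIndices.1 hj
  have hg := gap_pos n
  have hpi := Real.pi_pos
  have hm := sideAngle_mem hj
  rw [← hs] at hm
  have ht0 := tw.1.1
  have ha := abs_sideAngle_sub k1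
  rw [← hs] at ha
  have hθ := fejerAngleUpper_le k1
  obtain ⟨θ, hθe⟩ : ∃ θ, θ = fejerAngleUpper n j := ⟨_, rfl⟩
  have h' : ∀ u, 0 < max (3 * gap n / 2) u := fun u => lt_max_of_lt_left (by positivity)
  have a1 := div_max_le_decay (n := n) (v := t') ha
  have a2 := h2 (gap n) _ s s' t t' hg sw tw hout.le ha
  have a3 := h1 n t t' s s' tw sw hm.2
  have ha' := abs_le.1 ha
  unfold cellModel
  rw [← hθe] at ha hθ hout a1 a2 ha' ⊢
  have e0 : max (3 * gap n / 2) |θ - s'| = 3 * gap n / 2 := by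
    rw [abs_sub_comm]; exact max_eq_left (by linarith)
  have b2 : max (3 * gap n / 2) |θ - s| / max (3 * gap n / 2) |θ - t| ≤ C2 := by
    rw [div_le_iff₀ (h' _)]; exact a2
  have b3 : max (3 * gap n / 2) (θ + s) / max (3 * gap n / 2) (θ + t) ≤ 3 := by
    rw [div_le_iff₀ (h' _)]
    have u2 := le_max_right (3 * gap n / 2) (θ + t)
    exact max_le (by linarith [le_max_left (3 * gap n / 2) (θ + t)]) (by linarith [sw.1.2])
  have g0 : 0 ≤ (radius t + radius s) / radius s := by
    have := radius_nonneg_inner tw.1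
    have := radius_nonneg_inner sw.1
    positivity
  have hd := decay_pos n s' t'
  calc (radius t + radius s) / radius s *
        (max (3 * gap n / 2) |θ - s| * max (3 * gap n / 2) |θ - s'| *
          max (3 * gap n / 2) (θ + s) ^ 2 / (max (3 * gap n / 2) |θ - t| *
          max (3 * gap n / 2) |θ - t'| * max (3 * gap n / 2) (θ + t) ^ 2))
      = (radius t + radius s) / radius s * ((3 * gap n / 2) / max (3 * gap n / 2) |θ - t'| *
        (max (3 * gap n / 2) |θ - s| / max (3 * gap n / 2) |θ - t|) *
        (max (3 * gap n / 2) (θ + s) / max (3 * gap n / 2) (θ + t)) ^ 2) := by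
        rw [e0]
        congr 1
        rw [div_pow, div_mul_div_comm, div_mul_div_comm, mul_comm (3 * gap n / 2) _,
          mul_comm (max (3 * gap n / 2) |θ - t'|) _]
    _ ≤ (radius t + radius s) / radius s * (3 * decay n s' t' * C2 * 3 ^ 2) := by
        gcongr
    _ = 3 * C2 * 3 ^ 2 * ((radius t + radius s) / radius s * decay n s' t') := by
        ring
    _ ≤ 3 * C2 * 3 ^ 2 * (C1 * (decay n s' t' + decay n s' π)) := by gcongr
    _ = _ := by ring

/-! ### Lower bounds for the defects at the nodes -/

theorem sq_le_prod_defect {n : ℕ} {S : Finset ℕ} (hS : S ⊆ posIndices n) {c s : ℝ} (hc : 0 < c)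
    (hc1 : c ≤ 1) (h : ∀ k ∈ S, c ≤ defect n k s) : c ^ 2 ≤ ∏ k ∈ S, defect n k s := by
  have hg := gap_pos n
  have hcard := card_near_le (S := S) (a := sideAngle n) (t := s) hg
    (fun j hj k hk hjk => gap_le_sideAngle_sub (mem_posIndices.1 (hS hj)).1
      (mem_posIndices.1 (hS hk)).1 hjk) 1
  rw [Nat.cast_one, one_mul] at hcard
  rw [← Finset.prod_filter_mul_prod_filter_not S fun k => |sideAngle n k - s| < gap n]
  have e : ∏ k ∈ S with ¬ |sideAngle n k - s| < gap n, defect n k s = 1 := by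
    refine Finset.prod_eq_one fun k hk => min_eq_left ?_
    rw [le_div_iff₀ hg, one_mul]
    exact not_lt.1 (Finset.mem_filter.1 hk).2
  rw [e, mul_one]
  calc c ^ 2 ≤ c ^ (S.filter fun k => |sideAngle n k - s| < gap n).card :=
        pow_le_pow_of_le_one hc.le hc1 hcard
    _ = ∏ k ∈ S with |sideAngle n k - s| < gap n, c := (Finset.prod_const c).symm
    _ ≤ _ := Finset.prod_le_prod (fun _ _ => hc.le) fun k hk => h k (Finset.mem_filter.1 hk).1

theorem le_defect {n k : ℕ} {c s : ℝ} (hc1 : c ≤ 1) (h : c * gap n ≤ |sideAngle n k - s|) :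
    c ≤ defect n k s :=
  le_min hc1 ((le_div_iff₀ (gap_pos n)).2 h)

theorem exists_le_defect : ∃ c, 0 < c ∧ c ≤ 1 ∧ ∀ (n : ℕ), ∀ j ∈ posIndices n,
    ∀ k ∈ (posIndices n).erase j, ∀ s', Twin (adjustedAngleUpper n j) s' →
    c ≤ defect n k (adjustedAngleUpper n j) ∧
    (fejerAngleUpper n k ≤ 2 * π / 3 → c ≤ defect n k s') ∧
    (2 * π / 3 < fejerAngleUpper n j → c ≤ defect n k s') := by
  obtain ⟨C, hC⟩ := twin_tip_cmp
  have p : 0 < C := (hC _ _ twin_zero).3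
  have hc1 : 1 / (1 + C) ≤ 1 := by rw [div_le_one (by positivity)]; linarith
  refine ⟨1 / (1 + C), by positivity, hc1, fun n j hj k hk s' sw => ?_⟩
  obtain ⟨hne, hk⟩ := Finset.mem_erase.1 hk
  have hg := gap_pos n
  have j1 := (mem_posIndices.1 hj).1
  have k1 := (mem_posIndices.1 hk).1
  have sep := gap_le_adjusted_sub k1 j1 hne
  have jm := adjusted_mem' hj
  have km := adjusted_mem' hk
  have opp : ∀ a b b', Twin b b' → a ≤ 2 * π / 3 → gap n ≤ |a - b| →
      1 / (1 + C) * gap n ≤ b' - a := by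
    intro a b b' bw ha hab
    have h1 := (hC b b' bw).4
    have h2 := bw.1.2
    have h3 := bw.2.1
    rw [div_mul_eq_mul_div, one_mul, div_le_iff₀ (by positivity)]
    have h4 : |a - b| ≤ (2 * π / 3 - a) + (2 * π / 3 - b) :=
      abs_le.2 ⟨by linarith, by linarith⟩
    nlinarith
  have weak : ∀ x, gap n ≤ x → 1 / (1 + C) * gap n ≤ x := fun x hx => by nlinarith
  refine ⟨?_, fun hin => ?_, fun hout => ?_⟩
  · rcases le_or_gt (fejerAngleUpper n k) (2 * π / 3) with h | h
    · exact le_defect hc1 (weak _ (by rwa [sideAngle_inner h]))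
    · refine le_defect hc1 ((opp _ _ _ (twin_sideAngle k1 h) jm.2 ?_).trans (le_abs_self _))
      rwa [abs_sub_comm]
  · refine le_defect hc1 ?_
    rw [sideAngle_inner hin, abs_sub_comm]
    exact (opp _ _ _ sw km.2 sep).trans (le_abs_self _)
  · rw [sw.eq_outer (twin_sideAngle j1 hout)]
    exact le_defect hc1 (weak _ (gap_le_sideAngle_sub k1 j1 hne))

/-- The defects at a node are bounded below, except that for an inner node one outer node may be
very close to the twin of the node. -/
theorem exists_le_defectProd : ∃ c, 0 < c ∧ ∀ (n : ℕ), ∀ j ∈ posIndices n,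
    ∀ s', Twin (adjustedAngleUpper n j) s' →
    c ≤ defectProd n j (adjustedAngleUpper n j) s' ∨
    (fejerAngleUpper n j ≤ 2 * π / 3 ∧ ∃ k ∈ (posIndices n).erase j,
      2 * π / 3 < fejerAngleUpper n k ∧ 0 < |sideAngle n k - s'| ∧
      |sideAngle n k - s'| < gap n / 2 ∧
      c * (|sideAngle n k - s'| / gap n) ≤ defectProd n j (adjustedAngleUpper n j) s') := by
  obtain ⟨c, hc0, hc1, hc⟩ := exists_le_defect
  obtain ⟨d, hd⟩ : ∃ d, d = min c (1 / 2) := ⟨_, rfl⟩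
  have d0 : 0 < d := by rw [hd]; exact lt_min hc0 (by norm_num)
  have dc : d ≤ c := by rw [hd]; exact min_le_left _ _
  have dh : d ≤ 1 / 2 := by rw [hd]; exact min_le_right _ _
  have d1 : d ≤ 1 := dc.trans hc1
  clear hd
  refine ⟨c ^ 2 * d ^ 2, by positivity, fun n j hj s' sw => ?_⟩
  have hg := gap_pos n
  have hsub : (posIndices n).erase j ⊆ posIndices n := Finset.erase_subset _ _
  have hle : ∀ k ∈ (posIndices n).erase j, k ≤ n / 2 := fun k hk => (mem_posIndices.1 (hsub hk)).1
  rw [defectProd, Finset.prod_mul_distrib]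
  have a1 := sq_le_prod_defect hsub hc0 hc1 fun k hk => (hc n j hj k hk s' sw).1
  by_cases hK : ∃ k ∈ (posIndices n).erase j, fejerAngleUpper n j ≤ 2 * π / 3 ∧
      2 * π / 3 < fejerAngleUpper n k ∧ |sideAngle n k - s'| < gap n / 2
  · obtain ⟨k, hk, hin, hout, hlt⟩ := hK
    refine Or.inr ⟨hin, k, hk, hout, ?_, hlt, ?_⟩
    · rw [abs_pos, sub_ne_zero]
      intro h0
      have tk := twin_sideAngle (hle k hk) hout
      rw [h0] at tk
      have e := tk.eq_inner sw
      have := gap_le_adjusted_sub (hle k hk) (mem_posIndices.1 hj).1 (Finset.ne_of_mem_erase hk)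
      rw [e, sub_self, abs_zero] at this
      linarith
    · rw [← Finset.mul_prod_erase _ (fun k => defect n k s') hk]
      have a2 := sq_le_prod_defect (S := ((posIndices n).erase j).erase k) (s := s')
        ((Finset.erase_subset _ _).trans hsub) d0 d1 (by
          intro l hl
          obtain ⟨hlk, hl⟩ := Finset.mem_erase.1 hl
          refine le_defect d1 ?_
          have := gap_le_sideAngle_sub (hle l hl) (hle k hk) hlk
          have h2 := abs_sub_le (sideAngle n l) s' (sideAngle n k)
          rw [abs_sub_comm s'] at h2
          have : d * gap n ≤ 1 / 2 * gap n := mul_le_mul_of_nonneg_right dh hg.le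
          linarith)
      have e : defect n k s' = |sideAngle n k - s'| / gap n :=
        min_eq_right (by rw [div_le_one hg]; linarith)
      rw [e]
      have b0 : 0 ≤ |sideAngle n k - s'| / gap n := by positivity
      calc c ^ 2 * d ^ 2 * (|sideAngle n k - s'| / gap n)
          = c ^ 2 * (|sideAngle n k - s'| / gap n * d ^ 2) := by ring
        _ ≤ _ := mul_le_mul a1 (mul_le_mul_of_nonneg_left a2 b0) (by positivity)
            (Finset.prod_nonneg fun k _ => defect_nonneg _ _ _)
  · left
    push Not at hK
    have a2 := sq_le_prod_defect (S := (posIndices n).erase j) (s := s') hsub d0 d1 (by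
      intro k hk
      rcases le_or_gt (fejerAngleUpper n k) (2 * π / 3) with h | h
      · exact dc.trans ((hc n j hj k hk s' sw).2.1 h)
      rcases le_or_gt (fejerAngleUpper n j) (2 * π / 3) with h' | h'
      · refine le_defect d1 ?_
        have := hK k hk h' h
        have : d * gap n ≤ 1 / 2 * gap n := mul_le_mul_of_nonneg_right dh hg.le
        linarith
      · exact dc.trans ((hc n j hj k hk s' sw).2.2 h'))
    exact mul_le_mul a1 a2 (by positivity) (Finset.prod_nonneg fun k _ => defect_nonneg _ _ _)

/-! ### Inner nodes close to the twin of an outer node -/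

theorem le_mul_of_pow_three_le {x y M : ℝ} (hy : 0 ≤ y) (hM : 1 ≤ M)
    (h : x ^ 3 ≤ M * y ^ 3) : x ≤ M * y := by
  refine le_of_pow_le_pow_left₀ (by norm_num : 3 ≠ 0) (by positivity) (h.trans ?_)
  rw [mul_pow]
  exact mul_le_mul_of_nonneg_right (le_self_pow₀ hM (by norm_num)) (by positivity)

theorem near_bound_case_close {K μ d b Δ δ D w y r : ℝ} (hK : 0 < K) (hμ : 0 < μ) (hδ : 0 < δ)
    (hb : 0 < b) (hy : 0 < y) (hD : 0 < D) (hd : d ≤ (b + Δ) / δ)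
    (hμt : μ * Δ ≤ K * δ * r) (hB : δ / b ≤ K * D / y ^ 2)
    (hr : r ≤ 36 * K ^ 4 * y ^ 2) (hw : 1 ≤ 2 * w) :
    μ * d * (δ / b) ≤ μ + 72 * K ^ 6 * w * D := by
  calc μ * d * (δ / b) ≤ μ * ((b + Δ) / δ) * (δ / b) := by gcongr
    _ = μ + (μ * Δ) / δ * (δ / b) := by field_simp
    _ ≤ μ + (K * δ * (36 * K ^ 4 * y ^ 2)) / δ * (K * D / y ^ 2) := by
        have h : μ * Δ ≤ K * δ * (36 * K ^ 4 * y ^ 2) := hμt.trans (by gcongr)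
        gcongr
    _ = μ + 36 * K ^ 6 * D * 1 := by field_simp
    _ ≤ μ + 36 * K ^ 6 * D * (2 * w) := by gcongr
    _ = _ := by ring

theorem near_bound_case_apart {K t s y Δ δ E w q : ℝ} (hK : 1 ≤ K) (ht : 0 ≤ t) (hs : 0 ≤ s)
    (hy : 0 < y) (hδ : 0 < δ) (hΔ : 0 < Δ) (hE : E = δ / Δ) (hEw : E ≤ 2 * w) (hq : 0 < q)
    (hw : 0 < w) (e3 : |t - s| * (t + s) ^ 2 ≤ K * Δ) (hsy : s ≤ 2 * K ^ 2 * y)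
    (hqy : δ ≤ K * y ^ 3 * q) :
    E * (t + s) ^ 2 / y ^ 2 ≤ 72 * K ^ 4 * (w + q) := by
  have hK0 : 0 < K := by linarith
  have hK2 : 1 ≤ K ^ 2 := one_le_pow₀ hK
  have hE0 : 0 < E := by rw [hE]; positivity
  have hK4 : K ^ 2 ≤ K ^ 4 := pow_le_pow_right₀ hK (by norm_num)
  rcases le_or_gt t (4 * K ^ 2 * y) with hty | hty
  · calc E * (t + s) ^ 2 / y ^ 2 ≤ E * (6 * K ^ 2 * y) ^ 2 / y ^ 2 := by gcongr; linarith
      _ = 36 * K ^ 4 * E := by field_simp; ring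
      _ ≤ 36 * K ^ 4 * (2 * w) := by gcongr
      _ = 72 * K ^ 4 * w := by ring
      _ ≤ _ := by gcongr; linarith
  · have hyt : y ≤ 4 * K ^ 2 * y := le_mul_of_one_le_left hy.le (by linarith)
    have hst : y ≤ 2 * |t - s| := by linarith [le_abs_self (t - s)]
    have h5 : y * (t + s) ^ 2 ≤ 2 * (K * Δ) := by
      refine le_trans ?_ (mul_le_mul_of_nonneg_left e3 two_pos.le)
      rw [← mul_assoc]
      exact mul_le_mul_of_nonneg_right hst (sq_nonneg _)
    have h6 : E * (t + s) ^ 2 / y ^ 2 * (y ^ 3 * Δ) ≤ 2 * K ^ 2 * q * (y ^ 3 * Δ) := by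
      calc E * (t + s) ^ 2 / y ^ 2 * (y ^ 3 * Δ) = δ * (y * (t + s) ^ 2) := by
            rw [hE]; field_simp
        _ ≤ (K * y ^ 3 * q) * (2 * (K * Δ)) := by gcongr
        _ = _ := by ring
    refine (le_of_mul_le_mul_right h6 (by positivity)).trans ?_
    calc 2 * K ^ 2 * q ≤ 72 * K ^ 4 * q := by gcongr; linarith
      _ ≤ _ := by gcongr; linarith

theorem near_bound_aux {K δ t t' s s' y u : ℝ} (hK : 1 ≤ K) (hδ : 0 < δ) (ht : 0 ≤ t) (hs : 0 ≤ s)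
    (hy : 0 ≤ y) (e1 : |y - s| * (y + s) ^ 2 ≤ K * |u - s'|)
    (e2 : |t' - s'| ≤ K * (|t - s| * (t + s) ^ 2)) (e3 : |t - s| * (t + s) ^ 2 ≤ K * |t' - s'|)
    (e4 : s ^ 3 ≤ K * (π - s')) (e5 : t ^ 3 ≤ K * (π - t')) (e6 : π - u ≤ K * y ^ 3)
    (h1 : δ ≤ |y - s|) (h2 : |u - s'| < δ / 2) (h3 : δ / 2 ≤ π - u) :
    δ / max δ |s - t| * min 1 (|u - t'| / δ) / (|u - s'| / δ) ≤
      72 * K ^ 6 * (δ / max δ |s - t| + (δ / max δ |u - t'| + δ / (π - u)) * (δ / |y - s|)) := by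
  have hK0 : 0 < K := by linarith
  have hK2 : 1 ≤ K ^ 2 := one_le_pow₀ hK
  have hK6 : 1 ≤ K ^ 6 := one_le_pow₀ hK
  have hy0 : 0 < y := by
    rcases hy.eq_or_lt with h | h
    · rw [← h] at e6; norm_num at e6; linarith
    · exact h
  have hs' := abs_lt.1 h2
  have cub : ∀ c : ℝ, 0 ≤ c → K * (c * (π - u)) ≤ c * K ^ 2 * y ^ 3 := fun c hc => by
    calc K * (c * (π - u)) ≤ K * (c * (K * y ^ 3)) := by gcongr
      _ = _ := by ring
  have hsy : s ≤ 2 * K ^ 2 * y := by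
    refine le_mul_of_pow_three_le hy (by linarith) (e4.trans (le_trans ?_ (cub 2 two_pos.le)))
    exact mul_le_mul_of_nonneg_left (by linarith) hK0.le
  have ha : 0 < |y - s| := by linarith
  have hb0 : 0 < |u - s'| := by
    have : 0 < |y - s| * (y + s) ^ 2 := by positivity
    exact pos_of_mul_pos_right (this.trans_le e1) hK0.le
  have hm0 : 0 < max δ |s - t| := lt_max_of_lt_left hδ
  have hB : δ / |u - s'| ≤ K * (δ / |y - s|) / y ^ 2 := by
    have : |y - s| * y ^ 2 ≤ K * |u - s'| := by
      refine le_trans ?_ e1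
      gcongr; linarith
    rw [mul_div_assoc', div_div, div_le_div_iff₀ hb0 (by positivity)]
    calc δ * (|y - s| * y ^ 2) ≤ δ * (K * |u - s'|) := by gcongr
      _ = _ := by ring
  have hμt : δ / max δ |s - t| * |t' - s'| ≤ K * δ * (t + s) ^ 2 := by
    have h4 : δ / max δ |s - t| * |t - s| ≤ δ := by
      rw [div_mul_eq_mul_div, div_le_iff₀ hm0, abs_sub_comm t s]
      exact mul_le_mul_of_nonneg_left (le_max_right _ _) hδ.le
    calc δ / max δ |s - t| * |t' - s'| ≤ δ / max δ |s - t| * (K * (|t - s| * (t + s) ^ 2)) := by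
          gcongr
      _ = K * (δ / max δ |s - t| * |t - s|) * (t + s) ^ 2 := by ring
      _ ≤ _ := by gcongr
  have hμ0 : 0 < δ / max δ |s - t| := by positivity
  have hM : 0 < max δ |u - t'| := lt_max_of_lt_left hδ
  have hw0 : 0 < δ / max δ |u - t'| := by positivity
  have hσ : 0 < π - u := by linarith
  have hq0 : 0 < δ / (π - u) := by positivity
  have hD0 : 0 < δ / |y - s| := by positivity
  have hqy : δ ≤ K * y ^ 3 * (δ / (π - u)) := by
    rw [mul_div_assoc', le_div_iff₀ hσ, mul_comm]
    exact mul_le_mul_of_nonneg_right e6 hδ.le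
  have tri : |u - t'| ≤ |u - s'| + |t' - s'| := by
    have := abs_sub_le u s' t'
    rwa [abs_sub_comm s' t'] at this
  have hEw : δ < |t' - s'| → δ / |t' - s'| ≤ 2 * (δ / max δ |u - t'|) := by
    intro hc
    rw [mul_div_assoc', div_le_div_iff₀ (by linarith) hM]
    have : max δ |u - t'| ≤ 2 * |t' - s'| := max_le (by linarith) (by linarith)
    calc δ * max δ |u - t'| ≤ δ * (2 * |t' - s'|) := by gcongr
      _ = _ := by ring
  have hwl : |t' - s'| ≤ δ → 1 ≤ 2 * (δ / max δ |u - t'|) := by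
    intro hc
    rw [mul_div_assoc', one_le_div hM]
    exact max_le (by linarith) (by linarith)
  have hty : |t' - s'| ≤ δ → (t + s) ^ 2 ≤ 36 * K ^ 4 * y ^ 2 := by
    intro hc
    have : t ≤ 4 * K ^ 2 * y := by
      refine le_mul_of_pow_three_le hy (by linarith) (e5.trans (le_trans ?_ (cub 4 (by norm_num))))
      exact mul_le_mul_of_nonneg_left (by linarith [neg_le_abs (t' - s')]) hK0.le
    calc (t + s) ^ 2 ≤ (6 * K ^ 2 * y) ^ 2 := by gcongr; linarith
      _ = _ := by ring
  have hd : min 1 (|u - t'| / δ) ≤ (|u - s'| + |t' - s'|) / δ :=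
    (min_le_right _ _).trans (by gcongr)
  have hapart : δ < |t' - s'| → δ / |t' - s'| * (t + s) ^ 2 / y ^ 2 ≤
      72 * K ^ 4 * (δ / max δ |u - t'| + δ / (π - u)) := fun hc =>
    near_bound_case_apart hK ht hs hy0 hδ (by linarith) rfl (hEw hc) hq0 hw0 e3 hsy hqy
  have hclose : |t' - s'| ≤ δ →
      δ / max δ |s - t| * min 1 (|u - t'| / δ) * (δ / |u - s'|) ≤
        δ / max δ |s - t| + 72 * K ^ 6 * (δ / max δ |u - t'|) * (δ / |y - s|) := fun hc =>
    near_bound_case_close hK0 hμ0 hδ hb0 hy0 hD0 hd hμt hB (hty hc) (hwl hc)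
  have hd1 : min 1 (|u - t'| / δ) ≤ 1 := min_le_left _ _
  have hd0 : 0 ≤ min 1 (|u - t'| / δ) := le_min zero_le_one (by positivity)
  rw [div_div_eq_mul_div, mul_div_assoc]
  have hΔ0 : δ < |t' - s'| → δ / max δ |s - t| ≤ K * (δ / |t' - s'| * (t + s) ^ 2) := by
    intro hc
    rw [div_mul_eq_mul_div, mul_div_assoc', le_div_iff₀ (by linarith : 0 < |t' - s'|)]
    linarith
  have hβ0 : 0 ≤ δ / |u - s'| := by positivity
  generalize δ / max δ |s - t| = μ at *
  generalize δ / max δ |u - t'| = w at *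
  generalize δ / (π - u) = q at *
  generalize δ / |y - s| = D at *
  generalize min 1 (|u - t'| / δ) = d at *
  generalize δ / |u - s'| = β at *
  have hμ6 : μ ≤ 72 * K ^ 6 * μ := le_mul_of_one_le_left hμ0.le (by linarith)
  have k6 : 0 < 72 * K ^ 6 := by linarith
  rcases le_or_gt |t' - s'| δ with hc | hc
  · refine (hclose hc).trans ?_
    have : 0 ≤ 72 * K ^ 6 * (q * D) := by positivity
    linarith
  · have h7 := hapart hc
    have h8 := hΔ0 hc
    have h9 : 0 ≤ K * (δ / |t' - s'| * (t + s) ^ 2) := hμ0.le.trans h8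
    have h10 : 0 ≤ K * D / y ^ 2 := by positivity
    calc μ * d * β ≤ K * (δ / |t' - s'| * (t + s) ^ 2) * 1 * (K * D / y ^ 2) := by
          exact mul_le_mul (mul_le_mul h8 hd1 hd0 h9) hB hβ0 (by linarith)
      _ = K ^ 2 * (δ / |t' - s'| * (t + s) ^ 2 / y ^ 2) * D := by ring
      _ ≤ K ^ 2 * (72 * K ^ 4 * (w + q)) * D := by gcongr
      _ = 72 * K ^ 6 * ((w + q) * D) := by ring
      _ ≤ _ := by
        have : 0 ≤ 72 * K ^ 6 * μ := by positivity
        linarith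

theorem near_bound : ∃ C, 0 < C ∧ ∀ (n : ℕ) (t t' s s' y u : ℝ), Twin t t' → Twin s s' →
    Twin y u → gap n ≤ |y - s| → |u - s'| < gap n / 2 → u ≤ π - gap n / 2 →
    decay n s t * min 1 (|u - t'| / gap n) / (|u - s'| / gap n) ≤
      C * (decay n s t + (decay n u t' + decay n u π) * decay n y s) := by
  obtain ⟨C1, h1⟩ := twin_sub_cmp
  obtain ⟨C2, h2⟩ := twin_cube_cmp
  obtain ⟨K, hK⟩ : ∃ K, K = 1 + C1 + C2 := ⟨_, rfl⟩
  have p1 := (h1 _ _ _ _ twin_zero twin_zero).3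
  have p2 := (h2 _ _ twin_zero).3
  refine ⟨72 * K ^ 6 * 2, by rw [hK]; positivity, fun n t t' s s' y u tw sw yw a b c => ?_⟩
  have hg := gap_pos n
  have q1 := (h1 _ _ _ _ yw sw).mono (by linarith : C1 ≤ K)
  have q2 := (h1 _ _ _ _ tw sw).mono (by linarith : C1 ≤ K)
  have q3 := (h2 _ _ sw).mono (by linarith : C2 ≤ K)
  have q4 := (h2 _ _ tw).mono (by linarith : C2 ≤ K)
  have q5 := (h2 _ _ yw).mono (by linarith : C2 ≤ K)
  have := near_bound_aux (K := K) (by rw [hK]; linarith) hg tw.1.1 sw.1.1 yw.1.1 q1.5 q2.4 q2.5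
    q3.4 q4.4 q5.5 a b (by linarith)
  have d1 := div_le_decay_pi c
  have d2 := decay_pos n s t
  have d3 := decay_pos n u t'
  have e : gap n / |y - s| = decay n y s := by rw [decay_eq, max_eq_right a]
  rw [e, ← decay_eq, ← decay_eq] at this
  refine this.trans ?_
  have d4 := decay_pos n y s
  rw [mul_assoc (72 * K ^ 6)]
  have : 0 < K := by rw [hK]; linarith
  refine mul_le_mul_of_nonneg_left ?_ (by positivity)
  nlinarith

/-! ### The upper bound -/

theorem defectProd_le_one (n j : ℕ) (t t' : ℝ) : defectProd n j t t' ≤ 1 :=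
  Finset.prod_le_one (fun k _ => mul_nonneg (defect_nonneg n k t) (defect_nonneg n k t'))
    fun k _ => mul_le_one₀ (defect_le_one n k t) (defect_nonneg n k t') (defect_le_one n k t')

theorem defectProd_le_defect {n j k : ℕ} (hk : k ∈ (posIndices n).erase j) (t t' : ℝ) :
    defectProd n j t t' ≤ defect n k t' := by
  rw [defectProd, ← Finset.mul_prod_erase _ _ hk]
  have h1 : ∏ l ∈ ((posIndices n).erase j).erase k, (defect n l t * defect n l t') ≤ 1 :=
    Finset.prod_le_one (fun k _ => mul_nonneg (defect_nonneg n k t) (defect_nonneg n k t'))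
      fun k _ => mul_le_one₀ (defect_le_one n k t) (defect_nonneg n k t') (defect_le_one n k t')
  have h2 := mul_le_of_le_one_left (defect_nonneg n k t') (defect_le_one n k t)
  exact (mul_le_of_le_one_right (mul_nonneg (defect_nonneg n k t) (defect_nonneg n k t')) h1).trans h2

/-- The weight of an index in the double sum of the upper bound. -/
noncomputable def weight (n : ℕ) (t' : ℝ) (k : ℕ) : ℝ :=
  decay n (sideAngle n k) t' + decay n (sideAngle n k) π

theorem weight_pos (n : ℕ) (t' : ℝ) (k : ℕ) : 0 < weight n t' k :=
  add_pos (decay_pos _ _ _) (decay_pos _ _ _)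

theorem lagCore_le : ∃ C, 0 < C ∧ ∀ (n : ℕ) (t t' s s' : ℝ), Twin t t' → Twin s s' →
    ∀ j ∈ posIndices n, s = adjustedAngleUpper n j →
    (radius t + radius s) / radius s * lagCore n t j ≤
      C * ((radius t + radius s) / radius s * (cellModel n s s' j / cellModel n t t' j) *
        (defectProd n j t t' / defectProd n j s s')) := by
  obtain ⟨C1, h1⟩ := exists_lagCore_cmp
  obtain ⟨C2, p2, h2⟩ := cornerFactor_bounds
  have p1 : 0 < C1 := by
    obtain ⟨k, hk⟩ : ∃ k, k ∈ posIndices 1 := ⟨0, by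
      rw [posIndices_of_odd (by decide)]; simp⟩
    have tw := twin_outerTwin (adjusted_mem' hk)
    exact (h1 1 _ _ _ _ tw tw k hk rfl).3
  refine ⟨C1 * C2, by positivity, fun n t t' s s' tw sw j hj hs => ?_⟩
  have rs : 0 < radius s := hs ▸ radius_adjusted_pos hj
  have rt := radius_nonneg_inner tw.1
  have q0 : 0 ≤ defectProd n j t t' / defectProd n j s s' :=
    div_nonneg (defectProd_nonneg _ _ _ _) (defectProd_nonneg _ _ _ _)
  have m0 : 0 ≤ cellModel n s s' j / cellModel n t t' j :=
    div_nonneg (cellModel_pos _ _ _ _).le (cellModel_pos _ _ _ _).le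
  have g0 : 0 ≤ (radius t + radius s) / radius s := by positivity
  calc _ ≤ (radius t + radius s) / radius s * (C1 * (cornerFactor n t *
        (cellModel n s s' j / cellModel n t t' j) *
        (defectProd n j t t' / defectProd n j s s'))) :=
        mul_le_mul_of_nonneg_left (h1 n t t' s s' tw sw j hj hs).4 g0
    _ ≤ (radius t + radius s) / radius s * (C1 * (C2 *
        (cellModel n s s' j / cellModel n t t' j) *
        (defectProd n j t t' / defectProd n j s s'))) := by
        have := (h2 n t t' tw).2.1
        gcongr
    _ = _ := by ring

theorem lagCore_term_le : ∃ C, 0 < C ∧ ∀ (n : ℕ) (t t' : ℝ), Twin t t' → ∀ j ∈ posIndices n,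
    (radius t + radius (adjustedAngleUpper n j)) / radius (adjustedAngleUpper n j) *
      lagCore n t j ≤ C * (decay n (adjustedAngleUpper n j) t + weight n t' j +
        ∑ k ∈ posIndices n, weight n t' k *
          decay n (adjustedAngleUpper n k) (adjustedAngleUpper n j)) := by
  obtain ⟨C1, p1, h1⟩ := lagCore_le
  obtain ⟨C2, p2, h2⟩ := inner_ratio_le
  obtain ⟨C3, p3, h3⟩ := outer_ratio_le
  obtain ⟨c, p4, h4⟩ := exists_le_defectProd
  obtain ⟨C5, p5, h5⟩ := near_bound
  refine ⟨C1 * (C2 + C3) * (1 / c) * (1 + C5), by positivity, fun n t t' tw j hj => ?_⟩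
  obtain ⟨s, hs⟩ : ∃ s, s = adjustedAngleUpper n j := ⟨_, rfl⟩
  obtain ⟨s', sw⟩ := exists_twin (adjusted_mem' hj)
  have a := h1 n t t' s s' tw (hs ▸ sw) j hj hs
  have b := h4 n j hj s' sw
  rw [← hs] at sw b ⊢
  have hg := gap_pos n
  have jn := (mem_posIndices.1 hj).1
  obtain ⟨Z, hZ⟩ : ∃ x, x = ∑ k ∈ posIndices n, weight n t' k *
    decay n (adjustedAngleUpper n k) s := ⟨_, rfl⟩
  have hterm : ∀ k ∈ posIndices n,
      weight n t' k * decay n (adjustedAngleUpper n k) s ≤ Z := by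
    intro k hk
    rw [hZ]
    exact Finset.single_le_sum (f := fun k => weight n t' k * decay n (adjustedAngleUpper n k) s)
      (fun i _ => (mul_pos (weight_pos _ _ _) (decay_pos _ _ _)).le) hk
  have hZ0 : 0 ≤ Z := (mul_pos (weight_pos n t' j) (decay_pos _ _ _)).le.trans (hterm j hj)
  rw [← hZ]
  have w0 := weight_pos n t' j
  have d0 := decay_pos n s t
  have q0 := defectProd_nonneg n j t t'
  have q1 := defectProd_le_one n j t t'
  have gr : (radius t + radius s) / radius s * (cellModel n s s' j / cellModel n t t' j) ≤
      (C2 + C3) * (decay n s t + weight n t' j) := by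
    rcases le_or_gt (fejerAngleUpper n j) (2 * π / 3) with hin | hout
    · refine (h2 n t t' s s' tw sw j hj hs hin).trans ?_
      gcongr <;> linarith
    · have e : s' = sideAngle n j := sw.eq_outer (hs ▸ twin_sideAngle jn hout)
      refine (h3 n t t' s s' tw sw j hj e hout).trans ?_
      have : decay n s' t' + decay n s' π = weight n t' j := by rw [weight, e]
      rw [this]
      gcongr <;> linarith
  have c0 : 0 < 1 / c := by positivity
  have K0 : 0 < C1 * (C2 + C3) * (1 / c) := by positivity
  rcases b with b | ⟨hin, k, hk, hout, b0, b1, b2⟩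
  · have qr : defectProd n j t t' / defectProd n j s s' ≤ 1 / c :=
      div_le_div₀ zero_le_one q1 p4 b
    have qr0 : 0 ≤ defectProd n j t t' / defectProd n j s s' :=
      div_nonneg q0 (p4.le.trans b)
    calc _ ≤ _ := a
      _ ≤ C1 * ((C2 + C3) * (decay n s t + weight n t' j) * (1 / c)) := by
          refine mul_le_mul_of_nonneg_left (mul_le_mul gr qr qr0 (by positivity)) p1.le
      _ = C1 * (C2 + C3) * (1 / c) * 1 * (decay n s t + weight n t' j) := by ring
      _ ≤ _ := mul_le_mul (mul_le_mul_of_nonneg_left (by linarith) K0.le) (by linarith)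
          (by positivity) (by positivity)
  · obtain ⟨hkj, hkU⟩ := Finset.mem_erase.1 hk
    have kn := (mem_posIndices.1 hkU).1
    have tk := twin_sideAngle kn hout
    have sep := gap_le_adjusted_sub kn jn hkj
    rw [← hs] at sep
    have near := h5 n t t' s s' _ _ tw sw tk sep b1 (sideAngle_mem hkU).2
    have gr' := h2 n t t' s s' tw sw j hj hs hin
    have B0 : 0 < |sideAngle n k - s'| / gap n := by positivity
    have dk := defectProd_le_defect hk t t'
    have qr : defectProd n j t t' / defectProd n j s s' ≤
        1 / c * (min 1 (|sideAngle n k - t'| / gap n) / (|sideAngle n k - s'| / gap n)) := by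
      rw [div_mul_div_comm, one_mul]
      exact div_le_div₀ (defect_nonneg n k t') dk (by positivity) b2
    have qr0 : 0 ≤ defectProd n j t t' / defectProd n j s s' :=
      div_nonneg q0 (defectProd_nonneg _ _ _ _)
    calc _ ≤ _ := a
      _ ≤ C1 * (C2 * decay n s t * (1 / c * (min 1 (|sideAngle n k - t'| / gap n) /
            (|sideAngle n k - s'| / gap n)))) := by
          refine mul_le_mul_of_nonneg_left (mul_le_mul gr' qr qr0 (by positivity)) p1.le
      _ = C1 * C2 * (1 / c) * (decay n s t * min 1 (|sideAngle n k - t'| / gap n) /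
            (|sideAngle n k - s'| / gap n)) := by ring
      _ ≤ C1 * C2 * (1 / c) * (C5 * (decay n s t + weight n t' k *
            decay n (adjustedAngleUpper n k) s)) := by
          exact mul_le_mul_of_nonneg_left near (by positivity)
      _ ≤ C1 * (C2 + C3) * (1 / c) * ((1 + C5) * (decay n s t + weight n t' j + Z)) := by
          have := hterm k hkU
          have hn : 0 ≤ decay n s t + weight n t' k * decay n (adjustedAngleUpper n k) s :=
            add_nonneg d0.le (mul_pos (weight_pos _ _ _) (decay_pos _ _ _)).le
          gcongr <;> linarith
      _ = _ := by ring

theorem decay_comm (n : ℕ) (u v : ℝ) : decay n u v = decay n v u := by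
  rw [decay, decay, abs_sub_comm]

theorem sum_decay_le {n : ℕ} (hn : 2 ≤ n) {a : ℕ → ℝ} {v : ℝ} (ha : ∀ k ∈ posIndices n, a k ∈ Icc 0 π)
    (hv : v ∈ Icc 0 π) (hs : ∀ j ∈ posIndices n, ∀ k ∈ posIndices n, j ≠ k → gap n ≤ |a j - a k|) :
    ∑ k ∈ posIndices n, decay n (a k) v ≤ 12 * Real.log n := by
  have hg := gap_pos n
  have hn' : (2 : ℝ) ≤ n := by exact_mod_cast hn
  have h := sum_one_div_max_le (S := posIndices n) (a := a) (t := v) hg hs (M := 2 * n + 2)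
    fun k hk => by
      have h1 := ha k hk
      have h2 : |a k - v| ≤ π := abs_le.2 ⟨by linarith [h1.1, hv.2], by linarith [h1.2, hv.1]⟩
      have h3 := gap_mul n
      push_cast
      nlinarith
  refine h.trans ?_
  have l1 : Real.log ((2 * n + 2 : ℕ) : ℝ) ≤ 3 * Real.log n := by
    rw [← Nat.cast_ofNat (R := ℝ) (n := 3), ← Real.log_pow]
    refine Real.log_le_log (by positivity) ?_
    push_cast
    nlinarith [mul_nonneg (sub_nonneg.2 hn') (sub_nonneg.2 hn'),
      mul_nonneg (mul_nonneg (sub_nonneg.2 hn') (sub_nonneg.2 hn')) (sub_nonneg.2 hn')]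
  have l2 : 2 ≤ 3 * Real.log n := by
    have h5 : Real.log 2 ≤ Real.log n := Real.log_le_log two_pos hn'
    linarith [Real.log_two_gt_d9]
  linarith

theorem lagCorner_le : ∃ C, 0 < C ∧ ∀ (n : ℕ), Even n → ∀ t t' : ℝ, Twin t t' →
    lagCorner n t ≤ C := by
  obtain ⟨C1, h1⟩ := prod_ker_cmp
  obtain ⟨κ, hκ⟩ := exists_sum_cellAverage
  obtain ⟨C2, h2⟩ := exp_cornerAverage_cmp
  have p1 := (h1 0 _ _ twin_zero 0).3
  have p2 := (h2 0 (by simp) _ _ twin_zero).3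
  refine ⟨C1 * C1 * (√(C2 * C2) * 16), by positivity, fun n hn t t' tw => ?_⟩
  have hg := gap_pos n
  have he : (posIndices n).erase 0 = posIndices n :=
    Finset.erase_eq_of_notMem (notMem_posIndices_zero hn)
  have split : ∀ t t', Twin t t' → ∏ k ∈ (posIndices n).erase 0,
      (Real.exp (cellAverage n t k) * (defect n k t * defect n k t')) =
      Real.exp (κ n) * (Real.exp (cornerAverage n t))⁻¹ * defectProd n 0 t t' := by
    intro t t' tw
    rw [Finset.prod_mul_distrib, defectProd, ← Real.exp_sum, he, hκ n t t' tw, ← Real.exp_neg,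
      ← Real.exp_add, sub_eq_add_neg]
  have a := (h1 n t t' tw 0).div (h1 n 0 π twin_zero 0)
  rw [split t t' tw, split 0 π twin_zero, he, ← Finset.prod_div_distrib] at a
  refine a.4.trans (mul_le_mul_of_nonneg_left ?_ (by positivity))
  have q0 := defectProd_nonneg n 0 t t'
  have q1 := defectProd_le_one n 0 t t'
  have hsub : (posIndices n).erase 0 ⊆ posIndices n := Finset.erase_subset _ _
  have qz : 1 / 16 ≤ defectProd n 0 0 π := by
    rw [defectProd, Finset.prod_mul_distrib]
    have b1 := sq_le_prod_defect (n := n) (c := 1 / 2) (s := 0) hsub (by norm_num) (by norm_num)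
      fun k hk => le_defect (by norm_num) (by
        have := (sideAngle_mem (hsub hk)).1
        exact le_trans (by linarith) (le_abs_self _))
    have b2 := sq_le_prod_defect (n := n) (c := 1 / 2) (s := π) hsub (by norm_num) (by norm_num)
      fun k hk => le_defect (by norm_num) (by
        have := (sideAngle_mem (hsub hk)).2
        exact le_trans (by linarith) (neg_le_abs _))
    calc (1 / 16 : ℝ) = (1 / 2) ^ 2 * (1 / 2) ^ 2 := by norm_num
      _ ≤ _ := mul_le_mul b1 b2 (by norm_num)
        (Finset.prod_nonneg fun k _ => defect_nonneg _ _ _)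
  have ratio : Real.exp (cornerAverage n 0) / Real.exp (cornerAverage n t) ≤ √(C2 * C2) := by
    refine Real.le_sqrt_of_sq_le ?_
    have b := (h2 n hn 0 π twin_zero).div (h2 n hn t t' tw)
    rw [div_pow]
    refine b.4.trans ?_
    refine mul_le_of_le_one_right (by positivity) ?_
    have := tw.1.1
    rw [div_le_one (by positivity)]
    gcongr
  have e : Real.exp (κ n) * (Real.exp (cornerAverage n t))⁻¹ * defectProd n 0 t t' /
      (Real.exp (κ n) * (Real.exp (cornerAverage n 0))⁻¹ * defectProd n 0 0 π) =
      Real.exp (cornerAverage n 0) / Real.exp (cornerAverage n t) *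
        (defectProd n 0 t t' / defectProd n 0 0 π) := by
    field_simp
  rw [e]
  have qr : defectProd n 0 t t' / defectProd n 0 0 π ≤ 16 := by
    rw [div_le_iff₀ (by linarith)]; linarith
  exact mul_le_mul ratio qr (div_nonneg q0 (by linarith)) (Real.sqrt_nonneg _)

theorem lebesgueConstant_upper : ∃ C, 0 < C ∧ ∀ n : ℕ, 2 ≤ n →
    lebesgueConstant (adjustedFejerPoint n) ≤ C * Real.log n ^ 2 := by
  obtain ⟨C1, p1, h1⟩ := lagCore_term_le
  obtain ⟨C2, p2, h2⟩ := lagCorner_le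
  refine ⟨9 * C2 + 2 * C1 * 1000, by positivity, fun n hn => ?_⟩
  have hpi := Real.pi_pos
  have hn' : (2 : ℝ) ≤ n := by exact_mod_cast hn
  have hL : 1 ≤ 3 * Real.log n := by
    have h5 : Real.log 2 ≤ Real.log n := Real.log_le_log two_pos hn'
    linarith [Real.log_two_gt_d9]
  obtain ⟨L, hLe⟩ : ∃ L, L = Real.log n := ⟨_, rfl⟩
  rw [← hLe] at hL ⊢
  have hL0 : 0 < L := by linarith
  refine lebesgueConstant_adjusted_le (by positivity) fun t ht => ?_
  obtain ⟨t', tw⟩ := exists_twin ht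
  have hle : ∀ k ∈ posIndices n, k ≤ n / 2 := fun k hk => (mem_posIndices.1 hk).1
  have hmem : ∀ k ∈ posIndices n, adjustedAngleUpper n k ∈ Icc 0 π := fun k hk =>
    Icc_subset_Icc_right (by linarith) (adjusted_mem' hk)
  have S1 : ∀ v ∈ Icc 0 π, ∑ k ∈ posIndices n, decay n (adjustedAngleUpper n k) v ≤ 12 * L :=
    fun v hv => hLe ▸ sum_decay_le hn hmem hv fun j hj k hk hjk =>
      gap_le_adjusted_sub (hle j hj) (hle k hk) hjk
  have S2 : ∀ v ∈ Icc 0 π, ∑ k ∈ posIndices n, decay n (sideAngle n k) v ≤ 12 * L :=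
    fun v hv => hLe ▸ sum_decay_le hn (fun k hk => sideAngle_mem' hk) hv fun j hj k hk hjk =>
      gap_le_sideAngle_sub (hle j hj) (hle k hk) hjk
  have W : ∑ k ∈ posIndices n, weight n t' k ≤ 24 * L := by
    unfold weight
    rw [Finset.sum_add_distrib]
    linarith [S2 t' tw.mem_outer, S2 π ⟨hpi.le, le_rfl⟩]
  have D : ∑ j ∈ posIndices n, ∑ k ∈ posIndices n, weight n t' k *
      decay n (adjustedAngleUpper n k) (adjustedAngleUpper n j) ≤ 24 * L * (12 * L) := by
    rw [Finset.sum_comm]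
    calc _ ≤ ∑ k ∈ posIndices n, weight n t' k * (12 * L) := by
          refine Finset.sum_le_sum fun k hk => ?_
          rw [← Finset.mul_sum]
          refine mul_le_mul_of_nonneg_left ?_ (weight_pos _ _ _).le
          simp only [decay_comm n (adjustedAngleUpper n k)]
          exact S1 _ (hmem k hk)
      _ ≤ _ := by
          rw [← Finset.sum_mul]
          exact mul_le_mul_of_nonneg_right W (by positivity)
  have total : ∑ j ∈ posIndices n, 2 * ((radius t + radius (adjustedAngleUpper n j)) /
      radius (adjustedAngleUpper n j) * lagCore n t j) ≤
      2 * C1 * (12 * L + 24 * L + 24 * L * (12 * L)) := by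
    calc _ ≤ ∑ j ∈ posIndices n, 2 * C1 * (decay n (adjustedAngleUpper n j) t + weight n t' j +
        ∑ k ∈ posIndices n, weight n t' k *
          decay n (adjustedAngleUpper n k) (adjustedAngleUpper n j)) := by
          refine Finset.sum_le_sum fun j hj => ?_
          rw [mul_assoc]
          exact mul_le_mul_of_nonneg_left (h1 n t t' tw j hj) two_pos.le
      _ ≤ _ := by
          rw [← Finset.mul_sum, Finset.sum_add_distrib, Finset.sum_add_distrib]
          refine mul_le_mul_of_nonneg_left ?_ (by positivity)
          linarith [S1 t tw.mem_inner]
  have cor : (if Even n then lagCorner n t else 0) ≤ C2 := by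
    split_ifs with he
    · exact h2 n he t t' tw
    · exact p2.le
  have q1 : C2 ≤ C2 * (9 * L ^ 2) := by
    refine le_mul_of_one_le_right p2.le ?_
    nlinarith
  have q2 : 12 * L + 24 * L + 24 * L * (12 * L) ≤ 1000 * L ^ 2 := by nlinarith
  have q3 := mul_le_mul_of_nonneg_left q2 (by positivity : 0 ≤ 2 * C1)
  calc _ ≤ C2 * (9 * L ^ 2) + 2 * C1 * (1000 * L ^ 2) :=
        add_le_add (cor.trans q1) (total.trans q3)
    _ = _ := by ring

/-! ### The lower bound -/

theorem cellModel_ratio_ge {n j : ℕ} {s s' t t' : ℝ} (hj : j ∈ posIndices n)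
    (hin : fejerAngleUpper n j ≤ 2 * π / 3) (hs : s = adjustedAngleUpper n j) (sw : Twin s s')
    (tw : Twin t t') (ht : t = gap n / 4) (hs4 : s ≤ 1 / 4) (hδ : gap n ≤ 1 / 4) :
    gap n / (8 * s) ≤ cellModel n s s' j / cellModel n t t' j := by
  have hg := gap_pos n
  have hp3 := Real.pi_gt_three
  have hp4 := Real.pi_le_four
  obtain ⟨jn, jp⟩ := mem_posIndices.1 hj
  have hθ := half_gap_le_of_pos jp
  have hc := abs_le.1 (abs_adjusted_sub_inner jn hin)
  have hsm := (adjusted_mem hj).1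
  rw [← hs] at hc hsm
  have h1 := sw.2.1
  have h2 := tw.2
  obtain ⟨θ, e⟩ : ∃ θ, θ = fejerAngleUpper n j := ⟨_, rfl⟩
  rw [cellModel, cellModel, ← e]
  rw [← e] at hθ hc
  have a1 : 3 * gap n / 2 * 1 * (θ + s) ^ 2 ≤ max (3 * gap n / 2) |θ - s| *
      max (3 * gap n / 2) |θ - s'| * max (3 * gap n / 2) (θ + s) ^ 2 := by
    have b1 := le_max_left (3 * gap n / 2) |θ - s|
    have b2 : 1 ≤ max (3 * gap n / 2) |θ - s'| :=
      le_max_of_le_right (le_trans (by linarith) (neg_le_abs _))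
    have b3 := le_max_right (3 * gap n / 2) (θ + s)
    have : 0 ≤ θ + s := by linarith
    gcongr
  have a2 : max (3 * gap n / 2) |θ - t| * max (3 * gap n / 2) |θ - t'| *
      max (3 * gap n / 2) (θ + t) ^ 2 ≤ θ * 4 * (θ + s) ^ 2 := by
    have b1 : max (3 * gap n / 2) |θ - t| ≤ θ := max_le hθ (abs_le.2 ⟨by linarith, by linarith⟩)
    have b2 : max (3 * gap n / 2) |θ - t'| ≤ 4 :=
      max_le (by linarith) (abs_le.2 ⟨by linarith [h2.2], by linarith [h2.1]⟩)
    have b3 : max (3 * gap n / 2) (θ + t) ≤ θ + s := max_le (by linarith) (by linarith)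
    have c3 : 0 ≤ max (3 * gap n / 2) (θ + t) := le_max_of_le_left (by linarith)
    have c2 : 0 ≤ max (3 * gap n / 2) |θ - t'| := le_max_of_le_left (by linarith)
    have : 0 ≤ θ := by linarith
    gcongr
  have a3 : 0 < max (3 * gap n / 2) |θ - t| * max (3 * gap n / 2) |θ - t'| *
      max (3 * gap n / 2) (θ + t) ^ 2 := by positivity
  have hs0 : 0 < s := by linarith
  rw [div_le_div_iff₀ (by positivity) a3]
  calc _ ≤ gap n * (θ * 4 * (θ + s) ^ 2) := mul_le_mul_of_nonneg_left a2 hg.le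
    _ = 4 * gap n * (θ + s) ^ 2 * θ := by ring
    _ ≤ 4 * gap n * (θ + s) ^ 2 * (3 * s) :=
        mul_le_mul_of_nonneg_left (by linarith) (by positivity)
    _ = (3 * gap n / 2 * 1 * (θ + s) ^ 2) * (8 * s) := by ring
    _ ≤ _ := mul_le_mul_of_nonneg_right a1 (by positivity)

theorem le_defectProd_corner {K : ℝ} {n j : ℕ} {t t' : ℝ} (hK : Cmp K (t ^ 3) (π - t'))
    (ht : t = gap n / 4) (hδ : K * gap n ≤ 16) (hδ' : gap n ≤ 1) :
    1 / 256 ≤ defectProd n j t t' := by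
  have hg := gap_pos n
  have hsub : (posIndices n).erase j ⊆ posIndices n := Finset.erase_subset _ _
  have ht' : π - t' ≤ gap n / 4 := by
    refine hK.5.trans ?_
    rw [ht]
    have : gap n * gap n ≤ 1 * gap n := mul_le_mul_of_nonneg_right hδ' hg.le
    calc K * (gap n / 4) ^ 3 = K * gap n * (gap n * gap n) / 64 := by ring
      _ ≤ 16 * (1 * gap n) / 64 := by
          have := mul_le_mul hδ this (by positivity) (by norm_num)
          linarith
      _ = gap n / 4 := by ring
  rw [defectProd, Finset.prod_mul_distrib]
  have b1 := sq_le_prod_defect (n := n) (c := 1 / 4) (s := t) hsub (by norm_num) (by norm_num)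
    fun k hk => le_defect (by norm_num) (by
      have := (sideAngle_mem (hsub hk)).1
      exact le_trans (by linarith) (le_abs_self _))
  have b2 := sq_le_prod_defect (n := n) (c := 1 / 4) (s := t') hsub (by norm_num) (by norm_num)
    fun k hk => le_defect (by norm_num) (by
      have := (sideAngle_mem (hsub hk)).2
      exact le_trans (by linarith) (neg_le_abs _))
  calc (1 / 256 : ℝ) = (1 / 4) ^ 2 * (1 / 4) ^ 2 := by norm_num
    _ ≤ _ := mul_le_mul b1 b2 (by norm_num)
      (Finset.prod_nonneg fun k _ => defect_nonneg _ _ _)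

theorem exists_lagCore_ge : ∃ c δ₀ : ℝ, 0 < c ∧ 0 < δ₀ ∧ ∀ n j : ℕ, gap n ≤ δ₀ →
    j ∈ posIndices n → fejerAngleUpper n j ≤ 2 * π / 3 → ∀ s s', s = adjustedAngleUpper n j →
    Twin s s' → s ≤ 1 / 4 → 0 < defectProd n j s s' ∧
      c * (gap n / s) ≤ lagCore n (gap n / 4) j * defectProd n j s s' := by
  obtain ⟨C1, h1⟩ := exists_lagCore_cmp
  obtain ⟨C2, p2, h2⟩ := cornerFactor_bounds
  obtain ⟨K, hK⟩ := twin_cube_cmp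
  obtain ⟨c, hc, h4⟩ := exists_le_defectProd
  have pK : 0 < K := (hK _ _ twin_zero).3
  have p1 : 0 < C1 := by
    obtain ⟨k, hk⟩ : ∃ k, k ∈ posIndices 1 := ⟨0, by
      rw [posIndices_of_odd (by decide)]; simp⟩
    have tw := twin_outerTwin (adjusted_mem' hk)
    exact (h1 1 _ _ _ _ tw tw k hk rfl).3
  refine ⟨1 / (C1 * C2 * 2048), min (1 / 4) (16 / K), by positivity, by positivity,
    fun n j hδ hj hin s s' hs sw hs4 => ?_⟩
  have hg := gap_pos n
  have hpi := Real.pi_gt_three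
  have hδ4 : gap n ≤ 1 / 4 := hδ.trans (min_le_left _ _)
  have hδK : K * gap n ≤ 16 := by
    rw [mul_comm]; exact (le_div_iff₀ pK).1 (hδ.trans (min_le_right _ _))
  have tm : gap n / 4 ∈ Icc 0 (2 * π / 3) := ⟨by linarith, by linarith⟩
  obtain ⟨t', tw⟩ := exists_twin tm
  have D0 : 0 < defectProd n j s s' := by
    rcases h4 n j hj s' (hs ▸ sw) with b | ⟨-, k, -, -, b0, -, b2⟩
    · rw [hs]; exact hc.trans_le b
    · rw [hs]; exact lt_of_lt_of_le (by positivity) b2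
  refine ⟨D0, ?_⟩
  have a := (h1 n _ t' s s' tw sw j hj hs).5
  have b := cellModel_ratio_ge hj hin hs sw tw rfl hs4 hδ4
  have d := le_defectProd_corner (j := j) (hK _ _ tw) rfl hδK (by linarith)
  have e := ((h2 n _ t' tw).2.2 (by linarith)).5
  have e' : 1 / C2 ≤ cornerFactor n (gap n / 4) := by
    rw [div_le_iff₀ (by linarith)]; linarith
  have hs0 : 0 < s := by linarith [hs ▸ (adjusted_mem hj).1]
  have f : 1 / C2 * (gap n / (8 * s)) * (1 / 256 / defectProd n j s s') ≤
      C1 * lagCore n (gap n / 4) j := by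
    refine le_trans ?_ a
    have C20 : 0 < C2 := by linarith
    exact mul_le_mul (mul_le_mul e' b (by positivity) (by linarith [one_div_pos.2 C20]))
      (div_le_div_of_nonneg_right d D0.le) (by positivity)
      (mul_nonneg (by linarith [one_div_pos.2 C20])
        (div_nonneg (cellModel_pos _ _ _ _).le (cellModel_pos _ _ _ _).le))
  have C20 : 0 < C2 := by linarith
  have g : 1 / (C1 * C2 * 2048) * (gap n / s) =
      1 / C1 * (1 / C2 * (gap n / (8 * s)) * (1 / 256 / defectProd n j s s')) *
        defectProd n j s s' := by
    field_simp; norm_num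
  rw [g]
  refine mul_le_mul_of_nonneg_right ?_ D0.le
  rw [one_div_mul_eq_div, div_le_iff₀ p1]
  linarith

theorem scales_small {K δ p l y : ℝ} (hK : 1 ≤ K) (hδ : 0 < δ) (hp : 2000000000 * K ^ 5 ≤ p)
    (hδp : δ * p ^ 6 ≤ 3) (hl : 1 ≤ l) (hlp : l ≤ p) (hy : 0 ≤ y) (h1 : y ^ 3 ≤ 6 * K * (δ * l))
    (h2 : δ * l ≤ K * y ^ 3) : 9 * δ * p ≤ y ∧ 162 * K * p * y ^ 2 < 1 ∧ y < 1 / 10 := by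
  have K5 : K ≤ K ^ 5 := le_self_pow₀ hK (by norm_num)
  have p1 : 1 ≤ p := by linarith
  have p0 : 0 < p := by linarith
  have q1 : δ * p ≤ 3 := by
    have := le_self_pow₀ p1 (n := 6) (by norm_num)
    exact (mul_le_mul_of_nonneg_left this hδ.le).trans hδp
  have q3 : δ * p ^ 3 ≤ 3 := by
    have := pow_le_pow_right₀ p1 (show 3 ≤ 6 by norm_num)
    exact (mul_le_mul_of_nonneg_left this hδ.le).trans hδp
  have q6 : δ ^ 2 * p ^ 6 ≤ 9 := by
    have := mul_le_mul q3 q3 (by positivity) (by norm_num)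
    calc δ ^ 2 * p ^ 6 = δ * p ^ 3 * (δ * p ^ 3) := by ring
      _ ≤ 3 * 3 := this
      _ = 9 := by norm_num
  have A : 9 * δ * p ≤ y := by
    refine le_of_pow_le_pow_left₀ (n := 3) (by norm_num) hy ?_
    have r1 : K * (δ * 2187) ≤ 1 := by
      have : δ * (2000000000 * K) ≤ δ * p := mul_le_mul_of_nonneg_left (by linarith) hδ.le
      nlinarith
    have r2 : K * (9 * δ * p) ^ 3 ≤ K * y ^ 3 := by
      calc K * (9 * δ * p) ^ 3 = K * (δ * 729) * (δ * p ^ 3) * δ := by ring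
        _ ≤ K * (δ * 729) * 3 * δ := by gcongr
        _ = K * (δ * 2187) * δ := by ring
        _ ≤ 1 * δ := mul_le_mul_of_nonneg_right r1 hδ.le
        _ ≤ δ * l := by rw [one_mul]; exact le_mul_of_one_le_right hδ.le hl
        _ ≤ _ := h2
    exact le_of_mul_le_mul_left r2 (by linarith)
  have B : 162 * K * p * y ^ 2 < 1 := by
    refine lt_of_pow_lt_pow_left₀ 3 (by norm_num) ?_
    have r1 : y ^ 3 * y ^ 3 ≤ 6 * K * (δ * p) * (6 * K * (δ * p)) := by
      have : y ^ 3 ≤ 6 * K * (δ * p) := h1.trans (by gcongr)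
      exact mul_le_mul this this (by positivity) (by positivity)
    calc (162 * K * p * y ^ 2) ^ 3 = 4251528 * K ^ 3 * p ^ 3 * (y ^ 3 * y ^ 3) := by ring
      _ ≤ 4251528 * K ^ 3 * p ^ 3 * (6 * K * (δ * p) * (6 * K * (δ * p))) := by gcongr
      _ = 153055008 * K ^ 5 * (δ ^ 2 * p ^ 5) := by ring
      _ < 1 ^ 3 := by
          refine lt_of_mul_lt_mul_right ?_ p0.le
          calc 153055008 * K ^ 5 * (δ ^ 2 * p ^ 5) * p
              = 153055008 * K ^ 5 * (δ ^ 2 * p ^ 6) := by ring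
            _ ≤ 153055008 * K ^ 5 * 9 := by gcongr
            _ < 1 ^ 3 * p := by linarith
  refine ⟨A, B, ?_⟩
  refine lt_of_pow_lt_pow_left₀ 2 (by norm_num) ?_
  have : 1 * 1 ≤ K * p := mul_le_mul hK p1 zero_le_one (by linarith)
  nlinarith [sq_nonneg y]

/-- The index of the `m`-th node to the right of the node with index `n / 2 - l`. -/
noncomputable def nearIndex (n l m : ℕ) : ℕ :=
  ⌊adjustedAngleUpper n (n / 2 - l) / (3 * gap n)⌋₊ + 1 + m

theorem exists_nearIndex : ∃ C P : ℝ, 0 < C ∧ ∀ n p l m : ℕ, P ≤ p → p ^ 6 ≤ n →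
    1 ≤ l → l ≤ p → 1 ≤ m → m ≤ p → ∀ j k, j = nearIndex n l m → k = n / 2 - l →
    j ∈ posIndices n ∧ ∀ s', Twin (adjustedAngleUpper n j) s' →
    fejerAngleUpper n j ≤ 2 * π / 3 ∧ adjustedAngleUpper n j ≤ 1 / 4 ∧
    k ∈ (posIndices n).erase j ∧ |sideAngle n k - s'| < gap n / 2 ∧
    adjustedAngleUpper n j * (|sideAngle n k - s'| / gap n) ≤ C * gap n * (l * m) := by
  obtain ⟨K1, h1⟩ := twin_cube_cmp
  obtain ⟨K2, h2⟩ := twin_sub_cmp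
  have p2 : 0 < K2 := (h2 _ _ _ _ twin_zero twin_zero).3
  obtain ⟨K, hK, hK1, hK2⟩ : ∃ K, 1 ≤ K ∧ K1 ≤ K ∧ K2 ≤ K :=
    ⟨max 1 (max K1 K2), le_max_left _ _, le_max_of_le_right (le_max_left _ _),
      le_max_of_le_right (le_max_right _ _)⟩
  refine ⟨972 * K ^ 2, 2000000000 * K ^ 5, by positivity,
    fun n p l m hp hpn hl hlp hm hmp j k ej ek => ?_⟩
  have hg := gap_pos n
  have hpi := Real.pi_gt_three
  have hgm := gap_mul n
  have K5 : 1 ≤ K ^ 5 := one_le_pow₀ hK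
  have hp2 : 2 ≤ p := by
    have : (2 : ℝ) ≤ p := by linarith
    exact_mod_cast this
  have hpn2 : 2 * p ≤ n := by
    have := Nat.mul_le_mul hp2 (le_refl p)
    calc 2 * p ≤ p * p := this
      _ = p ^ 2 := by ring
      _ ≤ p ^ 6 := Nat.pow_le_pow_right (by omega) (by norm_num)
      _ ≤ n := hpn
  have kn : k ≤ n / 2 := by omega
  have ekr : ((n / 2 : ℕ) : ℝ) - k = l := by
    rw [ek, Nat.cast_sub (by omega)]; ring
  have hlr : (1 : ℝ) ≤ l := by exact_mod_cast hl
  have hlpr : (l : ℝ) ≤ p := by exact_mod_cast hlp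
  have hmr : (1 : ℝ) ≤ m := by exact_mod_cast hm
  have hmpr : (m : ℝ) ≤ p := by exact_mod_cast hmp
  have hpnr : (p : ℝ) ^ 6 ≤ n := by exact_mod_cast hpn
  have hδp : gap n * (p : ℝ) ^ 6 ≤ 3 := by
    have : gap n * (p : ℝ) ^ 6 ≤ gap n * (n + 1) :=
      mul_le_mul_of_nonneg_left (by linarith) hg.le
    linarith [Real.pi_le_four]
  have θk : fejerAngleUpper n k = π - 3 * gap n / 2 - 3 * (gap n * l) := by
    have a := fejerAngleUpper_sub n (n / 2) k
    rw [ekr, fejerAngleUpper_last] at a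
    linarith
  have δl : gap n * l ≤ gap n * p := mul_le_mul_of_nonneg_left hlpr hg.le
  have δl1 : gap n * 1 ≤ gap n * l := mul_le_mul_of_nonneg_left hlr hg.le
  have δm : gap n * m ≤ gap n * p := mul_le_mul_of_nonneg_left hmpr hg.le
  have δm1 : gap n * 1 ≤ gap n * m := mul_le_mul_of_nonneg_left hmr hg.le
  have δp : gap n * p ≤ 1 / 9 := by
    have p1 : (2 : ℝ) ≤ p := by exact_mod_cast hp2
    have h32 : (32 : ℝ) ≤ p ^ 5 := by
      have := pow_le_pow_left₀ (by norm_num) p1 5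
      linarith
    have : gap n * p * 32 ≤ gap n * (p : ℝ) ^ 6 := by
      have := mul_le_mul_of_nonneg_left h32 (show 0 ≤ gap n * p by positivity)
      calc _ ≤ _ := this
        _ = _ := by ring
    linarith
  have hout : 2 * π / 3 < fejerAngleUpper n k := by rw [θk]; linarith
  have kU : k ∈ posIndices n := mem_posIndices.2 ⟨kn, outer_pos hout⟩
  have tk := twin_sideAngle kn hout
  have uk := abs_le.1 (abs_sideAngle_sub kn)
  have y0 := (adjusted_mem' kU).1
  obtain ⟨y, ey⟩ : ∃ y, y = adjustedAngleUpper n k := ⟨_, rfl⟩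
  obtain ⟨u, eu⟩ : ∃ u, u = sideAngle n k := ⟨_, rfl⟩
  obtain ⟨s, es⟩ : ∃ s, s = adjustedAngleUpper n j := ⟨_, rfl⟩
  rw [nearIndex, ← ek, ← ey] at ej
  rw [← ey, ← eu] at tk
  rw [← ey] at y0
  rw [← eu] at uk ⊢
  rw [← es]
  rw [θk] at uk
  have c1 := h1 _ _ tk
  have y3 : y ^ 3 ≤ 6 * K * (gap n * l) := by
    refine c1.4.trans ?_
    calc K1 * (π - u) ≤ K * (6 * (gap n * l)) :=
          mul_le_mul hK1 (by linarith) c1.2 (by linarith)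
      _ = _ := by ring
  have y3' : gap n * l ≤ K * y ^ 3 := by
    have := c1.5.trans (mul_le_mul_of_nonneg_right hK1 c1.1)
    linarith
  obtain ⟨s1, s2, s3⟩ := scales_small hK hg hp hδp hlr hlpr y0 y3 y3'
  obtain ⟨ε, hε, hfe⟩ := exists_fejerAngleUpper_eq n
  have ε0 : 0 ≤ ε ∧ ε ≤ 1 / 2 := by rcases hε with ⟨-, rfl⟩ | ⟨-, rfl⟩ <;> norm_num
  have f1 : ⌊y / (3 * gap n)⌋₊ * (3 * gap n) ≤ y :=
    (le_div_iff₀ (by positivity)).1 (Nat.floor_le (by positivity))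
  have f2 : y < (⌊y / (3 * gap n)⌋₊ + 1) * (3 * gap n) :=
    (div_lt_iff₀ (by positivity)).1 (Nat.lt_floor_add_one _)
  have θj : fejerAngleUpper n j = ⌊y / (3 * gap n)⌋₊ * (3 * gap n) + 3 * gap n +
      3 * (gap n * m) + 3 * (gap n * ε) := by
    rw [hfe, ej]; push_cast; ring
  have gε : gap n * ε ≤ gap n * (1 / 2) := mul_le_mul_of_nonneg_left ε0.2 hg.le
  have gε0 : 0 ≤ gap n * ε := mul_nonneg hg.le ε0.1
  have l1 : y + 3 * (gap n * m) ≤ fejerAngleUpper n j := by rw [θj]; linarith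
  have l2 : fejerAngleUpper n j ≤ y + 8 * (gap n * m) := by rw [θj]; linarith
  have hin : fejerAngleUpper n j ≤ 2 * π / 3 := by linarith
  have jn : j ≤ n / 2 := by
    by_contra hlt
    have a := fejerAngleUpper_sub n j (n / 2)
    have : (0 : ℝ) ≤ (j : ℝ) - (n / 2 : ℕ) := by
      have : ((n / 2 : ℕ) : ℝ) ≤ j := by exact_mod_cast (not_le.1 hlt).le
      linarith
    have := mul_nonneg (show 0 ≤ 3 * gap n by positivity) this
    rw [fejerAngleUpper_last] at a
    linarith
  have jU : j ∈ posIndices n := mem_posIndices.2 ⟨jn, by linarith⟩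
  have sj := abs_le.1 (abs_adjusted_sub_inner jn hin)
  rw [← es] at sj
  have m1 : 0 < s - y := by linarith
  have m2 : s - y ≤ 9 * (gap n * m) := by linarith
  have m3 : s ≤ 2 * y := by linarith
  have hne : k ≠ j := by rintro rfl; linarith
  refine ⟨jU, fun s' sw => ?_⟩
  have B : |u - s'| ≤ 81 * K * (gap n * m) * y ^ 2 := by
    refine (h2 _ _ _ _ tk sw).4.trans ?_
    rw [abs_sub_comm, abs_of_pos m1]
    have q : (y + s) ^ 2 ≤ (3 * y) ^ 2 := pow_le_pow_left₀ (by linarith) (by linarith) 2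
    calc K2 * ((s - y) * (y + s) ^ 2) ≤ K * (9 * (gap n * m) * (3 * y) ^ 2) :=
          mul_le_mul hK2 (mul_le_mul m2 q (by positivity) (by positivity)) (by positivity)
            (by linarith)
      _ = _ := by ring
  refine ⟨hin, by linarith, Finset.mem_erase.2 ⟨hne, kU⟩, ?_, ?_⟩
  · calc |u - s'| ≤ 81 * K * (gap n * m) * y ^ 2 := B
      _ ≤ 81 * K * (gap n * p) * y ^ 2 := by gcongr
      _ = (162 * K * p * y ^ 2) * gap n / 2 := by ring
      _ < 1 * gap n / 2 := by gcongr
      _ = gap n / 2 := by ring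
  · calc s * (|u - s'| / gap n) ≤ (2 * y) * (81 * K * (gap n * m) * y ^ 2 / gap n) := by
          gcongr
      _ = 162 * K * m * y ^ 3 := by field_simp; ring
      _ ≤ 162 * K * m * (6 * K * (gap n * l)) := by gcongr
      _ = _ := by ring

theorem lagCore_nearIndex_ge : ∃ c P : ℝ, 0 < c ∧ ∀ n p l m : ℕ, P ≤ p → p ^ 6 ≤ n →
    1 ≤ l → l ≤ p → 1 ≤ m → m ≤ p →
    c * (1 / l * (1 / m)) ≤ lagCore n (gap n / 4) (nearIndex n l m) := by
  obtain ⟨c, δ₀, hc, hδ₀, h1⟩ := exists_lagCore_ge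
  obtain ⟨C, P, hC, h2⟩ := exists_nearIndex
  refine ⟨c / C, max (max 1 P) (3 / δ₀), by positivity, fun n p l m hp hpn hl hlp hm hmp => ?_⟩
  have hg := gap_pos n
  have hP : P ≤ p := (le_max_right _ _).trans ((le_max_left _ _).trans hp)
  have hp1 : (1 : ℝ) ≤ p := (le_max_left _ _).trans ((le_max_left _ _).trans hp)
  have hδ : gap n ≤ δ₀ := by
    have a : 3 ≤ p * δ₀ := (div_le_iff₀ hδ₀).1 ((le_max_right _ _).trans hp)
    have b := gap_mul n
    have d : (p : ℝ) ≤ n + 1 := by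
      have : (p : ℝ) ^ 6 ≤ n := by exact_mod_cast hpn
      have := le_self_pow₀ hp1 (n := 6) (by norm_num)
      linarith
    have e : gap n * p ≤ gap n * (n + 1) := mul_le_mul_of_nonneg_left d hg.le
    have f : gap n * p ≤ δ₀ * p := by linarith [Real.pi_le_four]
    exact le_of_mul_le_mul_right f (by linarith)
  obtain ⟨jU, key⟩ := h2 n p l m hP hpn hl hlp hm hmp _ _ rfl rfl
  obtain ⟨s', sw⟩ := exists_twin (adjusted_mem' jU)
  obtain ⟨hin, h4, hk, -, hB⟩ := key s' sw
  have s0 : 0 < adjustedAngleUpper n (nearIndex n l m) := by linarith [(adjusted_mem jU).1]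
  obtain ⟨D0, hD⟩ := h1 n _ hδ jU hin _ s' rfl sw h4
  have Dle := (defectProd_le_defect hk (adjustedAngleUpper n (nearIndex n l m)) s').trans
    (min_le_right _ _)
  generalize adjustedAngleUpper n (nearIndex n l m) = s at *
  generalize defectProd n (nearIndex n l m) s s' = D at *
  have l0 : (0 : ℝ) < l := by exact_mod_cast hl
  have m0 : (0 : ℝ) < m := by exact_mod_cast hm
  have a : s * D ≤ C * gap n * (l * m) := (mul_le_mul_of_nonneg_left Dle s0.le).trans hB
  have b : c * gap n ≤ lagCore n (gap n / 4) (nearIndex n l m) * D * s := by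
    rw [← mul_div_assoc, div_le_iff₀ s0] at hD; exact hD
  refine le_of_mul_le_mul_right ?_ (show 0 < s * D by positivity)
  calc c / C * (1 / l * (1 / m)) * (s * D) ≤ c / C * (1 / l * (1 / m)) * (C * gap n * (l * m)) :=
        mul_le_mul_of_nonneg_left a (by positivity)
    _ = c * gap n := by field_simp
    _ ≤ _ := by linarith

theorem nearIndex_injOn : ∃ P : ℝ, ∀ n p : ℕ, P ≤ p → p ^ 6 ≤ n →
    (∀ x ∈ Finset.Icc 1 p ×ˢ Finset.Icc 1 p, nearIndex n x.1 x.2 ∈ posIndices n) ∧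
    ∀ x ∈ Finset.Icc 1 p ×ˢ Finset.Icc 1 p, ∀ y ∈ Finset.Icc 1 p ×ˢ Finset.Icc 1 p,
      nearIndex n x.1 x.2 = nearIndex n y.1 y.2 → x = y := by
  obtain ⟨C, P, -, h⟩ := exists_nearIndex
  refine ⟨max 2 P, fun n p hP' hpn => ?_⟩
  have hP := (le_max_right _ _).trans hP'
  have h2 : 2 ≤ p := by
    have : (2 : ℝ) ≤ p := (le_max_left _ _).trans hP'
    exact_mod_cast this
  have hx : ∀ x ∈ Finset.Icc 1 p ×ˢ Finset.Icc 1 p, ∀ j, j = nearIndex n x.1 x.2 →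
      j ∈ posIndices n ∧ ∀ s', Twin (adjustedAngleUpper n j) s' →
        n / 2 - x.1 ≤ n / 2 ∧ |sideAngle n (n / 2 - x.1) - s'| < gap n / 2 := by
    intro x hx j hj
    simp only [Finset.mem_product, Finset.mem_Icc] at hx
    obtain ⟨a, b⟩ := h n p x.1 x.2 hP hpn hx.1.1 hx.1.2 hx.2.1 hx.2.2 j _ hj rfl
    exact ⟨a, fun s' sw => ⟨Nat.sub_le _ _, (b s' sw).2.2.2.1⟩⟩
  refine ⟨fun x m => (hx x m _ rfl).1, fun x mx y my e => ?_⟩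
  obtain ⟨jU, a⟩ := hx x mx _ rfl
  obtain ⟨-, b⟩ := hx y my _ e
  obtain ⟨s', sw⟩ := exists_twin (adjusted_mem' jU)
  obtain ⟨a1, a2⟩ := a s' sw
  obtain ⟨b1, b2⟩ := b s' sw
  have hk : n / 2 - x.1 = n / 2 - y.1 := by
    by_contra hne
    have c := gap_le_sideAngle_sub a1 b1 hne
    have d := abs_sub_le (sideAngle n (n / 2 - x.1)) s' (sideAngle n (n / 2 - y.1))
    rw [abs_sub_comm s'] at d
    linarith
  simp only [Finset.mem_product, Finset.mem_Icc] at mx my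
  have e' := e
  rw [nearIndex, nearIndex, hk] at e'
  have hle : p ≤ n / 2 := by
    have : 2 * p ≤ n := by
      calc 2 * p ≤ p * p := Nat.mul_le_mul h2 le_rfl
        _ = p ^ 2 := by ring
        _ ≤ p ^ 6 := Nat.pow_le_pow_right (by omega) (by norm_num)
        _ ≤ n := hpn
    omega
  ext
  · omega
  · omega

theorem log_sq_le_sum_mul (p : ℕ) : Real.log (p + 1) ^ 2 ≤
    ∑ x ∈ Finset.Icc 1 p ×ˢ Finset.Icc 1 p, (1 / (x.1 : ℝ) * (1 / (x.2 : ℝ))) := by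
  have e : Real.log ((p : ℝ) + 1) ≤ ∑ i ∈ Finset.Icc 1 p, 1 / (i : ℝ) := by
    have e := log_add_one_le_harmonic p
    rw [harmonic_eq_sum_Icc] at e
    push_cast at e
    simpa only [← one_div] using e
  have l0 : 0 ≤ Real.log ((p : ℝ) + 1) := Real.log_nonneg (by linarith [Nat.cast_nonneg (α := ℝ) p])
  rw [Finset.sum_product]
  simp only
  rw [← Finset.sum_mul_sum, sq]
  exact mul_le_mul e e l0 (l0.trans e)

theorem log_sq_le_of_pow_le : ∃ c P : ℝ, 0 < c ∧ ∀ n p : ℕ, P ≤ p → p ^ 6 ≤ n →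
    c * Real.log (p + 1) ^ 2 ≤ lebesgueConstant (adjustedFejerPoint n) := by
  obtain ⟨c, P1, hc, h1⟩ := lagCore_nearIndex_ge
  obtain ⟨P2, h2⟩ := nearIndex_injOn
  refine ⟨c / 4, max P1 P2, div_pos hc four_pos, fun n p hp hpn => ?_⟩
  obtain ⟨m1, m2⟩ := h2 n p ((le_max_right _ _).trans hp) hpn
  have hg := gap_pos n
  have hgm := gap_mul n
  have tm : gap n / 4 ∈ Icc 0 (2 * π / 3) := by
    refine ⟨by linarith, ?_⟩
    have := mul_nonneg hg.le (Nat.cast_nonneg (α := ℝ) n)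
    linarith
  have inj : Set.InjOn (fun x : ℕ × ℕ => nearIndex n x.1 x.2)
      (Finset.Icc 1 p ×ˢ Finset.Icc 1 p : Finset (ℕ × ℕ)) := fun x hx y hy e =>
    m2 x (Finset.mem_coe.1 hx) y (Finset.mem_coe.1 hy) e
  have hJ : (Finset.Icc 1 p ×ˢ Finset.Icc 1 p).image (fun x : ℕ × ℕ => nearIndex n x.1 x.2) ⊆
      posIndices n := by
    intro j hj
    obtain ⟨x, hx, rfl⟩ := Finset.mem_image.1 hj
    exact m1 x hx
  have a := sum_lagCore_le tm hJ
  rw [Finset.sum_image inj] at a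
  have b : ∑ x ∈ Finset.Icc 1 p ×ˢ Finset.Icc 1 p, c * (1 / (x.1 : ℝ) * (1 / (x.2 : ℝ))) ≤
      ∑ x ∈ Finset.Icc 1 p ×ˢ Finset.Icc 1 p, lagCore n (gap n / 4) (nearIndex n x.1 x.2) := by
    refine Finset.sum_le_sum fun x hx => ?_
    simp only [Finset.mem_product, Finset.mem_Icc] at hx
    exact h1 n p x.1 x.2 ((le_max_left _ _).trans hp) hpn hx.1.1 hx.1.2 hx.2.1 hx.2.2
  rw [← Finset.mul_sum] at b
  have f := mul_le_mul_of_nonneg_left (log_sq_le_sum_mul p) hc.le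
  generalize lebesgueConstant (adjustedFejerPoint n) = L at *
  linarith [f.trans (b.trans a)]

theorem lebesgueConstant_lower : ∃ c, 0 < c ∧ ∀ n : ℕ, 2 ≤ n →
    c * Real.log n ^ 2 ≤ lebesgueConstant (adjustedFejerPoint n) := by
  obtain ⟨c, P, hc, h⟩ := log_sq_le_of_pow_le
  obtain ⟨N, hN⟩ := exists_nat_ge P
  have hL : 0 < Real.log (N + 2) := Real.log_pos (by linarith [Nat.cast_nonneg (α := ℝ) N])
  refine ⟨min (c / 36) (1 / (72 * Real.log (N + 2) ^ 2)), by positivity, fun n hn => ?_⟩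
  have hn' : (2 : ℝ) ≤ n := by exact_mod_cast hn
  have l0 : 0 ≤ Real.log n := Real.log_nonneg (by linarith)
  obtain ⟨p, hp⟩ : ∃ p, p = ⌊(n : ℝ) ^ (1 / 6 : ℝ)⌋₊ := ⟨_, rfl⟩
  have q0 : 0 ≤ (n : ℝ) ^ (1 / 6 : ℝ) := by positivity
  have p1 : (p : ℝ) ≤ (n : ℝ) ^ (1 / 6 : ℝ) := hp ▸ Nat.floor_le q0
  have p2 : (n : ℝ) ^ (1 / 6 : ℝ) ≤ p + 1 := hp ▸ (Nat.lt_floor_add_one _).le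
  have p3 : p ^ 6 ≤ n := by
    have := pow_le_pow_left₀ (Nat.cast_nonneg p) p1 6
    rw [← Real.rpow_mul_natCast (by linarith)] at this
    norm_num at this
    exact_mod_cast this
  have p4 : Real.log n ≤ 6 * Real.log (p + 1) := by
    have := Real.log_le_log (by positivity) p2
    rw [Real.log_rpow (by linarith)] at this
    linarith
  have p5 : Real.log n ^ 2 ≤ 36 * Real.log (p + 1) ^ 2 := by
    calc Real.log n ^ 2 ≤ (6 * Real.log (p + 1)) ^ 2 := pow_le_pow_left₀ l0 p4 2
      _ = _ := by ring
  rcases le_or_gt N p with hle | hlt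
  · have := h n p (hN.trans (by exact_mod_cast hle)) p3
    calc _ ≤ c / 36 * (36 * Real.log (p + 1) ^ 2) :=
          mul_le_mul (min_le_left _ _) p5 (by positivity) (by positivity)
      _ = c * Real.log (p + 1) ^ 2 := by ring
      _ ≤ _ := this
  · have hpN : Real.log ((p : ℝ) + 1) ≤ Real.log (N + 2) := by
      have : (p : ℝ) ≤ N := by exact_mod_cast hlt.le
      exact Real.log_le_log (by positivity) (by linarith)
    have l1 : 0 ≤ Real.log ((p : ℝ) + 1) :=
      Real.log_nonneg (by linarith [Nat.cast_nonneg (α := ℝ) p])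
    have := half_le_lebesgueConstant (injective_adjustedFejerPoint n)
    calc _ ≤ 1 / (72 * Real.log (N + 2) ^ 2) * (36 * Real.log (N + 2) ^ 2) := by
          refine mul_le_mul (min_le_right _ _) (p5.trans ?_) (by positivity) (by positivity)
          have := pow_le_pow_left₀ l1 hpN 2
          linarith
      _ = 1 / 2 := by field_simp; norm_num
      _ ≤ _ := this

end LArc

theorem theorem3 :
    (∀ n : ℕ, 1 ≤ n → Function.Injective (LArc.adjustedFejerPoint n)) ∧
      ∃ c₁ c₂ : ℝ, 0 < c₁ ∧ 0 < c₂ ∧ ∀ n : ℕ, 2 ≤ n →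
        c₁ * Real.log n ^ 2 ≤ LArc.lebesgueConstant (LArc.adjustedFejerPoint n) ∧
          LArc.lebesgueConstant (LArc.adjustedFejerPoint n) ≤ c₂ * Real.log n ^ 2 := by
  obtain ⟨c₁, h₁, lower⟩ := LArc.lebesgueConstant_lower
  obtain ⟨c₂, h₂, upper⟩ := LArc.lebesgueConstant_upper
  exact ⟨fun n _ => LArc.injective_adjustedFejerPoint n, c₁, c₂, h₁, h₂, fun n hn =>
    ⟨lower n hn, upper n hn⟩⟩
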